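/- Let $N$ be a positive integer and let $V$ be the space of trace zero matrices in $\mathrm{Mat}_2(\mathbb Q)$ with the quadratic form $Q(X)=-N\det X$ and bilinear form $(X,Y)=N\,\mathrm{tr}(XY)$, on which $\mathrm{SL}_2$ acts by conjugation. Let $L\subset V$ be an even lattice of full rank with dual lattice $L'$, and let $\Gamma\subset \mathrm{SL}_2(\mathbb Z)$ be a congruence subgroup that maps $L$ to itself and acts trivially on $L'/L$. Put $M=\Gamma\backslash\mathbb H$, $d\mu=dx\,dy/y^2$, $\Delta_z=-y^2(\partial_x^2+\partial_y^2)$. For every $\Gamma$-class of isotropic lines $\ell\subset V$ choose $\sigma_\ell\in \mathrm{SL}_2(\mathbb Z)$ such that $\sigma_\ell\ell_0$ represents it, where $\ell_0=\mathbb Q u_0$, $u_0=\begin{pmatrix}0&1\\0&0\end{pmatrix}$, and take $\ell=\sigma_\ell \ell_0$. Let $\alpha_\ell$ be the width of the cusp $\ell$, let $\beta_\ell\in\mathbb Q_{>0}$ be such that $\beta_\ell\,\sigma_\ell u_0$ is a primitive element of $\ell\cap L$, and put $\varepsilon_\ell=\alpha_\ell/\beta_\ell$. Let $K_\ell=(L\cap\ell^\perp)/(L\cap\ell)\subset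 \ell^\perp/\ell$, and for $\tau\in\mathbb H$ let $\tilde\Theta_{K_\ell}(\tau)=\sum_{h\in L'/L,\,h\perp\ell}\theta_{K_\ell,\bar h}(\tau)\,\mathfrak e_h$, where $\theta_{K_\ell,\bar h}(\tau)=\sum_{\lambda\in \bar h+K_\ell}e^{2\pi i Q(\lambda)\tau}$, where $h\perp\ell$ means that $h$ has a representative in $\ell^\perp$, and where $\bar h$ is the image of that representative modulo $\ell$. For $z=x+iy\in\mathbb H$ let $X(z)=\frac1{\sqrt N\,y}\begin{pmatrix}-x&z\bar z\\-1&x\end{pmatrix}$ and $(X,X)_z=(X,X)+(X,X(z))^2$; for $\tau=u+iv$ let $\varphi_0(X,\tau,z)=\sqrt v\,e^{-\pi v (X,X)_z}e^{\pi i u(X,X)}$ and $\Theta_L(\tau,z,\varphi)=\sum_{h\in L'/L}\sum_{X\in h+L}\varphi(X,\tau,z)\,\mathfrak e_h$ for $\varphi=\varphi_0$ or $\varphi=\Delta_z\varphi_0$. A weak Maass form of weight $0$ for $\Gamma$ with eigenvalue $\lambda$ is a smooth $\Gamma$-invariant function $g$ on $\mathbb H$ with $\Delta_z g=\lambda g$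 for which there is a $C>0$ such that, for all $\delta\in \mathrm{SL}_2(\mathbb Z)$, $g(\delta z)=O(e^{Cy})$ as $y\to\infty$, uniformly in $x$; it is harmonic if $\lambda=0$. Let $f$ be a harmonic weak Maass form of weight $0$ for $\Gamma$, and let $(f_s)_{s\in U}$, $U\subset\mathbb C$ an open neighborhood of $1$, be a spectral deformation of $f$: a holomorphic family (that is, $f_s(z)$ is continuous in $(s,z)$ and holomorphic in $s$) such that $f_s$ is a weak Maass form of weight $0$ for $\Gamma$ with eigenvalue $s(1-s)$ for each $s \in U$, and $f_1=f$. Then for $s$ near $1$ the constant term $\frac1{\alpha_\ell}\int_0^{\alpha_\ell}f_s(\sigma_\ell(x+iy))\,dx$ of the Fourier expansion of $f_s$ at the cusp $\ell$ has the form $A_\ell(s)y^s+B_\ell(s)y^{1-s}$ with functions $A_\ell,B_\ell$ holomorphic near $s=1$. The truncation regularization $$I^{reg}(\tau,f)=\mathrm{CT}_{s=0}\Big[\sum_{\ell}\lim_{T\to\infty}\int_{\mathcal F_T^{\alpha_\ell}}f(\sigma_\ell z)\,\Theta_L(\tau,\sigma_\ell z,\varphi_0)\,y^{-s}\,d\mu(z)\Big]$$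 is well defined (the limits exist for $\mathrm{Re}(s)$ large, their sum continues meromorphically to $\mathbb C$, and $\mathrm{CT}$ denotes the constant term of the Laurent expansion of the continuation). Here the sum is over the $\Gamma$-classes of isotropic lines, and $\mathcal F^{a}_T$ is the part $y\le T$ of $\bigcup_{j=0}^{a-1}(\mathcal F+j)$, with $\mathcal F=\{z\in\mathbb H:|x|\le\tfrac12,\ |z|\ge1\}$. The Kudla–Rallis type regularization $$J^{reg}(\tau,f)=\mathrm{CT}_{s=1}\Big[\frac1{s(1-s)}\int_M f_s(z)\,\Theta_L(\tau,z,\Delta_z\varphi_0)\,d\mu(z)\Big]$$ is also well defined (the integral converges absolutely for $s\in U$, and the expression in brackets is meromorphic at $s=1$). For all $\tau\in\mathbb H$ one has $$J^{reg}(\tau,f)=I^{reg}(\tau,f)+\sum_{\ell\in\Gamma\backslash \mathrm{Iso}(V)}\frac{B_\ell'(1)\,\varepsilon_\ell}{\sqrt N}\,\tilde\Theta_{K_\ell}(\tau).$$ In particular, if the constant terms of $f_s$ at all cusps vanish for $s$ near $1$, then $J^{reg}(\tau,f)=I^{reg}(\tau,f)$; in general the two regularizations differ by the displayed linear combination of unary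 theta series. -/

import Mathlib

open UpperHalfPlane MeasureTheory Filter Topology
open scoped MatrixGroups ContDiff

noncomputable section

namespace RegTheta

/-! ### The quadratic space of signature (2,1) -/

/-- The rational vector space `V` of trace zero `2 × 2` matrices over `ℚ`. -/
def V : Type := ↥(LinearMap.ker (Matrix.traceLinearMap (Fin 2) ℚ ℚ))

instance : AddCommGroup V :=
  inferInstanceAs (AddCommGroup ↥(LinearMap.ker (Matrix.traceLinearMap (Fin 2) ℚ ℚ)))

instance : Module ℚ V :=
  inferInstanceAs (Module ℚ ↥(LinearMap.ker (Matrix.traceLinearMap (Fin 2) ℚ ℚ)))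

/-- The matrix underlying an element of `V`. -/
def V.mat (X : V) : Matrix (Fin 2) (Fin 2) ℚ := X.1

theorem V.mat_add (X Y : V) : (X + Y).mat = X.mat + Y.mat := rfl

theorem V.mat_smul (c : ℚ) (X : V) : (c • X).mat = c • X.mat := rfl

theorem V.trace_mat (X : V) : X.mat.trace = 0 := X.2

/-- The quadratic form `Q(X) = -N det X`. -/
def Q (N : ℕ) (X : V) : ℚ := -(N : ℚ) * X.mat.det

/-- The bilinear form `(X, Y) = N tr(XY)` on `V`, for which `(X, X) = 2 Q(X)`. -/
def bil (N : ℕ) : LinearMap.BilinForm ℚ V :=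
  LinearMap.mk₂ ℚ (fun X Y => (N : ℚ) * (X.mat * Y.mat).trace)
    (fun X X' Y => by simp [V.mat_add, add_mul, mul_add])
    (fun c X Y => by simp [V.mat_smul, mul_left_comm])
    (fun X Y Y' => by simp [V.mat_add, mul_add])
    (fun c X Y => by simp [V.mat_smul, mul_left_comm])

theorem bil_self (N : ℕ) (X : V) : bil N X X = 2 * Q N X := by
  have h : X.mat 0 0 + X.mat 1 1 = 0 := by
    simpa [Matrix.trace_fin_two] using X.trace_mat
  have h' : X.mat 1 1 = -X.mat 0 0 := by linarith
  simp only [bil, Q, LinearMap.mk₂_apply, Matrix.trace_fin_two, Matrix.mul_apply,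
    Fin.sum_univ_two, Matrix.det_fin_two, h']
  ring

theorem bil_comm (N : ℕ) (X Y : V) : bil N X Y = bil N Y X := by
  simp only [bil, LinearMap.mk₂_apply]
  rw [Matrix.trace_mul_comm]

/-- The action `g.X = g X g⁻¹` of `SL₂(ℤ)` on `V`. -/
def conj (g : SL(2, ℤ)) : V →ₗ[ℚ] V where
  toFun X := ⟨((g.map (Int.castRingHom ℚ) : SL(2, ℚ)) : Matrix (Fin 2) (Fin 2) ℚ) * X.mat *
      (((g.map (Int.castRingHom ℚ))⁻¹ : SL(2, ℚ)) : Matrix (Fin 2) (Fin 2) ℚ), by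
    have hX := X.trace_mat
    have hg : (((g.map (Int.castRingHom ℚ))⁻¹ : SL(2, ℚ)) : Matrix (Fin 2) (Fin 2) ℚ) *
        ((g.map (Int.castRingHom ℚ) : SL(2, ℚ)) : Matrix (Fin 2) (Fin 2) ℚ) = 1 := by
      rw [← Matrix.SpecialLinearGroup.coe_mul, inv_mul_cancel,
        Matrix.SpecialLinearGroup.coe_one]
    rw [LinearMap.mem_ker, Matrix.traceLinearMap_apply, Matrix.trace_mul_comm, ← mul_assoc, hg,
      one_mul, hX]⟩
  map_add' X Y := by
    apply Subtype.ext
    simp only [V.mat_add, mul_add, add_mul]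
    rfl
  map_smul' c X := by
    apply Subtype.ext
    simp only [V.mat_smul, Matrix.mul_smul, Matrix.smul_mul, RingHom.id_apply]
    rfl

/-- The isotropic vector `u₀ = (0 1; 0 0)`. -/
def u₀ : V := ⟨!![0, 1; 0, 0], by simp [Matrix.trace_fin_two]⟩

/-- The isotropic line `ℓ₀` spanned by `u₀`; it corresponds to the cusp `∞`. -/
def ℓ₀ : Submodule ℚ V := Submodule.span ℚ {u₀}

/-- `Iso(V)`: the set of isotropic lines in `V`. -/
def Iso (N : ℕ) : Type :=
  {ℓ : Submodule ℚ V // Module.finrank ℚ ℓ = 1 ∧ ∀ X ∈ ℓ, Q N X = 0}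

/-- The cusps: the set `Γ \ Iso(V)` of `Γ`-equivalence classes of isotropic lines. -/
def Cusp (N : ℕ) (Γ : Subgroup SL(2, ℤ)) : Type :=
  Quot fun ℓ ℓ' : Iso N => ∃ γ ∈ Γ, ℓ.1.map (conj γ) = ℓ'.1

/-- `σ` picks, for every cusp `c`, an element `σ c ∈ SL₂(ℤ)` such that the line
`(σ c) ℓ₀` represents `c`. -/
def IsCuspChoice (N : ℕ) (Γ : Subgroup SL(2, ℤ)) (σ : Cusp N Γ → SL(2, ℤ)) : Prop :=
  ∀ c, ∃ ℓ : Iso N, Quot.mk _ ℓ = c ∧ ℓ.1 = ℓ₀.map (conj (σ c))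

/-- The width `α_ℓ` of the cusp `ℓ = g ℓ₀`: the least `k > 0` with `± g T^k g⁻¹ ∈ Γ`. -/
def cuspWidth (Γ : Subgroup SL(2, ℤ)) (g : SL(2, ℤ)) : ℕ :=
  sInf {k : ℕ | 0 < k ∧
    (g * ModularGroup.T ^ k * g⁻¹ ∈ Γ ∨ -(g * ModularGroup.T ^ k * g⁻¹) ∈ Γ)}

/-- `β_ℓ` for the line `ℓ = g ℓ₀`: with `u_ℓ = g u₀`, the positive rational number such that
`β_ℓ u_ℓ` is a primitive element of `ℓ ∩ L`, that is, the least positive `r` with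
`r u_ℓ ∈ L`. -/
def cuspBeta (L : Submodule ℤ V) (g : SL(2, ℤ)) : ℝ :=
  sInf {r : ℝ | 0 < r ∧ ∃ q : ℚ, (q : ℝ) = r ∧ q • conj g u₀ ∈ L}

/-- `ε_ℓ = α_ℓ / β_ℓ`. -/
def cuspEps (L : Submodule ℤ V) (Γ : Subgroup SL(2, ℤ)) (g : SL(2, ℤ)) : ℝ :=
  cuspWidth Γ g / cuspBeta L g

/-! ### Lattices -/

/-- An even lattice of full rank in `V`. -/
structure IsEvenLattice (N : ℕ) (L : Submodule ℤ V) : Prop where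
  fg : L.FG
  span_eq_top : Submodule.span ℚ (L : Set V) = ⊤
  even : ∀ X ∈ L, ∃ n : ℤ, Q N X = n

/-- The dual lattice `L'`. -/
def dual (N : ℕ) (L : Submodule ℤ V) : Submodule ℤ V := (bil N).dualSubmodule L

/-- The discriminant group `L'/L`. -/
abbrev Disc (N : ℕ) (L : Submodule ℤ V) : Type := ↥(dual N L) ⧸ L.submoduleOf (dual N L)

/-- `Γ` takes `L` to itself and acts trivially on `L'/L`. -/
def ActsTrivially (N : ℕ) (L : Submodule ℤ V) (Γ : Subgroup SL(2, ℤ)) : Prop :=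
  ∀ γ ∈ Γ, (∀ X ∈ L, conj γ X ∈ L) ∧ ∀ X ∈ dual N L, conj γ X - X ∈ L

/-! ### The theta functions attached to isotropic lines -/

/-- The orthogonal complement `ℓ^⊥`. -/
def perp (N : ℕ) (ℓ : Submodule ℚ V) : Submodule ℚ V := (bil N).orthogonal ℓ

/-- The unary quadratic space `W_ℓ = ℓ^⊥ / ℓ`. -/
abbrev W (N : ℕ) (ℓ : Submodule ℚ V) : Type := ↥(perp N ℓ) ⧸ ℓ.submoduleOf (perp N ℓ)

/-- The quadratic form on `W_ℓ` induced by `Q`. -/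
def QW (N : ℕ) (ℓ : Submodule ℚ V) (lam : W N ℓ) : ℚ :=
  Quotient.liftOn' lam (fun X => Q N (X : V)) (by
    intro X Y h
    have h1 : X - Y ∈ ℓ.submoduleOf (perp N ℓ) :=
      (Submodule.quotientRel_def _).mp h
    have h2 : ((X : V) - (Y : V)) ∈ ℓ := h1
    have hX : bil N ((X : V) - Y) X = 0 := (LinearMap.BilinForm.mem_orthogonal_iff.mp X.2) _ h2
    have hY : bil N ((X : V) - Y) Y = 0 := (LinearMap.BilinForm.mem_orthogonal_iff.mp Y.2) _ h2
    have e1 := bil_self N (X : V)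
    have e2 := bil_self N (Y : V)
    have e3 := bil_comm N (X : V) (Y : V)
    simp only [map_sub, LinearMap.sub_apply] at hX hY
    show Q N (X : V) = Q N (Y : V)
    linarith)

/-- The `h`-component of `Θ̃_{K_ℓ}`. If `h ⊥ ℓ`, i.e. if `h` has a representative in `ℓ^⊥`, the
set of all `λ ∈ W_ℓ` that are images of elements of `h ∩ ℓ^⊥` is the coset `h̄ + K_ℓ` of
`K_ℓ = (L ∩ ℓ^⊥) / (L ∩ ℓ)`, and the sum is `θ_{K_ℓ, h̄}(τ) = ∑_{λ ∈ h̄ + K_ℓ} e(Q(λ) τ)`.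
Otherwise the set is empty and the component is `0`. -/
def unaryTheta (N : ℕ) (L : Submodule ℤ V) (ℓ : Submodule ℚ V) (h : Disc N L) (τ : ℍ) : ℂ :=
  ∑' lam : {lam : W N ℓ // ∃ X : ↥(perp N ℓ), ∃ hX : (X : V) ∈ dual N L,
      Submodule.Quotient.mk (p := L.submoduleOf (dual N L)) ⟨X, hX⟩ = h ∧
      Submodule.Quotient.mk X = lam},
    Complex.exp (2 * Real.pi * Complex.I * ((QW N ℓ lam.1 : ℚ) : ℂ) * (τ : ℂ))

/-! ### Analysis on the upper half plane -/

/-- The hyperbolic Laplacian `Δ = -y² (∂²/∂x² + ∂²/∂y²)` of weight `0`. -/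
def hypLaplacian (f : ℍ → ℂ) (z : ℍ) : ℂ :=
  -((z.im : ℂ) ^ 2) * Laplacian.laplacian (fun w : ℂ => f (ofComplex w)) (z : ℂ)

/-- Weak Maass forms of weight `0` for `Γ` with eigenvalue `lam`: smooth `Γ`-invariant functions
with `Δ f = lam f` and at most linear exponential growth at all cusps (`= O(e^{Cy})` as
`y → ∞`, uniformly in `x`). -/
structure IsWeakMaassForm (Γ : Subgroup SL(2, ℤ)) (lam : ℂ) (f : ℍ → ℂ) : Prop where
  smooth : ContDiffOn ℝ ∞ (fun w : ℂ => f (ofComplex w)) {w : ℂ | 0 < w.im}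
  invariant : ∀ γ ∈ Γ, ∀ z : ℍ, f (γ • z) = f z
  eigen : ∀ z, hypLaplacian f z = lam * f z
  growth : ∃ C : ℝ, 0 < C ∧ ∀ δ : SL(2, ℤ),
    (fun z : ℍ => f (δ • z)) =O[atImInfty] fun z : ℍ => Real.exp (C * z.im)

/-- `H_0(Γ)`: harmonic weak Maass forms of weight `0`. -/
def IsHarmonicWeakMaassForm (Γ : Subgroup SL(2, ℤ)) (f : ℍ → ℂ) : Prop :=
  IsWeakMaassForm Γ 0 f

/-- A spectral deformation of `f` over the open neighbourhood `U` of `1`: a holomorphic family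
`(f_s)_{s ∈ U}` (that is, a holomorphic map from `U` to the continuous functions on `ℍ` with the
topology of locally uniform convergence) of weak Maass forms with eigenvalue `s (1 - s)` and with
`f_1 = f`. -/
structure IsSpectralDeformation (Γ : Subgroup SL(2, ℤ)) (f : ℍ → ℂ) (U : Set ℂ)
    (F : ℂ → ℍ → ℂ) : Prop where
  isOpen : IsOpen U
  one_mem : (1 : ℂ) ∈ U
  continuousOn : ContinuousOn (fun p : ℂ × ℍ => F p.1 p.2) (U ×ˢ Set.univ)
  holomorphic : ∀ z, DifferentiableOn ℂ (fun s => F s z) U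
  weakMaass : ∀ s ∈ U, IsWeakMaassForm Γ (s * (1 - s)) (F s)
  at_one : F 1 = f

/-- The constant term `a_ℓ(0, y) = (1/α) ∫_0^α f(g(x + iy)) dx` of the Fourier expansion of `f`
at the cusp `ℓ = g ℓ₀` of width `α`. -/
def constTerm (Γ : Subgroup SL(2, ℤ)) (g : SL(2, ℤ)) (f : ℍ → ℂ) (y : ℝ) : ℂ :=
  (1 / (cuspWidth Γ g : ℂ)) *
    ∫ x in (0 : ℝ)..(cuspWidth Γ g : ℝ), f (g • ofComplex ((x : ℂ) + (y : ℂ) * Complex.I))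

/-- The constant terms of `F s` at the cusps are `A_ℓ(s) y^s + B_ℓ(s) y^{1-s}` for `s` near `1`,
with `A_ℓ` and `B_ℓ` holomorphic near `1`. -/
def HasConstTerms {ι : Type} (Γ : Subgroup SL(2, ℤ)) (σ : ι → SL(2, ℤ)) (F : ℂ → ℍ → ℂ)
    (A B : ι → ℂ → ℂ) : Prop :=
  ∀ c, AnalyticAt ℂ (A c) 1 ∧ AnalyticAt ℂ (B c) 1 ∧
    ∀ᶠ s in 𝓝 (1 : ℂ), ∀ y : ℝ, 0 < y →
      constTerm Γ (σ c) (F s) y = A c s * (y : ℂ) ^ s + B c s * (y : ℂ) ^ (1 - s)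

/-- `h` is meromorphic at `s₀` and `a` is the constant term `CT_{s = s₀} h(s)` of its Laurent
expansion there. -/
def HasCT (h : ℂ → ℂ) (s₀ a : ℂ) : Prop :=
  ∃ (n : ℕ) (p : Fin n → ℂ) (g : ℂ → ℂ), AnalyticAt ℂ g s₀ ∧ g s₀ = a ∧
    ∀ᶠ s in 𝓝[≠] s₀, h s = g s + ∑ k : Fin n, p k / (s - s₀) ^ ((k : ℕ) + 1)

/-! ### The Siegel theta kernel -/

/-- `(X, Y) = N tr(XY)` on real matrices. -/
def bilR (N : ℕ) (X Y : Matrix (Fin 2) (Fin 2) ℝ) : ℝ := (N : ℝ) * (X * Y).trace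

/-- The vector `X(z) = (1 / (√N y)) (-x, z z̄; -1, x)` spanning the negative line of `z`. -/
def Xvec (N : ℕ) (z : ℍ) : Matrix (Fin 2) (Fin 2) ℝ :=
  (1 / (√(N : ℝ) * z.im)) • !![-z.re, Complex.normSq (z : ℂ); -1, z.re]

/-- The Gaussian `φ₀(X, z) = e^{-π (X,X)_z}` with the majorant
`(X, X)_z = (X, X) + (X, X(z))²`. -/
def gaussian (N : ℕ) (X : Matrix (Fin 2) (Fin 2) ℝ) (z : ℍ) : ℝ :=
  Real.exp (-Real.pi * (bilR N X X + bilR N X (Xvec N z) ^ 2))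

/-- `φ₀(X, τ, z) = √v φ₀(√v X, z) e^{π i (X,X) u}` for `τ = u + iv`. -/
def phi0 (N : ℕ) (X : Matrix (Fin 2) (Fin 2) ℝ) (τ z : ℍ) : ℂ :=
  ((√τ.im * gaussian N (√τ.im • X) z : ℝ) : ℂ) *
    Complex.exp (Real.pi * Complex.I * (bilR N X X : ℂ) * (τ.re : ℂ))

/-- The real matrix underlying `X ∈ V`. -/
def toReal (X : V) : Matrix (Fin 2) (Fin 2) ℝ :=
  X.mat.map (fun q : ℚ => (q : ℝ))

/-- The component `θ_h(τ, z, φ) = ∑_{X ∈ h + L} φ(X, τ, z)` of `Θ_L(τ, z, φ)`. -/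
def theta (N : ℕ) (L : Submodule ℤ V) (φ : Matrix (Fin 2) (Fin 2) ℝ → ℍ → ℍ → ℂ)
    (h : Disc N L) (τ z : ℍ) : ℂ :=
  ∑' X : {X : ↥(dual N L) // Submodule.Quotient.mk X = h}, φ (toReal (X.1 : V)) τ z

/-- The Schwartz function `Δ_z φ₀(X, τ, z)`. -/
def lapPhi0 (N : ℕ) (X : Matrix (Fin 2) (Fin 2) ℝ) (τ z : ℍ) : ℂ :=
  hypLaplacian (fun w => phi0 N X τ w) z

/-! ### The two regularized theta lifts -/

/-- The truncated domain `𝓕^a_T`: the part `y ≤ T` of the union of the translates by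
`j = 0, …, a - 1` of the standard fundamental domain of `SL₂(ℤ)`. -/
def truncDomain (a : ℕ) (T : ℝ) : Set ℍ :=
  {z : ℍ | z.im ≤ T ∧ ∃ j < a, ∃ w ∈ ModularGroup.fd, z = ModularGroup.T ^ j • w}

/-- `I` is the `h`-component of the regularized theta lift `I^reg(τ, f)` defined by truncation:
for `Re s` large the limits over truncated domains exist at all cusps, their sum has a meromorphic
continuation `Z` to the whole `s`-plane, and `I = CT_{s=0} Z(s)`.
The measure `volume` on `ℍ` is `dx dy / y²`. -/
def IsTruncLift (N : ℕ) (L : Submodule ℤ V) (Γ : Subgroup SL(2, ℤ)) (σ : Cusp N Γ → SL(2, ℤ))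
    (f : ℍ → ℂ) (h : Disc N L) (τ : ℍ) (I : ℂ) : Prop :=
  ∃ Z : ℂ → ℂ, MeromorphicOn Z Set.univ ∧
    (∃ r : ℝ, ∀ s : ℂ, r < s.re → ∃ v : Cusp N Γ → ℂ,
      (∀ c, Tendsto (fun T : ℝ => ∫ z in truncDomain (cuspWidth Γ (σ c)) T,
          f (σ c • z) * theta N L (phi0 N) h τ (σ c • z) * (z.im : ℂ) ^ (-s))
        atTop (𝓝 (v c))) ∧
      Z s = ∑ᶠ c, v c) ∧
    HasCT Z 0 I

/-- `D` is a fundamental domain for `M = Γ \ ℍ`, i.e. for the image of `Γ` in the group of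
transformations of `ℍ`, with respect to the invariant measure. -/
def IsFundDomain (Γ : Subgroup SL(2, ℤ)) (D : Set ℍ) : Prop :=
  IsFundamentalDomain ↥(MulAction.toPermHom ↥Γ ℍ).range D volume

/-- `J` is the `h`-component of the regularized theta lift
`J^reg(τ, f) = CT_{s=1} [ (1 / (s (1 - s))) ∫_M f_s(z) Θ_L(τ, z, Δ_z φ₀) dμ(z) ]`
defined by means of the spectral deformation `F = (f_s)_{s ∈ U}`, the integrals being absolutely
convergent; integrals over `M` are computed on the fundamental domain `D`. -/
def IsDiffLift (N : ℕ) (L : Submodule ℤ V) (D : Set ℍ) (U : Set ℂ) (F : ℂ → ℍ → ℂ)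
    (h : Disc N L) (τ : ℍ) (J : ℂ) : Prop :=
  (∀ s ∈ U, IntegrableOn (fun z => F s z * theta N L (lapPhi0 N) h τ z) D) ∧
    HasCT (fun s => 1 / (s * (1 - s)) * ∫ z in D, F s z * theta N L (lapPhi0 N) h τ z) 1 J

end RegTheta

end

noncomputable section

namespace RegTheta

/-! ### Constant terms of Laurent expansions and holomorphic parameter integrals -/

/-! Both lifts are evaluated explicitly as sums over the cusps, and the two values are compared.

At the cusp `σ c` the kernel attached to `φ₀` equals `κ y` up to an error `O(e^{-c y²})`, where `κ`
(`cuspKappa`) is the unary theta series divided by `√N β`; the kernel attached to `Δφ₀` is itself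
`O(e^{-c y²})` (`theta_cusp_asymptotics`). Indeed vectors not orthogonal to the isotropic line
contribute Gaussian decay only. The orthogonal ones are summed along the line by Poisson summation:
the zero frequency gives `κ y` for `φ₀`, and for `Δφ₀` the zero-frequency terms cancel.

Let `cuspPart` be the integral of `f_s Θ` over the compact core of the cusp plus the integral of
`f_s (Θ - κ y)` over the strip `y > 1`. Green's formula on `Γ \ ℍ` (`green`, `integral_lift`) turns
the integral of `f_s` against the kernel of `Δφ₀` into the sum over cusps of `s(1-s) cuspPart(f_s) +
κ α (a'(1) - a(1))`, with `a` the constant term of `f_s` at the cusp. For `a = A y^s + B y^{1-s}`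
the last bracket is `(s-1) A - s B`. Division by `s(1-s)` leaves a simple pole at `s = 1`, and the
constant term there is `cuspPart(f) + κ α (B'(1) - A(1))` (`hasCT_diffLift`). In the truncated
integral the strip contributes `κ α (A(1)/(s-1) + B(1)/s)` to the continuation, whose constant term
at `s = 0` is `-κ α A(1)` (`exists_truncLift`). The difference is `κ α B'(1)`, which is `B'(1) ε /
√N` times the unary theta series.

Two analytic points need work. In Green's formula the form may grow exponentially and nothing is
assumed on its derivatives; a smooth cutoff in an `SL₂(ℤ)`-invariant height function together with
an interior energy estimate (`energy_estimate`) shows that the commutator terms die against the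
Gaussian error, while against `κ y` only the constant term is seen and an explicit primitive exists
(`integral_cutoff_linear`). Secondly, `cuspPart(f_s)` must be holomorphic near `s = 1`, although the
growth exponent of `f_s` is given for each `s` separately. The Fourier coefficients satisfy second
order equations in `y`; a Baire argument (`IsModeFamily.uniform_bound`) shows that only finitely
many of them can grow for `s` near `1`, the rest being bounded by their values at `y = 1`. Parseval
then gives a uniform exponential bound in mean square (`IsSpectralDeformation.exists_l2_bound`),
which suffices against Gaussian decay. -/

theorem HasCT.eventually_circleIntegral {h : ℂ → ℂ} {s₀ a : ℂ} (H : HasCT h s₀ a) :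
    ∀ᶠ r in 𝓝[>] (0 : ℝ), (∮ z in C(s₀, r), (z - s₀)⁻¹ * h z) = 2 * Real.pi * Complex.I * a := by
  obtain ⟨n, p, g, hg, rfl, hev⟩ := H
  obtain ⟨ρ, hρ, hgρ⟩ : ∃ ρ > 0, ∀ z ∈ Metric.ball s₀ ρ, DifferentiableAt ℂ g z :=
    Metric.eventually_nhds_iff_ball.mp
      (hg.eventually_analyticAt.mono fun z hz => hz.differentiableAt)
  obtain ⟨ρ', hρ', hh⟩ := Metric.eventually_nhds_iff_ball.mp (eventually_nhdsWithin_iff.mp hev)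
  have hmin : 0 < min ρ ρ' := lt_min hρ hρ'
  filter_upwards [Ioo_mem_nhdsGT hmin] with r hr
  have hr0 : 0 < r := hr.1
  have hrρ : r < ρ := hr.2.trans_le (min_le_left _ _)
  have hrρ' : r < ρ' := hr.2.trans_le (min_le_right _ _)
  have hgc : DifferentiableOn ℂ g (Metric.closedBall s₀ r) := fun z hz =>
    (hgρ z (Metric.closedBall_subset_ball hrρ hz)).differentiableWithinAt
  have h1 : (∮ z in C(s₀, r), (z - s₀)⁻¹ * g z) = 2 * Real.pi * Complex.I * g s₀ := by
    simpa [smul_eq_mul] using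
      hgc.circleIntegral_sub_inv_smul (w := s₀) (Metric.mem_ball_self hr0)
  have hne : ∀ z ∈ Metric.sphere s₀ r, z ≠ s₀ := fun z hz => by
    rintro rfl
    simp at hz
    linarith
  -- After division by `z - s₀` every polar term is a power with exponent at most `-2`, so its
  -- circle integral vanishes and only the holomorphic part survives.
  have h2 : ∀ k : Fin n, (∮ z in C(s₀, r), (z - s₀)⁻¹ * (p k / (z - s₀) ^ ((k : ℕ) + 1))) = 0 := by
    intro k
    have e : ∀ z ∈ Metric.sphere s₀ r, (z - s₀)⁻¹ * (p k / (z - s₀) ^ ((k : ℕ) + 1)) =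
        p k * (z - s₀) ^ (-((k : ℤ) + 2)) := by
      intro z hz
      have hz0 : z - s₀ ≠ 0 := sub_ne_zero.mpr (hne z hz)
      rw [zpow_neg, show ((k : ℤ) + 2) = ((k + 2 : ℕ) : ℤ) by push_cast; ring, zpow_natCast]
      field_simp
      ring
    rw [circleIntegral.integral_congr hr0.le e, circleIntegral.integral_const_mul,
      circleIntegral.integral_sub_zpow_of_ne (by omega), mul_zero]
  have hcont : ∀ k : Fin n, CircleIntegrable
      (fun z => (z - s₀)⁻¹ * (p k / (z - s₀) ^ ((k : ℕ) + 1))) s₀ r := by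
    intro k
    apply ContinuousOn.circleIntegrable hr0.le
    intro z hz
    have hz0 : z - s₀ ≠ 0 := sub_ne_zero.mpr (hne z hz)
    apply ContinuousAt.continuousWithinAt
    have : ContinuousAt (fun z : ℂ => z - s₀) z := by fun_prop
    exact (this.inv₀ hz0).mul (continuousAt_const.div (this.pow _) (pow_ne_zero _ hz0))
  have hgi : CircleIntegrable (fun z => (z - s₀)⁻¹ * g z) s₀ r := by
    apply ContinuousOn.circleIntegrable hr0.le
    intro z hz
    have hz0 : z - s₀ ≠ 0 := sub_ne_zero.mpr (hne z hz)
    have : ContinuousAt (fun z : ℂ => z - s₀) z := by fun_prop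
    exact (this.inv₀ hz0).continuousWithinAt.mul
      ((hgc.continuousOn z (Metric.sphere_subset_closedBall hz)).mono
        Metric.sphere_subset_closedBall)
  have e : ∀ z ∈ Metric.sphere s₀ r, (z - s₀)⁻¹ * h z =
      (z - s₀)⁻¹ * g z + ∑ k : Fin n, (z - s₀)⁻¹ * (p k / (z - s₀) ^ ((k : ℕ) + 1)) := by
    intro z hz
    rw [hh z (Metric.sphere_subset_closedBall.trans (Metric.closedBall_subset_ball hrρ') hz)
      (hne z hz), mul_add, Finset.mul_sum]
  rw [circleIntegral.integral_congr hr0.le e, circleIntegral.integral_add hgi, h1,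
    circleIntegral.integral_fun_sum]
  · simp [h2]
  · exact fun k _ => hcont k
  · have := CircleIntegrable.sum Finset.univ (fun k _ => hcont k)
    convert this using 1
    ext z
    simp

/-- Small circle integrals of `h(z)/(z - s₀)` do not depend on the chosen Laurent presentation, and
they determine the constant term. -/
theorem HasCT.unique {h : ℂ → ℂ} {s₀ a b : ℂ} (ha : HasCT h s₀ a) (hb : HasCT h s₀ b) :
    a = b := by
  obtain ⟨r, h1, h2⟩ := (ha.eventually_circleIntegral.and hb.eventually_circleIntegral).exists
  rw [h1] at h2
  exact mul_left_cancel₀ (by simp [Real.pi_ne_zero]) h2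

theorem HasCT.congr {h h' : ℂ → ℂ} {s₀ a : ℂ} (ha : HasCT h s₀ a)
    (hh : ∀ᶠ s in 𝓝[≠] s₀, h' s = h s) : HasCT h' s₀ a := by
  obtain ⟨n, p, g, hg, h0, hev⟩ := ha
  exact ⟨n, p, g, hg, h0, by filter_upwards [hev, hh] with s h1 h2; rw [h2, h1]⟩

theorem hasCT_of_simplePole {h g : ℂ → ℂ} {s₀ p : ℂ} (hg : AnalyticAt ℂ g s₀)
    (hh : ∀ᶠ s in 𝓝[≠] s₀, h s = g s + p / (s - s₀)) : HasCT h s₀ (g s₀) :=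
  ⟨1, fun _ => p, g, hg, rfl, by simpa using hh⟩

/-- Two meromorphic functions on `ℂ` that agree on a right half-plane have the same constant
terms. -/
theorem eventuallyEq_of_eqOn_halfPlane {Z W : ℂ → ℂ} (hZ : MeromorphicOn Z Set.univ)
    (hW : MeromorphicOn W Set.univ) {r : ℝ} (h : ∀ s : ℂ, r < s.re → Z s = W s) (s₀ : ℂ) :
    ∀ᶠ s in 𝓝[≠] s₀, Z s = W s := by
  have hd : MeromorphicOn (Z - W) Set.univ := hZ.sub hW
  have h1 : meromorphicOrderAt (Z - W) ((r : ℂ) + 1) = ⊤ := by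
    rw [meromorphicOrderAt_eq_top_iff]
    have : {s : ℂ | r < s.re} ∈ 𝓝 ((r : ℂ) + 1) :=
      (isOpen_lt continuous_const Complex.continuous_re).mem_nhds (by simp)
    filter_upwards [nhdsWithin_le_nhds this] with s hs
    simp [h s hs]
  have h2 : meromorphicOrderAt (Z - W) s₀ = ⊤ := by
    by_contra hne
    exact (hd.exists_meromorphicOrderAt_ne_top_iff_forall isConnected_univ).mp
      ⟨⟨s₀, trivial⟩, hne⟩ ⟨(r : ℂ) + 1, trivial⟩ h1
  rw [meromorphicOrderAt_eq_top_iff] at h2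
  filter_upwards [h2] with s hs
  exact sub_eq_zero.mp hs

/-- Parameter integrals of dominated holomorphic families are holomorphic. -/
theorem differentiableOn_integral_of_dominated {X : Type*} [MeasurableSpace X] {μ : Measure X}
    {G : ℂ → X → ℂ} {V : Set ℂ} (hV : IsOpen V)
    (hmeas : ∀ s ∈ V, AEStronglyMeasurable (G s) μ)
    (hhol : ∀ᵐ x ∂μ, DifferentiableOn ℂ (fun s => G s x) V)
    (hdom : ∀ s ∈ V, ∃ ε > 0, ∃ b : X → ℝ, Integrable b μ ∧
      ∀ᵐ x ∂μ, ∀ w ∈ Metric.ball s ε, ‖G w x‖ ≤ b x) :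
    DifferentiableOn ℂ (fun s => ∫ x, G s x ∂μ) V := by
  intro s hs
  obtain ⟨ε₁, hε₁, b, hb, hbd⟩ := hdom s hs
  obtain ⟨ε₂, hε₂, hsub⟩ := Metric.isOpen_iff.mp hV s hs
  set ε := min ε₁ ε₂ / 2 with hε
  have hε0 : 0 < ε := by positivity
  have hin : ∀ w ∈ Metric.ball s ε, Metric.closedBall w (ε / 2) ⊆
      Metric.ball s ε₁ ∩ Metric.ball s ε₂ := by
    intro w hw z hz
    have h1 : dist z s < ε + ε := by
      calc dist z s ≤ dist z w + dist w s := dist_triangle _ _ _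
        _ < ε + ε := by
          have := Metric.mem_closedBall.mp hz
          have := Metric.mem_ball.mp hw
          linarith
    have h2 : ε + ε = min ε₁ ε₂ := by rw [hε]; ring
    rw [h2] at h1
    exact ⟨h1.trans_le (min_le_left _ _), h1.trans_le (min_le_right _ _)⟩
  have hball : Metric.ball s ε ∈ 𝓝 s := Metric.ball_mem_nhds s hε0
  -- Cauchy's estimate on circles of radius `ε / 2` converts the majorant of the family into one of
  -- its derivatives.
  have hderiv : ∀ᵐ x ∂μ, ∀ w ∈ Metric.ball s ε, ‖deriv (fun s => G s x) w‖ ≤ b x / (ε / 2) := by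
    filter_upwards [hhol, hbd] with x hx hbx w hw
    apply Complex.norm_deriv_le_of_forall_mem_sphere_norm_le (by positivity)
    · apply DifferentiableOn.diffContOnCl
      rw [closure_ball _ (by positivity)]
      exact hx.mono fun z hz => hsub (hin w hw hz).2
    · exact fun z hz => hbx z (hin w hw (Metric.sphere_subset_closedBall hz)).1
  have hat : ∀ᵐ x ∂μ, ∀ w ∈ Metric.ball s ε,
      HasDerivAt (fun s => G s x) (deriv (fun s => G s x) w) w := by
    filter_upwards [hhol] with x hx w hw
    have hwV : w ∈ V := hsub (hin w hw (Metric.mem_closedBall_self (by positivity))).2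
    exact ((hx w hwV).differentiableAt (hV.mem_nhds hwV)).hasDerivAt
  -- The derivative is measurable as a limit of difference quotients along `s + 1/(n+1)`; the shift
  -- by `n₀` keeps all these points in `V`.
  have hF' : AEStronglyMeasurable (fun x => deriv (fun s => G s x) s) μ := by
    have hu : Tendsto (fun n : ℕ => s + ((1 / ((n : ℝ) + 1) : ℝ) : ℂ)) atTop (𝓝[≠] s) := by
      rw [tendsto_nhdsWithin_iff]
      constructor
      · have : Tendsto (fun n : ℕ => ((1 / ((n : ℝ) + 1) : ℝ) : ℂ)) atTop (𝓝 ((0 : ℝ) : ℂ)) :=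
          (Complex.continuous_ofReal.tendsto _).comp tendsto_one_div_add_atTop_nhds_zero_nat
        simpa using this.const_add s
      · refine Eventually.of_forall fun n => ?_
        simp only [Set.mem_compl_iff, Set.mem_singleton_iff, add_eq_left, Complex.ofReal_eq_zero]
        positivity
    have huV : ∀ᶠ n : ℕ in atTop, s + ((1 / ((n : ℝ) + 1) : ℝ) : ℂ) ∈ V :=
      (tendsto_nhdsWithin_iff.mp hu).1.eventually (hV.mem_nhds hs)
    obtain ⟨n₀, hn₀⟩ := eventually_atTop.mp huV
    refine aestronglyMeasurable_of_tendsto_ae (atTop : Filter ℕ)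
      (f := fun n x => slope (fun s => G s x) s (s + ((1 / (((n + n₀ : ℕ) : ℝ) + 1) : ℝ) : ℂ))) ?_ ?_
    · intro n
      simp only [slope_def_module]
      exact (((hmeas _ (hn₀ (n + n₀) (by omega))).sub (hmeas s hs))).const_smul
        ((s + ((1 / (((n + n₀ : ℕ) : ℝ) + 1) : ℝ) : ℂ) - s)⁻¹)
    · filter_upwards [hat] with x hx
      have h1 := (hx s (Metric.mem_ball_self hε0)).tendsto_slope
      exact (h1.comp hu).comp (tendsto_add_atTop_nat n₀)
  have hint : Integrable (G s) μ := by
    refine hb.mono' (hmeas s hs) ?_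
    filter_upwards [hbd] with x hx
    exact hx s (Metric.mem_ball_self hε₁)
  exact (hasDerivAt_integral_of_dominated_loc_of_deriv_le hball
    (by filter_upwards [hV.mem_nhds hs] with w hw using hmeas w hw) hint hF' hderiv
    (hb.div_const _) hat).2.differentiableAt.differentiableWithinAt

/-! ### The ordinary differential equations satisfied by Fourier coefficients -/

theorem const_of_hasDerivAt_zero_Ioi {g : ℝ → ℂ} (h : ∀ y : ℝ, 0 < y → HasDerivAt g 0 y) {y : ℝ}
    (hy : 0 < y) : g y = g 1 :=
  isOpen_Ioi.is_const_of_deriv_eq_zero isPreconnected_Ioi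
    (fun x hx => (h x hx).differentiableAt.differentiableWithinAt)
    (fun x hx => (h x hx).deriv) hy (by simp : (1 : ℝ) ∈ Set.Ioi 0)

theorem hasDerivAt_ofReal_cpow' {y : ℝ} (hy : 0 < y) (s : ℂ) :
    HasDerivAt (fun y : ℝ => (y : ℂ) ^ s) (s * (y : ℂ) ^ (s - 1)) y := by
  have h := (hasDerivAt_id (y : ℂ)).cpow_const (c := s) (Or.inl (by simpa using hy))
  simpa using h.comp_ofReal

theorem ofReal_cpow_sub_one {y : ℝ} (hy : 0 < y) (s : ℂ) :
    (y : ℂ) ^ (s - 1) = (y : ℂ) ^ s / y := by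
  rw [Complex.cpow_sub _ _ (by exact_mod_cast hy.ne'), Complex.cpow_one]

/-- The operator `d/dy - s/y` kills the solution `y^s` and sends `y^{1-s}` to a multiple of
`y^{-s}`, so multiplying by `y^s` gives a conserved quantity. -/
theorem eulerODE_first_integral {s : ℂ} {a a' : ℝ → ℂ}
    (h1 : ∀ y : ℝ, 0 < y → HasDerivAt a (a' y) y)
    (h2 : ∀ y : ℝ, 0 < y → HasDerivAt a' (-(s * (1 - s)) / (y : ℂ) ^ 2 * a y) y)
    {y : ℝ} (hy : 0 < y) :
    (y : ℂ) ^ s * (a' y - s / y * a y) = a' 1 - s * a 1 := by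
  have key : ∀ y : ℝ, 0 < y → HasDerivAt (fun y : ℝ => (y : ℂ) ^ s * (a' y - s / y * a y)) 0 y := by
    intro y hy
    have hy0 : (y : ℂ) ≠ 0 := by exact_mod_cast hy.ne'
    have hinv : HasDerivAt (fun y : ℝ => s / (y : ℂ)) (-s / (y : ℂ) ^ 2) y := by
      have := ((hasDerivAt_const (y : ℂ) s).div (hasDerivAt_id (y : ℂ)) hy0).comp_ofReal
      simpa using this
    have := (hasDerivAt_ofReal_cpow' hy s).mul ((h2 y hy).sub (hinv.mul (h1 y hy)))
    refine this.congr_deriv ?_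
    simp only [Pi.sub_apply, Pi.mul_apply]
    rw [ofReal_cpow_sub_one hy]
    field_simp
    ring
  have := const_of_hasDerivAt_zero_Ioi key hy
  simpa using this

/-- The equation is symmetric under `s ↦ 1 - s`, so there are two first integrals; they are linearly
independent in `a, a'` exactly when `2s ≠ 1`, and solving for `a` gives both coefficients. -/
theorem eulerODE_solution {s : ℂ} (hs : 2 * s - 1 ≠ 0) {a a' : ℝ → ℂ}
    (h1 : ∀ y : ℝ, 0 < y → HasDerivAt a (a' y) y)
    (h2 : ∀ y : ℝ, 0 < y → HasDerivAt a' (-(s * (1 - s)) / (y : ℂ) ^ 2 * a y) y) :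
    ∃ A B : ℂ, ∀ y : ℝ, 0 < y → a y = A * (y : ℂ) ^ s + B * (y : ℂ) ^ (1 - s) := by
  refine ⟨(a' 1 - (1 - s) * a 1) / (2 * s - 1), -(a' 1 - s * a 1) / (2 * s - 1), fun y hy => ?_⟩
  have hy0 : (y : ℂ) ≠ 0 := by exact_mod_cast hy.ne'
  have e1 := eulerODE_first_integral h1 h2 hy
  have e2 := eulerODE_first_integral (s := 1 - s) h1 (fun y hy => by
    convert h2 y hy using 1; ring) hy
  rw [← e1, ← e2]
  have hm : (y : ℂ) ^ s * (y : ℂ) ^ (1 - s) = y := by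
    rw [← Complex.cpow_add _ _ hy0]; simp
  rw [div_mul_eq_mul_div _ (2 * s - 1), div_mul_eq_mul_div _ (2 * s - 1), ← add_div,
    eq_div_iff hs]
  have e3 : (y : ℂ) ^ s * (y : ℂ) ^ (1 - s) / y = 1 := by rw [hm]; field_simp
  linear_combination (-(a y) * (2 * s - 1)) * e3

/-- This is the determinant of the evaluations of `y^s, y^{1-s}` at `y = 1, 2`; at `s = 1` it equals
`1`. -/
theorem cpow_two_ne_of_near_one : ∀ᶠ s in 𝓝 (1 : ℂ), (2 : ℂ) ^ s - (2 : ℂ) ^ (1 - s) ≠ 0 := by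
  have : ContinuousAt (fun s : ℂ => (2 : ℂ) ^ s - (2 : ℂ) ^ (1 - s)) 1 := by
    apply ContinuousAt.sub
    · exact continuousAt_const_cpow (by norm_num)
    · exact ContinuousAt.comp (g := fun s : ℂ => (2 : ℂ) ^ s)
        (continuousAt_const_cpow (by norm_num)) (by fun_prop)
  apply this.eventually_ne
  norm_num

theorem analyticAt_two_cpow {g : ℂ → ℂ} {s₀ : ℂ} (hg : AnalyticAt ℂ g s₀) :
    AnalyticAt ℂ (fun s => (2 : ℂ) ^ g s) s₀ := by
  have : (fun s => (2 : ℂ) ^ g s) = fun s => Complex.exp (Complex.log 2 * g s) := by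
    ext s
    rw [Complex.cpow_def_of_ne_zero (by norm_num)]
  rw [this]
  exact (analyticAt_const.mul hg).cexp

/-- Cramer's rule with the values at `y = 1` and `y = 2` expresses both coefficients through
functions analytic in `s`, so no separate choice of coefficients for each `s` is needed. -/
theorem powerSolutions_analytic {a : ℂ → ℝ → ℂ} (h1 : AnalyticAt ℂ (fun s => a s 1) 1)
    (h2 : AnalyticAt ℂ (fun s => a s 2) 1)
    (hform : ∀ᶠ s in 𝓝 (1 : ℂ), ∃ A B : ℂ, ∀ y : ℝ, 0 < y →
      a s y = A * (y : ℂ) ^ s + B * (y : ℂ) ^ (1 - s)) :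
    ∃ A B : ℂ → ℂ, AnalyticAt ℂ A 1 ∧ AnalyticAt ℂ B 1 ∧ ∀ᶠ s in 𝓝 (1 : ℂ), ∀ y : ℝ, 0 < y →
      a s y = A s * (y : ℂ) ^ s + B s * (y : ℂ) ^ (1 - s) := by
  set A : ℂ → ℂ := fun s => (a s 2 - a s 1 * (2 : ℂ) ^ (1 - s)) / ((2 : ℂ) ^ s - (2 : ℂ) ^ (1 - s))
    with hA
  have hAa : AnalyticAt ℂ A 1 := by
    apply AnalyticAt.div
    · exact h2.sub (h1.mul (analyticAt_two_cpow (by fun_prop)))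
    · exact (analyticAt_two_cpow (by fun_prop)).sub (analyticAt_two_cpow (by fun_prop))
    · exact cpow_two_ne_of_near_one.self_of_nhds
  refine ⟨A, fun s => a s 1 - A s, hAa, h1.sub hAa, ?_⟩
  filter_upwards [hform, cpow_two_ne_of_near_one] with s ⟨A', B', h⟩ hne y hy
  have e1 : a s 1 = A' + B' := by simpa using h 1 one_pos
  have e2 : a s 2 = A' * (2 : ℂ) ^ s + B' * (2 : ℂ) ^ (1 - s) := by simpa using h 2 two_pos
  have e3 : A s = A' := by
    simp only [hA, e1, e2]
    field_simp
    ring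
  rw [h y hy, e3, e1]
  ring

/-! #### Growth of solutions of `a'' = q a` -/

theorem hasDerivAt_norm_sq_complex {a : ℝ → ℂ} {a' : ℂ} {y : ℝ} (h : HasDerivAt a a' y) :
    HasDerivAt (fun y => ‖a y‖ ^ 2) (2 * (a' * (starRingEnd ℂ) (a y)).re) y := by
  have := h.norm_sq
  simpa [Complex.inner, mul_comm] using this

theorem re_mul_conj_le (u w : ℂ) : (u * (starRingEnd ℂ) w).re ≤ ‖u‖ * ‖w‖ := by
  refine (Complex.re_le_norm _).trans ?_
  simp

theorem le_of_hasDerivAt_nonpos {X X' : ℝ → ℝ} {y₀ : ℝ} (h : ∀ y ≥ y₀, HasDerivAt X (X' y) y)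
    (hX : ∀ y > y₀, X' y ≤ 0) {y y' : ℝ} (hy : y₀ ≤ y) (hyy' : y ≤ y') : X y' ≤ X y := by
  have : AntitoneOn X (Set.Ici y₀) := by
    apply antitoneOn_of_deriv_nonpos (convex_Ici _)
    · exact fun x hx => (h x hx).continuousAt.continuousWithinAt
    · intro x hx
      rw [interior_Ici] at hx
      exact (h x hx.le).differentiableAt.differentiableWithinAt
    · intro x hx
      rw [interior_Ici] at hx
      rw [(h x hx.le).deriv]
      exact hX x hx
  exact this hy (hy.trans hyy') hyy'

/-- Energy estimate for `a'' = q a`. -/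
theorem ode_energy {a a' q : ℝ → ℂ} {E E' : ℝ → ℝ} {k : ℝ} (hk : 0 < k)
    (h1 : ∀ y ≥ 1, HasDerivAt a (a' y) y) (h2 : ∀ y ≥ 1, HasDerivAt a' (q y * a y) y)
    (hE : ∀ y ≥ 1, HasDerivAt E (E' y) y) (hq : ∀ y ≥ 1, (k ^ 2 + ‖q y‖) / k ≤ E' y)
    {y : ℝ} (hy : 1 ≤ y) :
    k ^ 2 * ‖a y‖ ^ 2 + ‖a' y‖ ^ 2 ≤
      (k ^ 2 * ‖a 1‖ ^ 2 + ‖a' 1‖ ^ 2) * Real.exp (E y - E 1) := by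
  set X : ℝ → ℝ := fun y => k ^ 2 * ‖a y‖ ^ 2 + ‖a' y‖ ^ 2 with hX
  set X' : ℝ → ℝ := fun y => k ^ 2 * (2 * (a' y * (starRingEnd ℂ) (a y)).re) +
    2 * (q y * a y * (starRingEnd ℂ) (a' y)).re with hX'
  have hXd : ∀ y ≥ 1, HasDerivAt X (X' y) y := fun y hy =>
    ((hasDerivAt_norm_sq_complex (h1 y hy)).const_mul _).add
      (hasDerivAt_norm_sq_complex (h2 y hy))
  -- The weight `k²` is chosen so that `2 k ‖a‖ ‖a'‖ ≤ X` absorbs both terms of `X'`; multiplying by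
  -- `exp(-E)` then gives Gronwall's inequality.
  have hle : ∀ y ≥ 1, X' y ≤ E' y * X y := by
    intro y hy
    have e1 := re_mul_conj_le (a' y) (a y)
    have e2 := re_mul_conj_le (q y * a y) (a' y)
    rw [norm_mul] at e2
    have hX0 : 0 ≤ X y := by positivity
    calc X' y ≤ k ^ 2 * (2 * (‖a' y‖ * ‖a y‖)) + 2 * (‖q y‖ * ‖a y‖ * ‖a' y‖) := by
          simp only [hX']; gcongr
      _ = (k ^ 2 + ‖q y‖) / k * (2 * (k * ‖a y‖) * ‖a' y‖) := by field_simp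
      _ ≤ (k ^ 2 + ‖q y‖) / k * X y := by
          gcongr
          simp only [hX]
          nlinarith [sq_nonneg (k * ‖a y‖ - ‖a' y‖)]
      _ ≤ E' y * X y := by gcongr; exact hq y hy
  have := le_of_hasDerivAt_nonpos (y₀ := 1) (X := fun y => X y * Real.exp (-E y))
    (X' := fun y => X' y * Real.exp (-E y) + X y * (Real.exp (-E y) * -E' y))
    (fun y hy => (hXd y hy).mul ((hE y hy).neg.exp))
    (fun y hy => by
      have := hle y (le_of_lt hy)
      have e : X' y * Real.exp (-E y) + X y * (Real.exp (-E y) * -E' y) =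
        (X' y - E' y * X y) * Real.exp (-E y) := by ring
      rw [e]
      exact mul_nonpos_of_nonpos_of_nonneg (by linarith) (Real.exp_pos _).le) le_rfl hy
  calc X y = X y * Real.exp (-E y) * Real.exp (E y) := by
        rw [mul_assoc, ← Real.exp_add]; simp
    _ ≤ X 1 * Real.exp (-E 1) * Real.exp (E y) := by gcongr
    _ = _ := by rw [mul_assoc, ← Real.exp_add, show -E 1 + E y = E y - E 1 by ring]

/-- If `v > 0` is a supersolution and `a / v → 0`, then `‖a‖ / v` is nonincreasing. -/
theorem ode_ratio_le {a a' q : ℝ → ℂ} {v v' v'' : ℝ → ℝ}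
    (h1 : ∀ y ≥ 1, HasDerivAt a (a' y) y) (h2 : ∀ y ≥ 1, HasDerivAt a' (q y * a y) y)
    (hv : ∀ y ≥ 1, 0 < v y) (hv1 : ∀ y ≥ 1, HasDerivAt v (v' y) y)
    (hv2 : ∀ y ≥ 1, HasDerivAt v' (v'' y) y) (hvq : ∀ y ≥ 1, v'' y ≤ (q y).re * v y)
    (hlim : Tendsto (fun y => ‖a y‖ / v y) atTop (𝓝 0)) {y : ℝ} (hy : 1 ≤ y) :
    ‖a y‖ / v y ≤ ‖a 1‖ / v 1 := by
  -- `P = v² (‖a‖²/v²)'`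
  set u : ℝ → ℝ := fun y => ‖a y‖ ^ 2 with hu
  set u' : ℝ → ℝ := fun y => 2 * (a' y * (starRingEnd ℂ) (a y)).re with hu'
  have hud : ∀ y ≥ 1, HasDerivAt u (u' y) y := fun y hy => hasDerivAt_norm_sq_complex (h1 y hy)
  have hud2 : ∀ y ≥ 1, HasDerivAt u' (2 * ‖a' y‖ ^ 2 + 2 * (q y).re * u y) y := by
    intro y hy
    have hc : HasDerivAt (fun y => (starRingEnd ℂ) (a y)) ((starRingEnd ℂ) (a' y)) y := by
      have := (Complex.conjCLE.toContinuousLinearMap.hasFDerivAt (x := a y)).comp_hasDerivAt y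
        (h1 y hy)
      exact this.congr_deriv (by simp)
    have hm := ((h2 y hy).mul hc)
    have hr := (Complex.reCLM.hasFDerivAt (x := a' y * (starRingEnd ℂ) (a y))).comp_hasDerivAt y hm
    have := hr.const_mul 2
    refine this.congr_deriv ?_
    simp only [hu, ← Complex.normSq_eq_norm_sq, Complex.normSq_apply, Complex.reCLM_apply,
      Complex.add_re, Complex.mul_re, Complex.mul_im, Complex.conj_re, Complex.conj_im]
    ring
  set g : ℝ → ℝ := fun y => u y / v y ^ 2 with hg
  set P : ℝ → ℝ := fun y => u' y - 2 * v' y / v y * u y with hP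
  have hgd : ∀ y ≥ 1, HasDerivAt g (P y / v y ^ 2) y := by
    intro y hy
    have hvy := (hv y hy).ne'
    refine ((hud y hy).div ((hv1 y hy).pow 2) (pow_ne_zero 2 hvy)).congr_deriv ?_
    simp only [hP, Pi.pow_apply]
    field_simp
    ring
  have hPd : ∀ y ≥ 1, HasDerivAt P (2 * ‖a' y‖ ^ 2 + 2 * (q y).re * u y -
      ((2 * v'' y * v y - 2 * v' y * v' y) / v y ^ 2 * u y + 2 * v' y / v y * u' y)) y := by
    intro y hy
    exact (hud2 y hy).sub
      (((((hv2 y hy).const_mul 2).div (hv1 y hy) (hv y hy).ne')).mul (hud y hy))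
  -- Up to the positive factor `2 / v²`, the derivative of `P` is at least `(v ‖a'‖ - |v'| ‖a‖)²`
  -- plus `v ‖a‖² (v Re q - v'')`, and the last factor is nonnegative for a supersolution.
  have hPmono : ∀ y ≥ 1, ∀ y' ≥ y, P y ≤ P y' := by
    intro y hy y' hy'
    have := le_of_hasDerivAt_nonpos (y₀ := 1) (X := fun y => -P y) (fun y hy => (hPd y hy).neg)
      (fun y hy => by
        have hy' : (1 : ℝ) ≤ y := le_of_lt hy
        have hvy := hv y hy'
        have hq := hvq y hy'
        have hu0 : 0 ≤ u y := by positivity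
        have e1 : u' y * v' y ≤ 2 * (‖a' y‖ * ‖a y‖ * |v' y|) := by
          have h1 : |(a' y * (starRingEnd ℂ) (a y)).re| ≤ ‖a' y‖ * ‖a y‖ := by
            refine (Complex.abs_re_le_norm _).trans ?_
            simp
          calc u' y * v' y ≤ |u' y * v' y| := le_abs_self _
            _ = 2 * (|(a' y * (starRingEnd ℂ) (a y)).re| * |v' y|) := by
              simp only [hu', abs_mul, abs_two]; ring
            _ ≤ _ := by gcongr
        have e2 : 0 ≤ 2 * (v y * ‖a' y‖ - |v' y| * ‖a y‖) ^ 2 := by positivity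
        have e3 : |v' y| ^ 2 = v' y ^ 2 := sq_abs _
        rw [neg_nonpos]
        have e4 : 2 * ‖a' y‖ ^ 2 + 2 * (q y).re * u y -
            ((2 * v'' y * v y - 2 * v' y * v' y) / v y ^ 2 * u y + 2 * v' y / v y * u' y) =
            (2 * v y ^ 2 * ‖a' y‖ ^ 2 + 2 * v' y ^ 2 * u y - 2 * v y * (u' y * v' y)
              + 2 * v y * u y * ((q y).re * v y - v'' y)) / v y ^ 2 := by
          field_simp
          ring
        rw [e4]
        apply div_nonneg _ (by positivity)
        have e5 : 0 ≤ 2 * v y * u y * ((q y).re * v y - v'' y) := by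
          have := sub_nonneg.mpr hq
          positivity
        have e6 : 2 * v y * (u' y * v' y) ≤ 2 * v y * (2 * (‖a' y‖ * ‖a y‖ * |v' y|)) := by gcongr
        have e7 : u y = ‖a y‖ ^ 2 := rfl
        rw [e7] at e5 ⊢
        nlinarith) hy hy'
    linarith
  have hg0 : Tendsto g atTop (𝓝 0) := by
    have := hlim.pow 2
    simpa [hg, hu, div_pow] using this
  -- A positive value of `P` would persist and make `g` nondecreasing from there on. Since `g ≥ 0`
  -- tends to `0` it would then vanish identically, contradicting `g' = P / v² > 0`.
  have hP0 : ∀ y ≥ 1, P y ≤ 0 := by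
    intro y hy
    by_contra hpos
    push Not at hpos
    have hmono : ∀ z ≥ y, ∀ z' ≥ z, g z ≤ g z' := by
      intro z hz z' hz'
      have := le_of_hasDerivAt_nonpos (y₀ := y) (X := fun y => -g y)
        (fun x hx => (hgd x (hy.trans hx)).neg) (fun x hx => by
          rw [neg_nonpos]
          have := hPmono y hy x (le_of_lt hx)
          have : 0 ≤ P x := by linarith
          positivity) hz hz'
      linarith
    have hzero : ∀ z ≥ y, g z = 0 := by
      intro z hz
      apply le_antisymm
      · exact ge_of_tendsto hg0 ((eventually_ge_atTop z).mono fun z' hz' => hmono z hz z' hz')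
      · simp only [hg]; positivity
    have hd0 : HasDerivAt g 0 (y + 1) := by
      refine (hasDerivAt_const (y + 1) (0 : ℝ)).congr_of_eventuallyEq ?_
      filter_upwards [Ioi_mem_nhds (by linarith : y < y + 1)] with z hz
      exact hzero z (le_of_lt hz)
    have h3 := (hgd (y + 1) (by linarith)).unique hd0
    have h4 := hPmono y hy (y + 1) (by linarith)
    have h5 := hv (y + 1) (by linarith)
    have h6 : 0 < P (y + 1) / v (y + 1) ^ 2 := by
      have : 0 < P (y + 1) := by linarith
      positivity
    linarith
  have hfin : g y ≤ g 1 := le_of_hasDerivAt_nonpos (y₀ := 1) hgd (fun x hx => by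
    have := hP0 x (le_of_lt hx)
    have := hv x (le_of_lt hx)
    apply div_nonpos_of_nonpos_of_nonneg <;> first | assumption | positivity) le_rfl hy
  have e : ∀ z, g z = (‖a z‖ / v z) ^ 2 := fun z => by simp [hg, hu, div_pow]
  rw [e, e] at hfin
  exact le_of_sq_le_sq hfin (div_nonneg (norm_nonneg _) (hv 1 le_rfl).le)

theorem norm_sub_le_of_deriv_le {g : ℝ → ℂ} {g' : ℝ → ℂ} {b b' : ℝ → ℝ} {y₀ : ℝ}
    (hg : ∀ y ≥ y₀, HasDerivAt g (g' y) y) (hb : ∀ y ≥ y₀, HasDerivAt b (b' y) y)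
    (hle : ∀ y ≥ y₀, ‖g' y‖ ≤ b' y) {y y' : ℝ} (hy : y₀ ≤ y) (hyy' : y ≤ y') :
    ‖g y' - g y‖ ≤ b y' - b y := by
  have := image_norm_le_of_norm_deriv_right_le_deriv_boundary' (a := y) (b := y')
    (f := fun x => g x - g y) (f' := g') (B := fun x => b x - b y) (B' := b')
    (fun x hx => ((hg x (hy.trans hx.1)).continuousAt.sub continuousAt_const).continuousWithinAt)
    (fun x hx => ((hg x (hy.trans hx.1)).sub_const _).hasDerivWithinAt)
    (by simp)
    (fun x hx => ((hb x (hy.trans hx.1)).continuousAt.sub continuousAt_const).continuousWithinAt)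
    (fun x hx => ((hb x (hy.trans hx.1)).sub_const _).hasDerivWithinAt)
    (fun x hx => hle x (hy.trans hx.1))
  exact this ⟨hyy', le_rfl⟩

/-- The bound on the derivative has primitive `-C / y`, which gives the Cauchy property and the
explicit rate. -/
theorem exists_limit_of_deriv_le {g g' : ℝ → ℂ} {C : ℝ}
    (hg : ∀ y ≥ 1, HasDerivAt g (g' y) y) (hle : ∀ y ≥ 1, ‖g' y‖ ≤ C / y ^ 2) :
    ∃ l : ℂ, ∀ y ≥ 1, ‖g y - l‖ ≤ C / y := by
  have hb : ∀ y ≥ (1 : ℝ), HasDerivAt (fun y => -(C / y)) (C / y ^ 2) y := by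
    intro y hy
    have hy0 : y ≠ 0 := by positivity
    refine ((hasDerivAt_const y C).div (hasDerivAt_id y) hy0).neg.congr_deriv ?_
    simp [neg_div]
  have hC : 0 ≤ C := by
    have := (norm_nonneg _).trans (hle 1 le_rfl)
    simpa using this
  have hdiff : ∀ y ≥ 1, ∀ y' ≥ y, ‖g y' - g y‖ ≤ C / y := by
    intro y hy y' hy'
    have := norm_sub_le_of_deriv_le hg hb hle hy hy'
    have h2 : 0 ≤ C / y' := div_nonneg hC (by linarith)
    linarith
  have hlim : Tendsto (fun y : ℝ => C / y) atTop (𝓝 0) := tendsto_const_nhds.div_atTop tendsto_id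
  have hcau : Cauchy (map g atTop) := by
    rw [Metric.cauchy_iff]
    refine ⟨inferInstance, fun ε hε => ?_⟩
    obtain ⟨Y, hY1, hY⟩ := ((eventually_ge_atTop (1 : ℝ)).and
      (hlim.eventually (gt_mem_nhds (half_pos hε)))).exists
    refine ⟨g '' Set.Ici Y, image_mem_map (Ici_mem_atTop Y), ?_⟩
    rintro _ ⟨x, hx, rfl⟩ _ ⟨z, hz, rfl⟩
    have h1 := hdiff Y hY1 x hx
    have h2 := hdiff Y hY1 z hz
    calc dist (g x) (g z) ≤ dist (g x) (g Y) + dist (g z) (g Y) := dist_triangle_right _ _ _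
      _ < ε := by rw [dist_eq_norm, dist_eq_norm]; linarith
  obtain ⟨l, hl⟩ := CompleteSpace.complete hcau
  refine ⟨l, fun y hy => ?_⟩
  have h1 : Tendsto (fun y' => ‖g y' - g y‖) atTop (𝓝 ‖l - g y‖) :=
    ((show Tendsto g atTop (𝓝 l) from hl).sub_const _).norm
  rw [norm_sub_rev]
  exact le_of_tendsto h1 ((eventually_ge_atTop y).mono fun y' hy' => hdiff y hy y' hy')

/-- Solutions of `a'' = (k² + ε / y²) a` with `‖a‖ ≤ C e^{ky}`: the limit of `e^{-ky} a(y)` exists,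
with a rate of convergence that depends only on `C`. -/
theorem ode_exists_limit {a a' : ℝ → ℂ} {k C : ℝ} {e : ℂ} (hk : 2 ≤ k) (he : ‖e‖ ≤ 1)
    (h1 : ∀ y ≥ 1, HasDerivAt a (a' y) y)
    (h2 : ∀ y ≥ (1 : ℝ), HasDerivAt a' (((k : ℂ) ^ 2 + e / (y : ℂ) ^ 2) * a y) y)
    (ha : ∀ y ≥ 1, ‖a y‖ ≤ C * Real.exp (k * y)) :
    ∃ l : ℂ, ∀ y ≥ 1, ‖Real.exp (-(k * y)) * a y - l‖ ≤
      (2 * C + 2 * ‖Real.exp (-(k * 1)) * a 1 - l‖) / y := by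
  have hC : 0 ≤ C := by
    have := (norm_nonneg _).trans (ha 1 le_rfl)
    exact nonneg_of_mul_nonneg_left this (Real.exp_pos _)
  have hexp : ∀ (t y : ℝ), HasDerivAt (fun y : ℝ => (Real.exp (t * y) : ℂ))
      ((t : ℂ) * (Real.exp (t * y) : ℂ)) y := by
    intro t y
    have : HasDerivAt (fun y : ℝ => Real.exp (t * y)) (Real.exp (t * y) * (t * 1)) y :=
      ((hasDerivAt_id y).const_mul t).exp
    refine this.ofReal_comp.congr_deriv ?_
    push_cast
    ring
  -- The combination `a' + k a` removes the decaying exponential. Its rescaling `P` has derivative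
  -- `O(C / y²)`, hence a limit `p`.
  set P : ℝ → ℂ := fun y => Real.exp (-k * y) * (a' y + k * a y) with hP
  have hPd : ∀ y ≥ 1, HasDerivAt P (Real.exp (-k * y) * (e / (y : ℂ) ^ 2 * a y)) y := by
    intro y hy
    refine ((hexp (-k) y).mul ((h2 y hy).add ((h1 y hy).const_mul _))).congr_deriv ?_
    simp only [Pi.add_apply]
    push_cast
    ring
  obtain ⟨p, hp⟩ := exists_limit_of_deriv_le (C := C) hPd (fun y hy => by
    have hy0 : (0 : ℝ) < y := by linarith
    rw [norm_mul, norm_mul, norm_div, norm_pow, Complex.norm_real, Complex.norm_real,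
      Real.norm_eq_abs, Real.abs_exp, Real.norm_eq_abs, sq_abs]
    calc Real.exp (-k * y) * (‖e‖ / y ^ 2 * ‖a y‖)
        ≤ Real.exp (-k * y) * (1 / y ^ 2 * (C * Real.exp (k * y))) := by
          gcongr; exact ha y hy
      _ = (Real.exp (-k * y) * Real.exp (k * y)) * (C / y ^ 2) := by ring
      _ = C / y ^ 2 := by rw [← Real.exp_add]; simp)
  have hk0 : (k : ℂ) ≠ 0 := by
    have : k ≠ 0 := by linarith
    exact_mod_cast this
  -- If `e^{-ky} a` tends to `l` then `P` tends to `2 k l`, which dictates this choice.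
  refine ⟨p / (2 * k), fun y hy => ?_⟩
  set l : ℂ := p / (2 * k) with hl
  set b : ℝ → ℂ := fun y => Real.exp (-k * y) * a y - l with hb
  set M : ℝ := ‖b 1‖ with hM
  have hgd : ∀ y ≥ 1, HasDerivAt (fun y : ℝ => (Real.exp (2 * k * y) : ℂ) * b y)
      (Real.exp (2 * k * y) * (P y - p)) y := by
    intro y hy
    refine ((hexp (2 * k) y).mul (((hexp (-k) y).mul (h1 y hy)).sub_const l)).congr_deriv ?_
    simp only [hP, hl, Pi.mul_apply]
    push_cast
    field_simp
    ring
  -- A majorant for the growth of `e^{2ky} b`: its derivative exceeds `e^{2ky} C / y` because `2k -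
  -- 1/y ≥ 1`.
  have hbd : ∀ y ≥ (1 : ℝ), HasDerivAt (fun y : ℝ => Real.exp (2 * k * y) * (C / y))
      (Real.exp (2 * k * y) * (2 * k * 1) * (C / y) + Real.exp (2 * k * y) * -(C / y ^ 2)) y := by
    intro y hy
    have hy0 : y ≠ 0 := by positivity
    have h3 : HasDerivAt (fun y : ℝ => Real.exp (2 * k * y)) (Real.exp (2 * k * y) * (2 * k * 1)) y :=
      ((hasDerivAt_id y).const_mul (2 * k)).exp
    have h4 : HasDerivAt (fun y : ℝ => C / y) (-(C / y ^ 2)) y := by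
      refine ((hasDerivAt_const y C).div (hasDerivAt_id y) hy0).congr_deriv ?_
      simp [neg_div]
    exact h3.mul h4
  have hcmp := norm_sub_le_of_deriv_le hgd hbd (fun y hy => by
    have hy0 : (0 : ℝ) < y := by linarith
    rw [norm_mul, Complex.norm_real, Real.norm_eq_abs, Real.abs_exp]
    have h5 := hp y hy
    have h6 : C / y ^ 2 ≤ C / y := by
      apply div_le_div_of_nonneg_left hC hy0
      nlinarith
    have h7 : 0 ≤ C / y := by positivity
    calc Real.exp (2 * k * y) * ‖P y - p‖ ≤ Real.exp (2 * k * y) * (C / y) := by gcongr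
      _ ≤ Real.exp (2 * k * y) * (2 * k * (C / y) - C / y ^ 2) := by
          gcongr
          nlinarith
      _ = _ := by ring) (le_refl 1) hy
  have hy0 : (0 : ℝ) < y := by linarith
  have h8 : ‖(Real.exp (2 * k * y) : ℂ) * b y‖ ≤
      Real.exp (2 * k * y) * (C / y) + Real.exp (2 * k * 1) * M := by
    have h9 : ‖(Real.exp (2 * k * 1) : ℂ) * b 1‖ = Real.exp (2 * k * 1) * M := by
      rw [norm_mul, Complex.norm_real, Real.norm_eq_abs, Real.abs_exp]
    have h10 := norm_le_norm_add_norm_sub ((Real.exp (2 * k * 1) : ℂ) * b 1)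
      ((Real.exp (2 * k * y) : ℂ) * b y)
    have h11 : 0 ≤ Real.exp (2 * k * 1) * (C / 1) := by positivity
    rw [h9, norm_sub_rev] at h10
    linarith
  rw [norm_mul, Complex.norm_real, Real.norm_eq_abs, Real.abs_exp] at h8
  have h12 : Real.exp (2 * k * 1) ≤ Real.exp (2 * k * y) * (2 / y) := by
    have : y ≤ 2 * Real.exp (2 * k * y - 2 * k * 1) := by
      have := Real.add_one_le_exp (2 * k * y - 2 * k * 1)
      nlinarith
    rw [mul_div_assoc', le_div_iff₀ hy0]
    calc Real.exp (2 * k * 1) * y ≤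
        Real.exp (2 * k * 1) * (2 * Real.exp (2 * k * y - 2 * k * 1)) := by gcongr
      _ = _ := by rw [mul_left_comm, ← Real.exp_add]; ring_nf
  have h13 : ‖b y‖ ≤ C / y + (2 / y) * M := by
    have h14 : Real.exp (2 * k * y) * ‖b y‖ ≤ Real.exp (2 * k * y) * (C / y + 2 / y * M) := by
      calc _ ≤ _ := h8
        _ ≤ Real.exp (2 * k * y) * (C / y) + Real.exp (2 * k * y) * (2 / y) * M := by gcongr
        _ = _ := by ring
    exact le_of_mul_le_mul_left h14 (Real.exp_pos _)
  have e1 : ‖(Real.exp (-(k * y)) : ℂ) * a y - l‖ = ‖b y‖ := by simp [hb]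
  have e2 : ‖(Real.exp (-(k * 1)) : ℂ) * a 1 - l‖ = M := by simp [hM, hb]
  rw [e1, e2]
  calc ‖b y‖ ≤ C / y + (2 / y) * M := h13
    _ ≤ C / y + (2 / y) * M + C / y := by
      have : 0 ≤ C / y := by positivity
      linarith
    _ = _ := by ring

/-- A solution of `a'' = (k² + ε / y²) a` that is `o(e^{ky})` is bounded by its initial value. -/
theorem ode_recessive_le {a a' : ℝ → ℂ} {k : ℝ} {e : ℂ} (hk : 2 ≤ k) (he : ‖e‖ ≤ 1)
    (h1 : ∀ y ≥ 1, HasDerivAt a (a' y) y)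
    (h2 : ∀ y ≥ (1 : ℝ), HasDerivAt a' (((k : ℂ) ^ 2 + e / (y : ℂ) ^ 2) * a y) y)
    (hlim : Tendsto (fun y : ℝ => Real.exp (-(k * y)) * a y) atTop (𝓝 0)) {y : ℝ} (hy : 1 ≤ y) :
    ‖a y‖ ≤ ‖a 1‖ := by
  have hre : ∀ y ≥ (1 : ℝ), k ^ 2 - 1 / y ^ 2 ≤ ((k : ℂ) ^ 2 + e / (y : ℂ) ^ 2).re := by
    intro y hy
    have e1 : ((k : ℂ) ^ 2 + e / (y : ℂ) ^ 2).re = k ^ 2 + e.re / y ^ 2 := by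
      rw [Complex.add_re]
      congr 1
      · rw [← Complex.ofReal_pow, Complex.ofReal_re]
      · rw [← Complex.ofReal_pow, Complex.div_ofReal_re]
    rw [e1]
    have h3 : -1 ≤ e.re := by
      have := (abs_le.mp ((Complex.abs_re_le_norm e).trans he)).1
      exact this
    have : -1 / y ^ 2 ≤ e.re / y ^ 2 := by gcongr
    rw [neg_div] at this
    linarith
  have hg : ∀ η : ℝ, 0 < η → ‖a y‖ ≤ ‖a 1‖ * (1 + η * Real.exp (k * y + 1 / y)) := by
    intro η hη
    -- The supersolution is `1 + η w`. The summand `1 / y` in the exponent pays for the possible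
    -- loss `-1/y²` in the potential, since `(k - 1/y²)² + 2/y³ ≤ k² - 1/y²` for `k ≥ 2`; the
    -- constant `1` is a supersolution because `k² ≥ 1/y²`. As `a = o(e^{ky})`, the ratio to `1 + η
    -- w` tends to `0`, and `η → 0` gives the claim.
    set w : ℝ → ℝ := fun y => Real.exp (k * y + 1 / y) with hw
    have hinner : ∀ y ≥ (1 : ℝ), HasDerivAt (fun y : ℝ => k * y + 1 / y) (k - 1 / y ^ 2) y := by
      intro y hy
      have hy0 : y ≠ 0 := by positivity
      refine (((hasDerivAt_id y).const_mul k).add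
        ((hasDerivAt_const y (1 : ℝ)).div (hasDerivAt_id y) hy0)).congr_deriv ?_
      simp [neg_div, sub_eq_add_neg]
    have hwd : ∀ y ≥ (1 : ℝ), HasDerivAt w (w y * (k - 1 / y ^ 2)) y := fun y hy =>
      (hinner y hy).exp
    have hwd2 : ∀ y ≥ (1 : ℝ), HasDerivAt (fun y => w y * (k - 1 / y ^ 2))
        (w y * ((k - 1 / y ^ 2) ^ 2 + 2 / y ^ 3)) y := by
      intro y hy
      have hy0 : y ≠ 0 := by positivity
      have h3 : HasDerivAt (fun y : ℝ => k - 1 / y ^ 2) (2 / y ^ 3) y := by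
        refine ((hasDerivAt_const y k).sub ((hasDerivAt_const y (1 : ℝ)).div
          ((hasDerivAt_id y).pow 2) (pow_ne_zero 2 hy0))).congr_deriv ?_
        simp
        field_simp
      refine ((hwd y hy).mul h3).congr_deriv ?_
      ring
    have hvpos : ∀ y ≥ (1 : ℝ), 0 < 1 + η * w y := fun y _ => by positivity
    have := ode_ratio_le (v := fun y => 1 + η * w y) (v' := fun y => η * (w y * (k - 1 / y ^ 2)))
      (v'' := fun y => η * (w y * ((k - 1 / y ^ 2) ^ 2 + 2 / y ^ 3))) h1 h2 hvpos
      (fun y hy => ((hwd y hy).const_mul η).const_add 1)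
      (fun y hy => (hwd2 y hy).const_mul η)
      (fun y hy => by
        have hy0 : (0 : ℝ) < y := by linarith
        have h3 := hre y hy
        have hi : 1 / y ≤ 1 := by rw [div_le_one hy0]; exact hy
        have hi0 : 0 < 1 / y := by positivity
        set t := 1 / y with ht
        have e1 : 1 / y ^ 2 = t ^ 2 := by rw [ht]; ring
        have e2 : 2 / y ^ 3 = 2 * t ^ 3 := by rw [ht]; ring
        rw [e1] at h3
        rw [e1, e2]
        have h4 : (k - t ^ 2) ^ 2 + 2 * t ^ 3 ≤ k ^ 2 - t ^ 2 := by
          have : t ^ 2 * (2 * k - 1 - t ^ 2 - 2 * t) ≥ 0 := by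
            apply mul_nonneg (sq_nonneg _)
            nlinarith
          nlinarith
        have h5 : 0 ≤ k ^ 2 - t ^ 2 := by nlinarith
        calc η * (w y * ((k - t ^ 2) ^ 2 + 2 * t ^ 3)) ≤ η * (w y * (k ^ 2 - t ^ 2)) := by
              gcongr
          _ ≤ (k ^ 2 - t ^ 2) * (1 + η * w y) := by nlinarith
          _ ≤ _ := mul_le_mul_of_nonneg_right h3 (hvpos y hy).le)
      (by
        have hl2 : Tendsto (fun y : ℝ => ‖(Real.exp (-(k * y)) : ℂ) * a y‖ / η) atTop (𝓝 0) := by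
          simpa using hlim.norm.div_const η
        refine squeeze_zero' ?_ ?_ hl2
        · filter_upwards [eventually_ge_atTop 1] with y hy
          exact div_nonneg (norm_nonneg _) (hvpos y hy).le
        · filter_upwards [eventually_ge_atTop 1] with y hy
          have hy0 : (0 : ℝ) < y := by linarith
          rw [norm_mul, Complex.norm_real, Real.norm_eq_abs, Real.abs_exp, Real.exp_neg]
          rw [inv_mul_eq_div, div_div]
          apply div_le_div_of_nonneg_left (norm_nonneg _) (by positivity)
          have : Real.exp (k * y) ≤ w y := Real.exp_le_exp.mpr (by
            have : 0 < 1 / y := by positivity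
            linarith)
          nlinarith) hy
    rw [div_le_div_iff₀ (hvpos y hy) (hvpos 1 le_rfl)] at this
    have hw1 : 0 ≤ η * w 1 := by positivity
    have hna : 0 ≤ ‖a y‖ := norm_nonneg _
    nlinarith
  have hcont : Tendsto (fun η : ℝ => ‖a 1‖ * (1 + η * Real.exp (k * y + 1 / y))) (𝓝[>] 0)
      (𝓝 (‖a 1‖ * (1 + 0 * Real.exp (k * y + 1 / y)))) := by
    apply Tendsto.mono_left _ nhdsWithin_le_nhds
    exact Continuous.tendsto (by fun_prop) 0
  simp only [zero_mul, add_zero, mul_one] at hcont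
  exact ge_of_tendsto hcont (by filter_upwards [self_mem_nhdsWithin] with η hη using hg η hη)

/-- A family of functions `a_n(s, y)`, holomorphic in `s`, that satisfy the differential equations
of the Fourier coefficients of eigenfunctions of the Laplacian with eigenvalue `s (1 - s)`. -/
structure IsModeFamily (κ : ℝ) (V : Set ℂ) (a a' : ℤ → ℂ → ℝ → ℂ) : Prop where
  hasDeriv : ∀ n, ∀ s ∈ V, ∀ y : ℝ, 0 < y → HasDerivAt (a n s) (a' n s y) y
  hasDeriv' : ∀ n, ∀ s ∈ V, ∀ y : ℝ, 0 < y →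
    HasDerivAt (a' n s) ((((κ * n : ℝ) : ℂ) ^ 2 - s * (1 - s) / (y : ℂ) ^ 2) * a n s y) y
  holo : ∀ n, ∀ y : ℝ, 0 < y → DifferentiableOn ℂ (fun s => a n s y) V
  bound : ∃ M : ℝ, ∀ n, ∀ s ∈ V, ∀ y ∈ Set.Icc (1 : ℝ) 2, ‖a n s y‖ ≤ M
  growth : ∀ s ∈ V, ∃ C K : ℝ, ∀ n, ∀ y ≥ (1 : ℝ), ‖a n s y‖ ≤ K * Real.exp (C * y)

namespace IsModeFamily

variable {κ : ℝ} {V : Set ℂ} {a a' : ℤ → ℂ → ℝ → ℂ}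

/-- Only `a` is controlled on `[1, 2]`. The equation bounds `a''` there, and Taylor's formula
between `1` and `2` recovers a bound for `a'(1)` that is uniform in `s`. -/
theorem deriv_one_bound (h : IsModeFamily κ V a a') (hV : ∀ s ∈ V, ‖s * (1 - s)‖ ≤ 1) (n : ℤ) :
    ∃ M : ℝ, ∀ s ∈ V, ‖a n s 1‖ ≤ M ∧ ‖a' n s 1‖ ≤ M := by
  obtain ⟨M, hM⟩ := h.bound
  set Q : ℝ := (κ * n) ^ 2 + 1 with hQ
  have hQ0 : 0 ≤ Q := by positivity
  refine ⟨max M (Q * M + 2 * M), fun s hs => ⟨(hM n s hs 1 (by simp)).trans (le_max_left _ _), ?_⟩⟩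
  have hM0 : 0 ≤ M := (norm_nonneg _).trans (hM n s hs 1 (by simp))
  have hb2 : ∀ y ∈ Set.Icc (1 : ℝ) 2,
      ‖(((κ * n : ℝ) : ℂ) ^ 2 - s * (1 - s) / (y : ℂ) ^ 2) * a n s y‖ ≤ Q * M := by
    intro y hy
    have hy0 : (0 : ℝ) < y := by linarith [hy.1]
    rw [norm_mul]
    gcongr
    · calc _ ≤ ‖((κ * n : ℝ) : ℂ) ^ 2‖ + ‖s * (1 - s) / (y : ℂ) ^ 2‖ := norm_sub_le _ _
        _ ≤ (κ * n) ^ 2 + 1 := by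
          gcongr
          · rw [norm_pow, Complex.norm_real, Real.norm_eq_abs, sq_abs]
          · rw [norm_div, norm_pow, Complex.norm_real, Real.norm_eq_abs, sq_abs]
            rw [div_le_one (by positivity)]
            have := hV s hs
            nlinarith [hy.1]
    · exact hM n s hs y hy
  have h1 : ∀ y ∈ Set.Icc (1 : ℝ) 2, ‖a' n s y - a' n s 1‖ ≤ Q * M * (y - 1) := by
    intro y hy
    exact norm_image_sub_le_of_norm_deriv_le_segment' (C := Q * M)
      (fun x hx => (h.hasDeriv' n s hs x (by linarith [hx.1])).hasDerivWithinAt)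
      (fun x hx => hb2 x ⟨hx.1, hx.2.le⟩) y hy
  have h2 : ‖(a n s 2 - 2 * a' n s 1) - (a n s 1 - 1 * a' n s 1)‖ ≤ Q * M * (2 - 1) := by
    refine norm_image_sub_le_of_norm_deriv_le_segment' (C := Q * M)
      (f := fun y : ℝ => a n s y - (y : ℂ) * a' n s 1) (f' := fun y => a' n s y - 1 * a' n s 1)
      (a := 1) (b := 2) (fun x hx => ?_) (fun x hx => ?_) 2 (by simp) |>.trans_eq' (by simp)
    · exact ((h.hasDeriv n s hs x (by linarith [hx.1])).sub
        (((hasDerivAt_id x).ofReal_comp).mul_const _)).hasDerivWithinAt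
    · rw [one_mul]
      refine (h1 x ⟨hx.1, hx.2.le⟩).trans ?_
      have : 0 ≤ Q * M := by positivity
      nlinarith [hx.2]
  have e : a' n s 1 = (a n s 2 - a n s 1) -
      ((a n s 2 - 2 * a' n s 1) - (a n s 1 - 1 * a' n s 1)) := by ring
  refine le_trans ?_ (le_max_right _ _)
  rw [e]
  have h3 := norm_sub_le (a n s 2 - a n s 1)
    ((a n s 2 - 2 * a' n s 1) - (a n s 1 - 1 * a' n s 1))
  have h4 := norm_sub_le (a n s 2) (a n s 1)
  have h5 := hM n s hs 1 (by simp)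
  have h6 := hM n s hs 2 (by simp)
  linarith

theorem coeff_eq (n : ℤ) (s : ℂ) (y : ℝ) :
    ((κ * n : ℝ) : ℂ) ^ 2 - s * (1 - s) / (y : ℂ) ^ 2 =
      ((|κ * n| : ℝ) : ℂ) ^ 2 + -(s * (1 - s)) / (y : ℂ) ^ 2 := by
  rw [← Complex.ofReal_pow |κ * n|, sq_abs, Complex.ofReal_pow, neg_div, sub_eq_add_neg]

/-- A crude bound, uniform in `s`, with a rate quadratic in `n`. It is good enough for finitely many
exceptional modes and covers small `|κ n|`, in particular `n = 0`. -/
theorem norm_le_exp (h : IsModeFamily κ V a a') (hV : ∀ s ∈ V, ‖s * (1 - s)‖ ≤ 1) (n : ℤ) :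
    ∃ C K : ℝ, 0 ≤ C ∧ 0 ≤ K ∧ ∀ s ∈ V, ∀ y ≥ (1 : ℝ), ‖a n s y‖ ≤ K * Real.exp (C * y) := by
  obtain ⟨M, hM⟩ := h.deriv_one_bound hV n
  set Q : ℝ := (κ * n) ^ 2 + 1 with hQ
  refine ⟨1 + Q, 2 * |M| + 1, by positivity, by positivity, fun s hs y hy => ?_⟩
  have he := ode_energy (k := 1) (a := a n s) (a' := a' n s)
    (q := fun y => ((κ * n : ℝ) : ℂ) ^ 2 - s * (1 - s) / (y : ℂ) ^ 2)
    (E := fun y => (1 + Q) * y) (E' := fun y => (1 + Q) * 1) one_pos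
    (fun y hy => h.hasDeriv n s hs y (by linarith)) (fun y hy => h.hasDeriv' n s hs y (by linarith))
    (fun y hy => (hasDerivAt_id y).const_mul _) (fun y hy => by
      have hy0 : (0 : ℝ) < y := by linarith
      have h1 : ‖((κ * n : ℝ) : ℂ) ^ 2 - s * (1 - s) / (y : ℂ) ^ 2‖ ≤ Q := by
        calc _ ≤ ‖((κ * n : ℝ) : ℂ) ^ 2‖ + ‖s * (1 - s) / (y : ℂ) ^ 2‖ := norm_sub_le _ _
          _ ≤ (κ * n) ^ 2 + 1 := by
            gcongr
            · rw [norm_pow, Complex.norm_real, Real.norm_eq_abs, sq_abs]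
            · rw [norm_div, norm_pow, Complex.norm_real, Real.norm_eq_abs, sq_abs]
              rw [div_le_one (by positivity)]
              have := hV s hs
              nlinarith
      simp only [one_pow, div_one, mul_one]
      linarith) hy
  obtain ⟨h1, h2⟩ := hM s hs
  have hM0 : 0 ≤ M := (norm_nonneg _).trans h1
  rw [abs_of_nonneg hM0]
  have h3 : Real.exp ((1 + Q) * y - (1 + Q) * 1) ≤ Real.exp ((1 + Q) * y) :=
    Real.exp_le_exp.mpr (by have : 0 ≤ Q := by positivity
                            linarith)
  have h4 : ‖a n s y‖ ^ 2 ≤ (2 * M ^ 2) * Real.exp ((1 + Q) * y) := by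
    calc ‖a n s y‖ ^ 2 ≤ 1 ^ 2 * ‖a n s y‖ ^ 2 + ‖a' n s y‖ ^ 2 := by
          have := sq_nonneg ‖a' n s y‖
          linarith
      _ ≤ _ := he
      _ ≤ (1 ^ 2 * M ^ 2 + M ^ 2) * Real.exp ((1 + Q) * y) := by gcongr
      _ = _ := by ring
  have h5 : (1 : ℝ) ≤ Real.exp ((1 + Q) * y) := Real.one_le_exp (by positivity)
  apply le_of_sq_le_sq _ (by positivity)
  nlinarith [mul_nonneg (mul_nonneg hM0 hM0) (Real.exp_pos ((1 + Q) * y)).le,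
    mul_nonneg hM0 (Real.exp_pos ((1 + Q) * y)).le]

/-- With the energy weighted by `k = |κ n|` the growth rate of the energy is `2k + 1/y²`; the
correction is integrable and costs only a constant, so the exact exponential rate is reached. -/
theorem norm_le_exp_sharp (h : IsModeFamily κ V a a') (hV : ∀ s ∈ V, ‖s * (1 - s)‖ ≤ 1) {n : ℤ}
    (hn : 2 ≤ |κ * n|) :
    ∃ C : ℝ, 0 ≤ C ∧ ∀ s ∈ V, ∀ y ≥ (1 : ℝ), ‖a n s y‖ ≤ C * Real.exp (|κ * n| * y) := by
  obtain ⟨M, hM⟩ := h.deriv_one_bound hV n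
  set k : ℝ := |κ * n| with hk
  have hk0 : 0 < k := by linarith
  refine ⟨2 * |M| * Real.exp 1, by positivity, fun s hs y hy => ?_⟩
  obtain ⟨h1, h2⟩ := hM s hs
  have hM0 : 0 ≤ M := (norm_nonneg _).trans h1
  rw [abs_of_nonneg hM0]
  have he := ode_energy (k := k) (a := a n s) (a' := a' n s)
    (q := fun y => (k : ℂ) ^ 2 + -(s * (1 - s)) / (y : ℂ) ^ 2)
    (E := fun y => 2 * k * y - 1 / y) (E' := fun y => 2 * k * 1 + 1 / y ^ 2) hk0
    (fun y hy => h.hasDeriv n s hs y (by linarith))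
    (fun y hy => by rw [hk, ← coeff_eq]; exact h.hasDeriv' n s hs y (by linarith))
    (fun y hy => by
      have hy0 : y ≠ 0 := by positivity
      refine (((hasDerivAt_id y).const_mul (2 * k)).sub
        ((hasDerivAt_const y (1 : ℝ)).div (hasDerivAt_id y) hy0)).congr_deriv ?_
      simp [neg_div]) (fun y hy => by
      have hy0 : (0 : ℝ) < y := by linarith
      have h1 : ‖(k : ℂ) ^ 2 + -(s * (1 - s)) / (y : ℂ) ^ 2‖ ≤ k ^ 2 + 1 / y ^ 2 := by
        calc _ ≤ ‖(k : ℂ) ^ 2‖ + ‖-(s * (1 - s)) / (y : ℂ) ^ 2‖ := norm_add_le _ _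
          _ ≤ _ := by
            gcongr
            · rw [norm_pow, Complex.norm_real, Real.norm_eq_abs, sq_abs]
            · rw [norm_div, norm_pow, Complex.norm_real, Real.norm_eq_abs, sq_abs, norm_neg]
              gcongr
              exact hV s hs
      rw [div_le_iff₀ hk0]
      have h3 : 0 ≤ 1 / y ^ 2 := by positivity
      nlinarith) hy
  have h4 : Real.exp (2 * k * y - 1 / y - (2 * k * 1 - 1 / 1)) ≤
      (Real.exp 1 * Real.exp (k * y)) ^ 2 := by
    rw [← Real.exp_add, ← Real.exp_nat_mul]
    apply Real.exp_le_exp.mpr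
    have : 0 < 1 / y := by positivity
    push_cast
    linarith
  have h5 : k ^ 2 * ‖a n s y‖ ^ 2 ≤ k ^ 2 * (2 * M * Real.exp 1 * Real.exp (k * y)) ^ 2 := by
    calc k ^ 2 * ‖a n s y‖ ^ 2 ≤ k ^ 2 * ‖a n s y‖ ^ 2 + ‖a' n s y‖ ^ 2 := by
          have := sq_nonneg ‖a' n s y‖
          linarith
      _ ≤ _ := he
      _ ≤ (k ^ 2 * M ^ 2 + M ^ 2) * (Real.exp 1 * Real.exp (k * y)) ^ 2 := by gcongr
      _ ≤ (k ^ 2 * (4 * M ^ 2)) * (Real.exp 1 * Real.exp (k * y)) ^ 2 := by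
          gcongr
          nlinarith [sq_nonneg M, mul_le_mul hn hn (by norm_num) hk0.le]
      _ = _ := by ring
  have h6 := le_of_mul_le_mul_left h5 (by positivity)
  exact le_of_sq_le_sq h6 (by positivity)

/-- The limit is the coefficient of the growing solution. Convergence is uniform in `s`, since its
rate depends only on the uniform constant `C`, and therefore the coefficient is holomorphic. -/
theorem exists_limit (h : IsModeFamily κ V a a') (hVo : IsOpen V)
    (hV : ∀ s ∈ V, ‖s * (1 - s)‖ ≤ 1) {n : ℤ} (hn : 2 ≤ |κ * n|) :
    ∃ l : ℂ → ℂ, DifferentiableOn ℂ l V ∧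
      ∀ s ∈ V, Tendsto (fun y : ℝ => Real.exp (-(|κ * n| * y)) * a n s y) atTop (𝓝 (l s)) := by
  obtain ⟨C, hC0, hC⟩ := h.norm_le_exp_sharp hV hn
  set k : ℝ := |κ * n| with hk
  have hex : ∀ s ∈ V, ∃ l : ℂ, ∀ y ≥ (1 : ℝ), ‖Real.exp (-(k * y)) * a n s y - l‖ ≤
      (2 * C + 2 * ‖Real.exp (-(k * 1)) * a n s 1 - l‖) / y := fun s hs =>
    ode_exists_limit (e := -(s * (1 - s))) hn (by rw [norm_neg]; exact hV s hs)
      (fun y hy => h.hasDeriv n s hs y (by linarith))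
      (fun y hy => by rw [hk, ← coeff_eq]; exact h.hasDeriv' n s hs y (by linarith))
      (fun y hy => hC s hs y hy)
  choose! l hl using hex
  have hnorm : ∀ s ∈ V, ∀ y ≥ (1 : ℝ), ‖(Real.exp (-(k * y)) : ℂ) * a n s y‖ ≤ C := by
    intro s hs y hy
    rw [norm_mul, Complex.norm_real, Real.norm_eq_abs, Real.abs_exp]
    calc _ ≤ Real.exp (-(k * y)) * (C * Real.exp (k * y)) := by
          gcongr; exact hC s hs y hy
      _ = C * (Real.exp (-(k * y)) * Real.exp (k * y)) := by ring
      _ = C := by rw [← Real.exp_add]; simp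
  have hlim : ∀ s ∈ V, Tendsto (fun y : ℝ => Real.exp (-(k * y)) * a n s y) atTop (𝓝 (l s)) := by
    intro s hs
    rw [tendsto_iff_norm_sub_tendsto_zero]
    refine squeeze_zero' (Eventually.of_forall fun _ => norm_nonneg _)
      (by filter_upwards [eventually_ge_atTop 1] with y hy using hl s hs y hy)
      (tendsto_const_nhds.div_atTop tendsto_id)
  have hlC : ∀ s ∈ V, ‖l s‖ ≤ C := fun s hs => le_of_tendsto (hlim s hs).norm
    (by filter_upwards [eventually_ge_atTop 1] with y hy using hnorm s hs y hy)
  refine ⟨l, ?_, hlim⟩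
  have hunif : TendstoUniformlyOn (fun (y : ℝ) s => (Real.exp (-(k * y)) : ℂ) * a n s y) l atTop V := by
    rw [Metric.tendstoUniformlyOn_iff]
    intro ε hε
    have hz : Tendsto (fun y : ℝ => 6 * C / y) atTop (𝓝 0) :=
      tendsto_const_nhds.div_atTop tendsto_id
    filter_upwards [eventually_ge_atTop 1, hz.eventually (gt_mem_nhds hε)] with y hy hy2 s hs
    rw [dist_comm, dist_eq_norm]
    refine (hl s hs y hy).trans_lt (lt_of_le_of_lt ?_ hy2)
    have h1 := norm_sub_le ((Real.exp (-(k * 1)) : ℂ) * a n s 1) (l s)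
    have h2 := hnorm s hs 1 le_rfl
    have h3 := hlC s hs
    have hy0 : (0 : ℝ) < y := by linarith
    gcongr
    linarith
  refine hunif.tendstoLocallyUniformlyOn.differentiableOn ?_ hVo
  filter_upwards [eventually_gt_atTop 0] with y hy
  exact (h.holo n y hy).const_mul _

/-- The growth exponent `C` may depend on `s` in an uncontrolled way; the point is to bound the
growing modes uniformly all the same. A mode whose growing coefficient is not identically zero grows
on a dense open set of parameters. By Baire's theorem all such modes grow at one common parameter
`s`, where the single exponent `C` of that `s` forces `|κ n| ≤ C`. Hence there are finitely many of
them. All other modes with `|κ n| > 2` are recessive for every `s`, hence bounded by their value at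
`y = 1`. -/
theorem uniform_bound (h : IsModeFamily κ V a a') (hκ : 0 < κ) (hVo : IsOpen V)
    (hVc : IsPreconnected V) (hne : V.Nonempty)
    (hV : ∀ s ∈ V, ‖s * (1 - s)‖ ≤ 1) :
    ∃ S : Finset ℤ, (∀ n ∉ S, ∀ s ∈ V, ∀ y ≥ (1 : ℝ), ‖a n s y‖ ≤ ‖a n s 1‖) ∧
      ∃ C K : ℝ, 0 ≤ C ∧ 0 ≤ K ∧
        ∀ n ∈ S, ∀ s ∈ V, ∀ y ≥ (1 : ℝ), ‖a n s y‖ ≤ K * Real.exp (C * y) := by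
  have hfin : ∀ R : ℝ, {n : ℤ | |κ * n| ≤ R}.Finite := by
    intro R
    refine (Set.finite_Icc (-⌈R / κ⌉) ⌈R / κ⌉).subset fun n hn => ?_
    have h1 : |(n : ℝ)| ≤ R / κ := by
      rw [le_div_iff₀ hκ]
      have : |κ * n| = κ * |(n : ℝ)| := by rw [abs_mul, abs_of_pos hκ]
      rw [Set.mem_ofPred_eq, this] at hn
      linarith
    have h2 := abs_le.mp (h1.trans (Int.le_ceil _))
    constructor
    · have : ((-⌈R / κ⌉ : ℤ) : ℝ) ≤ n := by push_cast; exact h2.1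
      exact_mod_cast this
    · exact_mod_cast h2.2
  have hex : ∀ n : ℤ, ∃ l : ℂ → ℂ, 2 ≤ |κ * n| → DifferentiableOn ℂ l V ∧
      ∀ s ∈ V, Tendsto (fun y : ℝ => Real.exp (-(|κ * n| * y)) * a n s y) atTop (𝓝 (l s)) := by
    intro n
    by_cases hn : 2 ≤ |κ * n|
    · obtain ⟨l, hl⟩ := h.exists_limit hVo hV hn
      exact ⟨l, fun _ => hl⟩
    · exact ⟨0, fun h => absurd h hn⟩
  choose l hl using hex
  set bad : Set ℤ := {n | 2 ≤ |κ * n| ∧ ∃ s ∈ V, l n s ≠ 0} with hbad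
  -- the leading coefficients of the bad modes are nonzero on dense open sets
  have hO : ∀ n ∈ bad, IsOpen ({s | s ∈ V ∧ l n s ≠ 0} ∪ (closure V)ᶜ) ∧
      Dense ({s | s ∈ V ∧ l n s ≠ 0} ∪ (closure V)ᶜ) := by
    rintro n ⟨hn, s₁, hs₁, hl₁⟩
    have han : AnalyticOnNhd ℂ (l n) V := (hl n hn).1.analyticOnNhd hVo
    constructor
    · refine IsOpen.union ?_ isClosed_closure.isOpen_compl
      exact ((hl n hn).1.continuousOn.isOpen_inter_preimage hVo isOpen_compl_singleton)
    · have hVsub : V ⊆ closure {s | s ∈ V ∧ l n s ≠ 0} := by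
        intro s hs
        rw [mem_closure_iff_frequently]
        intro hcon
        have hz : l n =ᶠ[𝓝 s] 0 := by
          filter_upwards [hcon, hVo.mem_nhds hs] with w hw hwV
          by_contra hne'
          exact hw ⟨hwV, hne'⟩
        exact hl₁ (han.eqOn_zero_of_preconnected_of_eventuallyEq_zero hVc hs hz hs₁)
      intro s
      rw [closure_union]
      by_cases hs : s ∈ closure V
      · left
        exact closure_minimal hVsub isClosed_closure hs
      · right
        exact subset_closure hs
  have hbadfin : bad.Finite := by
    have hdense : Dense (⋂ n : bad, ({s | s ∈ V ∧ l n s ≠ 0} ∪ (closure V)ᶜ)) :=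
      dense_iInter_of_isOpen (fun n => (hO n n.2).1) (fun n => (hO n n.2).2)
    -- The complement of `closure V` was added only to have dense sets in all of `ℂ`; a point of the
    -- intersection lying in `V` avoids the zeros of every bad coefficient.
    obtain ⟨s, hsV, hs⟩ := hdense.inter_open_nonempty V hVo hne
    rw [Set.mem_iInter] at hs
    obtain ⟨C, K, hg⟩ := h.growth s hsV
    refine (hfin C).subset fun n hn => ?_
    by_contra hnC
    rw [Set.mem_ofPred_eq, not_le] at hnC
    rcases hs ⟨n, hn⟩ with h1 | h1
    · apply h1.2
      refine tendsto_nhds_unique ((hl n hn.1).2 s hsV) ?_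
      rw [tendsto_zero_iff_norm_tendsto_zero]
      have hz : Tendsto (fun y : ℝ => K * Real.exp (-((|κ * n| - C) * y))) atTop (𝓝 (K * 0)) := by
        refine Tendsto.const_mul K (Real.tendsto_exp_neg_atTop_nhds_zero.comp ?_)
        exact tendsto_id.const_mul_atTop (sub_pos.mpr hnC)
      rw [mul_zero] at hz
      refine squeeze_zero' (Eventually.of_forall fun _ => norm_nonneg _) ?_ hz
      filter_upwards [eventually_ge_atTop 1] with y hy
      rw [norm_mul, Complex.norm_real, Real.norm_eq_abs, Real.abs_exp]
      calc _ ≤ Real.exp (-(|κ * n| * y)) * (K * Real.exp (C * y)) := by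
            gcongr; exact hg n y hy
        _ = K * (Real.exp (-(|κ * n| * y)) * Real.exp (C * y)) := by ring
        _ = _ := by rw [← Real.exp_add]; ring_nf
    · exact h1 (subset_closure hsV)
  have hSfin : (bad ∪ {n : ℤ | |κ * n| ≤ 2}).Finite := hbadfin.union (hfin 2)
  refine ⟨hSfin.toFinset, ?_, ?_⟩
  · intro n hn s hs y hy
    rw [Set.Finite.mem_toFinset, Set.mem_union, not_or] at hn
    have hn2 : 2 < |κ * n| := not_le.mp hn.2
    have hl0 : l n s = 0 := by
      by_contra hne
      exact hn.1 ⟨hn2.le, s, hs, hne⟩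
    have := (hl n hn2.le).2 s hs
    rw [hl0] at this
    exact ode_recessive_le (e := -(s * (1 - s))) hn2.le (by rw [norm_neg]; exact hV s hs)
      (fun y hy => h.hasDeriv n s hs y (by linarith))
      (fun y hy => by rw [← coeff_eq]; exact h.hasDeriv' n s hs y (by linarith)) this hy
  · choose C K hC hK hCK using fun n => h.norm_le_exp hV n
    refine ⟨∑ n ∈ hSfin.toFinset, C n, ∑ n ∈ hSfin.toFinset, K n,
      Finset.sum_nonneg fun n _ => hC n, Finset.sum_nonneg fun n _ => hK n,
      fun n hn s hs y hy => (hCK n s hs y hy).trans ?_⟩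
    have hy0 : (0 : ℝ) ≤ y := by linarith
    have h1 := Finset.single_le_sum (f := C) (fun n _ => hC n) hn
    have h2 := Finset.single_le_sum (f := K) (fun n _ => hK n) hn
    have h3 := (hK n).trans h2
    gcongr

end IsModeFamily

/-! ### The Laplacian on the plane and on the upper half-plane -/

theorem laplacian_apply (f : ℂ → ℂ) (z : ℂ) : Laplacian.laplacian f z =
    fderiv ℝ (fderiv ℝ f) z 1 1 + fderiv ℝ (fderiv ℝ f) z Complex.I Complex.I := by
  rw [InnerProductSpace.laplacian_eq_iteratedFDeriv_complexPlane]
  simp [iteratedFDeriv_two_apply]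

theorem _root_.ContDiffAt.differentiableAt_fderiv_two {f : ℂ → ℂ} {z : ℂ}
    (hf : ContDiffAt ℝ 2 f z) : DifferentiableAt ℝ (fderiv ℝ f) z :=
  (hf.fderiv_right (m := 1) (by norm_num)).differentiableAt (by norm_num)

theorem _root_.ContDiffAt.eventually_differentiableAt {f : ℂ → ℂ} {z : ℂ}
    (hf : ContDiffAt ℝ 2 f z) : ∀ᶠ w in 𝓝 z, DifferentiableAt ℝ f w :=
  (hf.eventually (by simp)).mono fun _ hw => hw.differentiableAt (by norm_num)

theorem fderiv_fderiv_apply {f : ℂ → ℂ} {z : ℂ} (hf : ContDiffAt ℝ 2 f z) (v w : ℂ) :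
    fderiv ℝ (fun x => fderiv ℝ f x v) z w = fderiv ℝ (fderiv ℝ f) z w v := by
  rw [fderiv_clm_apply hf.differentiableAt_fderiv_two (differentiableAt_const v)]
  simp

theorem fderiv_fderiv_symm {f : ℂ → ℂ} {z : ℂ} (hf : ContDiffAt ℝ 2 f z) (v w : ℂ) :
    fderiv ℝ (fderiv ℝ f) z v w = fderiv ℝ (fderiv ℝ f) z w v :=
  (hf.isSymmSndFDerivAt (by simp)) v w

theorem laplacian_mul {u w : ℂ → ℂ} {z : ℂ} (hu : ContDiffAt ℝ 2 u z) (hw : ContDiffAt ℝ 2 w z) :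
    Laplacian.laplacian (fun x => u x * w x) z =
      u z * Laplacian.laplacian w z + Laplacian.laplacian u z * w z +
        2 * (fderiv ℝ u z 1 * fderiv ℝ w z 1 +
          fderiv ℝ u z Complex.I * fderiv ℝ w z Complex.I) := by
  have key : ∀ v : ℂ, fderiv ℝ (fderiv ℝ (fun x => u x * w x)) z v v =
      u z * fderiv ℝ (fderiv ℝ w) z v v + fderiv ℝ (fderiv ℝ u) z v v * w z +
        2 * (fderiv ℝ u z v * fderiv ℝ w z v) := by
    intro v
    rw [← fderiv_fderiv_apply (hu.mul hw)]
    have e : (fun x => fderiv ℝ (fun x => u x * w x) x v) =ᶠ[𝓝 z]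
        fun x => u x * fderiv ℝ w x v + w x * fderiv ℝ u x v := by
      filter_upwards [hu.eventually_differentiableAt, hw.eventually_differentiableAt] with x h1 h2
      rw [fderiv_fun_mul h1 h2]
      simp
    rw [e.fderiv_eq]
    have d1 := hu.differentiableAt (by norm_num)
    have d2 := hw.differentiableAt (by norm_num)
    have d3 : DifferentiableAt ℝ (fun x => fderiv ℝ w x v) z :=
      hw.differentiableAt_fderiv_two.clm_apply (differentiableAt_const v)
    have d4 : DifferentiableAt ℝ (fun x => fderiv ℝ u x v) z :=
      hu.differentiableAt_fderiv_two.clm_apply (differentiableAt_const v)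
    rw [fderiv_fun_add (show DifferentiableAt ℝ (fun x => u x * fderiv ℝ w x v) z from d1.mul d3)
      (show DifferentiableAt ℝ (fun x => w x * fderiv ℝ u x v) z from d2.mul d4), fderiv_fun_mul d1 d3, fderiv_fun_mul d2 d4]
    simp only [add_apply, smul_apply, smul_eq_mul,
      fderiv_fderiv_apply hu, fderiv_fderiv_apply hw]
    ring
  rw [laplacian_apply, laplacian_apply, laplacian_apply, key, key]
  ring

/-- Conformal invariance: the terms with `h''` cancel because `1² + I² = 0`, and the mixed second
derivatives of `f` cancel because `c` and `c I` are orthogonal of equal length. -/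
theorem laplacian_comp_holomorphic {f h : ℂ → ℂ} {z : ℂ} (hh : AnalyticAt ℂ h z)
    (hf : ContDiffAt ℝ 2 f (h z)) :
    Laplacian.laplacian (f ∘ h) z =
      (Complex.normSq (deriv h z) : ℂ) * Laplacian.laplacian f (h z) := by
  have hhc : ContDiffAt ℝ 2 h z := (hh.contDiffAt (n := 2)).restrict_scalars ℝ
  have hd : ∀ᶠ w in 𝓝 z, HasDerivAt h (deriv h w) w :=
    hh.eventually_analyticAt.mono fun w hw => hw.differentiableAt.hasDerivAt
  have key : ∀ v : ℂ, fderiv ℝ (fderiv ℝ (f ∘ h)) z v v =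
      fderiv ℝ (fderiv ℝ f) (h z) (deriv h z * v) (deriv h z * v) +
        fderiv ℝ f (h z) (deriv (deriv h) z * (v * v)) := by
    intro v
    rw [← fderiv_fderiv_apply (hf.comp z hhc)]
    have e : (fun x => fderiv ℝ (f ∘ h) x v) =ᶠ[𝓝 z]
        fun x => fderiv ℝ f (h x) (deriv h x * v) := by
      filter_upwards [hd, hh.continuousAt.eventually hf.eventually_differentiableAt] with x h1 h2
      have h3 : HasFDerivAt h ((ContinuousLinearMap.toSpanSingleton ℂ (deriv h x)).restrictScalars ℝ) x :=
        h1.hasFDerivAt.restrictScalars ℝ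
      rw [(h2.hasFDerivAt.comp x h3).fderiv]
      simp [mul_comm]
    rw [e.fderiv_eq]
    have h1 : HasDerivAt h (deriv h z) z := hd.self_of_nhds
    have h2 : HasDerivAt (deriv h) (deriv (deriv h) z) z := hh.deriv.differentiableAt.hasDerivAt
    have h3 : HasFDerivAt h ((ContinuousLinearMap.toSpanSingleton ℂ (deriv h z)).restrictScalars ℝ) z :=
      h1.hasFDerivAt.restrictScalars ℝ
    have h4 : HasFDerivAt (fun x => deriv h x * v)
        ((ContinuousLinearMap.toSpanSingleton ℂ (deriv (deriv h) z * v)).restrictScalars ℝ) z :=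
      (h2.mul_const v).hasFDerivAt.restrictScalars ℝ
    have h5 : HasFDerivAt (fun x => fderiv ℝ f (h x)) _ z :=
      hf.differentiableAt_fderiv_two.hasFDerivAt.comp z h3
    rw [(h5.clm_apply h4).fderiv]
    simp only [add_apply, ContinuousLinearMap.comp_apply, ContinuousLinearMap.flip_apply,
      ContinuousLinearMap.coe_restrictScalars', ContinuousLinearMap.toSpanSingleton_apply,
      smul_eq_mul]
    rw [add_comm, mul_comm v (deriv h z), show v * (deriv (deriv h) z * v) =
      deriv (deriv h) z * (v * v) by ring]
  rw [laplacian_apply, laplacian_apply, key, key]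
  set c := deriv h z
  set B := fderiv ℝ (fderiv ℝ f) (h z) with hB
  set l := fderiv ℝ f (h z)
  have hsymm : B 1 Complex.I = B Complex.I 1 := fderiv_fderiv_symm hf _ _
  have e1 : c * 1 = c.re • (1 : ℂ) + c.im • Complex.I := by
    simp only [mul_one, Complex.real_smul]
    exact (Complex.re_add_im c).symm
  have e2 : c * Complex.I = (-c.im) • (1 : ℂ) + c.re • Complex.I := by
    apply Complex.ext <;> simp
  have e3 : l (deriv (deriv h) z * (1 * 1)) + l (deriv (deriv h) z * (Complex.I * Complex.I)) = 0 := by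
    rw [← map_add]
    simp
  rw [e1, e2]
  simp only [map_add, map_smul, add_apply, smul_apply, hsymm]
  simp only [Complex.real_smul]
  rw [Complex.normSq_apply]
  push_cast
  linear_combination e3

/-- Twice continuously differentiable functions on the upper half-plane. -/
def IsC2 (f : ℍ → ℂ) : Prop := ∀ z : ℍ, ContDiffAt ℝ 2 (fun w : ℂ => f (ofComplex w)) (z : ℂ)

theorem IsWeakMaassForm.isC2 {Γ : Subgroup SL(2, ℤ)} {lam : ℂ} {f : ℍ → ℂ}
    (hf : IsWeakMaassForm Γ lam f) : IsC2 f := fun z =>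
  ((hf.smooth z z.2).contDiffAt ((isOpen_lt continuous_const Complex.continuous_im).mem_nhds z.2)).of_le
    (by norm_cast)

theorem IsC2.continuous {f : ℍ → ℂ} (hf : IsC2 f) : Continuous f := by
  have : f = fun z : ℍ => (fun w : ℂ => f (ofComplex w)) (z : ℂ) := by
    ext z; simp [ofComplex_apply]
  rw [this, continuous_iff_continuousAt]
  intro z
  exact ContinuousAt.comp (g := fun w : ℂ => f (ofComplex w)) (hf z).continuousAt
    continuous_coe.continuousAt

theorem eventually_ofComplex (z : ℍ) : ∀ᶠ w : ℂ in 𝓝 (z : ℂ), ((ofComplex w : ℍ) : ℂ) = w := by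
  filter_upwards [(isOpen_lt continuous_const Complex.continuous_im).mem_nhds z.2] with w hw
  rw [ofComplex_apply_of_im_pos hw]

theorem det_toGL_map (g : SL(2, ℤ)) : ((Matrix.SpecialLinearGroup.toGL
    ((Matrix.SpecialLinearGroup.map (Int.castRingHom ℝ)) g)) : Matrix (Fin 2) (Fin 2) ℝ).det = 1 :=
  ((Matrix.SpecialLinearGroup.map (Int.castRingHom ℝ)) g).2

theorem analyticAt_smul (g : SL(2, ℤ)) (z : ℍ) :
    AnalyticAt ℂ (fun w : ℂ => ((g • ofComplex w : ℍ) : ℂ)) z := by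
  rw [Complex.analyticAt_iff_eventually_differentiableAt]
  filter_upwards [(isOpen_lt continuous_const Complex.continuous_im).mem_nhds z.2] with w hw
  have := hasStrictDerivAt_smul (g := (Matrix.SpecialLinearGroup.toGL
    ((Matrix.SpecialLinearGroup.map (Int.castRingHom ℝ)) g))) (by rw [det_toGL_map]; exact one_pos) ⟨w, hw⟩
  exact this.hasDerivAt.differentiableAt

theorem deriv_smul (g : SL(2, ℤ)) (z : ℍ) :
    deriv (fun w : ℂ => ((g • ofComplex w : ℍ) : ℂ)) z =
      1 / denom (Matrix.SpecialLinearGroup.toGL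
        ((Matrix.SpecialLinearGroup.map (Int.castRingHom ℝ)) g)) z ^ 2 := by
  have := hasStrictDerivAt_smul (g := (Matrix.SpecialLinearGroup.toGL
    ((Matrix.SpecialLinearGroup.map (Int.castRingHom ℝ)) g))) (by rw [det_toGL_map]; exact one_pos) z
  rw [show (fun w : ℂ => ((g • ofComplex w : ℍ) : ℂ)) = fun w : ℂ =>
    (((Matrix.SpecialLinearGroup.toGL
    ((Matrix.SpecialLinearGroup.map (Int.castRingHom ℝ)) g)) • ofComplex w : ℍ) : ℂ) from rfl,
    this.hasDerivAt.deriv, det_toGL_map, Complex.ofReal_one]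

theorem comp_smul_ofComplex (f : ℍ → ℂ) (g : SL(2, ℤ)) :
    (fun w : ℂ => f (g • ofComplex w)) =
      (fun w : ℂ => f (ofComplex w)) ∘ fun w : ℂ => ((g • ofComplex w : ℍ) : ℂ) := by
  ext w
  simp [ofComplex_apply]

theorem IsC2.comp_smul {f : ℍ → ℂ} (hf : IsC2 f) (g : SL(2, ℤ)) : IsC2 fun z => f (g • z) := by
  intro z
  rw [comp_smul_ofComplex]
  refine ContDiffAt.comp (z : ℂ) ?_ (((analyticAt_smul g z).contDiffAt (n := 2)).restrict_scalars ℝ)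
  simp only [ofComplex_apply]
  exact hf _

/-- The Laplacian commutes with the action of `SL₂(ℤ)`. -/
theorem hypLaplacian_comp_smul {f : ℍ → ℂ} (hf : IsC2 f) (g : SL(2, ℤ)) (z : ℍ) :
    hypLaplacian (fun z => f (g • z)) z = hypLaplacian f (g • z) := by
  unfold hypLaplacian
  -- The conformal factor is `1 / |cz + d|⁴`, which is exactly the square of the factor by which `Im
  -- z` changes.
  rw [comp_smul_ofComplex, laplacian_comp_holomorphic (analyticAt_smul g z)
    (by simp only [ofComplex_apply]; exact hf _), deriv_smul, ModularGroup.im_smul_eq_div_normSq]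
  simp only [ofComplex_apply]
  set d := denom (Matrix.SpecialLinearGroup.toGL
    ((Matrix.SpecialLinearGroup.map (Int.castRingHom ℝ)) g)) z
  have hd : (Complex.normSq d : ℂ) ≠ 0 := by
    rw [Complex.ofReal_ne_zero, ne_eq, Complex.normSq_eq_zero]
    exact denom_ne_zero _ _
  rw [map_div₀, map_pow, map_one]
  push_cast
  field_simp

theorem IsC2.mul {f g : ℍ → ℂ} (hf : IsC2 f) (hg : IsC2 g) : IsC2 fun z => f z * g z :=
  fun z => (hf z).mul (hg z)

theorem hypLaplacian_congr {f g : ℍ → ℂ} {z : ℍ} (h : ∀ᶠ w in 𝓝 z, f w = g w) :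
    hypLaplacian f z = hypLaplacian g z := by
  unfold hypLaplacian
  congr 1
  apply (InnerProductSpace.laplacian_congr_nhds _).self_of_nhds
  have : Tendsto (fun w : ℂ => (ofComplex w : ℍ)) (𝓝 (z : ℂ)) (𝓝 z) := by
    have h1 := (contMDiffAt_ofComplex (n := 0) z.2).continuousAt
    have h2 : ofComplex (z : ℂ) = z := ofComplex_apply z
    unfold ContinuousAt at h1
    rwa [h2] at h1
  exact this.eventually h

theorem IsC2.congr {f g : ℍ → ℂ} (z : ℍ) (hf : ContDiffAt ℝ 2 (fun w : ℂ => f (ofComplex w)) z)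
    (h : ∀ᶠ w in 𝓝 z, g w = f w) : ContDiffAt ℝ 2 (fun w : ℂ => g (ofComplex w)) z := by
  refine hf.congr_of_eventuallyEq ?_
  have : Tendsto (fun w : ℂ => (ofComplex w : ℍ)) (𝓝 (z : ℂ)) (𝓝 z) := by
    have h1 := (contMDiffAt_ofComplex (n := 0) z.2).continuousAt
    have h2 : ofComplex (z : ℂ) = z := ofComplex_apply z
    unfold ContinuousAt at h1
    rwa [h2] at h1
  exact this.eventually h

theorem continuous_hypLaplacian {f : ℍ → ℂ} (hf : IsC2 f) : Continuous (hypLaplacian f) := by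
  rw [continuous_iff_continuousAt]
  intro z
  unfold hypLaplacian
  have h1 : ContinuousAt (Laplacian.laplacian (fun w : ℂ => f (ofComplex w))) (z : ℂ) := by
    have e : Laplacian.laplacian (fun w : ℂ => f (ofComplex w)) = fun x =>
      fderiv ℝ (fderiv ℝ (fun w : ℂ => f (ofComplex w))) x 1 1 +
      fderiv ℝ (fderiv ℝ (fun w : ℂ => f (ofComplex w))) x Complex.I Complex.I := by
      ext x; exact laplacian_apply _ _
    rw [e]
    have h2 : ContinuousAt (fderiv ℝ (fderiv ℝ (fun w : ℂ => f (ofComplex w)))) (z : ℂ) :=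
      (((hf z).fderiv_right (m := 1) (by norm_num)).fderiv_right (m := 0)
        (by norm_num)).continuousAt
    exact ((h2.clm_apply continuousAt_const).clm_apply continuousAt_const).add
      ((h2.clm_apply continuousAt_const).clm_apply continuousAt_const)
  have h3 : ContinuousAt (fun z : ℍ => Laplacian.laplacian (fun w : ℂ => f (ofComplex w)) (z : ℂ)) z :=
    ContinuousAt.comp (g := Laplacian.laplacian (fun w : ℂ => f (ofComplex w))) h1
      continuous_coe.continuousAt
  exact ((Complex.continuous_ofReal.comp continuous_im).pow 2).neg.continuousAt.mul h3

/-! ### Integration on the upper half-plane -/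

theorem continuous_mul_of_tsupport {X : Type*} [TopologicalSpace X] {φ ψ : X → ℂ} {O : Set X}
    (hφ : Continuous φ) (hsub : tsupport φ ⊆ O) (hψ : ∀ z ∈ O, ContinuousAt ψ z) :
    Continuous fun z => φ z * ψ z := by
  rw [continuous_iff_continuousAt]
  intro z
  by_cases hz : z ∈ tsupport φ
  · exact hφ.continuousAt.mul (hψ z (hsub hz))
  · have : (fun z => φ z * ψ z) =ᶠ[𝓝 z] fun _ => 0 := by
      filter_upwards [notMem_tsupport_iff_eventuallyEq.mp hz] with w hw
      simp [hw]
    exact continuousAt_const.congr this.symm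

theorem integrable_mul_of_tsupport {φ ψ : ℂ → ℂ} {O : Set ℂ}
    (hφ : Continuous φ) (hc : HasCompactSupport φ) (hsub : tsupport φ ⊆ O)
    (hψ : ∀ z ∈ O, ContinuousAt ψ z) : Integrable fun z => φ z * ψ z :=
  (continuous_mul_of_tsupport hφ hsub hψ).integrable_of_hasCompactSupport hc.mul_right

/-- Two integrations by parts in each of the directions `1` and `I`. All integrands carry a
derivative of `η` or `η` itself, so regularity of `w` is needed only near its support. -/
theorem integral_mul_laplacian {η w : ℂ → ℂ} {O : Set ℂ} (hη : ContDiff ℝ 2 η)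
    (hc : HasCompactSupport η) (hsub : tsupport η ⊆ O) (hw : ∀ z ∈ O, ContDiffAt ℝ 2 w z) :
    ∫ z, η z * Laplacian.laplacian w z = ∫ z, Laplacian.laplacian η z * w z := by
  have hη1 : ContDiff ℝ 1 (fderiv ℝ η) := hη.fderiv_right (by norm_num)
  have hd : ∀ v : ℂ, ContDiff ℝ 1 (fun z => fderiv ℝ η z v) := fun v => hη1.clm_apply contDiff_const
  have hcd : ∀ v : ℂ, HasCompactSupport (fun z => fderiv ℝ η z v) := fun v =>
    hc.fderiv_apply (𝕜 := ℝ) v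
  have hsd : ∀ v : ℂ, tsupport (fun z => fderiv ℝ η z v) ⊆ O := fun v =>
    (tsupport_fderiv_apply_subset ℝ v).trans hsub
  have hcdd : ∀ v : ℂ, HasCompactSupport (fun z => fderiv ℝ (fun z => fderiv ℝ η z v) z v) :=
    fun v => (hcd v).fderiv_apply (𝕜 := ℝ) v
  have hsdd : ∀ v : ℂ, tsupport (fun z => fderiv ℝ (fun z => fderiv ℝ η z v) z v) ⊆ O := fun v =>
    (tsupport_fderiv_apply_subset ℝ v).trans (hsd v)
  have hcontdd : ∀ v : ℂ, Continuous (fun z => fderiv ℝ (fun z => fderiv ℝ η z v) z v) := fun v =>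
    ((hd v).continuous_fderiv (by norm_num)).clm_apply continuous_const
  have hw1 : ∀ v : ℂ, ∀ z ∈ O, ContDiffAt ℝ 1 (fun z => fderiv ℝ w z v) z := fun v z hz =>
    ((hw z hz).fderiv_right (m := 1) (by norm_num)).clm_apply contDiffAt_const
  have hw2 : ∀ v : ℂ, ∀ z ∈ O, ContinuousAt (fun z => fderiv ℝ (fun z => fderiv ℝ w z v) z v) z :=
    fun v z hz => (((hw1 v z hz).fderiv_right (m := 0) (by norm_num)).clm_apply
      contDiffAt_const).continuousAt
  have key : ∀ v : ℂ, ∫ z, η z * fderiv ℝ (fun z => fderiv ℝ w z v) z v =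
      ∫ z, fderiv ℝ (fun z => fderiv ℝ η z v) z v * w z := by
    intro v
    have e1 : ∫ z, η z * fderiv ℝ (fun z => fderiv ℝ w z v) z v =
        - ∫ z, fderiv ℝ η z v * fderiv ℝ w z v :=
      integral_mul_fderiv_eq_neg_fderiv_mul_of_integrable
        (integrable_mul_of_tsupport (hd v).continuous (hcd v) (hsd v)
          fun z hz => (hw1 v z hz).continuousAt)
        (integrable_mul_of_tsupport hη.continuous hc hsub (hw2 v))
        (integrable_mul_of_tsupport hη.continuous hc hsub fun z hz => (hw1 v z hz).continuousAt)
        (fun z _ => hη.differentiable (by norm_num) z)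
        (fun z hz => (hw1 v z (hsub hz)).differentiableAt (by norm_num))
    have e2 : ∫ z, fderiv ℝ η z v * fderiv ℝ w z v =
        - ∫ z, fderiv ℝ (fun z => fderiv ℝ η z v) z v * w z :=
      integral_mul_fderiv_eq_neg_fderiv_mul_of_integrable
        (integrable_mul_of_tsupport (hcontdd v) (hcdd v) (hsdd v)
          fun z hz => (hw z hz).continuousAt)
        (integrable_mul_of_tsupport (hd v).continuous (hcd v) (hsd v)
          fun z hz => (hw1 v z hz).continuousAt)
        (integrable_mul_of_tsupport (hd v).continuous (hcd v) (hsd v)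
          fun z hz => (hw z hz).continuousAt)
        (fun z _ => (hd v).differentiable (by norm_num) z)
        (fun z hz => (hw z (hsd v hz)).differentiableAt (by norm_num))
    rw [e1, e2, neg_neg]
  have h1 : ∀ z, η z * Laplacian.laplacian w z =
      η z * fderiv ℝ (fun z => fderiv ℝ w z 1) z 1 +
      η z * fderiv ℝ (fun z => fderiv ℝ w z Complex.I) z Complex.I := by
    intro z
    by_cases hz : z ∈ tsupport η
    · rw [fderiv_fderiv_apply (hw z (hsub hz)), fderiv_fderiv_apply (hw z (hsub hz)),
        laplacian_apply, mul_add]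
    · rw [image_eq_zero_of_notMem_tsupport hz]
      simp
  have h2 : ∀ z, Laplacian.laplacian η z * w z =
      fderiv ℝ (fun z => fderiv ℝ η z 1) z 1 * w z +
      fderiv ℝ (fun z => fderiv ℝ η z Complex.I) z Complex.I * w z := by
    intro z
    rw [fderiv_fderiv_apply hη.contDiffAt, fderiv_fderiv_apply hη.contDiffAt, laplacian_apply,
      add_mul]
  simp_rw [h1, h2]
  rw [integral_add, integral_add, key, key]
  · exact integrable_mul_of_tsupport (hcontdd _) (hcdd _) (hsdd _) fun z hz => (hw z hz).continuousAt
  · exact integrable_mul_of_tsupport (hcontdd _) (hcdd _) (hsdd _) fun z hz => (hw z hz).continuousAt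
  · exact integrable_mul_of_tsupport hη.continuous hc hsub (hw2 _)
  · exact integrable_mul_of_tsupport hη.continuous hc hsub (hw2 _)

/-- The point `x + i y` of the upper half-plane. -/
def pt (x y : ℝ) : ℍ := ofComplex ((x : ℂ) + (y : ℂ) * Complex.I)

theorem coe_pt {x y : ℝ} (hy : 0 < y) : (pt x y : ℂ) = (x : ℂ) + (y : ℂ) * Complex.I := by
  have h : 0 < ((x : ℂ) + (y : ℂ) * Complex.I).im := by simpa using hy
  rw [pt, ofComplex_apply_of_im_pos h]

theorem pt_re {x y : ℝ} (hy : 0 < y) : (pt x y).re = x := by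
  have := congrArg Complex.re (coe_pt (x := x) hy)
  simpa using this

theorem pt_im {x y : ℝ} (hy : 0 < y) : (pt x y).im = y := by
  have := congrArg Complex.im (coe_pt (x := x) hy)
  simpa using this

theorem pt_re_im (z : ℍ) : pt z.re z.im = z := by
  apply UpperHalfPlane.ext
  rw [coe_pt z.im_pos]
  exact Complex.re_add_im (z : ℂ)

theorem setIntegral_uhp (G : ℍ → ℂ) {S : Set ℂ} (hS : MeasurableSet S) (hpos : ∀ w ∈ S, 0 < w.im) :
    ∫ z in {z : ℍ | (z : ℂ) ∈ S}, G z =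
      ∫ w in S, ((1 / w.im ^ 2 : ℝ) : ℂ) * G (ofComplex w) := by
  have hS' : MeasurableSet {z : ℍ | (z : ℂ) ∈ S} := measurable_coe hS
  have hmeas : Measurable fun z : ℍ => ((1 / NNReal.mk z.im z.im_pos.le : NNReal) ^ 2) := by
    refine Measurable.pow_const (Measurable.const_div ?_ _) _
    exact (continuous_im.subtype_mk _).measurable
  rw [volume_def]
  have e1 := setIntegral_withDensity_eq_setIntegral_smul (μ := volume.comap UpperHalfPlane.coe)
    hmeas G hS'
  rw [e1]
  have e2 : ∀ z : ℍ, ((1 / NNReal.mk z.im z.im_pos.le : NNReal) ^ 2) • G z =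
      (fun w : ℂ => ((1 / w.im ^ 2 : ℝ) : ℂ) * G (ofComplex w)) (z : ℂ) := by
    intro z
    simp only [ofComplex_apply, NNReal.smul_def, Complex.real_smul]
    congr 2
    push_cast
    simp
  simp_rw [e2]
  have e3 := (measurableEmbedding_coe).setIntegral_map (μ := volume.comap UpperHalfPlane.coe)
    (fun w : ℂ => ((1 / w.im ^ 2 : ℝ) : ℂ) * G (ofComplex w)) S
  rw [show (UpperHalfPlane.coe ⁻¹' S) = {z : ℍ | (z : ℂ) ∈ S} from rfl] at e3
  rw [← e3, measurableEmbedding_coe.map_comap, Measure.restrict_restrict hS,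
    Set.inter_eq_left.mpr]
  intro w hw
  exact ⟨⟨w, hpos w hw⟩, rfl⟩

theorem integrableOn_uhp_iff (G : ℍ → ℂ) {S : Set ℂ} (hS : MeasurableSet S)
    (hpos : ∀ w ∈ S, 0 < w.im) :
    IntegrableOn G {z : ℍ | (z : ℂ) ∈ S} ↔
      IntegrableOn (fun w : ℂ => ((1 / w.im ^ 2 : ℝ) : ℂ) * G (ofComplex w)) S := by
  have hS' : MeasurableSet {z : ℍ | (z : ℂ) ∈ S} := measurable_coe hS
  have hmeas : Measurable fun z : ℍ => ((1 / NNReal.mk z.im z.im_pos.le : NNReal) ^ 2) := by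
    refine Measurable.pow_const (Measurable.const_div ?_ _) _
    exact (continuous_im.subtype_mk _).measurable
  rw [IntegrableOn, volume_def, restrict_withDensity hS']
  rw [integrable_withDensity_iff_integrable_smul hmeas]
  have e2 : ∀ z : ℍ, ((1 / NNReal.mk z.im z.im_pos.le : NNReal) ^ 2) • G z =
      (fun w : ℂ => ((1 / w.im ^ 2 : ℝ) : ℂ) * G (ofComplex w)) (z : ℂ) := by
    intro z
    simp only [ofComplex_apply, NNReal.smul_def, Complex.real_smul]
    congr 2
    push_cast
    simp
  simp_rw [e2]
  have e3 := (measurableEmbedding_coe).integrableOn_map_iff (μ := volume.comap UpperHalfPlane.coe)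
    (f := fun w : ℂ => ((1 / w.im ^ 2 : ℝ) : ℂ) * G (ofComplex w)) (s := S)
  rw [show (UpperHalfPlane.coe ⁻¹' S) = {z : ℍ | (z : ℂ) ∈ S} from rfl] at e3
  rw [show Integrable (fun z : ℍ => (fun w : ℂ => ((1 / w.im ^ 2 : ℝ) : ℂ) * G (ofComplex w)) (z : ℂ))
    ((volume.comap UpperHalfPlane.coe).restrict {z : ℍ | (z : ℂ) ∈ S}) ↔ _ from e3.symm]
  rw [measurableEmbedding_coe.map_comap, IntegrableOn, IntegrableOn, Measure.restrict_restrict hS,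
    Set.inter_eq_left.mpr]
  intro w hw
  exact ⟨⟨w, hpos w hw⟩, rfl⟩

/-- The points `z` with `Re z ∈ I` and `Im z ∈ J`. -/
def rect (I J : Set ℝ) : Set ℍ := {z | z.re ∈ I ∧ z.im ∈ J}

theorem measurableSet_rect {I J : Set ℝ} (hI : MeasurableSet I) (hJ : MeasurableSet J) :
    MeasurableSet (rect I J) :=
  (continuous_re.measurable hI).inter (continuous_im.measurable hJ)

theorem measurableSet_reProdIm' {I J : Set ℝ} (hI : MeasurableSet I) (hJ : MeasurableSet J) :
    MeasurableSet {w : ℂ | w.re ∈ I ∧ w.im ∈ J} :=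
  (Complex.measurable_re hI).inter (Complex.measurable_im hJ)

theorem setIntegral_rect (G : ℍ → ℂ) {I J : Set ℝ} (hI : MeasurableSet I) (hJ : MeasurableSet J)
    (hpos : J ⊆ Set.Ioi 0) :
    ∫ z in rect I J, G z =
      ∫ p in I ×ˢ J, ((1 / p.2 ^ 2 : ℝ) : ℂ) * G (pt p.1 p.2) := by
  rw [show rect I J = {z : ℍ | (z : ℂ) ∈ {w : ℂ | w.re ∈ I ∧ w.im ∈ J}} from rfl,
    setIntegral_uhp G (measurableSet_reProdIm' hI hJ) fun w hw => hpos hw.2]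
  rw [← Complex.volume_preserving_equiv_real_prod.symm.setIntegral_preimage_emb
    Complex.measurableEquivRealProd.symm.measurableEmbedding]
  have e : ∀ p : ℝ × ℝ, Complex.measurableEquivRealProd.symm p = (p.1 : ℂ) + (p.2 : ℂ) * Complex.I :=
    fun p => Complex.ext (by simp) (by simp)
  congr 1
  ext p
  simp [e, pt]

theorem integrableOn_rect_iff (G : ℍ → ℂ) {I J : Set ℝ} (hI : MeasurableSet I)
    (hJ : MeasurableSet J) (hpos : J ⊆ Set.Ioi 0) :
    IntegrableOn G (rect I J) ↔
      IntegrableOn (fun p : ℝ × ℝ => ((1 / p.2 ^ 2 : ℝ) : ℂ) * G (pt p.1 p.2)) (I ×ˢ J) := by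
  rw [show rect I J = {z : ℍ | (z : ℂ) ∈ {w : ℂ | w.re ∈ I ∧ w.im ∈ J}} from rfl,
    integrableOn_uhp_iff G (measurableSet_reProdIm' hI hJ) fun w hw => hpos hw.2]
  rw [← Complex.volume_preserving_equiv_real_prod.symm.integrableOn_comp_preimage
    Complex.measurableEquivRealProd.symm.measurableEmbedding]
  have e : ∀ p : ℝ × ℝ, Complex.measurableEquivRealProd.symm p = (p.1 : ℂ) + (p.2 : ℂ) * Complex.I :=
    fun p => Complex.ext (by simp) (by simp)
  have e1 : (fun w : ℂ => ((1 / w.im ^ 2 : ℝ) : ℂ) * G (ofComplex w)) ∘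
      Complex.measurableEquivRealProd.symm =
      fun p : ℝ × ℝ => ((1 / p.2 ^ 2 : ℝ) : ℂ) * G (pt p.1 p.2) := by
    ext p
    simp [e, pt]
  have e2 : Complex.measurableEquivRealProd.symm ⁻¹' {w | w.re ∈ I ∧ w.im ∈ J} = I ×ˢ J := by
    ext p
    simp [e]
  rw [e1, e2]

/-- Extension by zero to the plane. -/
def extendZero (η : ℍ → ℂ) (w : ℂ) : ℂ := if 0 < w.im then η (ofComplex w) else 0

theorem tsupport_extendZero {η : ℍ → ℂ} (hc : HasCompactSupport η) :
    tsupport (extendZero η) ⊆ UpperHalfPlane.coe '' tsupport η := by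
  apply closure_minimal _ (hc.image continuous_coe).isClosed
  intro w hw
  rw [Function.mem_support, extendZero] at hw
  split_ifs at hw with h
  · exact ⟨ofComplex w, subset_tsupport _ hw, ofComplex_apply_of_im_pos h ▸ rfl⟩
  · exact absurd rfl hw

theorem extendZero_eventuallyEq (η : ℍ → ℂ) (z : ℍ) :
    extendZero η =ᶠ[𝓝 (z : ℂ)] fun w => η (ofComplex w) := by
  filter_upwards [(isOpen_lt continuous_const Complex.continuous_im).mem_nhds z.2] with w hw
  exact if_pos hw

theorem contDiff_extendZero {η : ℍ → ℂ} (hη : IsC2 η) (hc : HasCompactSupport η) :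
    ContDiff ℝ 2 (extendZero η) := by
  rw [contDiff_iff_contDiffAt]
  intro w
  by_cases hw : w ∈ tsupport (extendZero η)
  · obtain ⟨z, -, rfl⟩ := tsupport_extendZero hc hw
    exact (hη z).congr_of_eventuallyEq (extendZero_eventuallyEq η z)
  · exact contDiffAt_const.congr_of_eventuallyEq (notMem_tsupport_iff_eventuallyEq.mp hw)

theorem integral_uhp (G : ℍ → ℂ) :
    ∫ z, G z = ∫ w in {w : ℂ | 0 < w.im}, ((1 / w.im ^ 2 : ℝ) : ℂ) * G (ofComplex w) := by
  rw [← setIntegral_uhp G (measurableSet_lt measurable_const Complex.measurable_im) (fun w hw => hw)]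
  rw [show {z : ℍ | (z : ℂ) ∈ {w : ℂ | 0 < w.im}} = Set.univ from
    Set.eq_univ_of_forall fun z => z.2, setIntegral_univ]

/-- The Laplacian is symmetric. -/
theorem integral_mul_hypLaplacian {η w : ℍ → ℂ} (hη : IsC2 η) (hc : HasCompactSupport η)
    (hw : IsC2 w) : ∫ z, η z * hypLaplacian w z = ∫ z, hypLaplacian η z * w z := by
  have hO : IsOpen {w : ℂ | 0 < w.im} := isOpen_lt continuous_const Complex.continuous_im
  have hsub : tsupport (extendZero η) ⊆ {w : ℂ | 0 < w.im} := by
    intro w hw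
    obtain ⟨z, -, rfl⟩ := tsupport_extendZero hc hw
    exact z.2
  have hcs : HasCompactSupport (extendZero η) :=
    (hc.image continuous_coe).of_isClosed_subset (isClosed_tsupport _) (tsupport_extendZero hc)
  have main := integral_mul_laplacian (contDiff_extendZero hη hc) hcs hsub
    (w := fun x => w (ofComplex x)) (fun z hz => by
      have := hw ⟨z, hz⟩
      exact this)
  rw [integral_uhp, integral_uhp]
  -- The factor `y²` of the hyperbolic Laplacian cancels the density `y⁻²` of the invariant measure,
  -- which reduces the claim to the Euclidean Laplacian.
  have key : ∀ x ∈ {w : ℂ | 0 < w.im}, ((1 / x.im ^ 2 : ℝ) : ℂ) *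
      (η (ofComplex x) * hypLaplacian w (ofComplex x)) =
      -(extendZero η x * Laplacian.laplacian (fun x => w (ofComplex x)) x) := by
    intro x hx
    have hx0 : (x.im : ℂ) ≠ 0 := by
      have : x.im ≠ 0 := ne_of_gt hx
      exact_mod_cast this
    have e : ofComplex x = ⟨x, hx⟩ := ofComplex_apply_of_im_pos hx
    simp only [hypLaplacian, extendZero, if_pos (show 0 < x.im from hx), e]
    simp only [← coe_im]
    push_cast
    field_simp
  have key2 : ∀ x ∈ {w : ℂ | 0 < w.im}, ((1 / x.im ^ 2 : ℝ) : ℂ) *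
      (hypLaplacian η (ofComplex x) * w (ofComplex x)) =
      -(Laplacian.laplacian (extendZero η) x * w (ofComplex x)) := by
    intro x hx
    have hx0 : (x.im : ℂ) ≠ 0 := by
      have : x.im ≠ 0 := ne_of_gt hx
      exact_mod_cast this
    have e : ofComplex x = ⟨x, hx⟩ := ofComplex_apply_of_im_pos hx
    have e2 : Laplacian.laplacian (extendZero η) x =
        Laplacian.laplacian (fun w => η (ofComplex w)) x :=
      (InnerProductSpace.laplacian_congr_nhds (extendZero_eventuallyEq η ⟨x, hx⟩)).self_of_nhds
    simp only [hypLaplacian, e2, e]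
    simp only [← coe_im]
    push_cast
    field_simp
  rw [setIntegral_congr_fun hO.measurableSet key, setIntegral_congr_fun hO.measurableSet key2,
    integral_neg, integral_neg]
  congr 1
  rw [setIntegral_eq_integral_of_forall_compl_eq_zero, main,
    setIntegral_eq_integral_of_forall_compl_eq_zero]
  · intro x hx
    have h1 : x ∉ tsupport (extendZero η) := fun h => hx (hsub h)
    have h2 : Laplacian.laplacian (extendZero η) x = 0 := by
      rw [(InnerProductSpace.laplacian_congr_nhds
        (notMem_tsupport_iff_eventuallyEq.mp h1)).self_of_nhds]
      have : (0 : ℂ → ℂ) = fun _ => 0 := rfl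
      rw [this, InnerProductSpace.laplacian_const]
      rfl
    rw [h2, zero_mul]
  · intro x hx
    rw [extendZero, if_neg (show ¬ 0 < x.im from hx), zero_mul]

/-! ### Cusps -/

theorem V.mat_injective : Function.Injective V.mat := Subtype.val_injective

theorem V.mat_one_one (X : V) : X.mat 1 1 = -X.mat 0 0 := by
  have := X.trace_mat
  rw [Matrix.trace_fin_two] at this
  linarith

theorem V.ext_entries {X Y : V} (h1 : X.mat 0 0 = Y.mat 0 0) (h2 : X.mat 0 1 = Y.mat 0 1)
    (h3 : X.mat 1 0 = Y.mat 1 0) : X = Y := by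
  apply V.mat_injective
  ext i j
  fin_cases i <;> fin_cases j <;> simp [h1, h2, h3, V.mat_one_one]

theorem conj_mat (g : SL(2, ℤ)) (X : V) : (conj g X).mat =
    ((g.map (Int.castRingHom ℚ) : SL(2, ℚ)) : Matrix (Fin 2) (Fin 2) ℚ) * X.mat *
      (((g.map (Int.castRingHom ℚ))⁻¹ : SL(2, ℚ)) : Matrix (Fin 2) (Fin 2) ℚ) := rfl

theorem conj_mul (g h : SL(2, ℤ)) (X : V) : conj (g * h) X = conj g (conj h X) := by
  apply V.mat_injective
  simp only [conj_mat, map_mul, mul_inv_rev, Matrix.SpecialLinearGroup.coe_mul, mul_assoc]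

theorem conj_one (X : V) : conj 1 X = X := by
  apply V.mat_injective
  simp [conj_mat]

theorem conj_inv_conj (g : SL(2, ℤ)) (X : V) : conj g⁻¹ (conj g X) = X := by
  rw [← conj_mul, inv_mul_cancel, conj_one]

theorem conj_conj_inv (g : SL(2, ℤ)) (X : V) : conj g (conj g⁻¹ X) = X := by
  rw [← conj_mul, mul_inv_cancel, conj_one]

theorem conj_entries (g : SL(2, ℤ)) (X : V) :
    (conj g X).mat 0 0 = (g 0 0 * g 1 1 + g 0 1 * g 1 0) * X.mat 0 0 - g 0 0 * g 1 0 * X.mat 0 1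
      + g 0 1 * g 1 1 * X.mat 1 0 ∧
    (conj g X).mat 0 1 = -2 * g 0 0 * g 0 1 * X.mat 0 0 + g 0 0 ^ 2 * X.mat 0 1
      - g 0 1 ^ 2 * X.mat 1 0 ∧
    (conj g X).mat 1 0 = 2 * g 1 0 * g 1 1 * X.mat 0 0 - g 1 0 ^ 2 * X.mat 0 1
      + g 1 1 ^ 2 * X.mat 1 0 := by
  rw [conj_mat, Matrix.SpecialLinearGroup.coe_inv, Matrix.adjugate_fin_two]
  simp [Matrix.mul_apply, Fin.sum_univ_two, V.mat_one_one]
  refine ⟨by ring, by ring, by ring⟩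

theorem u₀_mat : u₀.mat = !![0, 1; 0, 0] := rfl

theorem conj_u₀_entries (g : SL(2, ℤ)) :
    (conj g u₀).mat 0 0 = -(g 0 0 * g 1 0) ∧ (conj g u₀).mat 0 1 = g 0 0 ^ 2 ∧
      (conj g u₀).mat 1 0 = -g 1 0 ^ 2 := by
  obtain ⟨h1, h2, h3⟩ := conj_entries g u₀
  rw [h1, h2, h3, u₀_mat]
  simp

theorem Q_conj (N : ℕ) (g : SL(2, ℤ)) (X : V) : Q N (conj g X) = Q N X := by
  unfold Q
  rw [conj_mat, Matrix.det_mul, Matrix.det_mul, Matrix.SpecialLinearGroup.det_coe,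
    Matrix.SpecialLinearGroup.det_coe, one_mul, mul_one]

theorem conj_injective (g : SL(2, ℤ)) : Function.Injective (conj g) :=
  Function.LeftInverse.injective (conj_inv_conj g)

theorem map_conj_mul (g h : SL(2, ℤ)) (ℓ : Submodule ℚ V) :
    ℓ.map (conj (g * h)) = (ℓ.map (conj h)).map (conj g) := by
  rw [← Submodule.map_comp]
  congr 1
  ext X : 1
  exact conj_mul g h X

theorem map_conj_one (ℓ : Submodule ℚ V) : ℓ.map (conj 1) = ℓ := by
  have : conj 1 = LinearMap.id := LinearMap.ext conj_one
  rw [this, Submodule.map_id]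

theorem map_conj_inv_eq {g : SL(2, ℤ)} {ℓ ℓ' : Submodule ℚ V} (h : ℓ.map (conj g) = ℓ') :
    ℓ'.map (conj g⁻¹) = ℓ := by
  rw [← h, ← map_conj_mul, inv_mul_cancel, map_conj_one]

theorem u₀_ne_zero : u₀ ≠ 0 := by
  intro h
  have := congrArg (fun X : V => X.mat 0 1) h
  simp [u₀_mat] at this
  exact one_ne_zero this

/-- The isotropic line `g ℓ₀`. -/
def isoLine (N : ℕ) (g : SL(2, ℤ)) : Iso N :=
  ⟨ℓ₀.map (conj g), by
    rw [ℓ₀, Submodule.map_span, Set.image_singleton]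
    apply finrank_span_singleton
    intro h
    exact u₀_ne_zero (conj_injective g (h.trans (map_zero _).symm)), by
    rintro _ ⟨X, hX, rfl⟩
    rw [Q_conj]
    obtain ⟨c, rfl⟩ := Submodule.mem_span_singleton.mp hX
    simp [Q, V.mat_smul, u₀_mat, Matrix.det_fin_two]⟩

theorem cusp_mk_eq_iff {N : ℕ} {Γ : Subgroup SL(2, ℤ)} {ℓ ℓ' : Iso N} :
    (Quot.mk _ ℓ : Cusp N Γ) = Quot.mk _ ℓ' ↔ ∃ γ ∈ Γ, ℓ.1.map (conj γ) = ℓ'.1 := by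
  have hequiv : Equivalence fun ℓ ℓ' : Iso N => ∃ γ ∈ Γ, ℓ.1.map (conj γ) = ℓ'.1 :=
    ⟨fun ℓ => ⟨1, Γ.one_mem, map_conj_one _⟩,
      fun ⟨γ, hγ, h⟩ => ⟨γ⁻¹, Γ.inv_mem hγ, map_conj_inv_eq h⟩,
      fun ⟨γ, hγ, h⟩ ⟨γ', hγ', h'⟩ => ⟨γ' * γ, Γ.mul_mem hγ' hγ, by rw [map_conj_mul, h, h']⟩⟩
  constructor
  · intro h
    exact (hequiv.eqvGen_iff).mp (Quot.eqvGen_exact h)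
  · exact fun h => Quot.sound h

theorem IsCuspChoice.mk_isoLine {N : ℕ} {Γ : Subgroup SL(2, ℤ)} {σ : Cusp N Γ → SL(2, ℤ)}
    (hσ : IsCuspChoice N Γ σ) (c : Cusp N Γ) : Quot.mk _ (isoLine N (σ c)) = c := by
  obtain ⟨ℓ, h1, h2⟩ := hσ c
  rw [← h1]
  congr 1
  apply Subtype.ext
  rw [h2, h1]
  rfl

/-- The lower left entry of `g u₀ g⁻¹` is `-c²`. Together with the next lemma this identifies the
stabiliser of the line as the group of all `± T^n`. -/
theorem lower_left_eq_zero_of_map_ℓ₀ {g : SL(2, ℤ)} (h : ℓ₀.map (conj g) = ℓ₀) : g 1 0 = 0 := by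
  have h1 : conj g u₀ ∈ ℓ₀ := h ▸ Submodule.mem_map_of_mem (Submodule.mem_span_singleton_self u₀)
  obtain ⟨c, hc⟩ := Submodule.mem_span_singleton.mp h1
  have h2 := (conj_u₀_entries g).2.2
  rw [← hc, V.mat_smul, u₀_mat] at h2
  simp at h2
  exact h2

theorem eq_T_zpow_of_lower_left_eq_zero {g : SL(2, ℤ)} (h : g 1 0 = 0) :
    ∃ n : ℤ, g = ModularGroup.T ^ n ∨ g = -ModularGroup.T ^ n := by
  have hd := g.det_coe
  rw [Matrix.det_fin_two, h, mul_zero, sub_zero] at hd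
  rcases Int.eq_one_or_neg_one_of_mul_eq_one' hd with ⟨h1, h2⟩ | ⟨h1, h2⟩
  · refine ⟨g 0 1, Or.inl ?_⟩
    ext i j
    fin_cases i <;> fin_cases j <;> simp [ModularGroup.coe_T_zpow, h, h1, h2]
  · refine ⟨-g 0 1, Or.inr ?_⟩
    ext i j
    fin_cases i <;> fin_cases j <;> simp [ModularGroup.coe_T_zpow, h, h1, h2]

/-- The subgroup `±Γ`. -/
def pm (Γ : Subgroup SL(2, ℤ)) : Subgroup SL(2, ℤ) where
  carrier := {δ | δ ∈ Γ ∨ -δ ∈ Γ}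
  mul_mem' := by
    rintro a b (ha | ha) (hb | hb)
    · exact Or.inl (Γ.mul_mem ha hb)
    · right; simpa using Γ.mul_mem ha hb
    · right; simpa using Γ.mul_mem ha hb
    · left; simpa using Γ.mul_mem ha hb
  one_mem' := Or.inl Γ.one_mem
  inv_mem' := by
    rintro a (ha | ha)
    · exact Or.inl (Γ.inv_mem ha)
    · right; simpa using Γ.inv_mem ha

theorem exists_smul_eq_of_mem_pm {Γ : Subgroup SL(2, ℤ)} {δ : SL(2, ℤ)} (h : δ ∈ pm Γ) :
    ∃ γ ∈ Γ, ∀ z : ℍ, δ • z = γ • z := by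
  rcases h with h | h
  · exact ⟨δ, h, fun _ => rfl⟩
  · exact ⟨-δ, h, fun z => (ModularGroup.SL_neg_smul δ z).symm⟩

section Width

variable (Γ : Subgroup SL(2, ℤ)) (g : SL(2, ℤ))

theorem cuspWidth_spec [Γ.FiniteIndex] : 0 < cuspWidth Γ g ∧
    g * ModularGroup.T ^ cuspWidth Γ g * g⁻¹ ∈ pm Γ := by
  have hne : {k : ℕ | 0 < k ∧
      (g * ModularGroup.T ^ k * g⁻¹ ∈ Γ ∨ -(g * ModularGroup.T ^ k * g⁻¹) ∈ Γ)}.Nonempty := by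
    obtain ⟨k, hk, -, h⟩ := Subgroup.exists_pow_mem_of_index_ne_zero
      (Subgroup.FiniteIndex.index_ne_zero (H := Γ)) (g * ModularGroup.T * g⁻¹)
    exact ⟨k, hk, Or.inl (by rwa [conj_pow] at h)⟩
  exact Nat.sInf_mem hne

theorem cuspWidth_pos [Γ.FiniteIndex] : 0 < cuspWidth Γ g := (cuspWidth_spec Γ g).1

/-- The admissible exponents form a subgroup of `ℤ`; a nonzero remainder modulo the width would be a
smaller positive exponent. -/
theorem cuspWidth_dvd [Γ.FiniteIndex] {n : ℤ} (h : g * ModularGroup.T ^ n * g⁻¹ ∈ pm Γ) :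
    (cuspWidth Γ g : ℤ) ∣ n := by
  obtain ⟨hpos, hmem⟩ := cuspWidth_spec Γ g
  set α := cuspWidth Γ g with hα
  rw [Int.dvd_iff_emod_eq_zero]
  by_contra hne
  have h0 : 0 ≤ n % α := Int.emod_nonneg _ (by positivity)
  have h1 : n % α < α := Int.emod_lt_of_pos _ (by exact_mod_cast hpos)
  have h2 : g * ModularGroup.T ^ (n % α) * g⁻¹ ∈ pm Γ := by
    have e : g * ModularGroup.T ^ (n % α) * g⁻¹ =
        (g * ModularGroup.T ^ n * g⁻¹) * ((g * ModularGroup.T ^ α * g⁻¹) ^ (n / α))⁻¹ := by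
      rw [conj_zpow, ← zpow_natCast, ← zpow_mul, mul_inv_rev, mul_inv_rev, inv_inv]
      rw [Int.emod_def, zpow_sub]
      group
    rw [e]
    exact (pm Γ).mul_mem h ((pm Γ).inv_mem ((pm Γ).zpow_mem hmem _))
  have h3 : (n % α).toNat ∈ {k : ℕ | 0 < k ∧
      (g * ModularGroup.T ^ k * g⁻¹ ∈ Γ ∨ -(g * ModularGroup.T ^ k * g⁻¹) ∈ Γ)} := by
    refine ⟨by omega, ?_⟩
    rw [← zpow_natCast, Int.toNat_of_nonneg h0]
    exact h2
  have := Nat.sInf_le h3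
  change α ≤ _ at this
  omega

end Width

/-- Distinct cusps give distinct cosets of `(σ c)⁻¹` in the finite set `SL₂(ℤ) ⧸ Γ`. -/
theorem finite_cusp {N : ℕ} {Γ : Subgroup SL(2, ℤ)} [Γ.FiniteIndex] {σ : Cusp N Γ → SL(2, ℤ)}
    (hσ : IsCuspChoice N Γ σ) : Finite (Cusp N Γ) := by
  have : Finite (SL(2, ℤ) ⧸ Γ) := inferInstance
  refine Finite.of_injective (fun c => (QuotientGroup.mk (σ c)⁻¹ : SL(2, ℤ) ⧸ Γ)) fun c c' h => ?_
  have h1 : ((σ c)⁻¹)⁻¹ * (σ c')⁻¹ ∈ Γ := QuotientGroup.eq.mp h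
  rw [inv_inv] at h1
  rw [← hσ.mk_isoLine c, ← hσ.mk_isoLine c']
  refine (cusp_mk_eq_iff.mpr ⟨_, h1, ?_⟩).symm
  change (ℓ₀.map (conj (σ c'))).map _ = ℓ₀.map (conj (σ c))
  rw [← map_conj_mul]
  congr 2
  group

/-- Every element of `SL₂(ℤ)` is of the form `γ σ_c (± T^n)`. -/
theorem IsCuspChoice.exists_decomp {N : ℕ} {Γ : Subgroup SL(2, ℤ)} {σ : Cusp N Γ → SL(2, ℤ)}
    (hσ : IsCuspChoice N Γ σ) (g : SL(2, ℤ)) :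
    ∃ (c : Cusp N Γ) (n : ℤ), g * (σ c * ModularGroup.T ^ n)⁻¹ ∈ pm Γ := by
  set c : Cusp N Γ := Quot.mk _ (isoLine N g) with hc
  have h := hσ.mk_isoLine c
  rw [hc, cusp_mk_eq_iff] at h
  obtain ⟨γ, hγ, h⟩ := h
  rw [← hc] at h
  -- If `γ` moves `σ_c ℓ₀` to `g ℓ₀`, then `g⁻¹ γ σ_c` stabilises `ℓ₀` and so equals some `± T^n`.
  have h2 : ℓ₀.map (conj (g⁻¹ * γ * σ c)) = ℓ₀ := by
    rw [mul_assoc, map_conj_mul, map_conj_mul]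
    exact map_conj_inv_eq h.symm
  obtain ⟨n, hn⟩ := eq_T_zpow_of_lower_left_eq_zero (lower_left_eq_zero_of_map_ℓ₀ h2)
  refine ⟨c, -n, ?_⟩
  have e : g * (σ c * ModularGroup.T ^ (-n))⁻¹ = γ * (σ c * (g⁻¹ * γ * σ c)⁻¹ *
      ModularGroup.T ^ n * (σ c)⁻¹) := by
    group
  rcases hn with hn | hn
  · left
    rw [e, hn]
    have : γ * (σ c * (ModularGroup.T ^ n)⁻¹ * ModularGroup.T ^ n * (σ c)⁻¹) = γ := by group
    rwa [this]
  · right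
    rw [e, hn]
    have : -(γ * (σ c * (-ModularGroup.T ^ n)⁻¹ * ModularGroup.T ^ n * (σ c)⁻¹)) = γ := by
      rw [show (-ModularGroup.T ^ n)⁻¹ = -(ModularGroup.T ^ n)⁻¹ by simp]
      simp only [mul_neg, neg_mul, neg_neg]
      group
    rwa [this]

/-- Uniqueness in the decomposition `γ σ_c (± T^n)`: powers of `T` fix `ℓ₀`, so the cusp is
determined, and the exponent is then determined modulo the width. -/
theorem IsCuspChoice.eq_of_decomp {N : ℕ} {Γ : Subgroup SL(2, ℤ)} [Γ.FiniteIndex]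
    {σ : Cusp N Γ → SL(2, ℤ)} (hσ : IsCuspChoice N Γ σ) {c c' : Cusp N Γ} {n n' : ℤ}
    (h : (σ c * ModularGroup.T ^ n) * (σ c' * ModularGroup.T ^ n')⁻¹ ∈ pm Γ) :
    c = c' ∧ (cuspWidth Γ (σ c) : ℤ) ∣ n - n' := by
  have hT : ∀ m : ℤ, ℓ₀.map (conj (ModularGroup.T ^ m)) = ℓ₀ := by
    intro m
    rw [ℓ₀, Submodule.map_span, Set.image_singleton]
    congr 2
    obtain ⟨h1, h2, h3⟩ := conj_u₀_entries (ModularGroup.T ^ m)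
    apply V.ext_entries
    · rw [h1]; simp [ModularGroup.coe_T_zpow, u₀_mat]
    · rw [h2]; simp [ModularGroup.coe_T_zpow, u₀_mat]
    · rw [h3]; simp [ModularGroup.coe_T_zpow, u₀_mat]
  have hneg : ∀ g : SL(2, ℤ), conj (-g) = conj g := by
    intro g
    ext X : 1
    obtain ⟨h1, h2, h3⟩ := conj_entries g X
    obtain ⟨h1', h2', h3'⟩ := conj_entries (-g) X
    apply V.ext_entries
    · rw [h1, h1']; simp
    · rw [h2, h2']; simp
    · rw [h3, h3']; simp
  have hc : c = c' := by
    obtain ⟨γ, hγ, hγe⟩ : ∃ γ ∈ Γ, conj γ =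
        conj ((σ c * ModularGroup.T ^ n) * (σ c' * ModularGroup.T ^ n')⁻¹) := by
      rcases h with h | h
      · exact ⟨_, h, rfl⟩
      · exact ⟨_, h, hneg _⟩
    rw [← hσ.mk_isoLine c, ← hσ.mk_isoLine c']
    refine (cusp_mk_eq_iff.mpr ⟨γ, hγ, ?_⟩).symm
    change (ℓ₀.map (conj (σ c'))).map _ = ℓ₀.map (conj (σ c))
    rw [hγe, ← map_conj_mul, show σ c * ModularGroup.T ^ n * (σ c' * ModularGroup.T ^ n')⁻¹ * σ c' =
      σ c * ModularGroup.T ^ (n - n') by group, map_conj_mul, hT]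
  subst hc
  refine ⟨rfl, cuspWidth_dvd Γ (σ c) ?_⟩
  rw [show σ c * ModularGroup.T ^ (n - n') * (σ c)⁻¹ =
    (σ c * ModularGroup.T ^ n) * (σ c * ModularGroup.T ^ n')⁻¹ by group]
  exact h

/-! ### The action on the upper half-plane and fundamental domains for `Γ` -/

open scoped Pointwise

instance : ContinuousConstSMul SL(2, ℤ) ℍ :=
  ⟨fun g => continuous_const_smul (Matrix.SpecialLinearGroup.toGL (g.map (Int.castRingHom ℝ)))⟩

instance : MeasurableConstSMul SL(2, ℤ) ℍ := ⟨fun g => (continuous_const_smul g).measurable⟩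

instance : SMulInvariantMeasure SL(2, ℤ) ℍ volume :=
  ⟨fun g _ hs => measure_preimage_smul_of_nullMeasurableSet (μ := (volume : Measure ℍ))
    hs.nullMeasurableSet (Matrix.SpecialLinearGroup.toGL (g.map (Int.castRingHom ℝ)))⟩

instance : Countable SL(2, ℤ) :=
  have : Countable (Matrix (Fin 2) (Fin 2) ℤ) := inferInstanceAs (Countable (Fin 2 → Fin 2 → ℤ))
  Function.Injective.countable (f := fun g : SL(2, ℤ) => (g : Matrix (Fin 2) (Fin 2) ℤ))
    Subtype.val_injective

section Range

variable (Γ : Subgroup SL(2, ℤ))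

/-- The image of `Γ` in the group of transformations of `ℍ`. -/
abbrev modGroup : Type := ↥(MulAction.toPermHom ↥Γ ℍ).range

theorem modGroup_smul (g : modGroup Γ) : ∃ γ ∈ Γ, ∀ z : ℍ, g • z = γ • z := by
  obtain ⟨_, γ, rfl⟩ := g
  exact ⟨γ.1, γ.2, fun _ => rfl⟩

variable {Γ} in
theorem exists_modGroup {γ : SL(2, ℤ)} (h : γ ∈ Γ) : ∃ g : modGroup Γ, ∀ z : ℍ, g • z = γ • z :=
  ⟨⟨_, ⟨⟨γ, h⟩, rfl⟩⟩, fun _ => rfl⟩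

instance : Countable (modGroup Γ) := by
  have : Countable ↥Γ := inferInstance
  exact (MulAction.toPermHom ↥Γ ℍ).rangeRestrict_surjective.countable

instance : ContinuousConstSMul (modGroup Γ) ℍ := ⟨fun g => by
  obtain ⟨γ, -, h⟩ := modGroup_smul Γ g
  simp only [h]
  exact continuous_const_smul γ⟩

instance : MeasurableConstSMul (modGroup Γ) ℍ := ⟨fun g => (continuous_const_smul g).measurable⟩

instance : SMulInvariantMeasure (modGroup Γ) ℍ volume := ⟨fun g s hs => by
  obtain ⟨γ, -, h⟩ := modGroup_smul Γ g
  simp only [h]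
  exact measure_preimage_smul_of_nullMeasurableSet hs.nullMeasurableSet γ⟩

end Range

/-- The boundary lies on the unit circle and the two lines `Re z = ± 1/2`. -/
theorem volume_fd_diff_fdo : volume (ModularGroup.fd \ ModularGroup.fdo) = 0 := by
  rw [volume_eq_lintegral]
  have h : ((↑) '' (ModularGroup.fd \ ModularGroup.fdo : Set ℍ) : Set ℂ) ⊆
      Metric.sphere 0 1 ∪ (frontier {w : ℂ | w.re ≤ 1 / 2} ∪ frontier {w : ℂ | w.re ≤ -(1 / 2)}) := by
    rintro _ ⟨z, ⟨⟨h1, h2⟩, h3⟩, rfl⟩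
    rw [Complex.frontier_setOfPred_re_le, Complex.frontier_setOfPred_re_le]
    by_cases hn : Complex.normSq (z : ℂ) = 1
    · left
      rw [mem_sphere_zero_iff_norm]
      rw [Complex.normSq_eq_norm_sq] at hn
      nlinarith [norm_nonneg (z : ℂ)]
    · right
      have h1' : 1 < Complex.normSq (z : ℂ) := lt_of_le_of_ne h1 (Ne.symm hn)
      have h4 : ¬ |z.re| < 1 / 2 := fun h => h3 ⟨h1', h⟩
      have h5 : |z.re| = 1 / 2 := le_antisymm h2 (not_lt.mp h4)
      rcases (abs_eq (by norm_num)).mp h5 with h | h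
      · left; simpa using h
      · right; simpa using h
  refine le_antisymm ((lintegral_mono_set h).trans (le_of_eq ?_)) zero_le
  refine setLIntegral_measure_zero _ _ ?_
  rw [measure_union_null_iff, measure_union_null_iff]
  exact ⟨Measure.addHaar_sphere _ _ _, (convex_halfSpace_re_le _).addHaar_frontier _,
    (convex_halfSpace_re_le _).addHaar_frontier _⟩

/-- The union of the translates of the standard fundamental domain by `0, …, a - 1`. -/
def fdT (a : ℕ) : Set ℍ := {z | ∃ j < a, ∃ w ∈ ModularGroup.fd, z = ModularGroup.T ^ j • w}

/-- The union of the translates of the open fundamental domain by `0, …, a - 1`. -/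
def fdTo (a : ℕ) : Set ℍ := {z | ∃ j < a, ∃ w ∈ ModularGroup.fdo, z = ModularGroup.T ^ j • w}

theorem fdT_eq (a : ℕ) : fdT a = ⋃ j ∈ Finset.range a, ModularGroup.T ^ j • ModularGroup.fd := by
  ext z
  simp only [fdT, Set.mem_ofPred_eq, Set.mem_iUnion, Finset.mem_range, Set.mem_smul_set, exists_prop]
  simp only [eq_comm (a := z)]

theorem fdTo_eq (a : ℕ) : fdTo a = ⋃ j ∈ Finset.range a, ModularGroup.T ^ j • ModularGroup.fdo := by
  ext z
  simp only [fdTo, Set.mem_ofPred_eq, Set.mem_iUnion, Finset.mem_range, Set.mem_smul_set,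
    exists_prop]
  simp only [eq_comm (a := z)]

theorem isOpen_fdTo (a : ℕ) : IsOpen (fdTo a) := by
  rw [fdTo_eq]
  exact isOpen_biUnion fun j _ => ModularGroup.isOpen_fdo.smul _

theorem fdTo_ae_eq (a : ℕ) : fdTo a =ᵐ[volume] fdT a := by
  have hsub : ModularGroup.fdo ⊆ ModularGroup.fd := fun z hz => ⟨hz.1.le, hz.2.le⟩
  rw [fdTo_eq, fdT_eq]
  refine EventuallyLE.antisymm (Filter.Eventually.of_forall ?_) ?_
  · exact Set.biUnion_mono subset_rfl fun j _ => Set.smul_set_mono hsub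
  · rw [ae_le_set]
    refine measure_mono_null (t := ⋃ j ∈ Finset.range a, ModularGroup.T ^ j •
      (ModularGroup.fd \ ModularGroup.fdo)) ?_ ?_
    · intro z hz
      simp only [Set.mem_sdiff, Set.mem_iUnion, not_exists, exists_prop] at hz ⊢
      obtain ⟨⟨j, hj, h1⟩, h2⟩ := hz
      refine ⟨j, hj, ?_⟩
      rw [Set.smul_set_sdiff]
      exact ⟨h1, fun h => h2 j ⟨hj, h⟩⟩
    · refine (measure_biUnion_null_iff (Finset.countable_toSet (Finset.range a))).mpr fun j _ => ?_
      rw [measure_smul]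
      exact volume_fd_diff_fdo

section FundDomain

variable {N : ℕ} {Γ : Subgroup SL(2, ℤ)} [Γ.FiniteIndex] {σ : Cusp N Γ → SL(2, ℤ)}

theorem IsCuspChoice.exists_decomp_lt (hσ : IsCuspChoice N Γ σ) (g : SL(2, ℤ)) :
    ∃ (c : Cusp N Γ) (j : ℕ), j < cuspWidth Γ (σ c) ∧
      g * (σ c * ModularGroup.T ^ j)⁻¹ ∈ pm Γ := by
  obtain ⟨c, n, h⟩ := hσ.exists_decomp g
  obtain ⟨hpos, hmem⟩ := cuspWidth_spec Γ (σ c)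
  set α := cuspWidth Γ (σ c)
  have h0 : 0 ≤ n % α := Int.emod_nonneg _ (by positivity)
  have h1 : n % α < α := Int.emod_lt_of_pos _ (by exact_mod_cast hpos)
  refine ⟨c, (n % α).toNat, by omega, ?_⟩
  rw [← zpow_natCast ModularGroup.T, Int.toNat_of_nonneg h0]
  have e : g * (σ c * ModularGroup.T ^ (n % α))⁻¹ = (g * (σ c * ModularGroup.T ^ n)⁻¹) *
      (σ c * ModularGroup.T ^ α * (σ c)⁻¹) ^ (n / α) := by
    rw [conj_zpow, ← zpow_natCast, ← zpow_mul, Int.emod_def, zpow_sub]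
    group
  rw [e]
  exact (pm Γ).mul_mem h ((pm Γ).zpow_mem hmem _)

/-- Two interior points of the standard domain are equivalent only through `± 1`. Hence the
representatives `σ_c T^j` involved coincide modulo `±Γ`, so `c = c'` and `j = j'`, and what remains
of `γ` is `± 1`. -/
theorem IsCuspChoice.eq_of_smul_eq (hσ : IsCuspChoice N Γ σ) {γ : SL(2, ℤ)} (hγ : γ ∈ Γ)
    {c c' : Cusp N Γ} {j j' : ℕ} (hj : j < cuspWidth Γ (σ c)) (hj' : j' < cuspWidth Γ (σ c'))
    {w w' : ℍ} (hw : w ∈ ModularGroup.fdo) (hw' : w' ∈ ModularGroup.fdo)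
    (h : γ • σ c • ModularGroup.T ^ j • w = σ c' • ModularGroup.T ^ j' • w') :
    c = c' ∧ ∀ z : ℍ, γ • z = z := by
  have h1 : ((σ c' * ModularGroup.T ^ j')⁻¹ * (γ * (σ c * ModularGroup.T ^ j))) • w = w' := by
    rw [mul_smul, mul_smul, mul_smul, h, ← mul_smul, ← mul_smul]
    simp
  have h2 := ModularGroup.eq_one_or_neg_one_of_mem_fdo_mem_fdo hw (h1 ▸ hw')
  have h3 : γ * (σ c * ModularGroup.T ^ j) * (σ c' * ModularGroup.T ^ j')⁻¹ ∈ ({1, -1} : Set SL(2, ℤ)) := by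
    rcases h2 with h2 | h2
    · left
      rw [inv_mul_eq_one] at h2
      rw [← h2, mul_inv_cancel]
    · right
      rw [inv_mul_eq_iff_eq_mul] at h2
      rw [h2]
      simp
  have h4 : (σ c * ModularGroup.T ^ (j : ℤ)) * (σ c' * ModularGroup.T ^ (j' : ℤ))⁻¹ ∈ pm Γ := by
    rw [zpow_natCast, zpow_natCast]
    have e : σ c * ModularGroup.T ^ j * (σ c' * ModularGroup.T ^ j')⁻¹ =
      γ⁻¹ * (γ * (σ c * ModularGroup.T ^ j) * (σ c' * ModularGroup.T ^ j')⁻¹) := by group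
    rw [e]
    refine (pm Γ).mul_mem (Or.inl (Γ.inv_mem hγ)) ?_
    rcases h3 with h3 | h3
    · rw [h3]; exact one_mem _
    · rw [h3]; right; simp
  obtain ⟨hc, hd⟩ := hσ.eq_of_decomp h4
  subst hc
  have hjj : j = j' := by
    obtain ⟨k, hk⟩ := hd
    have : k = 0 := by
      by_contra hk0
      have h5 : (cuspWidth Γ (σ c) : ℤ) ≤ |(j : ℤ) - j'| := by
        rw [hk, abs_mul, Nat.abs_cast]
        have := Int.one_le_abs hk0
        nlinarith [(Nat.cast_nonneg (cuspWidth Γ (σ c)) : (0 : ℤ) ≤ _)]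
      have h6 : |(j : ℤ) - j'| < cuspWidth Γ (σ c) := by
        rw [abs_lt]; constructor <;> omega
      omega
    rw [this] at hk
    omega
  subst hjj
  refine ⟨rfl, fun z => ?_⟩
  have h7 : γ ∈ ({1, -1} : Set SL(2, ℤ)) := by
    rwa [mul_assoc, mul_inv_cancel, mul_one] at h3
  rcases h7 with h7 | h7
  · rw [h7, one_smul]
  · rw [h7, ModularGroup.SL_neg_smul, one_smul]

/-- The fundamental domain for `Γ` glued from translates of the standard one. -/
def cuspDomain (Γ : Subgroup SL(2, ℤ)) (σ : Cusp N Γ → SL(2, ℤ)) : Set ℍ :=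
  ⋃ c, σ c • fdTo (cuspWidth Γ (σ c))

omit [Γ.FiniteIndex] in
theorem mem_cuspDomain {z : ℍ} : z ∈ cuspDomain Γ σ ↔ ∃ c, ∃ j < cuspWidth Γ (σ c),
    ∃ w ∈ ModularGroup.fdo, z = σ c • ModularGroup.T ^ j • w := by
  simp only [cuspDomain, Set.mem_iUnion, Set.mem_smul_set, fdTo, Set.mem_ofPred_eq]
  constructor
  · rintro ⟨c, _, ⟨j, hj, w, hw, rfl⟩, rfl⟩
    exact ⟨c, j, hj, w, hw, rfl⟩
  · rintro ⟨c, j, hj, w, hw, rfl⟩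
    exact ⟨c, _, ⟨j, hj, w, hw, rfl⟩, rfl⟩

/-- The elements `σ_c T^j` with `0 ≤ j < α_c` represent the cosets of `±Γ` in `SL₂(ℤ)`, so the
corresponding translates of the standard domain tile a domain for `Γ`. With open translates
disjointness is exact and covering holds almost everywhere. -/
theorem IsCuspChoice.isFundDomain (hσ : IsCuspChoice N Γ σ) :
    IsFundDomain Γ (cuspDomain Γ σ) := by
  refine IsFundamentalDomain.mk'' ?_ ?_ ?_ fun g => (measurePreserving_smul g _).quasiMeasurePreserving
  · exact (isOpen_iUnion fun c => (isOpen_fdTo _).smul _).measurableSet.nullMeasurableSet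
  · have h : ∀ᵐ z : ℍ, ∀ g : SL(2, ℤ), g • z ∉ ModularGroup.fd \ ModularGroup.fdo := by
      rw [ae_all_iff]
      intro g
      rw [ae_iff]
      simp only [not_not]
      exact (measure_preimage_smul_null volume_fd_diff_fdo g)
    filter_upwards [h] with z hz
    obtain ⟨g, hg⟩ := ModularGroup.exists_smul_mem_fd z
    have hg' : g • z ∈ ModularGroup.fdo := by
      by_contra hn
      exact hz g ⟨hg, hn⟩
    obtain ⟨c, j, hj, hm⟩ := hσ.exists_decomp_lt g⁻¹
    obtain ⟨γ, hγ, h1⟩ := exists_smul_eq_of_mem_pm ((pm Γ).inv_mem hm)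
    obtain ⟨e, he⟩ := exists_modGroup hγ
    refine ⟨e, mem_cuspDomain.mpr ⟨c, j, hj, _, hg', ?_⟩⟩
    rw [he, ← h1, mul_inv_rev, inv_inv, inv_inv, mul_smul, mul_smul]
  · intro g hg
    refine Disjoint.aedisjoint (Set.disjoint_left.mpr ?_)
    rintro _ ⟨z, hz, rfl⟩ hz'
    obtain ⟨c, j, hj, w, hw, rfl⟩ := mem_cuspDomain.mp hz
    obtain ⟨c', j', hj', w', hw', h⟩ := mem_cuspDomain.mp hz'
    obtain ⟨γ, hγ, hgγ⟩ := modGroup_smul Γ g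
    simp only [hgγ] at h
    refine hg (Subtype.ext (Equiv.ext fun z => ?_))
    exact (hgγ z).trans ((hσ.eq_of_smul_eq hγ hj hj' hw hw' h).2 z)

theorem IsCuspChoice.pairwise_disjoint (hσ : IsCuspChoice N Γ σ) :
    Pairwise (Function.onFun Disjoint fun c => σ c • fdTo (cuspWidth Γ (σ c))) := by
  intro c c' hc
  refine Set.disjoint_left.mpr ?_
  rintro _ ⟨_, ⟨j, hj, w, hw, rfl⟩, rfl⟩ ⟨_, ⟨j', hj', w', hw', rfl⟩, h⟩
  refine hc (hσ.eq_of_smul_eq Γ.one_mem hj hj' hw hw' ?_).1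
  rw [one_smul]
  exact h.symm

variable (hσ : IsCuspChoice N Γ σ) {D : Set ℍ} (hD : IsFundDomain Γ D) {G : ℍ → ℂ}
  (hG : ∀ γ ∈ Γ, ∀ z : ℍ, G (γ • z) = G z)

include hσ hD hG in
-- Integrability of an invariant function does not depend on the fundamental domain, so the given
-- `D` may be exchanged for the domain glued from cuspidal pieces.
theorem integrableOn_fundDomain_iff :
    IntegrableOn G D ↔ ∀ c, IntegrableOn (fun z => G (σ c • z)) (fdT (cuspWidth Γ (σ c))) := by
  have := finite_cusp hσ
  have hG' : ∀ (g : modGroup Γ) z, G (g • z) = G z := fun g z => by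
    obtain ⟨γ, hγ, h⟩ := modGroup_smul Γ g
    rw [h, hG γ hγ]
  rw [IsFundamentalDomain.integrableOn_iff hD hσ.isFundDomain hG', cuspDomain,
    integrableOn_finite_iUnion]
  refine forall_congr' fun c => ?_
  rw [← integrableOn_congr_set_ae (fdTo_ae_eq (cuspWidth Γ (σ c)))]
  exact (measurePreserving_smul (σ c) volume).integrableOn_image (measurableEmbedding_const_smul _)

include hσ hD hG in
theorem setIntegral_fundDomain (hi : IntegrableOn G D) :
    ∫ z in D, G z = ∑ᶠ c, ∫ z in fdT (cuspWidth Γ (σ c)), G (σ c • z) := by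
  have := finite_cusp hσ
  have := Fintype.ofFinite (Cusp N Γ)
  have hG' : ∀ (g : modGroup Γ) z, G (g • z) = G z := fun g z => by
    obtain ⟨γ, hγ, h⟩ := modGroup_smul Γ g
    rw [h, hG γ hγ]
  rw [IsFundamentalDomain.setIntegral_eq hD hσ.isFundDomain hG', cuspDomain,
    integral_iUnion (fun c => ((isOpen_fdTo _).smul _).measurableSet) hσ.pairwise_disjoint,
    tsum_fintype, finsum_eq_sum_of_fintype]
  · refine Finset.sum_congr rfl fun c _ => ?_
    rw [← setIntegral_congr_set (fdTo_ae_eq (cuspWidth Γ (σ c)))]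
    exact (measurePreserving_smul (σ c) volume).setIntegral_image_emb
      (measurableEmbedding_const_smul _) _ _
  · exact (IsFundamentalDomain.integrableOn_iff hD hσ.isFundDomain hG').mp hi

end FundDomain

theorem truncDomain_eq (a : ℕ) (T : ℝ) : truncDomain a T =
    ⋃ j ∈ Finset.range a, (fun z : ℍ => ModularGroup.T ^ j • z) ''
      ModularGroup.truncatedFundamentalDomain T := by
  ext z
  simp only [truncDomain, Set.mem_ofPred_eq, Set.mem_iUnion, Finset.mem_range, Set.mem_image,
    exists_prop, ModularGroup.truncatedFundamentalDomain]
  have him : ∀ (j : ℕ) (w : ℍ), (ModularGroup.T ^ j • w).im = w.im := fun j w => by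
    rw [← zpow_natCast, ModularGroup.im_T_zpow_smul]
  constructor
  · rintro ⟨h, j, hj, w, hw, rfl⟩
    exact ⟨j, hj, w, ⟨hw, by rwa [him] at h⟩, rfl⟩
  · rintro ⟨j, hj, w, ⟨hw, h⟩, rfl⟩
    exact ⟨by rwa [him], j, hj, w, hw, rfl⟩

theorem isCompact_truncDomain (a : ℕ) (T : ℝ) : IsCompact (truncDomain a T) := by
  rw [truncDomain_eq]
  exact Finset.isCompact_biUnion _ fun j _ =>
    (ModularGroup.isCompact_truncatedFundamentalDomain T).image (continuous_const_smul _)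

/-- Above height `1` the condition `|z| ≥ 1` is automatic, so the translates of the standard domain
fill a full strip of width `a`. -/
theorem fdT_inter_Ioi {a : ℕ} (ha : 0 < a) {z : ℍ} (hz : 1 < z.im) :
    z ∈ fdT a ↔ z.re ∈ Set.Icc (-(1 / 2) : ℝ) (a - 1 / 2) := by
  have him : ∀ (j : ℕ) (w : ℍ), (ModularGroup.T ^ j • w).im = w.im := fun j w => by
    rw [← zpow_natCast, ModularGroup.im_T_zpow_smul]
  have hre : ∀ (j : ℕ) (w : ℍ), (ModularGroup.T ^ j • w).re = w.re + j := fun j w => by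
    rw [← zpow_natCast, ModularGroup.re_T_zpow_smul]; simp
  constructor
  · rintro ⟨j, hj, w, ⟨-, hw⟩, rfl⟩
    have hw' := abs_le.mp hw
    have : (j : ℝ) ≤ a - 1 := by
      have : (j : ℝ) + 1 ≤ a := by exact_mod_cast hj
      linarith
    rw [hre]
    constructor
    · have : (0 : ℝ) ≤ j := by positivity
      linarith
    · linarith
  · rintro ⟨h1, h2⟩
    have h3 : ∃ j : ℕ, j < a ∧ |z.re - j| ≤ 1 / 2 := by
      -- Rounding up sends the right endpoint `a - 1/2` to `a - 1`, and the natural-number ceiling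
      -- gives `j = 0` on `[-1/2, 1/2]`.
      refine ⟨⌈z.re - 1 / 2⌉₊, ?_, ?_⟩
      · have : ⌈z.re - 1 / 2⌉₊ ≤ a - 1 := by
          rw [Nat.ceil_le, Nat.cast_pred ha]
          linarith
        omega
      · have h4 := Nat.le_ceil (z.re - 1 / 2)
        rw [abs_le]
        refine ⟨?_, by linarith⟩
        rcases le_or_gt (z.re - 1 / 2) 0 with h | h
        · rw [Nat.ceil_eq_zero.mpr h]; simpa using h1
        · have := Nat.ceil_lt_add_one h.le
          linarith
    obtain ⟨j, hj, h3⟩ := h3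
    refine ⟨j, hj, (ModularGroup.T ^ j)⁻¹ • z, ⟨?_, ?_⟩, by rw [smul_inv_smul]⟩
    · have : ((ModularGroup.T ^ j)⁻¹ • z).im = z.im := by
        rw [← him j, smul_inv_smul]
      rw [Complex.normSq_apply]
      change 1 ≤ _ * _ + ((ModularGroup.T ^ j)⁻¹ • z).im * ((ModularGroup.T ^ j)⁻¹ • z).im
      rw [this]
      nlinarith [mul_self_nonneg (((ModularGroup.T ^ j)⁻¹ • z : ℍ) : ℂ).re]
    · have h5 : ((ModularGroup.T ^ j)⁻¹ • z).re = z.re - j := by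
        have := hre j ((ModularGroup.T ^ j)⁻¹ • z)
        rw [smul_inv_smul] at this
        linarith
      rw [h5]
      exact h3

theorem truncDomain_eq_inter (a : ℕ) (T : ℝ) : truncDomain a T = fdT a ∩ {z | z.im ≤ T} := by
  ext z
  exact and_comm

/-- The splitting used at every cusp: a compact core, where everything continuous is integrable, and
a cuspidal strip. -/
theorem fdT_diff_eq {a : ℕ} (ha : 0 < a) :
    fdT a = truncDomain a 1 ∪ rect (Set.Icc (-(1 / 2) : ℝ) (a - 1 / 2)) (Set.Ioi 1) := by
  ext z
  rw [truncDomain_eq_inter]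
  by_cases hz : 1 < z.im
  · have := fdT_inter_Ioi ha hz
    simp only [Set.mem_union, Set.mem_inter_iff, Set.mem_ofPred_eq, not_le.mpr hz, and_false,
      false_or, this]
    exact ⟨fun h => ⟨h, hz⟩, fun h => h.1⟩
  · simp only [Set.mem_union, Set.mem_inter_iff, Set.mem_ofPred_eq, not_lt.mp hz, and_true]
    exact ⟨fun h => Or.inl h, fun h => h.elim id fun h => absurd h.2 hz⟩

theorem truncDomain_eq_union {a : ℕ} (ha : 0 < a) {T : ℝ} (hT : 1 ≤ T) :
    truncDomain a T = truncDomain a 1 ∪ rect (Set.Icc (-(1 / 2) : ℝ) (a - 1 / 2)) (Set.Ioc 1 T) := by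
  rw [truncDomain_eq_inter a T, fdT_diff_eq ha]
  ext z
  simp only [truncDomain_eq_inter a 1, Set.mem_union, Set.mem_inter_iff, Set.mem_ofPred_eq, rect,
    Set.mem_Ioi, Set.mem_Ioc]
  constructor
  · rintro ⟨h1 | h1, h2⟩
    · exact Or.inl h1
    · exact Or.inr ⟨h1.1, h1.2, h2⟩
  · rintro (h | h)
    · exact ⟨Or.inl h, h.2.trans hT⟩
    · exact ⟨Or.inr ⟨h.1, h.2.1⟩, h.2.2⟩

theorem disjoint_truncDomain_rect (a : ℕ) (I : Set ℝ) (T : ℝ) :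
    Disjoint (truncDomain a T) (rect I (Set.Ioi T)) :=
  Set.disjoint_left.mpr fun _ h h' => absurd h.1 (not_le.mpr h'.2)

theorem hasSum_congr {ι : Type*} {f g : ι → ℂ} {a : ℂ} (h : ∀ n, f n = g n) :
    HasSum f a ↔ HasSum g a := by
  rw [show f = g from funext h]

/-! ### Shifted Gaussian sums and Poisson summation -/

section GaussSum

variable (β t : ℝ)

/-- The shifted Gaussian sum `∑ exp(-μ (t + β n)²)`. -/
def gaussSum (μ : ℂ) : ℂ := ∑' n : ℤ, Complex.exp (-μ * (((t + β * n) ^ 2 : ℝ) : ℂ))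

/-- The main term of the Gaussian sum. -/
def gaussMain (μ : ℂ) : ℂ := ((Real.pi : ℂ) / (μ * (β : ℂ) ^ 2)) ^ (1 / 2 : ℂ)

variable {β} (hβ : 0 < β)

include hβ in
theorem summable_gauss {δ : ℝ} (hδ : 0 < δ) :
    Summable fun n : ℤ => Real.exp (-δ * (t + β * n) ^ 2) := by
  have h := summable_pow_mul_jacobiTheta₂_term_bound (δ * β * |t| / Real.pi)
    (T := δ * β ^ 2 / Real.pi) (by positivity) 0
  refine h.of_nonneg_of_le (fun n => (Real.exp_pos _).le) fun n => ?_
  rw [pow_zero, one_mul, Real.exp_le_exp]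
  have h1 : -Real.pi * (δ * β ^ 2 / Real.pi * (n : ℝ) ^ 2 -
      2 * (δ * β * |t| / Real.pi) * ((|n| : ℤ) : ℝ)) =
      -(δ * β ^ 2 * n ^ 2) + 2 * (δ * β) * (|t| * |(n : ℝ)|) := by
    push_cast
    field_simp
    ring
  rw [h1, ← abs_mul]
  have h2 : 0 ≤ δ * β * (|t * n| + t * n) :=
    mul_nonneg (by positivity) (by linarith [neg_abs_le (t * (n : ℝ))])
  nlinarith [mul_nonneg hδ.le (sq_nonneg t)]

theorem norm_cexp_neg_mul_ofReal (μ : ℂ) (x : ℝ) :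
    ‖Complex.exp (-μ * (x : ℂ))‖ = Real.exp (-μ.re * x) := by
  rw [Complex.norm_exp]
  simp

theorem isOpen_re_gt (δ : ℝ) : IsOpen {μ : ℂ | δ < μ.re} :=
  isOpen_lt continuous_const Complex.continuous_re

theorem mul_exp_neg_le {δ x : ℝ} (hδ : 0 < δ) :
    x * Real.exp (-δ * x) ≤ 2 / δ * Real.exp (-(δ / 2) * x) := by
  have h1 : δ / 2 * x ≤ Real.exp (δ / 2 * x) := by linarith [Real.add_one_le_exp (δ / 2 * x)]
  have h2 : Real.exp (-(δ / 2) * x) = Real.exp (δ / 2 * x) * Real.exp (-δ * x) := by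
    rw [← Real.exp_add]; ring_nf
  rw [h2]
  have h3 : x ≤ 2 / δ * Real.exp (δ / 2 * x) := by
    rw [div_mul_eq_mul_div, le_div_iff₀ hδ]; linarith
  calc x * Real.exp (-δ * x) ≤ 2 / δ * Real.exp (δ / 2 * x) * Real.exp (-δ * x) :=
        mul_le_mul_of_nonneg_right h3 (Real.exp_pos _).le
    _ = _ := by ring

include hβ in
theorem differentiableOn_gaussSum : DifferentiableOn ℂ (gaussSum β t) {μ | 0 < μ.re} := by
  intro μ hμ
  have hμ : 0 < μ.re := hμ
  have hm : μ ∈ {w : ℂ | μ.re / 2 < w.re} := by simp only [Set.mem_ofPred_eq]; linarith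
  have := Complex.differentiableOn_tsum_of_summable_norm
    (F := fun (n : ℤ) (μ : ℂ) => Complex.exp (-μ * (((t + β * n) ^ 2 : ℝ) : ℂ)))
    (summable_gauss t hβ (δ := μ.re / 2) (by linarith)) (fun n => by fun_prop)
    (isOpen_re_gt (μ.re / 2)) (fun n w hw => ?_)
  · exact (this.differentiableAt ((isOpen_re_gt _).mem_nhds hm)).differentiableWithinAt
  · rw [norm_cexp_neg_mul_ofReal, Real.exp_le_exp]
    have hw : μ.re / 2 < w.re := hw
    nlinarith [sq_nonneg (t + β * n)]

theorem hasDerivAt_gauss_term (x : ℝ) (μ : ℂ) :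
    HasDerivAt (fun μ : ℂ => Complex.exp (-μ * (x : ℂ))) (-x * Complex.exp (-μ * (x : ℂ))) μ := by
  have := (((hasDerivAt_id μ).neg).mul_const (x : ℂ)).cexp
  refine this.congr_deriv ?_
  simp only [id, Pi.neg_apply]
  ring

include hβ in
theorem hasSum_deriv_gaussSum {μ : ℂ} (hμ : 0 < μ.re) :
    HasSum (fun n : ℤ => -(((t + β * n) ^ 2 : ℝ) : ℂ) *
      Complex.exp (-μ * (((t + β * n) ^ 2 : ℝ) : ℂ))) (deriv (gaussSum β t) μ) := by
  have hm : μ ∈ {w : ℂ | μ.re / 2 < w.re} := by simp only [Set.mem_ofPred_eq]; linarith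
  have := Complex.hasSum_deriv_of_summable_norm
    (F := fun (n : ℤ) (μ : ℂ) => Complex.exp (-μ * (((t + β * n) ^ 2 : ℝ) : ℂ)))
    (summable_gauss t hβ (δ := μ.re / 2) (by linarith)) (fun n => by fun_prop)
    (isOpen_re_gt (μ.re / 2)) (fun n w hw => ?_) hm
  · simp only [(hasDerivAt_gauss_term _ _).deriv] at this
    exact this
  · rw [norm_cexp_neg_mul_ofReal, Real.exp_le_exp]
    have hw : μ.re / 2 < w.re := hw
    nlinarith [sq_nonneg (t + β * n)]

include hβ in
theorem hasSum_deriv_deriv_gaussSum {μ : ℂ} (hμ : 0 < μ.re) :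
    HasSum (fun n : ℤ => ((((t + β * n) ^ 2 : ℝ) : ℂ)) ^ 2 *
      Complex.exp (-μ * (((t + β * n) ^ 2 : ℝ) : ℂ))) (deriv (deriv (gaussSum β t)) μ) := by
  have hm : μ ∈ {w : ℂ | μ.re / 2 < w.re} := by simp only [Set.mem_ofPred_eq]; linarith
  have hs := (summable_gauss t hβ (δ := μ.re / 4) (by linarith)).mul_left (2 / (μ.re / 2))
  have := Complex.hasSum_deriv_of_summable_norm
    (F := fun (n : ℤ) (μ : ℂ) => -(((t + β * n) ^ 2 : ℝ) : ℂ) *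
      Complex.exp (-μ * (((t + β * n) ^ 2 : ℝ) : ℂ)))
    hs (fun n => by fun_prop) (isOpen_re_gt (μ.re / 2)) (fun n w hw => ?_) hm
  · have e : deriv (gaussSum β t) =ᶠ[𝓝 μ] fun w => ∑' n : ℤ, -(((t + β * n) ^ 2 : ℝ) : ℂ) *
        Complex.exp (-w * (((t + β * n) ^ 2 : ℝ) : ℂ)) := by
      filter_upwards [(isOpen_re_gt 0).mem_nhds hμ] with w hw
      exact (hasSum_deriv_gaussSum t hβ hw).tsum_eq.symm
    rw [e.deriv_eq]
    refine (hasSum_congr fun n => ?_).mp this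
    rw [((hasDerivAt_gauss_term _ _).const_mul _).deriv]
    ring
  · rw [norm_mul, norm_cexp_neg_mul_ofReal, norm_neg, Complex.norm_real,
      Real.norm_of_nonneg (sq_nonneg _)]
    have hw : μ.re / 2 < w.re := hw
    refine le_trans (mul_le_mul_of_nonneg_left (Real.exp_le_exp.mpr ?_) (sq_nonneg _))
      ((mul_exp_neg_le (δ := μ.re / 2) (x := (t + β * n) ^ 2) (by linarith)).trans (le_of_eq ?_))
    · nlinarith [sq_nonneg (t + β * n)]
    · ring_nf

include hβ in
theorem gaussArg_re {μ : ℂ} (hμ : 0 < μ.re) :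
    ((Real.pi : ℂ) / (μ * (β : ℂ) ^ 2)).re = Real.pi / β ^ 2 * (μ.re / Complex.normSq μ) := by
  have h0 : μ ≠ 0 := fun h => by simp [h] at hμ
  have e : (Real.pi : ℂ) / (μ * (β : ℂ) ^ 2) = ((Real.pi / β ^ 2 : ℝ) : ℂ) * μ⁻¹ := by
    push_cast
    have : (β : ℂ) ≠ 0 := by exact_mod_cast hβ.ne'
    field_simp
  rw [e, Complex.re_ofReal_mul, Complex.inv_re]

include hβ in
theorem gaussArg_re_pos {μ : ℂ} (hμ : 0 < μ.re) :
    0 < ((Real.pi : ℂ) / (μ * (β : ℂ) ^ 2)).re := by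
  have h0 : μ ≠ 0 := fun h => by simp [h] at hμ
  rw [gaussArg_re hβ hμ]
  have := Complex.normSq_pos.mpr h0
  positivity

include hβ in
theorem hasDerivAt_gaussMain {μ : ℂ} (hμ : 0 < μ.re) :
    HasDerivAt (gaussMain β) (-gaussMain β μ / (2 * μ)) μ := by
  have h0 : μ ≠ 0 := fun h => by simp [h] at hμ
  have hb : (β : ℂ) ≠ 0 := by exact_mod_cast hβ.ne'
  have hpi : (Real.pi : ℂ) ≠ 0 := by exact_mod_cast Real.pi_ne_zero
  have ha := gaussArg_re_pos hβ hμ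
  have h1 : HasDerivAt (fun μ : ℂ => (Real.pi : ℂ) / (μ * (β : ℂ) ^ 2))
      (-((Real.pi : ℂ) / (μ * (β : ℂ) ^ 2)) / μ) μ := by
    have := (hasDerivAt_const μ (Real.pi : ℂ)).div ((hasDerivAt_id μ).mul_const ((β : ℂ) ^ 2))
      (by simp [h0, hb])
    refine this.congr_deriv ?_
    simp only [id]
    field_simp
    ring
  have h2 := h1.cpow_const (c := (1 / 2 : ℂ)) (Or.inl ha)
  refine h2.congr_deriv ?_
  have ha0 : (Real.pi : ℂ) / (μ * (β : ℂ) ^ 2) ≠ 0 := fun h => by rw [h] at ha; simp at ha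
  rw [Complex.cpow_sub _ _ ha0, Complex.cpow_one, gaussMain]
  field_simp

include hβ in
theorem deriv_deriv_gaussMain {μ : ℂ} (hμ : 0 < μ.re) :
    deriv (deriv (gaussMain β)) μ = 3 * gaussMain β μ / (4 * μ ^ 2) := by
  have h0 : μ ≠ 0 := fun h => by simp [h] at hμ
  have e : deriv (gaussMain β) =ᶠ[𝓝 μ] fun w => -gaussMain β w / (2 * w) := by
    filter_upwards [(isOpen_re_gt 0).mem_nhds hμ] with w hw
    exact (hasDerivAt_gaussMain hβ hw).deriv
  rw [e.deriv_eq]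
  have := (hasDerivAt_gaussMain hβ hμ).neg.div ((hasDerivAt_id μ).const_mul 2) (by simp [h0])
  refine (this.congr_deriv ?_).deriv
  simp only [id, Pi.neg_apply]
  field_simp
  ring

include hβ in
theorem differentiableOn_gaussMain : DifferentiableOn ℂ (gaussMain β) {μ | 0 < μ.re} :=
  fun _ hμ => (hasDerivAt_gaussMain hβ hμ).differentiableAt.differentiableWithinAt

include hβ in
theorem gaussMain_ofReal {l : ℝ} (hl : 0 < l) :
    gaussMain β (l : ℂ) = ((√(Real.pi / l) / β : ℝ) : ℂ) := by
  rw [gaussMain]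
  have e : (Real.pi : ℂ) / ((l : ℂ) * (β : ℂ) ^ 2) = ((Real.pi / (l * β ^ 2) : ℝ) : ℂ) := by
    push_cast; rfl
  rw [e, show (1 / 2 : ℂ) = ((1 / 2 : ℝ) : ℂ) by push_cast; rfl,
    ← Complex.ofReal_cpow (by positivity), ← Real.sqrt_eq_rpow]
  congr 1
  rw [← div_div, Real.sqrt_div (by positivity), Real.sqrt_sq hβ.le]

include hβ in
-- Poisson summation. The frequency `n = 0` on the dual side contributes exactly `gaussMain`, and
-- the shift `t` survives only as a phase.
theorem gaussSum_eq {μ : ℂ} (hμ : 0 < μ.re) :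
    gaussSum β t μ = gaussMain β μ * ∑' n : ℤ, Complex.exp (-Real.pi *
      ((Real.pi : ℂ) / (μ * (β : ℂ) ^ 2)) * n ^ 2 + 2 * Real.pi * (-Complex.I * (t / β)) * n) := by
  have h0 : μ ≠ 0 := fun h => by simp [h] at hμ
  have hb : (β : ℂ) ≠ 0 := by exact_mod_cast hβ.ne'
  have hpi : (Real.pi : ℂ) ≠ 0 := by exact_mod_cast Real.pi_ne_zero
  have ha := gaussArg_re_pos hβ hμ
  have ha0 : (Real.pi : ℂ) / (μ * (β : ℂ) ^ 2) ≠ 0 := fun h => by rw [h] at ha; simp at ha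
  rw [Complex.tsum_exp_neg_quadratic ha, gaussMain, ← mul_assoc, mul_one_div, div_self, one_mul,
    gaussSum]
  · refine tsum_congr fun n => ?_
    congr 1
    push_cast
    rw [show Complex.I * (-Complex.I * ((t : ℂ) / β)) = t / β by
      rw [← mul_assoc, mul_neg, Complex.I_mul_I]; ring]
    field_simp
    ring
  · exact (Complex.cpow_ne_zero_iff_of_exponent_ne_zero (by norm_num)).mpr ha0

theorem summable_exp_sq {x : ℝ} (hx : 0 < x) :
    Summable fun n : ℤ => Real.exp (-x * ((n : ℝ) ^ 2 - 1)) := by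
  have := (summable_gauss 0 one_pos hx).mul_right (Real.exp x)
  refine this.congr fun n => ?_
  rw [← Real.exp_add]
  ring_nf

include hβ in
-- The estimate is made on a complex disc around `l` rather than at `l` alone, so that Cauchy's
-- estimates later handle derivatives in `μ`; uniformity in `t` holds because the shift enters only
-- through phases.
theorem gauss_remainder_le {Λ : ℝ} (hΛ : 0 < Λ) : ∃ C c : ℝ, 0 ≤ C ∧ 0 < c ∧
    ∀ t l : ℝ, 0 < l → l ≤ Λ → ∀ μ ∈ Metric.closedBall (l : ℂ) (l / 2),
      ‖gaussSum β t μ - gaussMain β μ‖ ≤ C * Real.exp (-c / l) := by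
  -- On the disc `Re μ ≥ l/2` and `|μ| ≤ 3l/2`, so `Re(1/μ) ≥ 2/(9 l)`; this yields the decay rate
  -- `c₀ / l` of the nonzero frequencies.
  set c₀ : ℝ := 2 * Real.pi ^ 2 / (9 * β ^ 2) with hc₀
  have hc₀p : 0 < c₀ := by positivity
  set K : ℝ := ∑' n : ℤ, Real.exp (-(c₀ / Λ) * ((n : ℝ) ^ 2 - 1)) with hK
  have hK0 : 0 ≤ K := tsum_nonneg fun n => (Real.exp_pos _).le
  set E : ℝ := √(2 * Real.pi / β ^ 2) with hE
  refine ⟨E * (1 + 2 / c₀) * K, c₀ / 2, by positivity, by positivity, fun t l hl hlΛ μ hμ => ?_⟩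
  rw [Metric.mem_closedBall, dist_eq_norm] at hμ
  have hre : l / 2 ≤ μ.re := by
    have := (Complex.abs_re_le_norm (μ - l)).trans hμ
    rw [Complex.sub_re, Complex.ofReal_re] at this
    linarith [(abs_le.mp this).1]
  have hμ0 : 0 < μ.re := by linarith
  have hn1 : ‖μ‖ ≤ 3 / 2 * l := by
    have : ‖μ‖ ≤ ‖μ - l‖ + ‖(l : ℂ)‖ := by simpa using norm_add_le (μ - l) (l : ℂ)
    rw [Complex.norm_real, Real.norm_of_nonneg hl.le] at this
    linarith
  have hn2 : l / 2 ≤ ‖μ‖ := hre.trans ((le_abs_self _).trans (Complex.abs_re_le_norm μ))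
  set a : ℂ := (Real.pi : ℂ) / (μ * (β : ℂ) ^ 2) with ha
  have hare : c₀ / l ≤ Real.pi * a.re := by
    rw [ha, gaussArg_re hβ hμ0, hc₀, Complex.normSq_eq_norm_sq]
    have h1 : (l / 2) / (3 / 2 * l) ^ 2 ≤ μ.re / ‖μ‖ ^ 2 := by
      have : 0 < ‖μ‖ := by linarith
      gcongr
    have h2 : 2 * Real.pi ^ 2 / (9 * β ^ 2) / l = Real.pi * (Real.pi / β ^ 2 * ((l / 2) / (3 / 2 * l) ^ 2)) := by
      field_simp
      norm_num
    rw [h2]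
    gcongr
  have hx0 : c₀ / Λ ≤ c₀ / l := by gcongr
  set u : ℤ → ℂ := fun n => Complex.exp (-Real.pi * a * n ^ 2 +
    2 * Real.pi * (-Complex.I * (t / β)) * n) with hu
  have hunorm : ∀ n, ‖u n‖ = Real.exp (-(Real.pi * a.re) * (n : ℝ) ^ 2) := by
    intro n
    rw [hu, Complex.norm_exp]
    congr 1
    have e1 : 2 * (Real.pi : ℂ) * (-Complex.I * (t / β)) * n =
        ((-(2 * Real.pi * (t / β) * n) : ℝ) : ℂ) * Complex.I := by push_cast; ring
    have e2 : -(Real.pi : ℂ) * a * n ^ 2 = ((-Real.pi * (n : ℝ) ^ 2 : ℝ) : ℂ) * a := by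
      push_cast; ring
    rw [e1, e2, Complex.add_re, Complex.re_ofReal_mul, Complex.re_ofReal_mul, Complex.I_re]
    ring
  have hbound : ∀ n, ‖u n - if n = 0 then 1 else 0‖ ≤
      Real.exp (-c₀ / l) * Real.exp (-(c₀ / Λ) * ((n : ℝ) ^ 2 - 1)) := by
    intro n
    split_ifs with h
    · rw [h]
      have : u 0 = 1 := by simp [hu]
      rw [this, sub_self, norm_zero]
      positivity
    · rw [sub_zero, hunorm, ← Real.exp_add, Real.exp_le_exp]
      have hn : (1 : ℝ) ≤ (n : ℝ) ^ 2 := by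
        have : 1 ≤ n ^ 2 := by
          have := sq_nonneg n
          have h3 : n ^ 2 ≠ 0 := pow_ne_zero 2 h
          omega
        exact_mod_cast this
      have h3 : -c₀ / l = -(c₀ / l) := by ring
      rw [h3]
      nlinarith
  have hsum := (summable_exp_sq (x := c₀ / Λ) (by positivity)).mul_left (Real.exp (-c₀ / l))
  have hs1 : Summable fun n : ℤ => u n - if n = 0 then 1 else 0 := Summable.of_norm_bounded hsum hbound
  have hs2 : HasSum (fun n : ℤ => (if n = 0 then 1 else 0 : ℂ)) 1 := hasSum_ite_eq 0 1
  have hs3 : Summable u := by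
    have := hs1.add hs2.summable
    simpa using this
  have hd : ‖∑' n, u n - 1‖ ≤ Real.exp (-c₀ / l) * K := by
    rw [← hs2.tsum_eq, ← hs3.tsum_sub hs2.summable, hK, ← tsum_mul_left]
    exact tsum_of_norm_bounded hsum.hasSum hbound
  have hmain : ‖gaussMain β μ‖ ≤ E * √(1 / l) := by
    rw [gaussMain, ← ha, hE, ← Real.sqrt_mul (by positivity)]
    rw [show (1 / 2 : ℂ) = ((1 / 2 : ℝ) : ℂ) by push_cast; rfl]
    have ha0 : a ≠ 0 := fun h => by
      have := gaussArg_re_pos hβ hμ0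
      rw [← ha, h] at this; simp at this
    rw [Complex.norm_cpow_real, ← Real.sqrt_eq_rpow]
    refine Real.sqrt_le_sqrt ?_
    rw [ha, norm_div, norm_mul, norm_pow, Complex.norm_real, Complex.norm_real,
      Real.norm_of_nonneg Real.pi_pos.le, Real.norm_of_nonneg hβ.le]
    have : 2 * Real.pi / β ^ 2 * (1 / l) = Real.pi / (l / 2 * β ^ 2) := by field_simp
    rw [this]
    gcongr
  -- The singular factor `l^{-1/2}` of the main term is absorbed by half of the exponential decay.
  have hsq : √(1 / l) * Real.exp (-c₀ / l) ≤ (1 + 2 / c₀) * Real.exp (-(c₀ / 2) / l) := by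
    have h1 : √(1 / l) ≤ 1 + 1 / l := by
      rw [Real.sqrt_le_left (by positivity)]
      have : 0 < 1 / l := by positivity
      nlinarith
    have h2 : c₀ / 2 / l ≤ Real.exp (c₀ / 2 / l) := by
      linarith [Real.add_one_le_exp (c₀ / 2 / l)]
    have h3 : 1 / l ≤ 2 / c₀ * Real.exp (c₀ / 2 / l) := by
      calc 1 / l = 2 / c₀ * (c₀ / 2 / l) := by field_simp
        _ ≤ _ := by gcongr
    have h4 : (1 : ℝ) ≤ Real.exp (c₀ / 2 / l) := Real.one_le_exp (by positivity)
    have h5 : Real.exp (-(c₀ / 2) / l) = Real.exp (c₀ / 2 / l) * Real.exp (-c₀ / l) := by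
      rw [← Real.exp_add]; congr 1; ring
    rw [h5, ← mul_assoc]
    refine mul_le_mul_of_nonneg_right (h1.trans ?_) (Real.exp_pos _).le
    rw [add_mul, one_mul]
    exact add_le_add h4 h3
  rw [gaussSum_eq t hβ hμ0, show gaussMain β μ * (∑' n : ℤ, Complex.exp (-Real.pi *
      ((Real.pi : ℂ) / (μ * (β : ℂ) ^ 2)) * n ^ 2 + 2 * Real.pi * (-Complex.I * (t / β)) * n)) -
      gaussMain β μ = gaussMain β μ * (∑' n, u n - 1) by rw [hu, ha]; ring, norm_mul]
  calc ‖gaussMain β μ‖ * ‖∑' n, u n - 1‖ ≤ (E * √(1 / l)) * (Real.exp (-c₀ / l) * K) :=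
        mul_le_mul hmain hd (norm_nonneg _) (by positivity)
    _ = E * K * (√(1 / l) * Real.exp (-c₀ / l)) := by ring
    _ ≤ E * K * ((1 + 2 / c₀) * Real.exp (-(c₀ / 2) / l)) := by gcongr
    _ = _ := by ring

include hβ in
-- The second and third sums are `-l` and `l²` times the first and second derivatives in `μ` of the
-- Gaussian sum at `l`. Differentiating the main term `μ^{-1/2}` produces the factors `1/2` and
-- `3/4`; the remainder is differentiated by Cauchy's estimate on a circle of radius `l/2`, the
-- worst constant being `2! · 2² = 8`.
theorem gauss_sum_asymptotics {Λ : ℝ} (hΛ : 0 < Λ) : ∃ C c : ℝ, 0 ≤ C ∧ 0 < c ∧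
    ∀ t l : ℝ, 0 < l → l ≤ Λ → ∃ R₀ R₁ R₂ : ℂ,
      ‖R₀‖ ≤ C * Real.exp (-c / l) ∧ ‖R₁‖ ≤ C * Real.exp (-c / l) ∧
      ‖R₂‖ ≤ C * Real.exp (-c / l) ∧
      HasSum (fun n : ℤ => ((Real.exp (-l * (t + β * n) ^ 2) : ℝ) : ℂ))
        (((√(Real.pi / l) / β : ℝ) : ℂ) + R₀) ∧
      HasSum (fun n : ℤ => ((l * (t + β * n) ^ 2 * Real.exp (-l * (t + β * n) ^ 2) : ℝ) : ℂ))
        (((√(Real.pi / l) / β : ℝ) : ℂ) / 2 + R₁) ∧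
      HasSum (fun n : ℤ => (((l * (t + β * n) ^ 2) ^ 2 * Real.exp (-l * (t + β * n) ^ 2) : ℝ) : ℂ))
        (3 * ((√(Real.pi / l) / β : ℝ) : ℂ) / 4 + R₂) := by
  obtain ⟨C, c, hC, hc, h⟩ := gauss_remainder_le hβ hΛ
  refine ⟨8 * C, c, by positivity, hc, fun t l hl hlΛ => ?_⟩
  have hl0 : (l : ℂ) ≠ 0 := by exact_mod_cast hl.ne'
  have hlre : 0 < (l : ℂ).re := by simpa using hl
  set R : ℂ → ℂ := fun μ => gaussSum β t μ - gaussMain β μ with hR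
  have hRd : DifferentiableOn ℂ R {μ | 0 < μ.re} :=
    (differentiableOn_gaussSum t hβ).sub (differentiableOn_gaussMain hβ)
  have hball : Metric.closedBall (l : ℂ) (l / 2) ⊆ {μ : ℂ | 0 < μ.re} := by
    intro μ hμ
    rw [Metric.mem_closedBall, dist_eq_norm] at hμ
    have := (Complex.abs_re_le_norm (μ - l)).trans hμ
    rw [Complex.sub_re, Complex.ofReal_re] at this
    have := (abs_le.mp this).1
    simp only [Set.mem_ofPred_eq]
    linarith
  have hcl : DiffContOnCl ℂ R (Metric.ball (l : ℂ) (l / 2)) :=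
    (hRd.mono ((Metric.closure_ball_subset_closedBall).trans hball)).diffContOnCl
  have hB : ∀ z ∈ Metric.sphere (l : ℂ) (l / 2), ‖R z‖ ≤ C * Real.exp (-c / l) :=
    fun z hz => h t l hl hlΛ z (Metric.sphere_subset_closedBall hz)
  have hR0 : ‖R l‖ ≤ C * Real.exp (-c / l) :=
    h t l hl hlΛ l (Metric.mem_closedBall_self (by positivity))
  have hR1 := Complex.norm_deriv_le_of_forall_mem_sphere_norm_le (by positivity) hcl hB
  have hR2 := Complex.norm_iteratedDeriv_le_of_forall_mem_sphere_norm_le 2 (by positivity) hcl hB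
  rw [iteratedDeriv_succ, iteratedDeriv_one] at hR2
  have hS : ∀ μ : ℂ, 0 < μ.re → DifferentiableAt ℂ (gaussSum β t) μ := fun μ hμ =>
    (differentiableOn_gaussSum t hβ).differentiableAt ((isOpen_re_gt 0).mem_nhds hμ)
  have hderiv : ∀ μ : ℂ, 0 < μ.re → deriv R μ = deriv (gaussSum β t) μ - deriv (gaussMain β) μ :=
    fun μ hμ => deriv_sub (hS μ hμ) (hasDerivAt_gaussMain hβ hμ).differentiableAt
  have hd1 : deriv (gaussSum β t) l = deriv R l - gaussMain β l / (2 * l) := by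
    rw [hderiv _ hlre, (hasDerivAt_gaussMain hβ hlre).deriv]; ring
  have hd2 : deriv (deriv (gaussSum β t)) l = deriv (deriv R) l + 3 * gaussMain β l / (4 * l ^ 2) := by
    have e : deriv R =ᶠ[𝓝 (l : ℂ)] fun μ => deriv (gaussSum β t) μ - deriv (gaussMain β) μ := by
      filter_upwards [(isOpen_re_gt 0).mem_nhds hlre] with μ hμ using hderiv μ hμ
    have hm : DifferentiableOn ℂ (deriv (gaussMain β)) {μ | 0 < μ.re} :=
      (differentiableOn_gaussMain hβ).deriv (isOpen_re_gt 0)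
    have hg : DifferentiableOn ℂ (deriv (gaussSum β t)) {μ | 0 < μ.re} :=
      (differentiableOn_gaussSum t hβ).deriv (isOpen_re_gt 0)
    have := (isOpen_re_gt 0).mem_nhds hlre
    rw [e.deriv_eq, deriv_fun_sub (hg.differentiableAt this) (hm.differentiableAt this),
      deriv_deriv_gaussMain hβ hlre]
    ring
  set B : ℝ := C * Real.exp (-c / l) with hBdef
  have hB0 : 0 ≤ B := by positivity
  have e8 : 8 * C * Real.exp (-c / l) = 8 * B := by rw [hBdef]; ring
  have hs0 : HasSum (fun n : ℤ => Complex.exp (-(l : ℂ) * (((t + β * n) ^ 2 : ℝ) : ℂ)))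
      (gaussSum β t l) := by
    refine Summable.hasSum (Summable.of_norm_bounded (summable_gauss t hβ hl) fun n => ?_)
    rw [norm_cexp_neg_mul_ofReal, Complex.ofReal_re]
  have hs1 := (hasSum_deriv_gaussSum t hβ hlre).mul_left (-(l : ℂ))
  have hs2 := (hasSum_deriv_deriv_gaussSum t hβ hlre).mul_left ((l : ℂ) ^ 2)
  refine ⟨R l, -(l : ℂ) * deriv R l, (l : ℂ) ^ 2 * deriv (deriv R) l, ?_, ?_, ?_, ?_, ?_, ?_⟩
  · rw [e8]; linarith
  · rw [e8, norm_mul, norm_neg, Complex.norm_real, Real.norm_of_nonneg hl.le]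
    calc l * ‖deriv R l‖ ≤ l * (B / (l / 2)) := by gcongr
      _ = 2 * B := by field_simp
      _ ≤ _ := by linarith
  · rw [e8, norm_mul, norm_pow, Complex.norm_real, Real.norm_of_nonneg hl.le]
    calc l ^ 2 * ‖deriv (deriv R) l‖ ≤ l ^ 2 * ((Nat.factorial 2 : ℕ) * B / (l / 2) ^ 2) := by gcongr
      _ = 8 * B := by simp only [Nat.factorial]; field_simp; norm_num; ring
      _ ≤ _ := le_rfl
  · rw [← gaussMain_ofReal hβ hl, show gaussMain β l + R l = gaussSum β t l by rw [hR]; ring]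
    refine (hasSum_congr fun n => ?_).mpr hs0
    push_cast; rfl
  · rw [← gaussMain_ofReal hβ hl]
    rw [hd1, show -(l : ℂ) * (deriv R l - gaussMain β l / (2 * l)) =
      gaussMain β l / 2 + -(l : ℂ) * deriv R l by field_simp; ring] at hs1
    refine (hasSum_congr fun n => ?_).mpr hs1
    push_cast; ring
  · rw [← gaussMain_ofReal hβ hl]
    rw [hd2, show (l : ℂ) ^ 2 * (deriv (deriv R) l + 3 * gaussMain β l / (4 * l ^ 2)) =
      3 * gaussMain β l / 4 + (l : ℂ) ^ 2 * deriv (deriv R) l by field_simp; ring] at hs2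
    refine (hasSum_congr fun n => ?_).mpr hs2
    push_cast; ring

end GaussSum

/-! ### The Laplacian of a Gaussian in the linear form `(X, X(z))` -/

theorem laplacian_of_lines {f g₁ g₂ : ℂ → ℂ} {z A B : ℂ} (hf : ContDiffAt ℝ 2 f z)
    (h₁ : ∀ᶠ w in 𝓝 z, HasDerivAt (fun t : ℝ => f (w + t)) (g₁ w) 0)
    (h₂ : ∀ᶠ w in 𝓝 z, HasDerivAt (fun t : ℝ => f (w + t * Complex.I)) (g₂ w) 0)
    (hA : HasDerivAt (fun t : ℝ => g₁ (z + t)) A 0)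
    (hB : HasDerivAt (fun t : ℝ => g₂ (z + t * Complex.I)) B 0) :
    Laplacian.laplacian f z = A + B := by
  have line : ∀ (h : ℂ → ℂ) (w v : ℂ), DifferentiableAt ℝ h w →
      HasDerivAt (fun t : ℝ => h (w + t * v)) (fderiv ℝ h w v) 0 := by
    intro h w v hd
    have h1 : HasDerivAt (fun t : ℝ => w + (t : ℂ) * v) v 0 := by
      have := ((Complex.ofRealCLM.hasDerivAt (x := (0 : ℝ))).mul_const v).const_add w
      simpa using this
    have h2 : HasFDerivAt h (fderiv ℝ h w) (w + ((0 : ℝ) : ℂ) * v) := by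
      simpa using hd.hasFDerivAt
    exact h2.comp_hasDerivAt (0 : ℝ) h1
  have key : ∀ (g : ℂ → ℂ) (v C : ℂ),
      (∀ᶠ w in 𝓝 z, HasDerivAt (fun t : ℝ => f (w + t * v)) (g w) 0) →
      HasDerivAt (fun t : ℝ => g (z + t * v)) C 0 → fderiv ℝ (fderiv ℝ f) z v v = C := by
    intro g v C h hC
    rw [← fderiv_fderiv_apply hf]
    have e : (fun w => fderiv ℝ f w v) =ᶠ[𝓝 z] g := by
      filter_upwards [h, hf.eventually_differentiableAt] with w hw hd
      exact (line f w v hd).unique hw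
    have hd : DifferentiableAt ℝ (fun w => fderiv ℝ f w v) z :=
      hf.differentiableAt_fderiv_two.clm_apply (differentiableAt_const v)
    have h3 := line g z v (e.differentiableAt_iff.mp hd)
    rw [e.fderiv_eq]
    exact h3.unique hC
  rw [laplacian_apply]
  congr 1
  · exact key g₁ 1 A (by simpa using h₁) (by simpa using hA)
  · exact key g₂ Complex.I B h₂ hB

theorem hasDerivAt_gauss_line (C : ℂ) (k : ℝ) {P P₁ : ℝ → ℝ} {t : ℝ} (h : HasDerivAt P (P₁ t) t) :
    HasDerivAt (fun t => C * Complex.exp ((-k * P t ^ 2 : ℝ) : ℂ))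
      (((-2 * k * P t * P₁ t : ℝ) : ℂ) * (C * Complex.exp ((-k * P t ^ 2 : ℝ) : ℂ))) t := by
  have h1 : HasDerivAt (fun t => -k * P t ^ 2) (-2 * k * P t * P₁ t) t := by
    refine ((h.pow 2).const_mul (-k)).congr_deriv ?_
    simp only [Nat.cast_ofNat, Nat.add_one_sub_one, pow_one]
    ring
  refine (h1.ofReal_comp.cexp.const_mul C).congr_deriv ?_
  ring

theorem hasDerivAt_gauss_line_two (C : ℂ) (k : ℝ) {P P₁ : ℝ → ℝ} {P₂ t : ℝ}
    (h : HasDerivAt P (P₁ t) t) (h' : HasDerivAt P₁ P₂ t) :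
    HasDerivAt (fun t => ((-2 * k * P t * P₁ t : ℝ) : ℂ) *
        (C * Complex.exp ((-k * P t ^ 2 : ℝ) : ℂ)))
      (((4 * k ^ 2 * P t ^ 2 * P₁ t ^ 2 - 2 * k * (P₁ t ^ 2 + P t * P₂) : ℝ) : ℂ) *
        (C * Complex.exp ((-k * P t ^ 2 : ℝ) : ℂ))) t := by
  have h1 : HasDerivAt (fun t => -2 * k * P t * P₁ t) (-2 * k * (P₁ t ^ 2 + P t * P₂)) t := by
    refine ((h.const_mul (-2 * k)).mul h').congr_deriv ?_
    ring
  refine (h1.ofReal_comp.mul (hasDerivAt_gauss_line C k h)).congr_deriv ?_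
  push_cast
  ring

section Forms

variable (N : ℕ)

/-- The linear form `(X, X(z))` in coordinates. -/
def pForm (a b c x y : ℝ) : ℝ := √(N : ℝ) * (c * (x ^ 2 + y ^ 2) - 2 * a * x - b) / y

/-- The majorant `(X, X)_z` in coordinates. -/
def mForm (a b c x y : ℝ) : ℝ :=
  2 * N * (a - x * c) ^ 2 + N * (c * y) ^ 2 + N * ((b + 2 * x * a - x ^ 2 * c) / y) ^ 2

theorem mForm_nonneg (a b c x y : ℝ) : 0 ≤ mForm N a b c x y := by unfold mForm; positivity

theorem mForm_eq (a b c x : ℝ) {y : ℝ} (hy : y ≠ 0) :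
    2 * N * (a ^ 2 + b * c) + pForm N a b c x y ^ 2 = mForm N a b c x y := by
  unfold mForm pForm
  rw [div_pow, mul_pow, Real.sq_sqrt (Nat.cast_nonneg N), mul_pow, div_pow]
  field_simp
  ring

/-- Write the form as `√N (c y - B)`, where `N (c y)²` and `N B²` are two of the three squares
making up the majorant. -/
theorem pForm_sq_le (a b c x y : ℝ) (hy : y ≠ 0) : pForm N a b c x y ^ 2 ≤ 2 * mForm N a b c x y := by
  have e : pForm N a b c x y = √(N : ℝ) * (c * y - (b + 2 * x * a - x ^ 2 * c) / y) := by
    unfold pForm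
    field_simp
    ring
  rw [e, mul_pow, Real.sq_sqrt (Nat.cast_nonneg N), mForm]
  set B := (b + 2 * x * a - x ^ 2 * c) / y
  have hN : (0 : ℝ) ≤ N := Nat.cast_nonneg N
  nlinarith [mul_nonneg hN (sq_nonneg (c * y + B)), mul_nonneg hN (sq_nonneg (a - x * c))]

theorem hasDerivAt_pForm_x (a b c x y : ℝ) :
    HasDerivAt (fun x => pForm N a b c x y) (√(N : ℝ) * (2 * c * x - 2 * a) / y) x := by
  have : HasDerivAt (fun x : ℝ => c * (x ^ 2 + y ^ 2) - 2 * a * x - b) (2 * c * x - 2 * a) x := by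
    refine ((((((hasDerivAt_id x).pow 2).add_const (y ^ 2)).const_mul c).sub
      ((hasDerivAt_id x).const_mul (2 * a))).sub_const b).congr_deriv ?_
    simp only [id, Nat.cast_ofNat, Nat.add_one_sub_one, pow_one]
    ring
  exact (this.const_mul _).div_const y

theorem hasDerivAt_pForm_xx (a c x y : ℝ) :
    HasDerivAt (fun x => √(N : ℝ) * (2 * c * x - 2 * a) / y) (√(N : ℝ) * (2 * c) / y) x := by
  refine (((((hasDerivAt_id x).const_mul (2 * c)).sub_const (2 * a)).const_mul _).div_const
    y).congr_deriv ?_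
  ring

theorem hasDerivAt_pForm_y (a b c x : ℝ) {y : ℝ} (hy : y ≠ 0) :
    HasDerivAt (fun y => pForm N a b c x y) (2 * √(N : ℝ) * c - pForm N a b c x y / y) y := by
  have : HasDerivAt (fun y : ℝ => √(N : ℝ) * (c * (x ^ 2 + y ^ 2) - 2 * a * x - b))
      (√(N : ℝ) * (c * (2 * y))) y := by
    refine (((((((hasDerivAt_id y).pow 2).const_add (x ^ 2)).const_mul c).sub_const
      (2 * a * x)).sub_const b).const_mul _).congr_deriv ?_
    simp only [id, Nat.cast_ofNat, Nat.add_one_sub_one, pow_one]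
    ring
  refine (this.div (hasDerivAt_id y) hy).congr_deriv ?_
  simp only [id, pForm]
  field_simp

theorem hasDerivAt_pForm_yy (a b c x : ℝ) {y : ℝ} (hy : y ≠ 0) :
    HasDerivAt (fun y => 2 * √(N : ℝ) * c - pForm N a b c x y / y)
      (-(2 * √(N : ℝ) * c - pForm N a b c x y / y) / y + pForm N a b c x y / y ^ 2) y := by
  refine (((hasDerivAt_pForm_y N a b c x hy).div (hasDerivAt_id y) hy).const_sub _).congr_deriv ?_
  simp only [id]
  field_simp
  ring

theorem contDiffAt_pForm (a b c : ℝ) {w : ℂ} (hw : w.im ≠ 0) :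
    ContDiffAt ℝ 2 (fun w : ℂ => pForm N a b c w.re w.im) w := by
  have h1 : ContDiffAt ℝ 2 (fun w : ℂ => w.re) w := Complex.reCLM.contDiff.contDiffAt
  have h2 : ContDiffAt ℝ 2 (fun w : ℂ => w.im) w := Complex.imCLM.contDiff.contDiffAt
  unfold pForm
  exact ContDiffAt.div (by fun_prop) h2 hw

/-- The explicit form of `Δ` applied to a Gaussian in `(X, X(z))`. -/
theorem laplacian_gauss (C : ℂ) (k a b c : ℝ) (z : ℍ) :
    (z.im : ℂ) ^ 2 * Laplacian.laplacian (fun w : ℂ =>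
        C * Complex.exp ((-k * pForm N a b c w.re w.im ^ 2 : ℝ) : ℂ)) z =
      (((4 * k ^ 2 * pForm N a b c z.re z.im ^ 2 - 2 * k) *
          (2 * mForm N a b c z.re z.im - pForm N a b c z.re z.im ^ 2) -
          4 * k * pForm N a b c z.re z.im ^ 2 : ℝ) : ℂ) *
        (C * Complex.exp ((-k * pForm N a b c z.re z.im ^ 2 : ℝ) : ℂ)) := by
  have hy := z.im_ne_zero
  have hev : ∀ᶠ w : ℂ in 𝓝 (z : ℂ), w.im ≠ 0 :=
    (isOpen_ne_fun Complex.continuous_im continuous_const).mem_nhds hy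
  set E : ℂ → ℂ := fun w => C * Complex.exp ((-k * pForm N a b c w.re w.im ^ 2 : ℝ) : ℂ) with hE
  have hC2 : ContDiffAt ℝ 2 E z := by
    have := contDiffAt_pForm N a b c (w := (z : ℂ)) hy
    have h2 : ContDiffAt ℝ 2 (fun w : ℂ => ((-k * pForm N a b c w.re w.im ^ 2 : ℝ) : ℂ)) z :=
      Complex.ofRealCLM.contDiff.contDiffAt.comp (z : ℂ) (contDiffAt_const.mul (this.pow 2))
    exact contDiffAt_const.mul h2.cexp
  have L := laplacian_of_lines (f := E) (z := z)
    (g₁ := fun w => ((-2 * k * pForm N a b c w.re w.im *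
      (√(N : ℝ) * (2 * c * w.re - 2 * a) / w.im) : ℝ) : ℂ) * E w)
    (g₂ := fun w => ((-2 * k * pForm N a b c w.re w.im *
      (2 * √(N : ℝ) * c - pForm N a b c w.re w.im / w.im) : ℝ) : ℂ) * E w)
    hC2 (Filter.Eventually.of_forall fun w => ?_) (hev.mono fun w hw => ?_)
    (hasDerivAt_gauss_line_two C k (t := 0) (P := fun t => pForm N a b c ((z : ℂ) + (t : ℂ)).re ((z : ℂ) + (t : ℂ)).im)
      (P₁ := fun t => √(N : ℝ) * (2 * c * ((z : ℂ) + (t : ℂ)).re - 2 * a) / ((z : ℂ) + (t : ℂ)).im)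
      (P₂ := √(N : ℝ) * (2 * c) / z.im) ?_ ?_)
    (hasDerivAt_gauss_line_two C k (t := 0)
      (P := fun t => pForm N a b c ((z : ℂ) + (t : ℂ) * Complex.I).re ((z : ℂ) + (t : ℂ) * Complex.I).im)
      (P₁ := fun t => 2 * √(N : ℝ) * c - pForm N a b c ((z : ℂ) + (t : ℂ) * Complex.I).re
        ((z : ℂ) + (t : ℂ) * Complex.I).im / ((z : ℂ) + (t : ℂ) * Complex.I).im)
      (P₂ := -(2 * √(N : ℝ) * c - pForm N a b c z.re (z.im + 0) / (z.im + 0)) / (z.im + 0) +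
        pForm N a b c z.re (z.im + 0) / (z.im + 0) ^ 2) ?_ ?_)
  · rw [L]
    simp only [Complex.add_re, Complex.add_im, Complex.ofReal_re, Complex.ofReal_im,
      Complex.mul_re, Complex.mul_im, Complex.I_re, Complex.I_im, mul_zero, mul_one,
      sub_zero, add_zero]
    rw [← add_mul, ← mul_assoc]
    congr 1
    norm_cast
    rw [← mForm_eq N a b c _ hy]
    have hN := Real.sq_sqrt (Nat.cast_nonneg N : (0 : ℝ) ≤ N)
    change z.im ^ 2 * _ = _
    have e : (z : ℂ).im = z.im := rfl
    have e' : (z : ℂ).re = z.re := rfl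
    rw [e, e']
    have hP : pForm N a b c z.re z.im * z.im = √(N : ℝ) * (c * (z.re ^ 2 + z.im ^ 2) - 2 * a * z.re - b) := by
      unfold pForm; field_simp
    set P := pForm N a b c z.re z.im
    -- For `p = (X, X(z))` this and the following identity say that `y² |∇p|² = p² + 2 (X, X)` and
    -- `y² (p_xx + p_yy) = 2 p`; the Laplacian of `exp(-k p²)` involves nothing else.
    have hgrad : z.im ^ 2 * ((√(N : ℝ) * (2 * c * z.re - 2 * a) / z.im) ^ 2 +
        (2 * √(N : ℝ) * c - P / z.im) ^ 2) = P ^ 2 + 2 * (2 * N * (a ^ 2 + b * c)) := by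
      field_simp
      linear_combination (4 * (c * z.re - a) ^ 2 + 4 * c ^ 2 * z.im ^ 2 -
        4 * c * (c * (z.re ^ 2 + z.im ^ 2) - 2 * a * z.re - b)) * hN - 4 * √(N : ℝ) * c * hP
    have hlap : z.im ^ 2 * (√(N : ℝ) * (2 * c) / z.im +
        (-(2 * √(N : ℝ) * c - P / z.im) / z.im + P / z.im ^ 2)) = 2 * P := by
      field_simp
      ring
    linear_combination (4 * k ^ 2 * P ^ 2 - 2 * k) * hgrad - 2 * k * P * hlap
  · refine (hasDerivAt_gauss_line C k (t := 0) (P := fun t => pForm N a b c (w + (t : ℂ)).re (w + (t : ℂ)).im)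
      (P₁ := fun t => √(N : ℝ) * (2 * c * (w + (t : ℂ)).re - 2 * a) / (w + (t : ℂ)).im) ?_).congr_deriv ?_
    · simp only [Complex.add_re, Complex.add_im, Complex.ofReal_re, Complex.ofReal_im, add_zero]
      exact ((hasDerivAt_pForm_x N a b c (w.re + 0) w.im).comp_const_add w.re 0).congr_deriv (by simp)
    · simp [hE]
  · refine (hasDerivAt_gauss_line C k (t := 0)
      (P := fun t => pForm N a b c (w + (t : ℂ) * Complex.I).re (w + (t : ℂ) * Complex.I).im)
      (P₁ := fun t => 2 * √(N : ℝ) * c - pForm N a b c (w + (t : ℂ) * Complex.I).re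
        (w + (t : ℂ) * Complex.I).im / (w + (t : ℂ) * Complex.I).im) ?_).congr_deriv ?_
    · simp only [Complex.add_re, Complex.add_im, Complex.ofReal_re, Complex.ofReal_im, add_zero,
        Complex.mul_re, Complex.mul_im, Complex.I_re, Complex.I_im, mul_zero, mul_one,
        sub_zero]
      exact ((hasDerivAt_pForm_y N a b c w.re (y := w.im + 0) (by simpa using hw)).comp_const_add w.im 0).congr_deriv (by simp)
    · simp [hE]
  · simp only [Complex.add_re, Complex.add_im, Complex.ofReal_re, Complex.ofReal_im, add_zero]
    exact ((hasDerivAt_pForm_x N a b c (z.re + 0) z.im).comp_const_add z.re 0).congr_deriv (by simp)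
  · simp only [Complex.add_re, Complex.add_im, Complex.ofReal_re, Complex.ofReal_im, add_zero]
    exact (hasDerivAt_pForm_xx N a c (z.re + 0) z.im).comp_const_add z.re 0
  · simp only [Complex.add_re, Complex.add_im, Complex.ofReal_re, Complex.ofReal_im, add_zero,
        Complex.mul_re, Complex.mul_im, Complex.I_re, Complex.I_im, mul_zero, mul_one,
        sub_zero]
    exact ((hasDerivAt_pForm_y N a b c z.re (y := z.im + 0) (by simpa using hy)).comp_const_add z.im 0).congr_deriv (by simp)
  · simp only [Complex.add_re, Complex.add_im, Complex.ofReal_re, Complex.ofReal_im, add_zero,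
        Complex.mul_re, Complex.mul_im, Complex.I_re, Complex.I_im, mul_zero, mul_one,
        sub_zero]
    exact ((hasDerivAt_pForm_yy N a b c z.re (y := z.im + 0) (by simpa using hy)).comp_const_add z.im 0).congr_deriv (by simp)

end Forms

/-- The entries of `X` as real numbers. -/
def V.ra (X : V) : ℝ := ((X.mat 0 0 : ℚ) : ℝ)

/-- The upper right entry of `X` as a real number. -/
def V.rb (X : V) : ℝ := ((X.mat 0 1 : ℚ) : ℝ)

/-- The lower left entry of `X` as a real number. -/
def V.rc (X : V) : ℝ := ((X.mat 1 0 : ℚ) : ℝ)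

/-! ### The Gaussian kernel and its Laplacian in coordinates -/

section Phi

variable (N : ℕ) (X : V) (τ z : ℍ)

theorem toReal_eq : toReal X = !![X.ra, X.rb; X.rc, -X.ra] := by
  ext i j
  fin_cases i <;> fin_cases j <;> simp [toReal, V.ra, V.rb, V.rc, V.mat_one_one]

theorem bilR_self : bilR N (toReal X) (toReal X) = 2 * N * (X.ra ^ 2 + X.rb * X.rc) := by
  rw [toReal_eq, bilR]
  simp only [Matrix.trace_fin_two, Matrix.mul_apply, Fin.sum_univ_two]
  simp
  ring

theorem Q_eq : ((Q N X : ℚ) : ℝ) = N * (X.ra ^ 2 + X.rb * X.rc) := by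
  simp only [Q, Matrix.det_fin_two, V.mat_one_one, V.ra, V.rb, V.rc]
  push_cast
  ring

theorem bilR_Xvec : bilR N (toReal X) (Xvec N z) = pForm N X.ra X.rb X.rc z.re z.im := by
  have hy := z.im_ne_zero
  have hn : Complex.normSq (z : ℂ) = z.re ^ 2 + z.im ^ 2 := by
    rw [Complex.normSq_apply, sq, sq]; rfl
  rw [toReal_eq, bilR, Xvec, hn, pForm]
  simp only [Matrix.trace_fin_two, Matrix.mul_apply, Fin.sum_univ_two, Matrix.smul_apply]
  simp
  rcases Nat.eq_zero_or_pos N with h | h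
  · simp [h]
  · have hN := Real.sq_sqrt (Nat.cast_nonneg N : (0 : ℝ) ≤ N)
    have h0 : √(N : ℝ) ≠ 0 := by positivity
    field_simp
    rw [hN]
    ring

theorem phi0_eq : phi0 N (toReal X) τ z = ((√τ.im *
      Real.exp (-(Real.pi * τ.im) * mForm N X.ra X.rb X.rc z.re z.im) : ℝ) : ℂ) *
    Complex.exp (2 * Real.pi * Complex.I * ((Q N X : ℚ) : ℂ) * (τ.re : ℂ)) := by
  have h1 : gaussian N (√τ.im • toReal X) z =
      Real.exp (-(Real.pi * τ.im) * mForm N X.ra X.rb X.rc z.re z.im) := by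
    rw [gaussian, ← mForm_eq N _ _ _ _ z.im_ne_zero, ← bilR_Xvec, ← bilR_self]
    have e1 : bilR N (√τ.im • toReal X) (√τ.im • toReal X) = τ.im * bilR N (toReal X) (toReal X) := by
      simp only [bilR, Matrix.smul_mul, Matrix.mul_smul, smul_smul, Matrix.trace_smul, smul_eq_mul,
        Real.mul_self_sqrt τ.im_pos.le]
      ring
    have e2 : bilR N (√τ.im • toReal X) (Xvec N z) = √τ.im * bilR N (toReal X) (Xvec N z) := by
      simp only [bilR, Matrix.smul_mul, Matrix.trace_smul, smul_eq_mul]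
      ring
    rw [e1, e2, mul_pow, Real.sq_sqrt τ.im_pos.le]
    congr 1
    ring
  have h2 : (bilR N (toReal X) (toReal X) : ℂ) = 2 * ((Q N X : ℚ) : ℂ) := by
    rw [bilR_self]
    have := Q_eq N X
    have h3 : ((Q N X : ℚ) : ℂ) = ((((Q N X : ℚ) : ℝ)) : ℂ) := by push_cast; rfl
    rw [h3, this]
    push_cast
    ring
  rw [phi0, h1, h2]
  congr 2
  ring

/-- The majorant depends on `z` only through `(X, X(z))²`; splitting off the constant factor makes
the Laplacian formula for Gaussians applicable. -/
theorem phi0_gauss : (fun w : ℂ => phi0 N (toReal X) τ (ofComplex w)) =ᶠ[𝓝 (z : ℂ)]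
    fun w : ℂ => ((√τ.im * Real.exp (-(Real.pi * τ.im) * (2 * N * (X.ra ^ 2 + X.rb * X.rc))) : ℝ) *
      Complex.exp (2 * Real.pi * Complex.I * ((Q N X : ℚ) : ℂ) * (τ.re : ℂ))) *
      Complex.exp ((-(Real.pi * τ.im) * pForm N X.ra X.rb X.rc w.re w.im ^ 2 : ℝ) : ℂ) := by
  filter_upwards [eventually_ofComplex z] with w hw
  rw [phi0_eq, ← mForm_eq N _ _ _ _ (ofComplex w).im_ne_zero]
  have h1 : (ofComplex w).re = w.re := congrArg Complex.re hw
  have h2 : (ofComplex w).im = w.im := congrArg Complex.im hw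
  rw [h1, h2, mul_add, Real.exp_add]
  push_cast
  ring

theorem isC2_phi0 : IsC2 (phi0 N (toReal X) τ) := by
  intro z
  refine ContDiffAt.congr_of_eventuallyEq ?_ (phi0_gauss N X τ z)
  have := contDiffAt_pForm N X.ra X.rb X.rc (w := (z : ℂ)) z.im_ne_zero
  have h2 : ContDiffAt ℝ 2 (fun w : ℂ => ((-(Real.pi * τ.im) *
      pForm N X.ra X.rb X.rc w.re w.im ^ 2 : ℝ) : ℂ)) z :=
    Complex.ofRealCLM.contDiff.contDiffAt.comp (z : ℂ) (contDiffAt_const.mul (this.pow 2))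
  exact contDiffAt_const.mul h2.cexp

/-- The polynomial factor of `Δ φ₀`. -/
def lapFactor (k m p : ℝ) : ℝ := 4 * k * p ^ 2 - (4 * k ^ 2 * p ^ 2 - 2 * k) * (2 * m - p ^ 2)

theorem lapPhi0_eq : lapPhi0 N (toReal X) τ z =
    (lapFactor (Real.pi * τ.im) (mForm N X.ra X.rb X.rc z.re z.im)
      (pForm N X.ra X.rb X.rc z.re z.im) : ℂ) * phi0 N (toReal X) τ z := by
  have h := phi0_gauss N X τ z
  have hz := h.eq_of_nhds
  simp only [ofComplex_apply, coe_re, coe_im] at hz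
  rw [lapPhi0, hypLaplacian, InnerProductSpace.laplacian_congr_nhds h |>.eq_of_nhds, neg_mul,
    laplacian_gauss, hz, lapFactor]
  push_cast
  ring

theorem norm_phi0 : ‖phi0 N (toReal X) τ z‖ =
    √τ.im * Real.exp (-(Real.pi * τ.im) * mForm N X.ra X.rb X.rc z.re z.im) := by
  have h1 : (2 * (Real.pi : ℂ) * Complex.I * ((Q N X : ℚ) : ℂ) * (τ.re : ℂ)) =
      ((2 * Real.pi * ((Q N X : ℚ) : ℝ) * τ.re : ℝ) : ℂ) * Complex.I := by
    push_cast; ring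
  rw [phi0_eq, norm_mul, h1, Complex.norm_exp_ofReal_mul_I, mul_one, Complex.norm_real,
    Real.norm_of_nonneg (by positivity)]

/-- The polynomial factor is quadratic in `k m`, because `p² ≤ 2m`, and half of the Gaussian absorbs
it. -/
theorem norm_lapPhi0_le : ‖lapPhi0 N (toReal X) τ z‖ ≤
    152 * √τ.im * Real.exp (-(Real.pi * τ.im / 2) * mForm N X.ra X.rb X.rc z.re z.im) := by
  rw [lapPhi0_eq, norm_mul, norm_phi0, Complex.norm_real, Real.norm_eq_abs]
  have hm := mForm_nonneg N X.ra X.rb X.rc z.re z.im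
  have hp := pForm_sq_le N X.ra X.rb X.rc z.re z.im z.im_ne_zero
  set m := mForm N X.ra X.rb X.rc z.re z.im
  set p := pForm N X.ra X.rb X.rc z.re z.im
  set k := Real.pi * τ.im with hk
  have hk0 : 0 < k := mul_pos Real.pi_pos τ.im_pos
  have hp0 := sq_nonneg p
  have h1 : |lapFactor k m p| ≤ 16 * (k * m) ^ 2 + 12 * (k * m) := by
    unfold lapFactor
    have e1 : 0 ≤ k * p ^ 2 := by positivity
    have e2 : k * p ^ 2 ≤ 2 * (k * m) := by nlinarith
    have e3 : 0 ≤ k * (2 * m - p ^ 2) := mul_nonneg hk0.le (by linarith)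
    have e4 : k * (2 * m - p ^ 2) ≤ 2 * (k * m) := by nlinarith
    have e5 : 0 ≤ k * m := by positivity
    have e6 : 0 ≤ (k * p ^ 2) * (k * (2 * m - p ^ 2)) := mul_nonneg e1 e3
    have e7 : (k * p ^ 2) * (k * (2 * m - p ^ 2)) ≤ (2 * (k * m)) * (2 * (k * m)) :=
      mul_le_mul e2 e4 e3 (by positivity)
    rw [abs_le]
    constructor <;> nlinarith
  -- With `t = k m / 2` the left side is `64 t² + 24 t`; `t² ≤ 2 e^t` and `t ≤ e^t` give `128 + 24 =
  -- 152`.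
  have h2 : 16 * (k * m) ^ 2 + 12 * (k * m) ≤ 152 * Real.exp (k / 2 * m) := by
    have e5 : 0 ≤ k / 2 * m := by positivity
    have := Real.pow_div_factorial_le_exp (k / 2 * m) e5 2
    have h3 := Real.add_one_le_exp (k / 2 * m)
    simp only [Nat.factorial] at this
    norm_num at this
    nlinarith
  have h3 : Real.exp (-(k / 2) * m) = Real.exp (k / 2 * m) * Real.exp (-k * m) := by
    rw [← Real.exp_add]; ring_nf
  rw [h3]
  have h4 : 0 ≤ √τ.im * Real.exp (-k * m) := by positivity
  calc |lapFactor k m p| * (√τ.im * Real.exp (-k * m)) ≤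
      (152 * Real.exp (k / 2 * m)) * (√τ.im * Real.exp (-k * m)) :=
        mul_le_mul_of_nonneg_right (h1.trans h2) h4
    _ = _ := by ring

end Phi

/-! ### Equivariance of the kernels under `SL₂(ℤ)` -/

section Equivariance

variable (N : ℕ) (g : SL(2, ℤ)) (X : V) (τ z : ℍ)

theorem smul_im_re : ∃ n : ℝ, 0 < n ∧ n = ((g 1 0 : ℝ) * z.re + g 1 1) ^ 2 + (g 1 0 * z.im) ^ 2 ∧
    (g • z).im = z.im / n ∧
    (g • z).re = (((g 0 0 : ℝ) * z.re + g 0 1) * (g 1 0 * z.re + g 1 1) + g 0 0 * g 1 0 * z.im ^ 2) / n ∧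
    (g • z).re ^ 2 + (g • z).im ^ 2 = (((g 0 0 : ℝ) * z.re + g 0 1) ^ 2 + (g 0 0 * z.im) ^ 2) / n := by
  have h := specialLinearGroup_apply g z
  have hdet : (g 0 0 : ℝ) * g 1 1 - g 0 1 * g 1 0 = 1 := by
    have := g.2
    rw [Matrix.det_fin_two] at this
    exact_mod_cast this
  simp only [algebraMap_int_eq, Int.coe_castRingHom] at h
  set D : ℂ := ((g 1 0 : ℝ) : ℂ) * (z : ℂ) + ((g 1 1 : ℝ) : ℂ) with hD
  set A : ℂ := ((g 0 0 : ℝ) : ℂ) * (z : ℂ) + ((g 0 1 : ℝ) : ℂ) with hA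
  have hDre : D.re = g 1 0 * z.re + g 1 1 := by simp [hD]
  have hDim : D.im = g 1 0 * z.im := by simp [hD]
  have hAre : A.re = g 0 0 * z.re + g 0 1 := by simp [hA]
  have hAim : A.im = g 0 0 * z.im := by simp [hA]
  have hn : Complex.normSq D = ((g 1 0 : ℝ) * z.re + g 1 1) ^ 2 + (g 1 0 * z.im) ^ 2 := by
    rw [Complex.normSq_apply, hDre, hDim]; ring
  have hD0 : D ≠ 0 := by
    intro h0
    have h1 : (g 1 0 : ℝ) * z.re + g 1 1 = 0 := by rw [← hDre, h0]; rfl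
    have h2 : (g 1 0 : ℝ) * z.im = 0 := by rw [← hDim, h0]; rfl
    have h3 : (g 1 0 : ℝ) = 0 := (mul_eq_zero.mp h2).resolve_right z.im_ne_zero
    rw [h3] at h1 hdet
    simp only [zero_mul, zero_add] at h1
    rw [h1] at hdet
    simp at hdet
  have hpos : 0 < Complex.normSq D := Complex.normSq_pos.mpr hD0
  have hgz : ((g • z : ℍ) : ℂ) = A / D := congrArg UpperHalfPlane.coe h
  have him : (g • z).im = z.im / Complex.normSq D := by
    change ((g • z : ℍ) : ℂ).im = _
    rw [hgz, Complex.div_im, hDre, hDim, hAre, hAim, ← sub_div]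
    congr 1
    linear_combination z.im * hdet
  have hre : (g • z).re = (((g 0 0 : ℝ) * z.re + g 0 1) * (g 1 0 * z.re + g 1 1) +
      g 0 0 * g 1 0 * z.im ^ 2) / Complex.normSq D := by
    change ((g • z : ℍ) : ℂ).re = _
    rw [hgz, Complex.div_re, hDre, hDim, hAre, hAim, ← add_div]
    congr 1
    ring
  refine ⟨Complex.normSq D, hpos, hn, him, hre, ?_⟩
  have : (g • z).re ^ 2 + (g • z).im ^ 2 = Complex.normSq ((g • z : ℍ) : ℂ) := by
    rw [Complex.normSq_apply, sq, sq]; rfl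
  rw [this, hgz, Complex.normSq_div]
  congr 1
  rw [Complex.normSq_apply, hAre, hAim]
  ring

/-- This is `X(g z) = g.X(z)` combined with invariance of the bilinear form, checked in coordinates;
the determinant relation is the only input. -/
theorem pForm_conj : pForm N (conj g X).ra (conj g X).rb (conj g X).rc (g • z).re (g • z).im =
    pForm N X.ra X.rb X.rc z.re z.im := by
  obtain ⟨n, hn, hn', him, hre, hnorm⟩ := smul_im_re g z
  obtain ⟨h1, h2, h3⟩ := conj_entries g X
  have hdet : (g 0 0 : ℝ) * g 1 1 - g 0 1 * g 1 0 = 1 := by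
    have := g.2
    rw [Matrix.det_fin_two] at this
    exact_mod_cast this
  have hy := z.im_ne_zero
  unfold pForm
  rw [hnorm, hre, him, V.ra, V.rb, V.rc, h1, h2, h3]
  push_cast
  rw [show ((X.mat 0 0 : ℚ) : ℝ) = X.ra from rfl, show ((X.mat 0 1 : ℚ) : ℝ) = X.rb from rfl,
    show ((X.mat 1 0 : ℚ) : ℝ) = X.rc from rfl]
  have hn0 := hn.ne'
  field_simp
  rw [hn']
  generalize (g 0 0 : ℝ) = p at *
  generalize (g 0 1 : ℝ) = q at *
  generalize (g 1 0 : ℝ) = r at *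
  generalize (g 1 1 : ℝ) = s at *
  linear_combination √(N : ℝ) * (X.rc * (z.re ^ 2 + z.im ^ 2) - 2 * X.ra * z.re - X.rb) * (p * s - q * r + 1) * hdet

theorem mForm_conj : mForm N (conj g X).ra (conj g X).rb (conj g X).rc (g • z).re (g • z).im =
    mForm N X.ra X.rb X.rc z.re z.im := by
  have h := Q_eq N (conj g X)
  rw [Q_conj, Q_eq] at h
  rw [← mForm_eq N _ _ _ _ (g • z).im_ne_zero, ← mForm_eq N _ _ _ _ z.im_ne_zero, pForm_conj]
  linear_combination -2 * h

theorem phi0_conj : phi0 N (toReal (conj g X)) τ (g • z) = phi0 N (toReal X) τ z := by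
  rw [phi0_eq, phi0_eq, mForm_conj, Q_conj]

theorem lapPhi0_conj : lapPhi0 N (toReal (conj g X)) τ (g • z) = lapPhi0 N (toReal X) τ z := by
  rw [lapPhi0_eq, lapPhi0_eq, mForm_conj, pForm_conj, phi0_conj]

end Equivariance

instance : Countable V :=
  Function.Injective.countable (f := fun X : V => (X.mat 0 0, X.mat 0 1, X.mat 1 0))
    fun X Y h => by
      simp only [Prod.mk.injEq] at h
      exact V.ext_entries h.1 h.2.1 h.2.2

/-! ### Lattices, duals and bounded denominators -/

section Lattice

variable {N : ℕ} {L : Submodule ℤ V}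

theorem exists_smul_mem_lattice (h : Submodule.span ℚ (L : Set V) = ⊤) (X : V) :
    ∃ n : ℕ, 0 < n ∧ (n : ℚ) • X ∈ L := by
  have hX : X ∈ Submodule.span ℚ (L : Set V) := h ▸ Submodule.mem_top
  induction hX using Submodule.span_induction with
  | mem x hx => exact ⟨1, one_pos, by simpa using hx⟩
  | zero => exact ⟨1, one_pos, by simp⟩
  | add x y _ _ hx hy =>
    obtain ⟨n, hn, h1⟩ := hx
    obtain ⟨m, hm, h2⟩ := hy
    refine ⟨n * m, Nat.mul_pos hn hm, ?_⟩
    have e : ((n * m : ℕ) : ℚ) • (x + y) = (m : ℤ) • ((n : ℚ) • x) + (n : ℤ) • ((m : ℚ) • y) := by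
      rw [← Int.cast_smul_eq_zsmul ℚ, ← Int.cast_smul_eq_zsmul ℚ, smul_smul, smul_smul, smul_add]
      push_cast
      rw [mul_comm (n : ℚ) m]
    rw [e]
    exact L.add_mem (L.smul_mem _ h1) (L.smul_mem _ h2)
  | smul a x _ hx =>
    obtain ⟨n, hn, h1⟩ := hx
    refine ⟨n * a.den, Nat.mul_pos hn a.pos, ?_⟩
    have e : ((n * a.den : ℕ) : ℚ) • a • x = a.num • ((n : ℚ) • x) := by
      rw [← Int.cast_smul_eq_zsmul ℚ, smul_smul, smul_smul]
      congr 1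
      push_cast
      rw [mul_assoc, Rat.den_mul_eq_num, mul_comm]
    rw [e]
    exact L.smul_mem _ h1

/-- `M` is a common denominator of the entries of `X`. -/
def HasDenom (M : ℕ) (X : V) : Prop := ∃ a b c : ℤ,
  (M : ℚ) * X.mat 0 0 = a ∧ (M : ℚ) * X.mat 0 1 = b ∧ (M : ℚ) * X.mat 1 0 = c

theorem HasDenom.conj {M : ℕ} {X : V} (h : HasDenom M X) (g : SL(2, ℤ)) : HasDenom M (conj g X) := by
  obtain ⟨a, b, c, h1, h2, h3⟩ := h
  obtain ⟨e1, e2, e3⟩ := conj_entries g X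
  refine ⟨(g 0 0 * g 1 1 + g 0 1 * g 1 0) * a - g 0 0 * g 1 0 * b + g 0 1 * g 1 1 * c,
    -2 * g 0 0 * g 0 1 * a + g 0 0 ^ 2 * b - g 0 1 ^ 2 * c,
    2 * g 1 0 * g 1 1 * a - g 1 0 ^ 2 * b + g 1 1 ^ 2 * c, ?_, ?_, ?_⟩
  · rw [e1]; push_cast; rw [← h1, ← h2, ← h3]; ring
  · rw [e2]; push_cast; rw [← h1, ← h2, ← h3]; ring
  · rw [e3]; push_cast; rw [← h1, ← h2, ← h3]; ring

theorem bil_eq (N : ℕ) (X Y : V) : bil N X Y =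
    N * (2 * X.mat 0 0 * Y.mat 0 0 + X.mat 0 1 * Y.mat 1 0 + X.mat 1 0 * Y.mat 0 1) := by
  simp only [bil, LinearMap.mk₂_apply, Matrix.trace_fin_two, Matrix.mul_apply, Fin.sum_univ_two,
    V.mat_one_one]
  ring

theorem mem_dual_iff {X : V} : X ∈ dual N L ↔ ∀ Y ∈ L, ∃ n : ℤ, bil N X Y = n := by
  rw [dual, LinearMap.BilinForm.mem_dualSubmodule]
  refine forall₂_congr fun Y _ => ?_
  rw [Submodule.mem_one]
  simp only [eq_intCast, eq_comm]

/-- The form is nondegenerate and suitable multiples of a basis of `V` lie in `L`; pairing a dual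
vector with them gives integers, which are its entries up to fixed factors. -/
theorem exists_hasDenom (hN : 0 < N) (hL : Submodule.span ℚ (L : Set V) = ⊤) :
    ∃ M : ℕ, 0 < M ∧ ∀ X ∈ dual N L, HasDenom M X := by
  obtain ⟨Y₁, hY₁⟩ : ∃ Y : V, Y.mat = !![1, 0; 0, -1] :=
    ⟨⟨!![1, 0; 0, -1], by simp [Matrix.trace_fin_two]⟩, rfl⟩
  obtain ⟨Y₂, hY₂⟩ : ∃ Y : V, Y.mat = !![0, 0; 1, 0] :=
    ⟨⟨!![0, 0; 1, 0], by simp [Matrix.trace_fin_two]⟩, rfl⟩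
  obtain ⟨n₁, hn₁, h₁⟩ := exists_smul_mem_lattice hL Y₁
  obtain ⟨n₂, hn₂, h₂⟩ := exists_smul_mem_lattice hL Y₂
  obtain ⟨n₃, hn₃, h₃⟩ := exists_smul_mem_lattice hL u₀
  refine ⟨2 * N * n₁ * n₂ * n₃, by positivity, fun X hX => ?_⟩
  obtain ⟨a, ha⟩ := mem_dual_iff.mp hX _ h₁
  obtain ⟨b, hb⟩ := mem_dual_iff.mp hX _ h₂
  obtain ⟨c, hc⟩ := mem_dual_iff.mp hX _ h₃
  rw [bil_eq, V.mat_smul] at ha hb hc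
  simp [hY₁] at ha
  simp [hY₂] at hb
  simp [u₀_mat] at hc
  refine ⟨n₂ * n₃ * a, 2 * n₁ * n₃ * b, 2 * n₁ * n₂ * c, ?_, ?_, ?_⟩
  · push_cast; rw [← ha]; ring
  · push_cast; rw [← hb]; ring
  · push_cast; rw [← hc]; ring

/-- Polarization: `(X, Y) = Q(X + Y) - Q(X) - Q(Y)`. -/
theorem IsEvenLattice.le_dual (hL : IsEvenLattice N L) : L ≤ dual N L := by
  intro X hX
  refine mem_dual_iff.mpr fun Y hY => ?_
  obtain ⟨a, ha⟩ := hL.even X hX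
  obtain ⟨b, hb⟩ := hL.even Y hY
  obtain ⟨c, hc⟩ := hL.even _ (L.add_mem hX hY)
  refine ⟨c - a - b, ?_⟩
  have h1 := bil_self N (X + Y)
  simp only [map_add, LinearMap.add_apply, bil_self, bil_comm N Y X] at h1
  push_cast
  linarith

theorem bil_conj (g : SL(2, ℤ)) (X Y : V) : bil N (conj g X) (conj g Y) = bil N X Y := by
  have h1 := bil_self N (conj g (X + Y))
  have h2 := bil_self N (X + Y)
  rw [Q_conj] at h1
  simp only [map_add, LinearMap.add_apply, bil_self, bil_comm N Y X,
    bil_comm N (conj g Y) (conj g X), Q_conj] at h1 h2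
  linarith

/-- The coset of `L` in `L'` corresponding to `h`. -/
abbrev CosetIdx (N : ℕ) (L : Submodule ℤ V) (h : Disc N L) : Type :=
  {X : ↥(dual N L) // Submodule.Quotient.mk (p := L.submoduleOf (dual N L)) X = h}

end Lattice

/-! ### Summable majorants for theta series -/

section Weight

/-- A summable weight on vectors with bounded denominators. -/
def weight (M : ℕ) (X : V) : ℝ :=
  (1 / (1 + (M * X.ra) ^ 2)) * (1 / (1 + (M * X.rb) ^ 2)) * (1 / (1 + (M * X.rc) ^ 2))

theorem weight_nonneg (M : ℕ) (X : V) : 0 ≤ weight M X := by unfold weight; positivity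

theorem summable_one_div_one_add_sq : Summable fun n : ℤ => 1 / (1 + (n : ℝ) ^ 2) := by
  have h1 : Summable fun n : ℤ => 1 / (n : ℝ) ^ 2 := Real.summable_one_div_int_pow.mpr one_lt_two
  have h2 : Summable fun n : ℤ => (if n = 0 then 1 else 0 : ℝ) := (hasSum_ite_eq 0 1).summable
  refine (h1.add h2).of_nonneg_of_le (fun n => by positivity) fun n => ?_
  split_ifs with h
  · simp [h]
  · have : 0 < (n : ℝ) ^ 2 := by positivity
    rw [add_zero]
    gcongr
    linarith

theorem summable_weight {M : ℕ} (hM : 0 < M) {ι : Type*} {X : ι → V} (hX : Function.Injective X)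
    (hd : ∀ i, HasDenom M (X i)) : Summable fun i => weight M (X i) := by
  choose a b c h1 h2 h3 using hd
  have hM0 : (M : ℚ) ≠ 0 := by exact_mod_cast hM.ne'
  have hinj : Function.Injective fun i => ((a i, b i), c i) := by
    intro i j hij
    simp only [Prod.mk.injEq] at hij
    obtain ⟨⟨e1, e2⟩, e3⟩ := hij
    apply hX
    apply V.ext_entries
    · exact mul_left_cancel₀ hM0 (by rw [h1, h1, e1])
    · exact mul_left_cancel₀ hM0 (by rw [h2, h2, e2])
    · exact mul_left_cancel₀ hM0 (by rw [h3, h3, e3])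
  have hs := summable_one_div_one_add_sq
  have hnn : (0 : ℤ → ℝ) ≤ fun n : ℤ => 1 / (1 + (n : ℝ) ^ 2) := fun n => by
    simp only [Pi.zero_apply]; positivity
  have hs2 := hs.mul_of_nonneg hs hnn hnn
  have hs3 := hs2.mul_of_nonneg hs (fun p => by simp only [Pi.zero_apply]; positivity) hnn
  refine (hs3.comp_injective hinj).congr fun i => ?_
  simp only [Function.comp, weight, V.ra, V.rb, V.rc]
  have e : ∀ {q : ℚ} {n : ℤ}, (M : ℚ) * q = n → (M : ℝ) * (q : ℝ) = n := fun h => by exact_mod_cast h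
  rw [e (h1 i), e (h2 i), e (h3 i)]

/-- In the region `|x| ≤ R`, `y ≥ y₀` the ratio `x / y` is bounded by `ρ = R / y₀`, so the change of
variables from `(A, Z, B)` to `(a, c y, b / y)` has bounded coefficients, uniformly as `y → ∞`. -/
theorem sq_le_mForm {N : ℕ} (hN : 0 < N) (R : ℝ) {y₀ : ℝ} (hy₀ : 0 < y₀) : ∃ C : ℝ, 0 < C ∧
    ∀ a b c x y : ℝ, |x| ≤ R → y₀ ≤ y →
      a ^ 2 + (c * y) ^ 2 + (b / y) ^ 2 ≤ C * mForm N a b c x y := by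
  have hN1 : (1 : ℝ) ≤ N := by exact_mod_cast hN
  set ρ := R / y₀ with hρ
  refine ⟨2 * (1 + 12 * ρ ^ 2) * (1 + ρ ^ 2) + 4 + 3 * ρ ^ 4, by positivity,
    fun a b c x y hx hy => ?_⟩
  have hy0 : 0 < y := hy₀.trans_le hy
  have hR : 0 ≤ R := (abs_nonneg x).trans hx
  set r := x / y with hr
  have hr1 : r ^ 2 ≤ ρ ^ 2 := by
    rw [← sq_abs r, hr, abs_div, abs_of_pos hy0, hρ]
    gcongr
  set A := a - x * c with hA
  set B := (b + 2 * x * a - x ^ 2 * c) / y with hB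
  set Z := c * y with hZ
  have ha : a = A + r * Z := by rw [hA, hr, hZ]; field_simp; ring
  have hb : b / y = B - 2 * r * a + r ^ 2 * Z := by rw [hB, hr, hZ]; field_simp; ring
  have hm : A ^ 2 + Z ^ 2 + B ^ 2 ≤ mForm N a b c x y := by
    unfold mForm
    rw [← hA, ← hB, ← hZ]
    nlinarith [sq_nonneg A, sq_nonneg B, sq_nonneg Z]
  have ha2 : a ^ 2 ≤ 2 * A ^ 2 + 2 * ρ ^ 2 * Z ^ 2 := by
    have : a ^ 2 ≤ 2 * A ^ 2 + 2 * r ^ 2 * Z ^ 2 := by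
      rw [ha]; nlinarith [sq_nonneg (A - r * Z)]
    nlinarith [sq_nonneg Z]
  have hb2 : (b / y) ^ 2 ≤ 3 * B ^ 2 + 12 * ρ ^ 2 * a ^ 2 + 3 * ρ ^ 4 * Z ^ 2 := by
    have h1 : (b / y) ^ 2 ≤ 3 * B ^ 2 + 12 * r ^ 2 * a ^ 2 + 3 * r ^ 4 * Z ^ 2 := by
      rw [hb]
      nlinarith [sq_nonneg (B + 2 * r * a), sq_nonneg (B - r ^ 2 * Z),
        sq_nonneg (2 * r * a + r ^ 2 * Z)]
    have h2 : r ^ 4 ≤ ρ ^ 4 := by nlinarith [sq_nonneg r, sq_nonneg ρ]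
    nlinarith [sq_nonneg Z, sq_nonneg a]
  have key : a ^ 2 + Z ^ 2 + (b / y) ^ 2 ≤
      (2 * (1 + 12 * ρ ^ 2) * (1 + ρ ^ 2) + 4 + 3 * ρ ^ 4) * (A ^ 2 + Z ^ 2 + B ^ 2) := by
    have h3 : (1 + 12 * ρ ^ 2) * a ^ 2 ≤ (1 + 12 * ρ ^ 2) * (2 * A ^ 2 + 2 * ρ ^ 2 * Z ^ 2) := by
      gcongr
    have : 0 ≤ ρ ^ 2 := sq_nonneg ρ
    have h4 : 0 ≤ ρ ^ 4 := by positivity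
    have h5 : a ^ 2 + Z ^ 2 + (b / y) ^ 2 ≤
        (1 + 12 * ρ ^ 2) * (2 * A ^ 2 + 2 * ρ ^ 2 * Z ^ 2) + Z ^ 2 + 3 * B ^ 2 + 3 * ρ ^ 4 * Z ^ 2 := by
      linarith
    refine h5.trans ?_
    have p1 := sq_nonneg A
    have p2 := sq_nonneg Z
    have p3 := sq_nonneg B
    have q1 := mul_nonneg this p1
    have q2 := mul_nonneg this p2
    have q3 := mul_nonneg this p3
    have q4 := mul_nonneg h4 p1
    have q5 := mul_nonneg h4 p3
    have q6 := mul_nonneg h4 p2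
    nlinarith
  exact key.trans (by gcongr)

theorem one_add_le_mul_exp {s t : ℝ} (ht : 0 ≤ t) (hs : 0 ≤ s) : 1 + s * t ≤ (1 + s) * Real.exp t := by
  have h1 := Real.add_one_le_exp t
  nlinarith [Real.one_le_exp ht]

/-- Each of three Gaussian factors is bounded via `e^{-t} ≤ (1 + s)/(1 + s t)` by a factor of the
weight. The factor in `b / y` is the only one to deteriorate as `y` grows, which accounts for `1 +
y²`. -/
theorem exp_mForm_le {N : ℕ} (hN : 0 < N) (M : ℕ) {k : ℝ} (hk : 0 < k) (R : ℝ) {y₀ : ℝ}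
    (hy₀ : 0 < y₀) : ∃ K : ℝ, 0 ≤ K ∧ ∀ (X : V) (x y : ℝ), |x| ≤ R → y₀ ≤ y →
      Real.exp (-k * mForm N X.ra X.rb X.rc x y) ≤ K * (1 + y ^ 2) * weight M X := by
  obtain ⟨C, hC, h⟩ := sq_le_mForm hN R hy₀
  set l := k / C with hl
  have hl0 : 0 < l := by positivity
  refine ⟨(1 + M ^ 2 / l) * (1 + M ^ 2 / (l * y₀ ^ 2)) * (1 + M ^ 2 / l), by positivity,
    fun X x y hx hy => ?_⟩
  have hy0 : 0 < y := hy₀.trans_le hy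
  have h1 := h X.ra X.rb X.rc x y hx hy
  have h2 : Real.exp (-k * mForm N X.ra X.rb X.rc x y) ≤
      Real.exp (-(l * X.ra ^ 2)) * Real.exp (-(l * (X.rc * y) ^ 2)) * Real.exp (-(l * (X.rb / y) ^ 2)) := by
    rw [← Real.exp_add, ← Real.exp_add, Real.exp_le_exp]
    have : l * (X.ra ^ 2 + (X.rc * y) ^ 2 + (X.rb / y) ^ 2) ≤ k * mForm N X.ra X.rb X.rc x y := by
      calc _ ≤ l * (C * mForm N X.ra X.rb X.rc x y) := by gcongr
        _ = _ := by rw [hl]; field_simp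
    linarith
  have aux : ∀ (s t : ℝ), 0 ≤ s → 0 ≤ t → Real.exp (-t) ≤ (1 + s) * (1 / (1 + s * t)) := by
    intro s t hs ht
    rw [mul_one_div, le_div_iff₀ (by positivity), Real.exp_neg, inv_mul_le_iff₀ (Real.exp_pos _)]
    rw [mul_comm (Real.exp t)]
    exact one_add_le_mul_exp ht hs
  have e1 := aux (M ^ 2 / l) (l * X.ra ^ 2) (by positivity) (by positivity)
  have e2 := aux (M ^ 2 / (l * y ^ 2)) (l * (X.rc * y) ^ 2) (by positivity) (by positivity)
  have e3 := aux (M ^ 2 * y ^ 2 / l) (l * (X.rb / y) ^ 2) (by positivity) (by positivity)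
  rw [show (M : ℝ) ^ 2 / l * (l * X.ra ^ 2) = (M * X.ra) ^ 2 by field_simp] at e1
  rw [show (M : ℝ) ^ 2 / (l * y ^ 2) * (l * (X.rc * y) ^ 2) = (M * X.rc) ^ 2 by field_simp] at e2
  rw [show (M : ℝ) ^ 2 * y ^ 2 / l * (l * (X.rb / y) ^ 2) = (M * X.rb) ^ 2 by field_simp] at e3
  have e2' : Real.exp (-(l * (X.rc * y) ^ 2)) ≤
      (1 + M ^ 2 / (l * y₀ ^ 2)) * (1 / (1 + (M * X.rc) ^ 2)) := by
    refine e2.trans ?_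
    gcongr
  have e3' : Real.exp (-(l * (X.rb / y) ^ 2)) ≤
      ((1 + M ^ 2 / l) * (1 + y ^ 2)) * (1 / (1 + (M * X.rb) ^ 2)) := by
    refine e3.trans ?_
    gcongr
    have : 0 ≤ (M : ℝ) ^ 2 / l := by positivity
    rw [mul_div_right_comm]
    nlinarith [sq_nonneg y]
  refine h2.trans ((mul_le_mul (mul_le_mul e1 e2' (Real.exp_pos _).le (by positivity)) e3'
    (Real.exp_pos _).le (by positivity)).trans (le_of_eq ?_))
  unfold weight
  ring

end Weight

/-! ### Convergence, continuity and invariance of the theta kernels -/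

section Theta

variable {N : ℕ} {L : Submodule ℤ V} {φ : Matrix (Fin 2) (Fin 2) ℝ → ℍ → ℍ → ℂ}

theorem kernel_norm_le (hφ : φ = phi0 N ∨ φ = lapPhi0 N) (X : V) (τ z : ℍ) :
    ‖φ (toReal X) τ z‖ ≤
      152 * √τ.im * Real.exp (-(Real.pi * τ.im / 2) * mForm N X.ra X.rb X.rc z.re z.im) := by
  rcases hφ with rfl | rfl
  · rw [norm_phi0]
    have h1 : Real.exp (-(Real.pi * τ.im) * mForm N X.ra X.rb X.rc z.re z.im) ≤
        Real.exp (-(Real.pi * τ.im / 2) * mForm N X.ra X.rb X.rc z.re z.im) := by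
      rw [Real.exp_le_exp]
      have := mForm_nonneg N X.ra X.rb X.rc z.re z.im
      have h2 := mul_pos Real.pi_pos τ.im_pos
      nlinarith
    have h2 : √τ.im ≤ 152 * √τ.im := by linarith [Real.sqrt_nonneg τ.im]
    exact mul_le_mul h2 h1 (Real.exp_pos _).le (by positivity)
  · exact norm_lapPhi0_le N X τ z

theorem kernel_conj (hφ : φ = phi0 N ∨ φ = lapPhi0 N) (g : SL(2, ℤ)) (X : V) (τ z : ℍ) :
    φ (toReal (conj g X)) τ (g • z) = φ (toReal X) τ z := by
  rcases hφ with rfl | rfl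
  · exact phi0_conj N g X τ z
  · exact lapPhi0_conj N g X τ z

theorem continuous_kernel (hφ : φ = phi0 N ∨ φ = lapPhi0 N) (X : V) (τ : ℍ) :
    Continuous (φ (toReal X) τ) := by
  rcases hφ with rfl | rfl
  · exact (isC2_phi0 N X τ).continuous
  · exact continuous_hypLaplacian (isC2_phi0 N X τ)

theorem kernel_norm_le_weight (hN : 0 < N) (hφ : φ = phi0 N ∨ φ = lapPhi0 N) (M : ℕ) (τ : ℍ)
    (R : ℝ) {y₀ : ℝ} (hy₀ : 0 < y₀) : ∃ K : ℝ, 0 ≤ K ∧ ∀ (X : V) (z : ℍ), |z.re| ≤ R → y₀ ≤ z.im →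
      ‖φ (toReal X) τ z‖ ≤ K * (1 + z.im ^ 2) * weight M X := by
  obtain ⟨K, hK, h⟩ := exp_mForm_le hN M (k := Real.pi * τ.im / 2)
    (half_pos (mul_pos Real.pi_pos τ.im_pos)) R hy₀
  refine ⟨152 * √τ.im * K, by positivity, fun X z h1 h2 => ?_⟩
  refine (kernel_norm_le hφ X τ z).trans ?_
  calc _ ≤ 152 * √τ.im * (K * (1 + z.im ^ 2) * weight M X) := by
        gcongr; exact h X _ _ h1 h2
    _ = _ := by ring

theorem theta_smul (hφ : φ = phi0 N ∨ φ = lapPhi0 N) (h : Disc N L) (g : SL(2, ℤ)) (τ z : ℍ) :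
    theta N L φ h τ (g • z) = ∑' X : CosetIdx N L h, φ (toReal (conj g⁻¹ (X.1 : V))) τ z := by
  refine tsum_congr fun X => ?_
  rw [← kernel_conj hφ g (conj g⁻¹ _), conj_conj_inv]

theorem cosetIdx_injective (h : Disc N L) (g : SL(2, ℤ)) :
    Function.Injective fun X : CosetIdx N L h => conj g (X.1 : V) :=
  (conj_injective g).comp (Subtype.val_injective.comp Subtype.val_injective)

theorem summable_kernel (hN : 0 < N) (hL : Submodule.span ℚ (L : Set V) = ⊤)
    (hφ : φ = phi0 N ∨ φ = lapPhi0 N) (h : Disc N L) (g : SL(2, ℤ)) (τ z : ℍ) :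
    Summable fun X : CosetIdx N L h => φ (toReal (conj g (X.1 : V))) τ z := by
  obtain ⟨M, hM, hd⟩ := exists_hasDenom hN hL
  obtain ⟨K, hK, hb⟩ := kernel_norm_le_weight hN hφ M τ |z.re| z.im_pos
  exact Summable.of_norm_bounded ((summable_weight hM (cosetIdx_injective h g)
    fun X => (hd _ X.1.2).conj g).mul_left (K * (1 + z.im ^ 2)))
    fun X => hb _ z le_rfl le_rfl

theorem continuous_theta (hN : 0 < N) (hL : Submodule.span ℚ (L : Set V) = ⊤)
    (hφ : φ = phi0 N ∨ φ = lapPhi0 N) (h : Disc N L) (τ : ℍ) : Continuous (theta N L φ h τ) := by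
  obtain ⟨M, hM, hd⟩ := exists_hasDenom hN hL
  rw [continuous_iff_continuousAt]
  intro z
  obtain ⟨K, hK, hb⟩ := kernel_norm_le_weight hN hφ M τ (|z.re| + 1) (half_pos z.im_pos)
  set O : Set ℍ := {w | |w.re| < |z.re| + 1 ∧ z.im / 2 < w.im ∧ w.im < 2 * z.im} with hO
  have hOo : IsOpen O := (isOpen_lt (continuous_abs.comp continuous_re) continuous_const).inter
    ((isOpen_lt continuous_const continuous_im).inter (isOpen_lt continuous_im continuous_const))
  have hz : z ∈ O := ⟨by linarith, by linarith [z.im_pos], by linarith [z.im_pos]⟩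
  refine ContinuousOn.continuousAt (s := O) ?_ (hOo.mem_nhds hz)
  refine continuousOn_tsum (u := fun X : CosetIdx N L h =>
    K * (1 + (2 * z.im) ^ 2) * weight M (conj 1 (X.1 : V)))
    (fun X => (continuous_kernel hφ _ τ).continuousOn) ?_ ?_
  · exact (summable_weight hM (cosetIdx_injective h 1) fun X => (hd _ X.1.2).conj 1).mul_left _
  · intro X w hw
    rw [conj_one]
    refine (hb _ w hw.1.le hw.2.1.le).trans ?_
    have := weight_nonneg M (X.1 : V)
    have := w.im_pos
    gcongr
    exact hw.2.2.le

/-- Since `Γ` acts trivially on `L'/L`, each `γ` permutes the vectors of the coset `h + L`. -/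
theorem theta_invariant (hL : IsEvenLattice N L) (hφ : φ = phi0 N ∨ φ = lapPhi0 N)
    {Γ : Subgroup SL(2, ℤ)} (hΓ : ActsTrivially N L Γ) (h : Disc N L) {γ : SL(2, ℤ)} (hγ : γ ∈ Γ)
    (τ z : ℍ) : theta N L φ h τ (γ • z) = theta N L φ h τ z := by
  have key : ∀ γ ∈ Γ, ∀ X : CosetIdx N L h, ∃ hX : conj γ (X.1 : V) ∈ dual N L,
      Submodule.Quotient.mk (p := L.submoduleOf (dual N L)) ⟨conj γ (X.1 : V), hX⟩ = h := by
    intro γ hγ X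
    have h1 := (hΓ γ hγ).2 _ X.1.2
    have h2 : conj γ (X.1 : V) ∈ dual N L := by
      have := (dual N L).add_mem (hL.le_dual h1) X.1.2
      rwa [sub_add_cancel] at this
    refine ⟨h2, ?_⟩
    refine Eq.trans ?_ X.2
    rw [Submodule.Quotient.eq]
    exact h1
  let e : CosetIdx N L h ≃ CosetIdx N L h :=
    { toFun := fun X => ⟨⟨conj γ⁻¹ (X.1 : V), (key _ (Γ.inv_mem hγ) X).1⟩, (key _ (Γ.inv_mem hγ) X).2⟩
      invFun := fun X => ⟨⟨conj γ (X.1 : V), (key _ hγ X).1⟩, (key _ hγ X).2⟩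
      left_inv := fun X => Subtype.ext (Subtype.ext (conj_conj_inv γ _))
      right_inv := fun X => Subtype.ext (Subtype.ext (conj_inv_conj γ _)) }
  rw [theta_smul hφ]
  exact e.tsum_eq fun X => φ (toReal (X.1 : V)) τ z

/-- `Δ` may be moved from the test function to the Gaussian in the theta kernel. -/
theorem integral_mul_theta_lap (hN : 0 < N) (hL : Submodule.span ℚ (L : Set V) = ⊤) (h : Disc N L)
    (τ : ℍ) {η : ℍ → ℂ} (hη : IsC2 η) (hc : HasCompactSupport η) :
    ∫ z, η z * theta N L (lapPhi0 N) h τ z = ∫ z, hypLaplacian η z * theta N L (phi0 N) h τ z := by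
  obtain ⟨M, hM, hd⟩ := exists_hasDenom hN hL
  have hcomp : IsCompact (tsupport η) := hc
  have hlc : Continuous (hypLaplacian η) := continuous_hypLaplacian hη
  have hls : Function.support (hypLaplacian η) ⊆ tsupport η := by
    intro z hz
    by_contra hn
    refine hz ?_
    have : ∀ᶠ w in 𝓝 z, η w = (fun _ => (0 : ℂ)) w := by
      filter_upwards [(isClosed_tsupport η).isOpen_compl.mem_nhds hn] with w hw
      exact image_eq_zero_of_notMem_tsupport hw
    rw [hypLaplacian_congr this]
    simp [hypLaplacian, laplacian_apply]
  -- On the compact support of `η` the weight majorizes the kernel uniformly, so sum and integral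
  -- may be interchanged; the claim then reduces to symmetry of `Δ` for each single vector.
  have swap : ∀ (u : ℍ → ℂ) (φ : Matrix (Fin 2) (Fin 2) ℝ → ℍ → ℍ → ℂ),
      (φ = phi0 N ∨ φ = lapPhi0 N) → Continuous u → Function.support u ⊆ tsupport η →
      ∫ z, u z * theta N L φ h τ z = ∑' X : CosetIdx N L h, ∫ z, u z * φ (toReal (X.1 : V)) τ z := by
    intro u φ hφ hu hs
    have hcu : HasCompactSupport u := hc.mono' hs
    obtain ⟨R, hR⟩ := (hcomp.image continuous_re).isBounded.subset_closedBall 0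
    obtain ⟨y₀, hy₀, hy₀'⟩ : ∃ y₀ : ℝ, 0 < y₀ ∧ ∀ z ∈ tsupport η, y₀ ≤ z.im := by
      rcases (tsupport η).eq_empty_or_nonempty with he | hne
      · exact ⟨1, one_pos, by simp [he]⟩
      · obtain ⟨w, hw, hmin⟩ := hcomp.exists_isMinOn hne continuous_im.continuousOn
        exact ⟨w.im, w.im_pos, fun z hz => hmin hz⟩
    obtain ⟨K, hK, hb⟩ := kernel_norm_le_weight hN hφ M τ R hy₀
    have hint : Integrable fun z : ℍ => ‖u z‖ * (K * (1 + z.im ^ 2)) :=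
      (Continuous.integrable_of_hasCompactSupport (by fun_prop) (hcu.norm.mul_right))
    have hbound : ∀ (X : CosetIdx N L h) z, ‖u z * φ (toReal (X.1 : V)) τ z‖ ≤
        ‖u z‖ * (K * (1 + z.im ^ 2)) * weight M (X.1 : V) := by
      intro X z
      rw [norm_mul]
      by_cases hz : u z = 0
      · simp [hz]
      · have hz' := hs hz
        rw [mul_assoc]
        refine mul_le_mul_of_nonneg_left (hb _ z ?_ (hy₀' z hz')) (norm_nonneg _)
        have := hR (Set.mem_image_of_mem _ hz')
        simpa using this
    have hsw : Summable fun X : CosetIdx N L h => weight M (X.1 : V) := by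
      have := summable_weight hM (cosetIdx_injective h 1) fun X => (hd _ X.1.2).conj 1
      simpa [conj_one] using this
    have : Countable (CosetIdx N L h) :=
      (Subtype.val_injective.comp Subtype.val_injective : Function.Injective
        fun X : CosetIdx N L h => (X.1 : V)).countable
    simp only [theta, ← tsum_mul_left]
    refine (integral_tsum_of_summable_integral_norm (fun X => ?_) ?_).symm
    · exact Continuous.integrable_of_hasCompactSupport (hu.mul (continuous_kernel hφ _ τ)) hcu.mul_right
    · refine (hsw.mul_left (∫ z, ‖u z‖ * (K * (1 + z.im ^ 2)))).of_nonneg_of_le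
        (fun X => integral_nonneg fun z => norm_nonneg _) fun X => ?_
      rw [← integral_mul_const]
      exact integral_mono_of_nonneg (Filter.Eventually.of_forall fun z => norm_nonneg _)
        (hint.mul_const _) (Filter.Eventually.of_forall (hbound X))
  rw [swap _ _ (Or.inr rfl) hη.continuous (subset_tsupport η), swap _ _ (Or.inl rfl) hlc hls]
  exact tsum_congr fun X => integral_mul_hypLaplacian hη hc (isC2_phi0 N _ τ)

end Theta

/-! ### The constant `β` and the orthogonal complement of an isotropic line -/

section Beta

variable {N : ℕ} {L : Submodule ℤ V}

/-- Bounded denominators make the set of `q` with `q g u₀ ∈ L` a discrete nonzero subgroup of `ℚ`.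
It is therefore generated by its least positive element, and the real infimum defining `β` is
attained. -/
theorem cuspBeta_spec (hN : 0 < N) (hL : IsEvenLattice N L) (g : SL(2, ℤ)) :
    ∃ β : ℚ, 0 < β ∧ cuspBeta L g = β ∧ β • conj g u₀ ∈ L ∧
      ∀ q : ℚ, q • conj g u₀ ∈ L → ∃ n : ℤ, q = n * β := by
  obtain ⟨M, hM, hd⟩ := exists_hasDenom hN hL.span_eq_top
  have hM0 : (M : ℚ) ≠ 0 := by exact_mod_cast hM.ne'
  have hMp : (0 : ℚ) < M := by exact_mod_cast hM
  have hint : ∀ q : ℚ, q • conj g u₀ ∈ L → ∃ k : ℤ, (M : ℚ) * q = k := by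
    intro q hq
    obtain ⟨-, b, -, -, hb, -⟩ := (hd _ (hL.le_dual hq)).conj g⁻¹
    rw [map_smul, conj_inv_conj, V.mat_smul, u₀_mat] at hb
    exact ⟨b, by simpa using hb⟩
  obtain ⟨n, hn, hnL⟩ := exists_smul_mem_lattice hL.span_eq_top (conj g u₀)
  set S : Set ℕ := {k | 0 < k ∧ ((k : ℚ) / M) • conj g u₀ ∈ L} with hS
  have hne : S.Nonempty := by
    refine ⟨n * M, Nat.mul_pos hn hM, ?_⟩
    rwa [Nat.cast_mul, mul_div_assoc, div_self hM0, mul_one]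
  obtain ⟨hpos, hmem⟩ := Nat.sInf_mem hne
  set k₀ := sInf S with hk₀
  have hk₀p : (0 : ℚ) < k₀ := by exact_mod_cast hpos
  have hgen : ∀ q : ℚ, q • conj g u₀ ∈ L → ∃ n : ℤ, q = n * ((k₀ : ℚ) / M) := by
    intro q hq
    obtain ⟨k, hk⟩ := hint q hq
    have h0 : 0 ≤ k % k₀ := Int.emod_nonneg _ (by positivity)
    have h1 : k % k₀ < k₀ := Int.emod_lt_of_pos _ (by exact_mod_cast hpos)
    have hq' : q = k / M := by rw [← hk]; field_simp
    have h2 : ((((k % k₀).toNat : ℕ) : ℚ) / M) • conj g u₀ ∈ L := by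
      have e : (((k % k₀).toNat : ℕ) : ℚ) = ((k % k₀ : ℤ) : ℚ) := by
        exact_mod_cast congrArg (fun z : ℤ => (z : ℚ)) (Int.toNat_of_nonneg h0)
      have e2 : ((k % k₀ : ℤ) : ℚ) / M = q - ((k / k₀ : ℤ) : ℚ) * ((k₀ : ℚ) / M) := by
        rw [Int.emod_def, hq']; push_cast; ring
      rw [e, e2, sub_smul, mul_smul, Int.cast_smul_eq_zsmul]
      exact L.sub_mem hq (L.smul_mem _ hmem)
    have h3 : (k % k₀).toNat = 0 := by
      by_contra hne0
      have := Nat.sInf_le (s := S) ⟨Nat.pos_of_ne_zero hne0, h2⟩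
      rw [← hk₀] at this
      omega
    have h4 : k % k₀ = 0 := by omega
    refine ⟨k / k₀, ?_⟩
    have h5 : (k : ℚ) = ((k / k₀ : ℤ) : ℚ) * k₀ := by
      have := Int.ediv_mul_add_emod k k₀
      rw [h4, add_zero] at this
      exact_mod_cast this.symm
    rw [hq', h5]
    ring
  refine ⟨(k₀ : ℚ) / M, by positivity, ?_, hmem, hgen⟩
  refine IsLeast.csInf_eq ⟨⟨by positivity, _, rfl, hmem⟩, ?_⟩
  rintro r ⟨hr, q, rfl, hq⟩
  obtain ⟨n, rfl⟩ := hgen q hq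
  have hn : 0 < n := by
    have h6 : (0 : ℚ) < n * ((k₀ : ℚ) / M) := by exact_mod_cast hr
    have h7 : (0 : ℚ) < n := (pos_iff_pos_of_mul_pos h6).mpr (by positivity)
    exact_mod_cast h7
  have hn1 : (1 : ℚ) ≤ n := by exact_mod_cast hn
  have h8 : (k₀ : ℚ) / M ≤ n * ((k₀ : ℚ) / M) := le_mul_of_one_le_left (by positivity) hn1
  exact_mod_cast h8

theorem mem_map_ℓ₀ {g : SL(2, ℤ)} {X : V} :
    X ∈ ℓ₀.map (conj g) ↔ ∃ q : ℚ, X = q • conj g u₀ := by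
  rw [ℓ₀, Submodule.map_span, Set.image_singleton, Submodule.mem_span_singleton]
  simp only [eq_comm]

/-- Pairing with `g u₀` reads off `N` times the lower left entry after pulling back by `g`. -/
theorem mem_perp_iff (hN : 0 < N) {g : SL(2, ℤ)} {X : V} :
    X ∈ perp N (ℓ₀.map (conj g)) ↔ (conj g⁻¹ X).mat 1 0 = 0 := by
  have hN0 : (N : ℚ) ≠ 0 := by exact_mod_cast hN.ne'
  have key : bil N (conj g u₀) X = N * (conj g⁻¹ X).mat 1 0 := by
    conv_lhs => rw [← conj_conj_inv g X]
    rw [bil_conj, bil_eq, u₀_mat]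
    simp
  rw [perp, LinearMap.BilinForm.mem_orthogonal_iff]
  constructor
  · intro h
    have := h _ (mem_map_ℓ₀.mpr ⟨1, (one_smul _ _).symm⟩)
    rw [key] at this
    exact (mul_eq_zero.mp this).resolve_left hN0
  · intro h Y hY
    obtain ⟨q, rfl⟩ := mem_map_ℓ₀.mp hY
    rw [map_smul, LinearMap.smul_apply, key, h]
    simp

end Beta

/-! ### The unary theta series and vectors orthogonal to an isotropic line -/

section Unary

variable {N : ℕ} {L : Submodule ℤ V} (g : SL(2, ℤ)) (h : Disc N L)

/-- The index set of the unary theta series. -/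
abbrev UnaryIdx (N : ℕ) (L : Submodule ℤ V) (ℓ : Submodule ℚ V) (h : Disc N L) : Type :=
  {lam : W N ℓ // ∃ X : ↥(perp N ℓ), ∃ hX : (X : V) ∈ dual N L,
      Submodule.Quotient.mk (p := L.submoduleOf (dual N L)) ⟨X, hX⟩ = h ∧
      Submodule.Quotient.mk X = lam}

/-- A representative of an element of the index set of the unary theta series. -/
def unaryRep {ℓ : Submodule ℚ V} (lam : UnaryIdx N L ℓ h) : ↥(perp N ℓ) := lam.2.choose

theorem unaryRep_spec {ℓ : Submodule ℚ V} (lam : UnaryIdx N L ℓ h) :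
    ∃ hX : (unaryRep h lam : V) ∈ dual N L,
      Submodule.Quotient.mk (p := L.submoduleOf (dual N L)) ⟨unaryRep h lam, hX⟩ = h ∧
      Submodule.Quotient.mk (unaryRep h lam) = lam.1 := lam.2.choose_spec

theorem QW_unaryRep {ℓ : Submodule ℚ V} (lam : UnaryIdx N L ℓ h) :
    QW N ℓ lam.1 = Q N (unaryRep h lam : V) := by
  rw [← (unaryRep_spec h lam).2.2]
  rfl

/-- The vectors of the coset orthogonal to the isotropic line. -/
abbrev PerpIdx (g : SL(2, ℤ)) (h : Disc N L) : Type :=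
  {X : CosetIdx N L h // (conj g⁻¹ (X.1 : V)).mat 1 0 = 0}

/-- The vectors of `h + L` orthogonal to the line fibre over the coset `h̄ + K_ℓ`, and each fibre is
a translate of `L ∩ ℓ = ℤ β g u₀`. This splits the orthogonal part of the theta series into a unary
sum and a one-dimensional Gaussian sum. -/
theorem exists_perp_equiv (hN : 0 < N) (hL : IsEvenLattice N L) {β : ℚ} (hβ : 0 < β)
    (hmem : β • conj g u₀ ∈ L) (hgen : ∀ q : ℚ, q • conj g u₀ ∈ L → ∃ n : ℤ, q = n * β) :
    ∃ e : UnaryIdx N L (ℓ₀.map (conj g)) h × ℤ ≃ PerpIdx g h, ∀ p,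
      ((e p).1.1 : V) = unaryRep h p.1 + (p.2 * β : ℚ) • conj g u₀ := by
  have hmul : ∀ n : ℤ, (n * β : ℚ) • conj g u₀ ∈ L := fun n => by
    rw [mul_smul, Int.cast_smul_eq_zsmul]
    exact L.smul_mem _ hmem
  have hdual : ∀ p : UnaryIdx N L (ℓ₀.map (conj g)) h × ℤ,
      (unaryRep h p.1 : V) + (p.2 * β : ℚ) • conj g u₀ ∈ dual N L := fun p =>
    (dual N L).add_mem (unaryRep_spec h p.1).1 (hL.le_dual (hmul p.2))
  have hmk : ∀ p : UnaryIdx N L (ℓ₀.map (conj g)) h × ℤ,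
      Submodule.Quotient.mk (p := L.submoduleOf (dual N L)) ⟨_, hdual p⟩ = h := fun p => by
    obtain ⟨hX, h1, -⟩ := unaryRep_spec h p.1
    refine Eq.trans ?_ h1
    rw [Submodule.Quotient.eq]
    change (unaryRep h p.1 : V) + (p.2 * β : ℚ) • conj g u₀ - unaryRep h p.1 ∈ L
    rw [add_sub_cancel_left]
    exact hmul p.2
  have hperp : ∀ p : UnaryIdx N L (ℓ₀.map (conj g)) h × ℤ,
      (conj g⁻¹ ((unaryRep h p.1 : V) + (p.2 * β : ℚ) • conj g u₀)).mat 1 0 = 0 := fun p => by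
    have h1 := (mem_perp_iff hN).mp (unaryRep h p.1).2
    rw [map_add, map_smul, conj_inv_conj, V.mat_add, V.mat_smul, u₀_mat]
    simp [h1]
  have hu0 : conj g u₀ ≠ 0 := fun h0 => u₀_ne_zero (conj_injective g (by rw [h0, map_zero]))
  set F : UnaryIdx N L (ℓ₀.map (conj g)) h × ℤ → PerpIdx g h :=
    fun p => ⟨⟨⟨_, hdual p⟩, hmk p⟩, hperp p⟩ with hF
  have hbij : Function.Bijective F := by
    constructor
    · rintro ⟨l, n⟩ ⟨l', n'⟩ hll
      have h1 : (unaryRep h l : V) + (n * β : ℚ) • conj g u₀ =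
          unaryRep h l' + (n' * β : ℚ) • conj g u₀ :=
        congrArg (fun X : PerpIdx g h => (X.1.1 : V)) hll
      have hl : l = l' := by
        apply Subtype.ext
        rw [← (unaryRep_spec h l).2.2, ← (unaryRep_spec h l').2.2, Submodule.Quotient.eq]
        change (unaryRep h l : V) - unaryRep h l' ∈ ℓ₀.map (conj g)
        refine mem_map_ℓ₀.mpr ⟨n' * β - n * β, ?_⟩
        rw [sub_smul, sub_eq_sub_iff_add_eq_add, h1, add_comm]
      subst hl
      rw [add_right_inj] at h1
      have h2 := smul_left_injective ℚ hu0 h1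
      have h3 : (n : ℚ) = n' := mul_right_cancel₀ hβ.ne' h2
      rw [show n = n' by exact_mod_cast h3]
    · rintro ⟨⟨⟨X, hXd⟩, hXh⟩, hX⟩
      have hXp : X ∈ perp N (ℓ₀.map (conj g)) := (mem_perp_iff hN).mpr hX
      set l : UnaryIdx N L (ℓ₀.map (conj g)) h :=
        ⟨Submodule.Quotient.mk ⟨X, hXp⟩, ⟨X, hXp⟩, hXd, hXh, rfl⟩ with hl
      obtain ⟨hd, h1, h2⟩ := unaryRep_spec h l
      have h3 : X - unaryRep h l ∈ ℓ₀.map (conj g) := by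
        have := (Submodule.Quotient.eq _).mp h2.symm
        exact this
      obtain ⟨q, hq⟩ := mem_map_ℓ₀.mp h3
      have h4 : X - unaryRep h l ∈ L := by
        have := (Submodule.Quotient.eq _).mp (hXh.trans h1.symm)
        exact this
      rw [hq] at h4
      obtain ⟨n, rfl⟩ := hgen q h4
      refine ⟨(l, n), Subtype.ext (Subtype.ext (Subtype.ext ?_))⟩
      change (unaryRep h l : V) + (n * β : ℚ) • conj g u₀ = X
      rw [← hq, add_sub_cancel]
  exact ⟨Equiv.ofBijective F hbij, fun p => rfl⟩

/-- The diagonal entry of the pullback of a representative. -/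
def unaryCoord (lam : UnaryIdx N L (ℓ₀.map (conj g)) h) : ℝ :=
  (conj g⁻¹ (unaryRep h lam : V)).ra

/-- After pulling back by `g` the lower left entry is `0`, so `Q` reduces to `N a²`. -/
theorem unaryTheta_term (hN : 0 < N) (lam : UnaryIdx N L (ℓ₀.map (conj g)) h) :
    ((QW N (ℓ₀.map (conj g)) lam.1 : ℚ) : ℂ) = ((N * unaryCoord g h lam ^ 2 : ℝ) : ℂ) := by
  have h1 := (mem_perp_iff hN).mp (unaryRep h lam).2
  have h2 := Q_eq N (conj g⁻¹ (unaryRep h lam : V))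
  rw [Q_conj, V.rc, h1] at h2
  rw [QW_unaryRep, unaryCoord]
  have h3 : ((Q N (unaryRep h lam : V) : ℚ) : ℂ) = (((Q N (unaryRep h lam : V) : ℚ) : ℝ) : ℂ) := by
    push_cast; rfl
  rw [h3, h2]
  simp

/-- A class modulo the line is determined by the diagonal entry of its pullback, and these entries
have bounded denominators, so the sum is dominated by a Gaussian sum over `ℤ`. -/
theorem summable_unary (hN : 0 < N) (hL : IsEvenLattice N L) {k : ℝ} (hk : 0 < k) :
    Summable fun lam : UnaryIdx N L (ℓ₀.map (conj g)) h => Real.exp (-k * unaryCoord g h lam ^ 2) := by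
  obtain ⟨M, hM, hd⟩ := exists_hasDenom hN hL.span_eq_top
  have hM0 : (M : ℝ) ≠ 0 := by exact_mod_cast hM.ne'
  have hM1 : (M : ℚ) ≠ 0 := by exact_mod_cast hM.ne'
  have h1 : ∀ lam : UnaryIdx N L (ℓ₀.map (conj g)) h,
      ∃ a : ℤ, (M : ℚ) * (conj g⁻¹ (unaryRep h lam : V)).mat 0 0 = a := fun lam =>
    ((hd _ (unaryRep_spec h lam).1).conj g⁻¹).imp fun a ⟨_, _, h, _⟩ => h
  choose a ha using h1
  have hinj : Function.Injective a := by
    intro l l' hll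
    have h2 : (conj g⁻¹ (unaryRep h l : V)).mat 0 0 = (conj g⁻¹ (unaryRep h l' : V)).mat 0 0 :=
      mul_left_cancel₀ hM1 (by rw [ha, ha, hll])
    apply Subtype.ext
    rw [← (unaryRep_spec h l).2.2, ← (unaryRep_spec h l').2.2, Submodule.Quotient.eq]
    change (unaryRep h l : V) - unaryRep h l' ∈ ℓ₀.map (conj g)
    refine mem_map_ℓ₀.mpr ⟨(conj g⁻¹ (unaryRep h l - unaryRep h l' : V)).mat 0 1, ?_⟩
    rw [← map_smul]
    rw [← conj_conj_inv g ((unaryRep h l : V) - unaryRep h l')]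
    congr 1
    rw [conj_conj_inv]
    have e1 := (mem_perp_iff hN).mp (unaryRep h l).2
    have e2 := (mem_perp_iff hN).mp (unaryRep h l').2
    have hsub : ∀ X Y : V, (X - Y).mat = X.mat - Y.mat := fun _ _ => rfl
    apply V.ext_entries
    · rw [V.mat_smul, u₀_mat, map_sub, hsub]; simp [h2]
    · rw [V.mat_smul, u₀_mat]; simp
    · rw [V.mat_smul, u₀_mat, map_sub, hsub]; simp [e1, e2]
  have hs := (summable_gauss 0 one_pos (δ := k / M ^ 2) (by positivity)).comp_injective hinj
  refine hs.congr fun lam => ?_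
  have h3 : (M : ℝ) * unaryCoord g h lam = a lam := by
    rw [unaryCoord, V.ra]
    exact_mod_cast congrArg (fun q : ℚ => (q : ℝ)) (ha lam)
  simp only [Function.comp]
  rw [← h3]
  congr 1
  field_simp
  ring

end Unary

/-! ### Asymptotics of the theta kernels at the cusps -/

section Cusp

variable {N : ℕ} {L : Submodule ℤ V}

theorem sq_mul_exp_le {c : ℝ} (hc : 0 < c) (y : ℝ) :
    (1 + y ^ 2) * Real.exp (-c * y ^ 2) ≤ (1 + 2 / c) * Real.exp (-(c / 2) * y ^ 2) := by
  have h1 := mul_exp_neg_le hc (x := y ^ 2)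
  have h2 : Real.exp (-c * y ^ 2) ≤ Real.exp (-(c / 2) * y ^ 2) := by
    rw [Real.exp_le_exp]; nlinarith [sq_nonneg y]
  rw [add_mul, add_mul, one_mul, one_mul]
  exact add_le_add h2 h1

theorem norm_tsum_compl_le {ι : Type*} (S : Set ι) (f : ι → ℂ) {w : ι → ℝ} (hw : Summable w)
    (hw0 : ∀ i, 0 ≤ w i) {D : ℝ} (hD : 0 ≤ D) (h : ∀ i, i ∉ S → ‖f i‖ ≤ D * w i) :
    ‖∑' i : ↑(Sᶜ), f i‖ ≤ D * ∑' i, w i := by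
  have h1 := tsum_of_norm_bounded (f := fun i : ↑(Sᶜ) => f i)
    ((hw.subtype Sᶜ).mul_left D).hasSum fun i => h i.1 i.2
  refine h1.trans ?_
  rw [tsum_mul_left]
  exact mul_le_mul_of_nonneg_left (Summable.tsum_subtype_le _ _ hw0 hw) hD

/-- The contribution of the vectors not orthogonal to the isotropic line decays rapidly. -/
theorem kernel_sum_compl_le (hN : 0 < N) (hL : IsEvenLattice N L) (h : Disc N L) (g : SL(2, ℤ))
    (τ : ℍ) (R : ℝ) {φ : Matrix (Fin 2) (Fin 2) ℝ → ℍ → ℍ → ℂ} (hφ : φ = phi0 N ∨ φ = lapPhi0 N) :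
    ∃ C c : ℝ, 0 ≤ C ∧ 0 < c ∧ ∀ z : ℍ, |z.re| ≤ R → 1 ≤ z.im →
      ‖∑' X : ↑({X : CosetIdx N L h | (conj g⁻¹ (X.1 : V)).mat 1 0 = 0}ᶜ),
        φ (toReal (conj g⁻¹ (X.1.1 : V))) τ z‖ ≤ C * Real.exp (-c * z.im ^ 2) := by
  obtain ⟨M, hM, hd⟩ := exists_hasDenom hN hL.span_eq_top
  have hv := mul_pos Real.pi_pos τ.im_pos
  obtain ⟨K, hK, hb⟩ := exp_mForm_le hN M (k := Real.pi * τ.im / 4) (by positivity) R one_pos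
  have hN1 : (1 : ℝ) ≤ N := by exact_mod_cast hN
  have hM1 : (0 : ℝ) < M := by exact_mod_cast hM
  -- Of the available exponent `π v / 2` one half secures summability over the lattice; the other
  -- half gives decay, since a nonzero lower left entry is at least `1 / M` in absolute value and
  -- makes the majorant at least `y² / M²`.
  set c : ℝ := Real.pi * τ.im / 4 / M ^ 2 with hc
  have hc0 : 0 < c := by positivity
  have hsw := (summable_weight hM (cosetIdx_injective h g⁻¹) fun X => (hd _ X.1.2).conj g⁻¹)
  set S := ∑' X : CosetIdx N L h, weight M (conj g⁻¹ (X.1 : V)) with hS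
  have hS0 : 0 ≤ S := tsum_nonneg fun X => weight_nonneg _ _
  refine ⟨152 * √τ.im * K * S * (1 + 2 / c), c / 2, by positivity, by positivity, fun z hx hy => ?_⟩
  have hterm : ∀ X : CosetIdx N L h, X ∉ {X : CosetIdx N L h | (conj g⁻¹ (X.1 : V)).mat 1 0 = 0} →
      ‖φ (toReal (conj g⁻¹ (X.1 : V))) τ z‖ ≤ 152 * √τ.im * K * ((1 + z.im ^ 2) *
        Real.exp (-c * z.im ^ 2)) * weight M (conj g⁻¹ (X.1 : V)) := by
    intro X hX0
    refine (kernel_norm_le hφ _ τ z).trans ?_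
    set Y := conj g⁻¹ (X.1 : V) with hY
    obtain ⟨-, -, n, -, -, hn⟩ := (hd _ X.1.2).conj g⁻¹
    have hn0 : n ≠ 0 := by
      rintro rfl
      refine hX0 ?_
      have hM2 : (M : ℚ) ≠ 0 := by exact_mod_cast hM.ne'
      change Y.mat 1 0 = 0
      simpa only [Int.cast_zero, mul_eq_zero, hM2, false_or] using hn
    have hrc : (M : ℝ) * Y.rc = n := by
      rw [V.rc]; exact_mod_cast congrArg (fun q : ℚ => (q : ℝ)) hn
    have hn1 : (1 : ℝ) ≤ (n : ℝ) ^ 2 := by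
      have : 1 ≤ n ^ 2 := by
        have := sq_nonneg n
        have h3 : n ^ 2 ≠ 0 := pow_ne_zero 2 hn0
        omega
      exact_mod_cast this
    have hm : z.im ^ 2 / M ^ 2 ≤ mForm N Y.ra Y.rb Y.rc z.re z.im := by
      have h1 : z.im ^ 2 / M ^ 2 ≤ (Y.rc * z.im) ^ 2 := by
        rw [div_le_iff₀ (by positivity)]
        calc z.im ^ 2 ≤ (n : ℝ) ^ 2 * z.im ^ 2 := le_mul_of_one_le_left (sq_nonneg _) hn1
          _ = _ := by rw [← hrc]; ring
      unfold mForm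
      have h2 := sq_nonneg (Y.rc * z.im)
      have h3 : 0 ≤ 2 * (N : ℝ) * (Y.ra - z.re * Y.rc) ^ 2 := by positivity
      have h4 : 0 ≤ (N : ℝ) * ((Y.rb + 2 * z.re * Y.ra - z.re ^ 2 * Y.rc) / z.im) ^ 2 := by positivity
      nlinarith
    have h5 : Real.exp (-(Real.pi * τ.im / 2) * mForm N Y.ra Y.rb Y.rc z.re z.im) ≤
        Real.exp (-c * z.im ^ 2) * (K * (1 + z.im ^ 2) * weight M Y) := by
      refine le_trans ?_ (mul_le_mul_of_nonneg_left (hb Y z.re z.im hx hy) (Real.exp_pos _).le)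
      rw [← Real.exp_add, Real.exp_le_exp]
      have h6 : c * z.im ^ 2 = Real.pi * τ.im / 4 * (z.im ^ 2 / M ^ 2) := by
        rw [hc]; field_simp
      nlinarith
    calc _ ≤ 152 * √τ.im * (Real.exp (-c * z.im ^ 2) * (K * (1 + z.im ^ 2) * weight M Y)) := by
          gcongr
      _ = _ := by ring
  have h7 := norm_tsum_compl_le {X : CosetIdx N L h | (conj g⁻¹ (X.1 : V)).mat 1 0 = 0}
    (fun X => φ (toReal (conj g⁻¹ (X.1 : V))) τ z) hsw (fun X => weight_nonneg _ _)
    (by positivity) hterm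
  refine h7.trans ?_
  rw [← hS]
  calc _ ≤ 152 * √τ.im * K * ((1 + 2 / c) * Real.exp (-(c / 2) * z.im ^ 2)) * S := by
        have := sq_mul_exp_le hc0 z.im
        have h9 : 0 ≤ 152 * √τ.im * K := by positivity
        exact mul_le_mul_of_nonneg_right (mul_le_mul_of_nonneg_left this h9) hS0
    _ = _ := by ring

variable (hN : 0 < N) (hL : IsEvenLattice N L) (h : Disc N L) (g : SL(2, ℤ)) (τ : ℍ)

/-- The leading coefficient of the theta kernel at the cusp `g ∞`. -/
def cuspKappa (N : ℕ) (L : Submodule ℤ V) (h : Disc N L) (g : SL(2, ℤ)) (τ : ℍ) : ℂ :=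
  unaryTheta N L (ℓ₀.map (conj g)) h τ / ((√(N : ℝ) * cuspBeta L g : ℝ) : ℂ)

theorem norm_unary_exp (a : ℝ) :
    ‖Complex.exp (2 * Real.pi * Complex.I * ((N * a ^ 2 : ℝ) : ℂ) * (τ : ℂ))‖ =
      Real.exp (-(2 * Real.pi * τ.im * N) * a ^ 2) := by
  rw [Complex.norm_exp]
  congr 1
  have : (2 * (Real.pi : ℂ) * Complex.I * ((N * a ^ 2 : ℝ) : ℂ) * (τ : ℂ)) =
      ((2 * Real.pi * (N * a ^ 2) : ℝ) : ℂ) * (Complex.I * (τ : ℂ)) := by push_cast; ring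
  rw [this, Complex.re_ofReal_mul]
  simp
  ring

set_option maxHeartbeats 2000000 in
include hN hL in
-- For vectors with lower left entry `0` the majorant is `2N a² + N (b + 2xa)² / y²`, and `b` runs
-- through a coset of `β ℤ`. Poisson summation over `b` with parameter `l = π v N / y²` produces a
-- main term proportional to `y` and an error exponentially small in `1 / l`, that is, in `y²`. The
-- dependence on `x` sits in the shift and disappears from the main term. For `Δφ₀` the
-- zero-frequency contributions cancel.
theorem kernel_sum_perp : ∃ C c : ℝ, 0 ≤ C ∧ 0 < c ∧ ∀ z : ℍ, 1 ≤ z.im →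
    ‖(∑' X : PerpIdx g h, phi0 N (toReal (conj g⁻¹ (X.1.1 : V))) τ z) -
      cuspKappa N L h g τ * z.im‖ ≤ C * Real.exp (-c * z.im ^ 2) ∧
    ‖∑' X : PerpIdx g h, lapPhi0 N (toReal (conj g⁻¹ (X.1.1 : V))) τ z‖ ≤
      C * Real.exp (-c * z.im ^ 2) := by
  obtain ⟨β, hβ, hβe, hmem, hgen⟩ := cuspBeta_spec hN hL g
  obtain ⟨e, he⟩ := exists_perp_equiv g h hN hL hβ hmem hgen
  have hβR : (0 : ℝ) < (β : ℝ) := by exact_mod_cast hβ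
  have hNR : (0 : ℝ) < N := by exact_mod_cast hN
  have hv := τ.im_pos
  set k : ℝ := Real.pi * τ.im with hk
  have hk0 : 0 < k := mul_pos Real.pi_pos hv
  obtain ⟨C, c, hC, hc, hgs⟩ := gauss_sum_asymptotics hβR (Λ := k * N) (by positivity)
  set A : UnaryIdx N L (ℓ₀.map (conj g)) h → ℝ := unaryCoord g h with hA
  set E : UnaryIdx N L (ℓ₀.map (conj g)) h → ℂ := fun lam =>
    Complex.exp (2 * Real.pi * Complex.I * ((N * A lam ^ 2 : ℝ) : ℂ) * (τ : ℂ)) with hE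
  have hEn : ∀ lam, ‖E lam‖ = Real.exp (-(2 * k * N) * A lam ^ 2) := fun lam => by
    rw [hE, norm_unary_exp, hk]; ring_nf
  have hEs : Summable fun lam => ‖E lam‖ := by
    simp only [hEn]; exact summable_unary g h hN hL (by positivity)
  have hEs2 := summable_unary g h hN hL (k := k * N) (by positivity)
  have hU : ∑' lam, E lam = unaryTheta N L (ℓ₀.map (conj g)) h τ := by
    rw [unaryTheta]
    refine tsum_congr fun lam => ?_
    rw [unaryTheta_term g h hN lam]
  set B := ∑' lam : UnaryIdx N L (ℓ₀.map (conj g)) h, Real.exp (-(k * N) * A lam ^ 2) with hB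
  have hB0 : 0 ≤ B := tsum_nonneg fun _ => (Real.exp_pos _).le
  refine ⟨√τ.im * C * 34 * B, c / (k * N), by positivity, by positivity, fun z hz => ?_⟩
  have hy := z.im_pos
  set l : ℝ := k * N / z.im ^ 2 with hl
  have hl0 : 0 < l := by positivity
  have hlΛ : l ≤ k * N := div_le_self (by positivity) (by nlinarith)
  have hexp : Real.exp (-c / l) = Real.exp (-(c / (k * N)) * z.im ^ 2) := by
    congr 1; rw [hl]; field_simp
  set tt : UnaryIdx N L (ℓ₀.map (conj g)) h → ℝ := fun lam =>
    (conj g⁻¹ (unaryRep h lam : V)).rb + 2 * z.re * A lam with htt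
  have hent : ∀ p : UnaryIdx N L (ℓ₀.map (conj g)) h × ℤ,
      (conj g⁻¹ ((e p).1.1 : V)).ra = A p.1 ∧
      (conj g⁻¹ ((e p).1.1 : V)).rb = (conj g⁻¹ (unaryRep h p.1 : V)).rb + β * p.2 ∧
      (conj g⁻¹ ((e p).1.1 : V)).rc = 0 := by
    intro p
    have h1 := (mem_perp_iff hN).mp (unaryRep h p.1).2
    have e0 : conj g⁻¹ ((e p).1.1 : V) = conj g⁻¹ (unaryRep h p.1 : V) + (p.2 * β : ℚ) • u₀ := by
      rw [he p, map_add, map_smul, conj_inv_conj]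
    refine ⟨?_, ?_, ?_⟩
    · rw [e0, hA, unaryCoord, V.ra, V.ra, V.mat_add, V.mat_smul, u₀_mat]; simp
    · rw [e0, V.rb, V.rb, V.mat_add, V.mat_smul, u₀_mat]; simp; ring
    · rw [V.rc, (e p).2]; simp
  have hm : ∀ p : UnaryIdx N L (ℓ₀.map (conj g)) h × ℤ,
      k * mForm N (conj g⁻¹ ((e p).1.1 : V)).ra (conj g⁻¹ ((e p).1.1 : V)).rb
        (conj g⁻¹ ((e p).1.1 : V)).rc z.re z.im =
      2 * k * N * A p.1 ^ 2 + l * (tt p.1 + β * p.2) ^ 2 := by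
    intro p
    obtain ⟨h1, h2, h3⟩ := hent p
    rw [h1, h2, h3, mForm, hl, htt]
    field_simp
    ring
  have hp : ∀ p : UnaryIdx N L (ℓ₀.map (conj g)) h × ℤ,
      k * pForm N (conj g⁻¹ ((e p).1.1 : V)).ra (conj g⁻¹ ((e p).1.1 : V)).rb
        (conj g⁻¹ ((e p).1.1 : V)).rc z.re z.im ^ 2 = l * (tt p.1 + β * p.2) ^ 2 := by
    intro p
    obtain ⟨h1, h2, h3⟩ := hent p
    rw [h1, h2, h3, pForm, hl, htt, div_pow, mul_pow, Real.sq_sqrt hNR.le]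
    field_simp
    ring
  have hphi : ∀ p : UnaryIdx N L (ℓ₀.map (conj g)) h × ℤ,
      phi0 N (toReal (conj g⁻¹ ((e p).1.1 : V))) τ z = ((√τ.im : ℝ) : ℂ) * E p.1 *
        ((Real.exp (-l * (tt p.1 + β * p.2) ^ 2) : ℝ) : ℂ) := by
    intro p
    have hQ : ((Q N (conj g⁻¹ ((e p).1.1 : V)) : ℚ) : ℂ) = ((N * A p.1 ^ 2 : ℝ) : ℂ) := by
      have h2 := Q_eq N (conj g⁻¹ ((e p).1.1 : V))
      rw [(hent p).1, (hent p).2.2] at h2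
      have h3 : ((Q N (conj g⁻¹ ((e p).1.1 : V)) : ℚ) : ℂ) =
          (((Q N (conj g⁻¹ ((e p).1.1 : V)) : ℚ) : ℝ) : ℂ) := by push_cast; rfl
      rw [h3, h2]
      simp
    rw [phi0_eq, hQ, neg_mul, hm p, hE]
    have hτ : (τ : ℂ) = (τ.re : ℂ) + (τ.im : ℂ) * Complex.I := (Complex.re_add_im _).symm
    push_cast
    rw [hτ, mul_assoc ((√τ.im : ℝ) : ℂ), mul_assoc ((√τ.im : ℝ) : ℂ), ← Complex.exp_add, ← Complex.exp_add]
    congr 2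
    rw [hk]
    push_cast
    linear_combination (-2 * Real.pi * N * (A p.1) ^ 2 * τ.im : ℂ) * Complex.I_sq
  have hlap : ∀ p : UnaryIdx N L (ℓ₀.map (conj g)) h × ℤ,
      lapPhi0 N (toReal (conj g⁻¹ ((e p).1.1 : V))) τ z = ((√τ.im : ℝ) : ℂ) * E p.1 *
        (6 * ((l * (tt p.1 + β * p.2) ^ 2 * Real.exp (-l * (tt p.1 + β * p.2) ^ 2) : ℝ) : ℂ) -
        4 * (((l * (tt p.1 + β * p.2) ^ 2) ^ 2 * Real.exp (-l * (tt p.1 + β * p.2) ^ 2) : ℝ) : ℂ) -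
        8 * ((2 * k * N * A p.1 ^ 2 : ℝ) : ℂ) *
          ((l * (tt p.1 + β * p.2) ^ 2 * Real.exp (-l * (tt p.1 + β * p.2) ^ 2) : ℝ) : ℂ) +
        4 * ((2 * k * N * A p.1 ^ 2 : ℝ) : ℂ) *
          ((Real.exp (-l * (tt p.1 + β * p.2) ^ 2) : ℝ) : ℂ)) := by
    intro p
    have hf : lapFactor k (mForm N (conj g⁻¹ ((e p).1.1 : V)).ra (conj g⁻¹ ((e p).1.1 : V)).rb
        (conj g⁻¹ ((e p).1.1 : V)).rc z.re z.im) (pForm N (conj g⁻¹ ((e p).1.1 : V)).ra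
        (conj g⁻¹ ((e p).1.1 : V)).rb (conj g⁻¹ ((e p).1.1 : V)).rc z.re z.im) =
        6 * (l * (tt p.1 + β * p.2) ^ 2) - 4 * (l * (tt p.1 + β * p.2) ^ 2) ^ 2 -
        8 * (2 * k * N * A p.1 ^ 2) * (l * (tt p.1 + β * p.2) ^ 2) + 4 * (2 * k * N * A p.1 ^ 2) := by
      have h1 := hm p
      have h2 := hp p
      set m := mForm N (conj g⁻¹ ((e p).1.1 : V)).ra (conj g⁻¹ ((e p).1.1 : V)).rb
        (conj g⁻¹ ((e p).1.1 : V)).rc z.re z.im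
      set P := pForm N (conj g⁻¹ ((e p).1.1 : V)).ra (conj g⁻¹ ((e p).1.1 : V)).rb
        (conj g⁻¹ ((e p).1.1 : V)).rc z.re z.im
      rw [lapFactor, show 4 * k * P ^ 2 - (4 * k ^ 2 * P ^ 2 - 2 * k) * (2 * m - P ^ 2) =
        4 * (k * P ^ 2) - (4 * (k * P ^ 2) - 2) * (2 * (k * m) - (k * P ^ 2)) by ring, h1, h2]
      ring
    rw [lapPhi0_eq, hf, hphi]
    push_cast
    ring
  have hR : ∀ lam, ∃ R₀ R' : ℂ, ‖R₀‖ ≤ C * Real.exp (-c / l) ∧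
      ‖R'‖ ≤ (10 + 12 * (2 * k * N * A lam ^ 2)) * (C * Real.exp (-c / l)) ∧
      HasSum (fun n : ℤ => phi0 N (toReal (conj g⁻¹ ((e (lam, n)).1.1 : V))) τ z)
        (((√τ.im : ℝ) : ℂ) * E lam * (((√(Real.pi / l) / β : ℝ) : ℂ) + R₀)) ∧
      HasSum (fun n : ℤ => lapPhi0 N (toReal (conj g⁻¹ ((e (lam, n)).1.1 : V))) τ z)
        (((√τ.im : ℝ) : ℂ) * E lam * R') := by
    intro lam
    obtain ⟨R₀, R₁, R₂, b0, b1, b2, s0, s1, s2⟩ := hgs (tt lam) l hl0 hlΛ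
    set D := C * Real.exp (-c / l)
    set q := 2 * k * N * A lam ^ 2 with hq
    have hq0 : 0 ≤ q := by positivity
    -- The polynomial factor of `Δφ₀` is `6 w - 4 w² - 8 q w + 4 q` in `w = l (t + β n)²`. Main
    -- terms of `1, w, w²` are in the ratio `1 : 1/2 : 3/4`, so they add up to `3 - 3 - 4q + 4q = 0`
    -- and only remainders survive.
    refine ⟨R₀, 6 * R₁ - 4 * R₂ - 8 * (q : ℂ) * R₁ + 4 * (q : ℂ) * R₀, b0, ?_, ?_, ?_⟩
    · have hqn : ‖(q : ℂ)‖ = q := by rw [Complex.norm_real, Real.norm_of_nonneg hq0]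
      have n1 : ‖6 * R₁‖ ≤ 6 * D := by rw [norm_mul]; norm_num; exact b1
      have n2 : ‖4 * R₂‖ ≤ 4 * D := by rw [norm_mul]; norm_num; exact b2
      have n3 : ‖8 * (q : ℂ) * R₁‖ ≤ 8 * q * D := by
        rw [norm_mul, norm_mul, hqn]; norm_num; gcongr
      have n4 : ‖4 * (q : ℂ) * R₀‖ ≤ 4 * q * D := by
        rw [norm_mul, norm_mul, hqn]; norm_num; gcongr
      calc _ ≤ ‖6 * R₁‖ + ‖4 * R₂‖ + ‖8 * (q : ℂ) * R₁‖ + ‖4 * (q : ℂ) * R₀‖ := by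
            refine (norm_add_le _ _).trans (add_le_add ((norm_sub_le _ _).trans
              (add_le_add (norm_sub_le _ _) le_rfl)) le_rfl)
        _ ≤ 6 * D + 4 * D + 8 * q * D + 4 * q * D := by gcongr
        _ = _ := by ring
    · refine (hasSum_congr fun n => ?_).mpr (s0.mul_left (((√τ.im : ℝ) : ℂ) * E lam))
      rw [hphi]
    · have := ((((s1.mul_left 6).sub (s2.mul_left 4)).sub (s1.mul_left (8 * (q : ℂ)))).add
        (s0.mul_left (4 * (q : ℂ)))).mul_left (((√τ.im : ℝ) : ℂ) * E lam)
      rw [show 6 * (((√(Real.pi / l) / β : ℝ) : ℂ) / 2 + R₁) -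
        4 * (3 * ((√(Real.pi / l) / β : ℝ) : ℂ) / 4 + R₂) -
        8 * (q : ℂ) * (((√(Real.pi / l) / β : ℝ) : ℂ) / 2 + R₁) +
        4 * (q : ℂ) * (((√(Real.pi / l) / β : ℝ) : ℂ) + R₀) =
        6 * R₁ - 4 * R₂ - 8 * (q : ℂ) * R₁ + 4 * (q : ℂ) * R₀ by ring] at this
      refine (hasSum_congr fun n => ?_).mpr this
      rw [hlap]
  choose R₀ R' hR0 hR' hs0 hs' using hR
  have hsumm : ∀ φ : Matrix (Fin 2) (Fin 2) ℝ → ℍ → ℍ → ℂ, (φ = phi0 N ∨ φ = lapPhi0 N) →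
      Summable fun p => φ (toReal (conj g⁻¹ ((e p).1.1 : V))) τ z := fun φ hφ =>
    (e.summable_iff (f := fun X : PerpIdx g h => φ (toReal (conj g⁻¹ (X.1.1 : V))) τ z)).mpr
      ((summable_kernel hN hL.span_eq_top hφ h g⁻¹ τ z).subtype
        {X : CosetIdx N L h | (conj g⁻¹ (X.1 : V)).mat 1 0 = 0})
  have hT : ∀ φ : Matrix (Fin 2) (Fin 2) ℝ → ℍ → ℍ → ℂ, (φ = phi0 N ∨ φ = lapPhi0 N) →
      ∑' X : PerpIdx g h, φ (toReal (conj g⁻¹ (X.1.1 : V))) τ z =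
        ∑' lam, ∑' n : ℤ, φ (toReal (conj g⁻¹ ((e (lam, n)).1.1 : V))) τ z := fun φ hφ => by
    rw [← (hsumm φ hφ).tsum_prod, ← e.tsum_eq]
  -- Here `√v` cancels the `v^{-1/2}` from Poisson summation, leaving `y / (√N β)`.
  have hmain : ((√τ.im : ℝ) : ℂ) * ((√(Real.pi / l) / β : ℝ) : ℂ) =
      (z.im : ℂ) / ((√(N : ℝ) * cuspBeta L g : ℝ) : ℂ) := by
    rw [hβe]
    norm_cast
    have h1 : √(Real.pi / l) = z.im / (√τ.im * √(N : ℝ)) := by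
      rw [hl, hk, show Real.pi / (Real.pi * τ.im * N / z.im ^ 2) = z.im ^ 2 / (τ.im * N) by
        field_simp, Real.sqrt_div (sq_nonneg _), Real.sqrt_sq hy.le, Real.sqrt_mul hv.le]
    have h2 : √τ.im ≠ 0 := (Real.sqrt_pos.mpr hv).ne'
    have h3 : √(N : ℝ) ≠ 0 := (Real.sqrt_pos.mpr hNR).ne'
    rw [h1]
    field_simp
  set D := C * Real.exp (-c / l) with hD
  have hD0 : 0 ≤ D := by positivity
  have hfin : √τ.im * C * 34 * B * Real.exp (-(c / (k * N)) * z.im ^ 2) = ∑' lam, √τ.im * D * 34 *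
      Real.exp (-(k * N) * A lam ^ 2) := by
    rw [tsum_mul_left, ← hB, hD, hexp]; ring
  have hsB : Summable fun lam => √τ.im * D * 34 * Real.exp (-(k * N) * A lam ^ 2) := hEs2.mul_left _
  constructor
  · rw [hT _ (Or.inl rfl), hfin]
    have e1 : cuspKappa N L h g τ * z.im = ∑' lam, ((√τ.im : ℝ) : ℂ) * E lam *
        ((√(Real.pi / l) / β : ℝ) : ℂ) := by
      have : ∀ lam, ((√τ.im : ℝ) : ℂ) * E lam * ((√(Real.pi / l) / β : ℝ) : ℂ) =
          E lam * ((z.im : ℂ) / ((√(N : ℝ) * cuspBeta L g : ℝ) : ℂ)) := fun lam => by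
        rw [← hmain]; ring
      simp only [this]
      rw [tsum_mul_right, hU, cuspKappa]
      ring
    have hsE : Summable fun lam => ((√τ.im : ℝ) : ℂ) * E lam * ((√(Real.pi / l) / β : ℝ) : ℂ) :=
      (hEs.of_norm.mul_left _).mul_right _
    have hs1 : Summable fun lam => ∑' n : ℤ, phi0 N (toReal (conj g⁻¹ ((e (lam, n)).1.1 : V))) τ z :=
      (hsumm _ (Or.inl rfl)).prod
    rw [e1, ← hs1.tsum_sub hsE]
    refine tsum_of_norm_bounded hsB.hasSum fun lam => ?_
    rw [(hs0 lam).tsum_eq, ← mul_sub, add_sub_cancel_left, norm_mul, norm_mul, hEn,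
      Complex.norm_real, Real.norm_of_nonneg (Real.sqrt_nonneg _)]
    have h1 : Real.exp (-(2 * k * N) * A lam ^ 2) ≤ Real.exp (-(k * N) * A lam ^ 2) := by
      rw [Real.exp_le_exp]
      have : 0 ≤ k * N * A lam ^ 2 := by positivity
      linarith
    calc _ ≤ √τ.im * Real.exp (-(k * N) * A lam ^ 2) * D := by
          gcongr; exact hR0 lam
      _ ≤ √τ.im * D * 34 * Real.exp (-(k * N) * A lam ^ 2) := by
          have : 0 ≤ √τ.im * D * Real.exp (-(k * N) * A lam ^ 2) := by positivity
          linarith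
  · rw [hT _ (Or.inr rfl), hfin]
    refine tsum_of_norm_bounded hsB.hasSum fun lam => ?_
    rw [(hs' lam).tsum_eq, norm_mul, norm_mul, hEn,
      Complex.norm_real, Real.norm_of_nonneg (Real.sqrt_nonneg _)]
    set w := k * N * A lam ^ 2 with hw
    have hw0 : 0 ≤ w := by positivity
    -- The factor quadratic in `A` is absorbed by half of the Gaussian: `(10 + 24 w) e^{-w} ≤ 34`.
    have h1 : Real.exp (-(2 * k * N) * A lam ^ 2) * (10 + 12 * (2 * k * N * A lam ^ 2)) ≤
        34 * Real.exp (-(k * N) * A lam ^ 2) := by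
      have e1 : Real.exp (-(2 * k * N) * A lam ^ 2) = Real.exp (-w) * Real.exp (-w) := by
        rw [← Real.exp_add, hw]; congr 1; ring
      have e2 : Real.exp (-(k * N) * A lam ^ 2) = Real.exp (-w) := by rw [hw]; congr 1; ring
      rw [e1, e2]
      have e3 : Real.exp (-w) * (10 + 24 * w) ≤ 34 := by
        rw [Real.exp_neg, inv_mul_le_iff₀ (Real.exp_pos _)]
        have := Real.add_one_le_exp w
        linarith
      have e4 : 10 + 12 * (2 * k * N * A lam ^ 2) = 10 + 24 * w := by rw [hw]; ring
      rw [e4]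
      have := (Real.exp_pos (-w)).le
      nlinarith
    calc _ ≤ √τ.im * Real.exp (-(2 * k * N) * A lam ^ 2) *
          ((10 + 12 * (2 * k * N * A lam ^ 2)) * D) := by
          gcongr; exact hR' lam
      _ = √τ.im * D * (Real.exp (-(2 * k * N) * A lam ^ 2) * (10 + 12 * (2 * k * N * A lam ^ 2))) := by
          ring
      _ ≤ √τ.im * D * (34 * Real.exp (-(k * N) * A lam ^ 2)) := by gcongr
      _ = _ := by ring

include hN hL in
/-- The asymptotics of the theta kernels at the cusp `g ∞`. -/
theorem theta_cusp_asymptotics (R : ℝ) : ∃ C c : ℝ, 0 ≤ C ∧ 0 < c ∧ ∀ z : ℍ, |z.re| ≤ R →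
    1 ≤ z.im →
    ‖theta N L (phi0 N) h τ (g • z) - cuspKappa N L h g τ * z.im‖ ≤ C * Real.exp (-c * z.im ^ 2) ∧
    ‖theta N L (lapPhi0 N) h τ (g • z)‖ ≤ C * Real.exp (-c * z.im ^ 2) := by
  obtain ⟨C₁, c₁, hC₁, hc₁, h1⟩ := kernel_sum_perp hN hL h g τ
  obtain ⟨C₂, c₂, hC₂, hc₂, h2⟩ := kernel_sum_compl_le hN hL h g τ R (Or.inl (rfl : phi0 N = phi0 N))
  obtain ⟨C₃, c₃, hC₃, hc₃, h3⟩ :=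
    kernel_sum_compl_le hN hL h g τ R (Or.inr (rfl : lapPhi0 N = lapPhi0 N))
  set c := min c₁ (min c₂ c₃) with hc
  have hm : ∀ (c' y : ℝ), c ≤ c' → Real.exp (-c' * y ^ 2) ≤ Real.exp (-c * y ^ 2) := fun c' y h => by
    rw [Real.exp_le_exp]; nlinarith [sq_nonneg y]
  have split : ∀ φ : Matrix (Fin 2) (Fin 2) ℝ → ℍ → ℍ → ℂ, (φ = phi0 N ∨ φ = lapPhi0 N) → ∀ z : ℍ,
      theta N L φ h τ (g • z) = (∑' X : PerpIdx g h, φ (toReal (conj g⁻¹ (X.1.1 : V))) τ z) +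
      ∑' X : ↑({X : CosetIdx N L h | (conj g⁻¹ (X.1 : V)).mat 1 0 = 0}ᶜ),
        φ (toReal (conj g⁻¹ (X.1.1 : V))) τ z := fun φ hφ z => by
    rw [theta_smul hφ]
    have hs := summable_kernel hN hL.span_eq_top hφ h g⁻¹ τ z
    exact (hs.tsum_subtype_add_tsum_subtype_compl
      {X : CosetIdx N L h | (conj g⁻¹ (X.1 : V)).mat 1 0 = 0}).symm
  refine ⟨C₁ + C₂ + C₃, c, by positivity, by positivity, fun z hx hy => ⟨?_, ?_⟩⟩
  · rw [split _ (Or.inl rfl), add_sub_right_comm]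
    refine (norm_add_le _ _).trans ((add_le_add (h1 z hy).1 (h2 z hx hy)).trans ?_)
    have := hm c₁ z.im (min_le_left _ _)
    have := hm c₂ z.im ((min_le_right _ _).trans (min_le_left _ _))
    have := Real.exp_pos (-c * z.im ^ 2)
    nlinarith
  · rw [split _ (Or.inr rfl)]
    refine (norm_add_le _ _).trans ((add_le_add (h1 z hy).2 (h3 z hx hy)).trans ?_)
    have := hm c₁ z.im (min_le_left _ _)
    have := hm c₃ z.im ((min_le_right _ _).trans (min_le_right _ _))
    have := Real.exp_pos (-c * z.im ^ 2)
    nlinarith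

end Cusp

/-! ### Green's formula on the quotient -/

theorem hypLaplacian_add {f g : ℍ → ℂ} (hf : IsC2 f) (hg : IsC2 g) (z : ℍ) :
    hypLaplacian (fun w => f w + g w) z = hypLaplacian f z + hypLaplacian g z := by
  unfold hypLaplacian
  have := (hf z).laplacian_add (hg z)
  rw [← mul_add, ← this]
  rfl

theorem hypLaplacian_sum {ι : Type*} (s : Finset ι) {f : ι → ℍ → ℂ} (hf : ∀ i ∈ s, IsC2 (f i)) (z : ℍ) :
    hypLaplacian (fun w => ∑ i ∈ s, f i w) z = ∑ i ∈ s, hypLaplacian (f i) z := by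
  classical
  induction s using Finset.induction_on with
  | empty => simp [hypLaplacian, laplacian_apply]
  | insert a s ha ih =>
    simp only [Finset.sum_insert ha]
    rw [← ih fun i hi => hf i (Finset.mem_insert_of_mem hi)]
    refine hypLaplacian_add (hf a (Finset.mem_insert_self _ _)) (fun w => ?_) z
    exact ContDiffAt.sum fun i hi => hf i (Finset.mem_insert_of_mem hi) w

section Green

variable {Γ : Subgroup SL(2, ℤ)}

theorem IsC2.comp_modGroup {f : ℍ → ℂ} (hf : IsC2 f) (g : modGroup Γ) : IsC2 fun z => f (g • z) := by
  obtain ⟨γ, -, h⟩ := modGroup_smul Γ g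
  simp only [h]
  exact hf.comp_smul γ

theorem hypLaplacian_comp_modGroup {f : ℍ → ℂ} (hf : IsC2 f) (g : modGroup Γ) (z : ℍ) :
    hypLaplacian (fun z => f (g • z)) z = hypLaplacian f (g • z) := by
  obtain ⟨γ, -, h⟩ := modGroup_smul Γ g
  simp only [h]
  exact hypLaplacian_comp_smul hf γ z

/-- Proper discontinuity of the action of `SL₂(ℤ)`, transported to the group of transformations by
choosing matrix representatives. -/
theorem finite_modGroup {K₁ K₂ : Set ℍ} (h₁ : IsCompact K₁) (h₂ : IsCompact K₂) :
    {g : modGroup Γ | ∃ z ∈ K₁, g • z ∈ K₂}.Finite := by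
  have hfin := ProperlyDiscontinuousSMul.finite_disjoint_inter_image
    (Γ := ↥(Matrix.SpecialLinearGroup.mapGL (n := Fin 2) (R := ℤ) ℝ).range) h₁ h₂
  choose γ hγ h using modGroup_smul Γ
  refine Set.Finite.of_injOn (f := fun g => (⟨Matrix.SpecialLinearGroup.mapGL ℝ (γ g), γ g, rfl⟩ :
    ↥(Matrix.SpecialLinearGroup.mapGL (n := Fin 2) (R := ℤ) ℝ).range)) ?_ ?_ hfin
  · rintro g ⟨z, hz, hgz⟩
    rw [h] at hgz
    exact ⟨γ g • z, ⟨z, hz, rfl⟩, hgz⟩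
  · intro g _ g' _ hgg
    have e := congrArg Subtype.val hgg
    refine Subtype.ext (Equiv.ext fun z => ?_)
    refine (h g z).trans (Eq.trans ?_ (h g' z).symm)
    exact congrArg (fun x : GL (Fin 2) ℝ => x • z) e

/-- Locally, only finitely many translates of a compactly supported function are nonzero. -/
theorem eventually_translate_eq_zero {η : ℍ → ℂ} (hc : HasCompactSupport η) (z : ℍ) :
    ∃ s : Finset (modGroup Γ), ∀ᶠ w in 𝓝 z, ∀ g ∉ s, η (g • w) = 0 := by
  obtain ⟨K, hK, hKz⟩ := exists_compact_mem_nhds z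
  refine ⟨(finite_modGroup (Γ := Γ) hK hc).toFinset, ?_⟩
  filter_upwards [hKz] with w hw g hg
  by_contra hne
  exact hg (by simpa using ⟨w, hw, subset_tsupport η hne⟩)

theorem exists_bump {K : Set ℍ} (hK : IsCompact K) : ∃ ψ : ℍ → ℝ, IsC2 (fun z => (ψ z : ℂ)) ∧
    HasCompactSupport ψ ∧ (∀ z, 0 ≤ ψ z) ∧ ∀ z ∈ K, 0 < ψ z := by
  rcases K.eq_empty_or_nonempty with rfl | hne
  · exact ⟨fun _ => 0, fun _ => by simpa using contDiffAt_const,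
      HasCompactSupport.zero, fun _ => le_rfl, by simp⟩
  obtain ⟨w, hw, hmin⟩ := hK.exists_isMinOn hne continuous_im.continuousOn
  have hcn : Continuous fun z : ℍ => Complex.normSq (z : ℂ) :=
    Complex.continuous_normSq.comp continuous_coe
  obtain ⟨w', hw', hmax⟩ := hK.exists_isMaxOn hne hcn.continuousOn
  set y₀ := w.im with hy₀
  have hy₀p : 0 < y₀ := w.im_pos
  set B := Complex.normSq (w' : ℂ) with hB
  have hB0 : 0 ≤ B := Complex.normSq_nonneg _
  -- The Euclidean disc of centre `iR` and squared radius `R² - 1` consists of the points with `|z|²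
  -- + 1 ≤ 2 R y`. This choice of `R` makes it contain `K`, while `ρ < R` leaves room for a slightly
  -- larger disc still inside the half-plane.
  set R : ℝ := (B + 1) / y₀ + 1 with hR
  have hR1 : 1 < R := by rw [hR]; have : 0 < (B + 1) / y₀ := by positivity
                         linarith
  set ρ : ℝ := √(R ^ 2 - 1) with hρ
  have hρ0 : 0 < ρ := Real.sqrt_pos.mpr (by nlinarith)
  have hρ2 : ρ ^ 2 = R ^ 2 - 1 := Real.sq_sqrt (by nlinarith)
  have hρR : ρ < R := by nlinarith
  let b : ContDiffBump ((R : ℂ) * Complex.I) :=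
    { rIn := ρ, rOut := (ρ + R) / 2, rIn_pos := hρ0, rIn_lt_rOut := by linarith }
  have hball : Metric.closedBall ((R : ℂ) * Complex.I) ((ρ + R) / 2) ⊆ Set.range UpperHalfPlane.coe := by
    intro u hu
    rw [Metric.mem_closedBall, dist_eq_norm] at hu
    have h1 := (Complex.abs_im_le_norm (u - R * Complex.I)).trans hu
    have h2 : (u - R * Complex.I).im = u.im - R := by simp
    rw [h2] at h1
    have h3 : 0 < u.im := by linarith [(abs_le.mp h1).1]
    exact ⟨⟨u, h3⟩, rfl⟩
  refine ⟨fun z => b (z : ℂ), fun z => ?_, ?_, fun z => b.nonneg, fun z hz => ?_⟩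
  · have h1 : ContDiffAt ℝ 2 (fun u : ℂ => ((b u : ℝ) : ℂ)) z :=
      Complex.ofRealCLM.contDiff.contDiffAt.comp (z : ℂ) (b.contDiff (n := 2)).contDiffAt
    refine h1.congr_of_eventuallyEq ?_
    filter_upwards [eventually_ofComplex z] with u hu
    rw [hu]
  · refine HasCompactSupport.intro (K := UpperHalfPlane.coe ⁻¹'
      Metric.closedBall ((R : ℂ) * Complex.I) ((ρ + R) / 2)) ?_ fun z hz => ?_
    · rw [isOpenEmbedding_coe.isInducing.isCompact_preimage_iff hball]
      exact isCompact_closedBall _ _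
    · by_contra hne
      have : (z : ℂ) ∈ Function.support b := hne
      rw [b.support_eq] at this
      exact hz (Metric.ball_subset_closedBall this)
  · have : (z : ℂ) ∈ Metric.closedBall ((R : ℂ) * Complex.I) b.rIn := by
      rw [Metric.mem_closedBall, dist_eq_norm]
      refine le_of_sq_le_sq ?_ hρ0.le
      change ‖(z : ℂ) - R * Complex.I‖ ^ 2 ≤ ρ ^ 2
      rw [hρ2, ← Complex.normSq_eq_norm_sq, Complex.normSq_apply]
      have h1 : ((z : ℂ) - R * Complex.I).re = z.re := by simp
      have h2 : ((z : ℂ) - R * Complex.I).im = z.im - R := by simp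
      rw [h1, h2]
      have h3 : Complex.normSq (z : ℂ) ≤ B := hmax hz
      have h4 : y₀ ≤ z.im := hmin hz
      rw [Complex.normSq_apply] at h3
      change z.re * z.re + z.im * z.im ≤ B at h3
      have h5 : B + 1 ≤ R * z.im := by
        calc B + 1 = (B + 1) / y₀ * y₀ := by field_simp
          _ ≤ R * z.im := mul_le_mul (by linarith) h4 hy₀p.le (by linarith)
      nlinarith
    change 0 < b (z : ℂ)
    rw [b.one_of_mem_closedBall this]
    exact one_pos

/-- Take `η = ψ G / Ψ`, where `ψ` is a bump positive on `K` and `Ψ` the sum of its translates. The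
translates of `ψ / Ψ` form a partition of unity on the support of `G`. -/
theorem exists_unfolding {K : Set ℍ} (hK : IsCompact K) {G : ℍ → ℂ} (hG : IsC2 G)
    (hinv : ∀ γ ∈ Γ, ∀ z : ℍ, G (γ • z) = G z) (hs : ∀ z ∈ tsupport G, ∃ γ ∈ Γ, γ • z ∈ K) :
    ∃ η : ℍ → ℂ, IsC2 η ∧ HasCompactSupport η ∧ ∀ z, ∑' g : modGroup Γ, η (g • z) = G z := by
  obtain ⟨ψ, hψ, hψc, hψ0, hψK⟩ := exists_bump hK
  have hψc' : HasCompactSupport fun z => (ψ z : ℂ) := hψc.comp_left (g := fun x : ℝ => (x : ℂ)) (by simp)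
  set Ψ : ℍ → ℂ := fun z => ∑' g : modGroup Γ, (ψ (g • z) : ℂ) with hΨ
  have hΨloc : ∀ z, ∃ s : Finset (modGroup Γ), ∀ᶠ w in 𝓝 z, Ψ w = ∑ g ∈ s, (ψ (g • w) : ℂ) := by
    intro z
    obtain ⟨s, hs⟩ := eventually_translate_eq_zero (Γ := Γ) hψc' z
    exact ⟨s, hs.mono fun w hw => tsum_eq_sum hw⟩
  have hΨ2 : IsC2 Ψ := by
    intro z
    obtain ⟨s, hs⟩ := hΨloc z
    refine IsC2.congr z (f := fun w => ∑ g ∈ s, (ψ (g • w) : ℂ)) ?_ hs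
    exact ContDiffAt.sum fun g _ => hψ.comp_modGroup g z
  have hΨinv : ∀ (g : modGroup Γ) z, Ψ (g • z) = Ψ z := by
    intro g z
    simp only [hΨ, ← mul_smul]
    exact (Equiv.mulRight g).tsum_eq fun g' : modGroup Γ => (ψ (g' • z) : ℂ)
  have hΨne : ∀ z ∈ tsupport G, Ψ z ≠ 0 := by
    intro z hz
    obtain ⟨γ, hγ, hγz⟩ := hs z hz
    obtain ⟨e, he⟩ := exists_modGroup hγ
    obtain ⟨s, hs'⟩ := eventually_translate_eq_zero (Γ := Γ) hψc' z
    have h1 : Ψ z = ((∑ g ∈ s, ψ (g • z) : ℝ) : ℂ) := by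
      rw [Complex.ofReal_sum]
      exact tsum_eq_sum hs'.self_of_nhds
    have h2 : 0 < ψ (e • z) := by rw [he]; exact hψK _ hγz
    have h3 : e ∈ s := by
      by_contra hn
      have := hs'.self_of_nhds e hn
      rw [Complex.ofReal_eq_zero] at this
      exact h2.ne' this
    have h4 : 0 < ∑ g ∈ s, ψ (g • z) :=
      Finset.sum_pos' (fun g _ => hψ0 _) ⟨e, h3, h2⟩
    rw [h1, Complex.ofReal_ne_zero]
    exact h4.ne'
  refine ⟨fun z => ψ z * G z / Ψ z, fun z => ?_, ?_, fun z => ?_⟩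
  · by_cases hz : z ∈ tsupport G
    · have h1 : ContDiffAt ℝ 2 (fun w : ℂ => (Ψ (ofComplex w))⁻¹) z :=
        (hΨ2 z).inv (by simpa [ofComplex_apply] using hΨne z hz)
      exact ((hψ z).mul (hG z)).mul h1
    · refine IsC2.congr z (f := fun _ => (0 : ℂ)) (g := fun z => (ψ z : ℂ) * G z / Ψ z)
        contDiffAt_const ?_
      filter_upwards [(isClosed_tsupport G).isOpen_compl.mem_nhds hz] with w hw
      rw [image_eq_zero_of_notMem_tsupport hw, mul_zero, zero_div]
  · refine hψc'.mono' (fun z hz => ?_)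
    refine subset_tsupport _ fun h0 => hz ?_
    change (ψ z : ℂ) = 0 at h0
    simp [h0]
  · have h1 : ∀ g : modGroup Γ, (ψ (g • z) : ℂ) * G (g • z) / Ψ (g • z) = ψ (g • z) * (G z / Ψ z) := by
      intro g
      obtain ⟨γ, hγ, h⟩ := modGroup_smul Γ g
      rw [hΨinv, h, hinv γ hγ, mul_div_assoc]
    simp only [h1]
    rw [tsum_mul_right]
    change Ψ z * (G z / Ψ z) = G z
    by_cases hz : z ∈ tsupport G
    · exact mul_div_cancel₀ _ (hΨne z hz)
    · rw [image_eq_zero_of_notMem_tsupport hz, zero_div, mul_zero]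

/-- The integral over the half-plane is the sum of the integrals over the translates of `D`, and
invariance of `T` lets the sum act on `u` alone. The group of transformations is used instead of
`Γ`, so `-1` causes no double counting. -/
theorem integral_unfold {D : Set ℍ} (hD : IsFundDomain Γ D) {u T : ℍ → ℂ} (hu : Continuous u)
    (hc : HasCompactSupport u) (hT : Continuous T) (hinv : ∀ γ ∈ Γ, ∀ z : ℍ, T (γ • z) = T z) :
    ∫ z, u z * T z = ∫ z in D, (∑' g : modGroup Γ, u (g • z)) * T z := by
  have hint : Integrable fun z => u z * T z :=
    (hu.mul hT).integrable_of_hasCompactSupport hc.mul_right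
  have hTg : ∀ (g : modGroup Γ) z, T (g • z) = T z := fun g z => by
    obtain ⟨γ, hγ, h⟩ := modGroup_smul Γ g
    rw [h, hinv γ hγ]
  rw [IsFundamentalDomain.integral_eq_tsum'' hD _ hint]
  simp only [hTg, ← tsum_mul_right]
  refine (integral_tsum (fun g => ?_) ?_).symm
  · exact ((hu.comp (continuous_const_smul g)).mul hT).aestronglyMeasurable
  · have h1 := IsFundamentalDomain.lintegral_eq_tsum'' hD fun z => ‖u z * T z‖ₑ
    simp only [hTg] at h1
    rw [← h1]
    exact hint.hasFiniteIntegral.ne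

/-- Green's formula for the theta kernels on `Γ \ ℍ`. -/
theorem green {N : ℕ} {L : Submodule ℤ V} (hN : 0 < N) (hL : IsEvenLattice N L)
    (hΓ : ActsTrivially N L Γ) {D : Set ℍ} (hD : IsFundDomain Γ D) (h : Disc N L) (τ : ℍ)
    {K : Set ℍ} (hK : IsCompact K) {G : ℍ → ℂ} (hG : IsC2 G)
    (hinv : ∀ γ ∈ Γ, ∀ z : ℍ, G (γ • z) = G z) (hs : ∀ z ∈ tsupport G, ∃ γ ∈ Γ, γ • z ∈ K) :
    ∫ z in D, G z * theta N L (lapPhi0 N) h τ z =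
      ∫ z in D, hypLaplacian G z * theta N L (phi0 N) h τ z := by
  obtain ⟨η, hη, hηc, hsum⟩ := exists_unfolding hK hG hinv hs
  have hηl : Continuous (hypLaplacian η) := continuous_hypLaplacian hη
  have hls : Function.support (hypLaplacian η) ⊆ tsupport η := by
    intro z hz
    by_contra hn
    refine hz ?_
    have : ∀ᶠ w in 𝓝 z, η w = (fun _ => (0 : ℂ)) w := by
      filter_upwards [(isClosed_tsupport η).isOpen_compl.mem_nhds hn] with w hw
      exact image_eq_zero_of_notMem_tsupport hw
    rw [hypLaplacian_congr this]
    simp [hypLaplacian, laplacian_apply]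
  -- Locally only finitely many translates of `η` are nonzero, so `Δ` passes through the sum.
  have hlsum : ∀ z, ∑' g : modGroup Γ, hypLaplacian η (g • z) = hypLaplacian G z := by
    intro z
    obtain ⟨s, hs⟩ := eventually_translate_eq_zero (Γ := Γ) hηc z
    have h1 : ∀ᶠ w in 𝓝 z, G w = ∑ g ∈ s, η (g • w) := hs.mono fun w hw => by
      rw [← hsum]; exact tsum_eq_sum hw
    rw [hypLaplacian_congr h1, hypLaplacian_sum s fun g _ => hη.comp_modGroup g]
    refine (tsum_eq_sum fun g hg => ?_).trans
      (Finset.sum_congr rfl fun g _ => (hypLaplacian_comp_modGroup hη g z).symm)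
    rw [← hypLaplacian_comp_modGroup hη g z, hypLaplacian_congr (g := fun _ => (0 : ℂ))
      (hs.mono fun w hw => hw g hg)]
    simp [hypLaplacian, laplacian_apply]
  have hcont := fun φ hφ => continuous_theta (φ := φ) hN hL.span_eq_top hφ h τ
  have hthinv : ∀ φ : Matrix (Fin 2) (Fin 2) ℝ → ℍ → ℍ → ℂ, (φ = phi0 N ∨ φ = lapPhi0 N) →
      ∀ γ ∈ Γ, ∀ z : ℍ, theta N L φ h τ (γ • z) = theta N L φ h τ z :=
    fun φ hφ γ hγ z => theta_invariant hL hφ hΓ h hγ τ z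
  -- The symmetry of `Δ` is used upstairs for the compactly supported `η`; folding both integrals
  -- back to `D` gives the formula for `G`.
  have := integral_mul_theta_lap hN hL.span_eq_top h τ hη hηc
  rw [integral_unfold hD hη.continuous hηc (hcont _ (Or.inr rfl)) (hthinv _ (Or.inr rfl)),
    integral_unfold hD hηl (hηc.mono' hls) (hcont _ (Or.inl rfl)) (hthinv _ (Or.inl rfl))] at this
  simpa only [hsum, hlsum] using this

end Green

/-! ### Fourier modes of periodic eigenfunctions of the Laplacian -/

theorem hasDerivAt_im_line {v : ℂ → ℂ} {x y : ℝ}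
    (hv : DifferentiableAt ℝ v (x + y * Complex.I)) :
    HasDerivAt (fun t : ℝ => v (x + t * Complex.I)) (fderiv ℝ v (x + y * Complex.I) Complex.I) y := by
  have h1 : HasDerivAt (fun t : ℝ => (x : ℂ) + t * Complex.I) Complex.I y := by
    simpa using ((Complex.ofRealCLM.hasDerivAt (x := y)).mul_const Complex.I).const_add (x : ℂ)
  exact hv.hasFDerivAt.comp_hasDerivAt y h1

theorem hasDerivAt_re_line {v : ℂ → ℂ} {x y : ℝ}
    (hv : DifferentiableAt ℝ v (x + y * Complex.I)) :
    HasDerivAt (fun t : ℝ => v (t + y * Complex.I)) (fderiv ℝ v (x + y * Complex.I) 1) x := by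
  have h1 : HasDerivAt (fun t : ℝ => (t : ℂ) + y * Complex.I) 1 x := by
    simpa using (Complex.ofRealCLM.hasDerivAt (x := x)).add_const (y * Complex.I)
  exact hv.hasFDerivAt.comp_hasDerivAt x h1

theorem im_line_pos {x y : ℝ} (hy : 0 < y) : 0 < ((x : ℂ) + y * Complex.I).im := by simpa using hy

theorem continuousAt_fderiv_apply {v : ℂ → ℂ} {w : ℂ} (hv : ContDiffAt ℝ 1 v w) (e : ℂ) :
    ContinuousAt (fun w => fderiv ℝ v w e) w :=
  ((hv.fderiv_right (m := 0) (by norm_num)).continuousAt).clm_apply continuousAt_const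

theorem continuous_line {v : ℂ → ℂ} (hv : ∀ w : ℂ, 0 < w.im → ContinuousAt v w) {y : ℝ}
    (hy : 0 < y) : Continuous fun x : ℝ => v (x + y * Complex.I) := by
  rw [continuous_iff_continuousAt]
  intro x
  exact ContinuousAt.comp (f := fun x : ℝ => (x : ℂ) + y * Complex.I) (g := v)
    (hv _ (im_line_pos hy)) (by fun_prop)

theorem hasDerivAt_integral_line {v : ℂ → ℂ} {e : ℝ → ℂ}
    (hv : ∀ w : ℂ, 0 < w.im → ContDiffAt ℝ 1 v w) (he : Continuous e) {a b y : ℝ} (hy : 0 < y) :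
    HasDerivAt (fun y : ℝ => ∫ x in a..b, v (x + y * Complex.I) * e x)
      (∫ x in a..b, fderiv ℝ v (x + y * Complex.I) Complex.I * e x) y := by
  have hcv : ∀ t : ℝ, 0 < t → Continuous fun x : ℝ => v (x + t * Complex.I) * e x := fun t ht =>
    (continuous_line (fun w hw => (hv w hw).continuousAt) ht).mul he
  have hcd : Continuous fun x : ℝ => fderiv ℝ v (x + y * Complex.I) Complex.I * e x :=
    (continuous_line (v := fun w => fderiv ℝ v w Complex.I)
      (fun w hw => continuousAt_fderiv_apply (hv w hw) _) hy).mul he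
  obtain ⟨M, hM⟩ := (isCompact_uIcc.prod isCompact_Icc).exists_bound_of_continuousOn
    (s := Set.uIcc a b ×ˢ Set.Icc (y / 2) (2 * y))
    (f := fun p : ℝ × ℝ => fderiv ℝ v (p.1 + p.2 * Complex.I) Complex.I * e p.1) (by
      intro p hp
      have hp2 : 0 < p.2 := by linarith [hp.2.1]
      refine (ContinuousAt.mul ?_ (he.comp continuous_fst).continuousAt).continuousWithinAt
      exact ContinuousAt.comp (f := fun p : ℝ × ℝ => (p.1 : ℂ) + p.2 * Complex.I)
        (g := fun w => fderiv ℝ v w Complex.I)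
        (continuousAt_fderiv_apply (hv _ (im_line_pos hp2)) _) (by fun_prop))
  refine (intervalIntegral.hasDerivAt_integral_of_dominated_loc_of_deriv_le (𝕜 := ℝ) (bound := fun _ => M)
    (F' := fun y x => fderiv ℝ v (x + y * Complex.I) Complex.I * e x)
    (Icc_mem_nhds (show y / 2 < y by linarith) (show y < 2 * y by linarith)) ?_
    ((hcv y hy).intervalIntegrable _ _) hcd.aestronglyMeasurable ?_ (by simp) ?_).2
  · filter_upwards [lt_mem_nhds hy] with t ht
    exact (hcv t ht).aestronglyMeasurable
  · exact ae_of_all _ fun x hx t ht => hM (x, t) ⟨Set.uIoc_subset_uIcc hx, ht⟩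
  · refine ae_of_all _ fun x hx t ht => ?_
    have ht0 : 0 < t := by linarith [ht.1]
    exact (hasDerivAt_im_line ((hv _ (im_line_pos ht0)).differentiableAt (by norm_num))).mul_const _

/-- Integration by parts over one period, where the boundary terms cancel. -/
theorem integral_deriv_mul_exp {p p' e : ℝ → ℂ} {c : ℂ} {α : ℝ}
    (hp : ∀ x, HasDerivAt p (p' x) x) (hp' : Continuous p')
    (he : ∀ x, HasDerivAt e (c * e x) x) (hpα : p α = p 0) (heα : e α = e 0) :
    ∫ x in (0 : ℝ)..α, p' x * e x = -c * ∫ x in (0 : ℝ)..α, p x * e x := by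
  have hpc : Continuous p := continuous_iff_continuousAt.mpr fun x => (hp x).continuousAt
  have hec : Continuous e := continuous_iff_continuousAt.mpr fun x => (he x).continuousAt
  have i1 : IntervalIntegrable (fun x => p' x * e x) volume 0 α :=
    (hp'.mul hec).intervalIntegrable _ _
  have i2 : IntervalIntegrable (fun x => p x * (c * e x)) volume 0 α :=
    (hpc.mul (continuous_const.mul hec)).intervalIntegrable _ _
  have h1 := intervalIntegral.integral_eq_sub_of_hasDerivAt (a := 0) (b := α)
    (fun x _ => (hp x).mul (he x)) (i1.add i2)
  simp only [Pi.mul_apply] at h1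
  rw [intervalIntegral.integral_add i1 i2, hpα, heα, sub_self] at h1
  have h2 : ∫ x in (0 : ℝ)..α, p x * (c * e x) = c * ∫ x in (0 : ℝ)..α, p x * e x := by
    rw [← intervalIntegral.integral_const_mul]
    congr 1; ext x; ring
  rw [h2] at h1
  linear_combination h1

/-- The character `x ↦ e(-nx/α)`. -/
def char (α : ℝ) (n : ℤ) (x : ℝ) : ℂ :=
  Complex.exp (-((2 * Real.pi / α * n : ℝ) : ℂ) * Complex.I * x)

theorem hasDerivAt_char (α : ℝ) (n : ℤ) (x : ℝ) :
    HasDerivAt (char α n) (-((2 * Real.pi / α * n : ℝ) : ℂ) * Complex.I * char α n x) x := by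
  have h := ((Complex.ofRealCLM.hasDerivAt (x := x)).const_mul
    (-((2 * Real.pi / α * n : ℝ) : ℂ) * Complex.I)).cexp
  refine h.congr_deriv ?_
  simp [char, mul_comm]

theorem continuous_char (α : ℝ) (n : ℤ) : Continuous (char α n) := by
  unfold char; fun_prop

theorem norm_char (α : ℝ) (n : ℤ) (x : ℝ) : ‖char α n x‖ = 1 := by
  have : -((2 * Real.pi / α * n : ℝ) : ℂ) * Complex.I * x =
      ((-(2 * Real.pi / α * n) * x : ℝ) : ℂ) * Complex.I := by push_cast; ring
  rw [char, this, Complex.norm_exp_ofReal_mul_I]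

theorem char_zero_apply (α : ℝ) (x : ℝ) : char α 0 x = 1 := by simp [char]

theorem char_period {α : ℝ} (hα : 0 < α) (n : ℤ) : char α n α = char α n 0 := by
  have : -((2 * Real.pi / α * n : ℝ) : ℂ) * Complex.I * α = (-n : ℤ) * (2 * Real.pi * Complex.I) := by
    have : (α : ℂ) ≠ 0 := by exact_mod_cast hα.ne'
    push_cast; field_simp
  rw [char, this, Complex.exp_int_mul_two_pi_mul_I]
  simp [char]

/-- The `n`-th Fourier mode of the restriction of `u` to the line of height `y`. -/
def mode (α : ℝ) (u : ℂ → ℂ) (n : ℤ) (y : ℝ) : ℂ :=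
  (1 / α : ℂ) * ∫ x in (0 : ℝ)..α, u (x + y * Complex.I) * char α n x

theorem norm_mode_le {α : ℝ} (hα : 0 < α) {u : ℂ → ℂ} {y M : ℝ} (n : ℤ)
    (h : ∀ x ∈ Set.Icc 0 α, ‖u (x + y * Complex.I)‖ ≤ M) : ‖mode α u n y‖ ≤ M := by
  have h1 := intervalIntegral.norm_integral_le_of_norm_le_const (a := 0) (b := α) (C := M)
    (f := fun x : ℝ => u (x + y * Complex.I) * char α n x) (fun x hx => by
      rw [Set.uIoc_of_le hα.le] at hx
      rw [norm_mul, norm_char, mul_one]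
      exact h x ⟨hx.1.le, hx.2⟩)
  rw [sub_zero, abs_of_pos hα] at h1
  rw [mode, norm_mul, norm_div, norm_one, Complex.norm_real, Real.norm_of_nonneg hα.le,
    one_div, inv_mul_le_iff₀ hα]
  linarith

theorem hasDerivAt_mode {α : ℝ} {u : ℂ → ℂ}
    (hu : ∀ w : ℂ, 0 < w.im → ContDiffAt ℝ 1 u w) (n : ℤ) {y : ℝ} (hy : 0 < y) :
    HasDerivAt (mode α u n) (mode α (fun w => fderiv ℝ u w Complex.I) n y) y :=
  (hasDerivAt_integral_line hu (continuous_char α n) hy).const_mul _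

/-- The eigenvalue equation expresses `u_yy` through `u` and `u_xx`; two integrations by parts over
a period turn `u_xx` into multiplication of the mode by `-(2πn/α)²`. -/
theorem hasDerivAt_mode_fderiv {α : ℝ} (hα : 0 < α) {u : ℂ → ℂ} {lam : ℂ}
    (hu : ∀ w : ℂ, 0 < w.im → ContDiffAt ℝ 2 u w) (hper : ∀ w : ℂ, 0 < w.im → u (w + α) = u w)
    (hlap : ∀ w : ℂ, 0 < w.im →
      Laplacian.laplacian u w = -(lam / (w.im : ℂ) ^ 2) * u w) (n : ℤ) {y : ℝ} (hy : 0 < y) :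
    HasDerivAt (mode α (fun w => fderiv ℝ u w Complex.I) n)
      ((((2 * Real.pi / α * n : ℝ) : ℂ) ^ 2 - lam / (y : ℂ) ^ 2) * mode α u n y) y := by
  have hfd : ∀ e w : ℂ, 0 < w.im → ContDiffAt ℝ 1 (fun w => fderiv ℝ u w e) w := fun e w hw =>
    ((hu w hw).fderiv_right (m := 1) (by norm_num)).clm_apply contDiffAt_const
  have hcl : ∀ v : ℂ → ℂ, (∀ w : ℂ, 0 < w.im → ContinuousAt v w) →
      IntervalIntegrable (fun x : ℝ => v (x + y * Complex.I) * char α n x) volume 0 α :=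
    fun v hv => ((continuous_line hv hy).mul (continuous_char α n)).intervalIntegrable _ _
  refine (hasDerivAt_mode (hfd Complex.I) n hy).congr_deriv ?_
  set c : ℂ := -((2 * Real.pi / α * n : ℝ) : ℂ) * Complex.I with hc
  -- Periodicity of the first derivative is needed so that the second integration by parts also has
  -- no boundary term.
  have hper' : ∀ w : ℂ, 0 < w.im → fderiv ℝ u (w + α) = fderiv ℝ u w := by
    intro w hw
    rw [← fderiv_comp_add_right (f := u) (α : ℂ)]
    refine Filter.EventuallyEq.fderiv_eq ?_
    filter_upwards [(isOpen_lt continuous_const Complex.continuous_im).mem_nhds hw] with w hw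
    exact hper w hw
  have hα0 : ((α : ℝ) : ℂ) + y * Complex.I = ((0 : ℝ) : ℂ) + y * Complex.I + α := by
    push_cast; ring
  have e1 := integral_deriv_mul_exp (p := fun x : ℝ => u (x + y * Complex.I)) (α := α)
    (fun x => hasDerivAt_re_line ((hu _ (im_line_pos hy)).differentiableAt (by norm_num)))
    (continuous_line (v := fun w => fderiv ℝ u w 1)
      (fun w hw => (hfd 1 w hw).continuousAt) hy) (hasDerivAt_char α n)
    (by simp only [hα0]; exact hper _ (im_line_pos hy)) (char_period hα n)
  have e2 := integral_deriv_mul_exp (p := fun x : ℝ => fderiv ℝ u (x + y * Complex.I) 1) (α := α)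
    (fun x => hasDerivAt_re_line (v := fun w => fderiv ℝ u w 1)
      ((hfd 1 _ (im_line_pos hy)).differentiableAt (by norm_num)))
    (continuous_line (v := fun w => fderiv ℝ (fun w => fderiv ℝ u w 1) w 1)
      (fun w hw => continuousAt_fderiv_apply (hfd 1 w hw) 1) hy) (hasDerivAt_char α n)
    (by simp only [hα0]; rw [hper' _ (im_line_pos hy)]) (char_period hα n)
  have e3 : ∫ x in (0 : ℝ)..α, fderiv ℝ (fun w => fderiv ℝ u w Complex.I) (x + y * Complex.I)
      Complex.I * char α n x = -(lam / (y : ℂ) ^ 2) * (∫ x in (0 : ℝ)..α,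
        u (x + y * Complex.I) * char α n x) - ∫ x in (0 : ℝ)..α,
        fderiv ℝ (fun w => fderiv ℝ u w 1) (x + y * Complex.I) 1 * char α n x := by
    rw [← intervalIntegral.integral_const_mul, ← intervalIntegral.integral_sub
      ((hcl u fun w hw => (hu w hw).continuousAt).const_mul _)
      (hcl (fun w => fderiv ℝ (fun w => fderiv ℝ u w 1) w 1)
        fun w hw => continuousAt_fderiv_apply (hfd 1 w hw) 1)]
    refine intervalIntegral.integral_congr fun x _ => ?_
    have h1 := hlap _ (im_line_pos (x := x) hy)
    rw [laplacian_apply, ← fderiv_fderiv_apply (hu _ (im_line_pos hy)),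
      ← fderiv_fderiv_apply (hu _ (im_line_pos hy))] at h1
    have h2 : ((x : ℂ) + y * Complex.I).im = y := by simp
    rw [h2] at h1
    linear_combination char α n x * h1
  unfold mode
  rw [e3, e2, e1]
  have hI : c ^ 2 = -((2 * Real.pi / α * n : ℝ) : ℂ) ^ 2 := by
    rw [hc, mul_pow, Complex.I_sq]; ring
  simp only [← hc]
  linear_combination (-(1 / α : ℂ) * ∫ x in (0 : ℝ)..α, u (x + y * Complex.I) * char α n x) * hI

/-- Parseval's identity on a horocycle. -/
theorem hasSum_sq_mode {α : ℝ} (hα : 0 < α) {u : ℂ → ℂ}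
    (hu : ∀ w : ℂ, 0 < w.im → ContinuousAt u w) {y : ℝ} (hy : 0 < y) :
    HasSum (fun n => ‖mode α u n y‖ ^ 2)
      (α⁻¹ * ∫ x in (0 : ℝ)..α, ‖u (x + y * Complex.I)‖ ^ 2) := by
  have hc := continuous_line hu hy
  have h := hasSum_sq_fourierCoeffOn hα (f := fun x : ℝ => u (x + y * Complex.I)) (by
    obtain ⟨M, hM⟩ := isCompact_Icc.exists_bound_of_continuousOn (s := Set.Icc 0 α) hc.continuousOn
    refine MemLp.of_bound hc.aestronglyMeasurable M ?_
    exact ae_restrict_of_forall_mem measurableSet_Ioc fun x hx => hM x ⟨hx.1.le, hx.2⟩)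
  rw [sub_zero, smul_eq_mul] at h
  rw [show (fun n => ‖mode α u n y‖ ^ 2) = fun n => ‖fourierCoeffOn hα
    (fun x : ℝ => u (x + y * Complex.I)) n‖ ^ 2 from funext fun n => ?_]
  · exact h
  rw [fourierCoeffOn_eq_integral, sub_zero, mode, Complex.real_smul]
  push_cast
  congr 4
  ext x
  rw [fourier_coe_apply, smul_eq_mul, mul_comm, char]
  congr 2
  push_cast
  ring

/-! ### Fourier expansions of spectral deformations at the cusps -/

theorem exists_ball_bound {X : Type*} [TopologicalSpace X] {S : Set X} (hS : IsCompact S)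
    {V : Set ℂ} (hV : IsOpen V) {G : ℂ → X → ℂ}
    (hG : ContinuousOn (fun p : ℂ × X => G p.1 p.2) (V ×ˢ S)) {s : ℂ} (hs : s ∈ V) :
    ∃ ε > 0, Metric.closedBall s ε ⊆ V ∧
      ∃ M, ∀ w ∈ Metric.closedBall s ε, ∀ x ∈ S, ‖G w x‖ ≤ M := by
  obtain ⟨ε, hε, hsub⟩ := Metric.nhds_basis_closedBall.mem_iff.mp (hV.mem_nhds hs)
  obtain ⟨M, hM⟩ := ((isCompact_closedBall s ε).prod hS).exists_bound_of_continuousOn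
    (hG.mono (Set.prod_mono hsub subset_rfl))
  exact ⟨ε, hε, hsub, M, fun w hw x hx => hM (w, x) ⟨hw, hx⟩⟩

theorem differentiableOn_integral_compact {X : Type*} [TopologicalSpace X] [MeasurableSpace X]
    [OpensMeasurableSpace X] {μ : Measure X} [IsFiniteMeasureOnCompacts μ] {S : Set X}
    (hS : IsCompact S) (hSm : MeasurableSet S) {V : Set ℂ} (hV : IsOpen V) {G : ℂ → X → ℂ}
    (hG : ContinuousOn (fun p : ℂ × X => G p.1 p.2) (V ×ˢ S))
    (hol : ∀ x ∈ S, DifferentiableOn ℂ (fun s => G s x) V) :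
    DifferentiableOn ℂ (fun s => ∫ x in S, G s x ∂μ) V := by
  refine differentiableOn_integral_of_dominated hV (fun s hs => ?_)
    (ae_restrict_of_forall_mem hSm hol) fun s hs => ?_
  · exact ContinuousOn.aestronglyMeasurable (hG.comp (f := fun x => (s, x)) (by fun_prop)
      fun x hx => ⟨hs, hx⟩) hSm
  · obtain ⟨ε, hε, -, M, hM⟩ := exists_ball_bound hS hV hG hs
    refine ⟨ε, hε, fun _ => M, ?_, ae_restrict_of_forall_mem hSm fun x hx w hw =>
      hM w (Metric.ball_subset_closedBall hw) x hx⟩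
    exact integrableOn_const hS.measure_lt_top.ne

/-- The pullback of `f` under `g`, as a function on `ℂ`. -/
def pull (g : SL(2, ℤ)) (f : ℍ → ℂ) (w : ℂ) : ℂ := f (g • ofComplex w)

theorem IsC2.contDiffAt_pull {f : ℍ → ℂ} (hf : IsC2 f) (g : SL(2, ℤ)) {w : ℂ} (hw : 0 < w.im) :
    ContDiffAt ℝ 2 (pull g f) w := by
  have h := hf.comp_smul g (ofComplex w)
  rw [ofComplex_apply_of_im_pos hw] at h
  exact h

section Width

variable {Γ : Subgroup SL(2, ℤ)} {f : ℍ → ℂ} {lam : ℂ}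

/-- The generator of the cusp stabiliser lies in `Γ` only up to sign, but `-1` acts trivially. -/
theorem apply_translate [Γ.FiniteIndex] (hinv : ∀ γ ∈ Γ, ∀ z : ℍ, f (γ • z) = f z) (g : SL(2, ℤ))
    (z : ℍ) : f (g • (ModularGroup.T ^ cuspWidth Γ g • z)) = f (g • z) := by
  obtain ⟨γ, hγ, h⟩ := exists_smul_eq_of_mem_pm (cuspWidth_spec Γ g).2
  rw [← hinv γ hγ (g • z), ← h, mul_smul, mul_smul, inv_smul_smul]

theorem pull_periodic [Γ.FiniteIndex] (hinv : ∀ γ ∈ Γ, ∀ z : ℍ, f (γ • z) = f z) (g : SL(2, ℤ))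
    {w : ℂ} (hw : 0 < w.im) : pull g f (w + (cuspWidth Γ g : ℝ)) = pull g f w := by
  have hw' : 0 < (w + (cuspWidth Γ g : ℝ)).im := by simpa using hw
  rw [pull, pull, ← apply_translate hinv g (ofComplex w)]
  congr 2
  apply UpperHalfPlane.ext
  rw [ofComplex_apply_of_im_pos hw', ← zpow_natCast, ModularGroup.coe_T_zpow_smul_eq,
    ofComplex_apply_of_im_pos hw]
  simp

theorem laplacian_pull (hf : IsWeakMaassForm Γ lam f) (g : SL(2, ℤ)) {w : ℂ} (hw : 0 < w.im) :
    Laplacian.laplacian (pull g f) w = -(lam / (w.im : ℂ) ^ 2) * pull g f w := by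
  have h1 := hypLaplacian_comp_smul hf.isC2 g (ofComplex w)
  rw [hf.eigen, hypLaplacian] at h1
  have h2 : (ofComplex w).im = w.im := by rw [ofComplex_apply_of_im_pos hw]; rfl
  have h3 : (w.im : ℂ) ≠ 0 := by exact_mod_cast hw.ne'
  rw [h2, ofComplex_apply_of_im_pos hw] at h1
  change -(w.im : ℂ) ^ 2 * Laplacian.laplacian (pull g f) w = _ at h1
  have h4 : f (g • ⟨w, hw⟩) = pull g f w := by rw [pull, ofComplex_apply_of_im_pos hw]
  rw [h4] at h1
  field_simp
  linear_combination -h1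

theorem constTerm_eq_mode (g : SL(2, ℤ)) (y : ℝ) :
    constTerm Γ g f y = mode (cuspWidth Γ g : ℝ) (pull g f) 0 y := by
  simp [constTerm, mode, pull, char_zero_apply]

theorem hasDerivAt_constTerm (hf : IsC2 f) (g : SL(2, ℤ)) {y : ℝ} (hy : 0 < y) :
    HasDerivAt (constTerm Γ g f)
      (mode (cuspWidth Γ g : ℝ) (fun w => fderiv ℝ (pull g f) w Complex.I) 0 y) y := by
  rw [show constTerm Γ g f = mode (cuspWidth Γ g : ℝ) (pull g f) 0 from
    funext fun y => constTerm_eq_mode g y]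
  exact hasDerivAt_mode (fun w hw => (hf.contDiffAt_pull g hw).of_le (by norm_num)) 0 hy

theorem isCompact_rect (I : Set ℝ) (hI : IsCompact I) {a b : ℝ} (ha : 0 < a) :
    IsCompact (rect I (Set.Icc a b)) := by
  have : rect I (Set.Icc a b) = (fun p : ℝ × ℝ => pt p.1 p.2) '' (I ×ˢ Set.Icc a b) := by
    ext z
    constructor
    · intro hz
      exact ⟨(z.re, z.im), hz, pt_re_im z⟩
    · rintro ⟨p, hp, rfl⟩
      have := ha.trans_le hp.2.1
      exact ⟨by rw [pt_re this]; exact hp.1, by rw [pt_im this]; exact hp.2⟩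
  rw [this]
  refine (hI.prod isCompact_Icc).image_of_continuousOn fun p hp => ?_
  have hp2 : 0 < p.2 := ha.trans_le hp.2.1
  refine ContinuousAt.continuousWithinAt ?_
  exact ContinuousAt.comp (f := fun p : ℝ × ℝ => (p.1 : ℂ) + p.2 * Complex.I)
    (g := fun w => (ofComplex w : ℍ))
    ((contMDiffAt_ofComplex (n := 0) (im_line_pos hp2)).continuousAt) (by fun_prop)

/-- The growth condition gives the bound from some height on; the remaining part of the strip is
compact. -/
theorem IsWeakMaassForm.strip_bound (hf : IsWeakMaassForm Γ lam f) (g : SL(2, ℤ)) (R : ℝ) :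
    ∃ C K : ℝ, 0 ≤ C ∧ 0 ≤ K ∧ ∀ z : ℍ, |z.re| ≤ R → 1 ≤ z.im →
      ‖f (g • z)‖ ≤ K * Real.exp (C * z.im) := by
  obtain ⟨C, hC, hO⟩ := hf.growth
  obtain ⟨K, hK⟩ := (hO g).bound
  obtain ⟨A, hA⟩ := atImInfty_mem _ |>.mp hK
  obtain ⟨M, hM⟩ := (isCompact_rect (Set.Icc (-R) R) isCompact_Icc (b := A)
    one_pos).exists_bound_of_continuousOn
    (f := fun z => f (g • z)) (hf.isC2.comp_smul g).continuous.continuousOn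
  refine ⟨C, max |K| |M|, hC.le, (abs_nonneg K).trans (le_max_left _ _), fun z hz hy => ?_⟩
  rcases le_total A z.im with h | h
  · have h1 := hA z h
    rw [Set.mem_ofPred_eq, Real.norm_of_nonneg (Real.exp_pos _).le] at h1
    refine h1.trans ?_
    gcongr
    exact (le_abs_self K).trans (le_max_left _ _)
  · have h1 := hM z ⟨abs_le.mp hz, hy, h⟩
    refine (h1.trans ((le_abs_self M).trans (le_max_right |K| |M|))).trans ?_
    exact le_mul_of_one_le_right ((abs_nonneg K).trans (le_max_left _ _))
      (Real.one_le_exp (by positivity))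

end Width

section Deformation

variable {Γ : Subgroup SL(2, ℤ)} [Γ.FiniteIndex] {f : ℍ → ℂ} {U : Set ℂ} {F : ℂ → ℍ → ℂ}

omit [Γ.FiniteIndex] in
theorem IsSpectralDeformation.continuousOn_pt (hF : IsSpectralDeformation Γ f U F) (g : SL(2, ℤ))
    {X : Type*} [TopologicalSpace X] {p : X → ℝ × ℝ} (hp : Continuous p) {S : Set X}
    (hS : ∀ x ∈ S, 0 < (p x).2) :
    ContinuousOn (fun q : ℂ × X => F q.1 (g • pt (p q.2).1 (p q.2).2)) (U ×ˢ S) := by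
  refine hF.continuousOn.comp (f := fun q : ℂ × X => (q.1, g • pt (p q.2).1 (p q.2).2))
    (fun q hq => ContinuousAt.continuousWithinAt ?_) fun q hq => ⟨hq.1, trivial⟩
  refine continuousAt_fst.prodMk (ContinuousAt.const_smul ?_ g)
  exact ContinuousAt.comp (f := fun q : ℂ × X => ((p q.2).1 : ℂ) + (p q.2).2 * Complex.I)
    (g := fun w => (ofComplex w : ℍ))
    ((contMDiffAt_ofComplex (n := 0) (im_line_pos (hS _ hq.2))).continuousAt) (by fun_prop)

omit [Γ.FiniteIndex] in
theorem IsSpectralDeformation.differentiableOn_mode (hF : IsSpectralDeformation Γ f U F)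
    (g : SL(2, ℤ)) {α : ℝ} (hα : 0 < α) (n : ℤ) {y : ℝ} (hy : 0 < y) :
    DifferentiableOn ℂ (fun s => mode α (pull g (F s)) n y) U := by
  unfold mode
  simp only [intervalIntegral.integral_of_le hα.le, ← integral_Icc_eq_integral_Ioc]
  refine (differentiableOn_integral_compact isCompact_Icc measurableSet_Icc hF.isOpen
    (G := fun s (x : ℝ) => pull g (F s) (x + y * Complex.I) * char α n x) ?_ fun x _ => ?_).const_mul _
  · exact (hF.continuousOn_pt g (p := fun x : ℝ => (x, y)) (by fun_prop) fun _ _ => hy).mul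
      ((continuous_char α n).comp continuous_snd).continuousOn
  · exact (hF.holomorphic _).mul_const _

/-- For the mode `n = 0` the equation in `y` is Euler's equation with exponents `s` and `1 - s`. -/
theorem IsSpectralDeformation.constTerm_form (hF : IsSpectralDeformation Γ f U F) (g : SL(2, ℤ))
    {s : ℂ} (hs : s ∈ U) (hs' : 2 * s - 1 ≠ 0) : ∃ A B : ℂ, ∀ y : ℝ, 0 < y →
      constTerm Γ g (F s) y = A * (y : ℂ) ^ s + B * (y : ℂ) ^ (1 - s) := by
  have hw := hF.weakMaass s hs
  refine eulerODE_solution hs' (fun y hy => hasDerivAt_constTerm hw.isC2 g hy) fun y hy => ?_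
  refine (hasDerivAt_mode_fderiv (by exact_mod_cast cuspWidth_pos Γ g)
    (fun w hw' => hw.isC2.contDiffAt_pull g hw') (fun w hw' => pull_periodic hw.invariant g hw')
    (fun w hw' => laplacian_pull hw g hw') 0 hy).congr_deriv ?_
  rw [constTerm_eq_mode]
  simp
  ring

theorem exists_hasConstTerms {ι : Type} (σ : ι → SL(2, ℤ)) (hF : IsSpectralDeformation Γ f U F) :
    ∃ A B : ι → ℂ → ℂ, HasConstTerms Γ σ F A B := by
  have hα : ∀ g, (0 : ℝ) < cuspWidth Γ g := fun g => by exact_mod_cast cuspWidth_pos Γ g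
  have key : ∀ c : ι, ∃ A B : ℂ → ℂ, AnalyticAt ℂ A 1 ∧ AnalyticAt ℂ B 1 ∧
      ∀ᶠ s in 𝓝 (1 : ℂ), ∀ y : ℝ, 0 < y →
        constTerm Γ (σ c) (F s) y = A s * (y : ℂ) ^ s + B s * (y : ℂ) ^ (1 - s) := by
    intro c
    have han : ∀ y : ℝ, 0 < y → AnalyticAt ℂ (fun s => constTerm Γ (σ c) (F s) y) 1 := by
      intro y hy
      simp only [constTerm_eq_mode]
      exact (hF.differentiableOn_mode (σ c) (hα _) 0 hy).analyticAt (hF.isOpen.mem_nhds hF.one_mem)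
    refine powerSolutions_analytic (a := fun s => constTerm Γ (σ c) (F s)) (han 1 one_pos)
      (han 2 two_pos) ?_
    have h1 : ∀ᶠ s in 𝓝 (1 : ℂ), 2 * s - 1 ≠ 0 :=
      ContinuousAt.eventually_ne (by fun_prop) (by norm_num)
    filter_upwards [h1, hF.isOpen.mem_nhds hF.one_mem] with s hs hsU
    exact hF.constTerm_form (σ c) hsU hs
  choose A B h1 h2 h3 using key
  exact ⟨A, B, fun c => ⟨h1 c, h2 c, h3 c⟩⟩

theorem IsSpectralDeformation.isModeFamily (hF : IsSpectralDeformation Γ f U F) (g : SL(2, ℤ))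
    {V : Set ℂ} (hV : V ⊆ U)
    (hb : ∃ M : ℝ, ∀ s ∈ V, ∀ x ∈ Set.Icc (0 : ℝ) (cuspWidth Γ g), ∀ y ∈ Set.Icc (1 : ℝ) 2,
      ‖F s (g • pt x y)‖ ≤ M) :
    IsModeFamily (2 * Real.pi / (cuspWidth Γ g : ℝ)) V
      (fun n s => mode (cuspWidth Γ g : ℝ) (pull g (F s)) n)
      (fun n s => mode (cuspWidth Γ g : ℝ) (fun w => fderiv ℝ (pull g (F s)) w Complex.I) n) := by
  have hα : (0 : ℝ) < cuspWidth Γ g := by exact_mod_cast cuspWidth_pos Γ g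
  refine ⟨fun n s hs y hy => ?_, fun n s hs y hy => ?_, fun n y hy => ?_, ?_, fun s hs => ?_⟩
  · exact hasDerivAt_mode (fun w hw =>
      ((hF.weakMaass s (hV hs)).isC2.contDiffAt_pull g hw).of_le (by norm_num)) n hy
  · have hw := hF.weakMaass s (hV hs)
    exact hasDerivAt_mode_fderiv hα
      (fun w hw' => hw.isC2.contDiffAt_pull g hw') (fun w hw' => pull_periodic hw.invariant g hw')
      (fun w hw' => laplacian_pull hw g hw') n hy
  · exact (hF.differentiableOn_mode g hα n hy).mono hV
  · obtain ⟨M, hM⟩ := hb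
    exact ⟨M, fun n s hs y hy => norm_mode_le hα n fun x hx => hM s hs x hx y hy⟩
  · obtain ⟨C, K, -, -, h⟩ := (hF.weakMaass s (hV hs)).strip_bound g (cuspWidth Γ g)
    refine ⟨C, K, fun n y hy => norm_mode_le hα n fun x hx => ?_⟩
    have hy0 : 0 < y := by linarith
    have := h (pt x y) (by rw [pt_re hy0, abs_of_nonneg hx.1]; exact hx.2) (by rwa [pt_im hy0])
    rwa [pt_im hy0] at this

/-- Near `s = 1` the mean square of `F s` on horocycles has exponential growth uniformly
in `s`. -/
theorem IsSpectralDeformation.exists_l2_bound (hF : IsSpectralDeformation Γ f U F)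
    (g : SL(2, ℤ)) : ∃ ε > 0, Metric.ball (1 : ℂ) ε ⊆ U ∧ ∃ C K : ℝ, 0 ≤ C ∧ 0 ≤ K ∧
      ∀ s ∈ Metric.ball (1 : ℂ) ε, ∀ y : ℝ, 1 ≤ y →
        ∫ x in (0 : ℝ)..(cuspWidth Γ g : ℝ), ‖F s (g • pt x y)‖ ^ 2 ≤ K * Real.exp (C * y) := by
  set α : ℝ := ((cuspWidth Γ g : ℕ) : ℝ) with hαd
  have hα : 0 < α := Nat.cast_pos.mpr (cuspWidth_pos Γ g)
  obtain ⟨ε, hε, hεU, M, hM⟩ := exists_ball_bound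
    (S := Set.Icc (0 : ℝ) α ×ˢ Set.Icc (1 : ℝ) 2) (isCompact_Icc.prod isCompact_Icc) hF.isOpen
    (G := fun s p => F s (g • pt p.1 p.2))
    (hF.continuousOn_pt g (p := id) continuous_id fun p hp => by
      have := hp.2.1; simp only [id]; linarith) hF.one_mem
  -- Radius at most `1/2` gives `‖s (1 - s)‖ ≤ 3/4`, within the bound `1` required by the estimates
  -- for the mode equations.
  set δ := min ε (1 / 2) with hδ
  have hδ0 : 0 < δ := lt_min hε (by norm_num)
  have hsub : Metric.ball (1 : ℂ) δ ⊆ Metric.closedBall 1 ε :=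
    Metric.ball_subset_closedBall.trans (Metric.closedBall_subset_closedBall (min_le_left _ _))
  have hfam := hF.isModeFamily g (hsub.trans hεU)
    ⟨M, fun s hs x hx y hy => hM s (hsub hs) (x, y) ⟨hx, hy⟩⟩
  obtain ⟨S, hS1, C, K, hC, hK, hS2⟩ := hfam.uniform_bound (by positivity) Metric.isOpen_ball
    (convex_ball _ _).isPreconnected ⟨1, Metric.mem_ball_self hδ0⟩ (fun s hs => by
      have h1 : ‖s - 1‖ < 1 / 2 := (mem_ball_iff_norm.mp hs).trans_le (min_le_right _ _)
      have h2 : ‖s‖ ≤ 3 / 2 := by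
        have := norm_add_le (s - 1) 1
        rw [sub_add_cancel, norm_one] at this
        linarith
      rw [norm_mul, norm_sub_rev]
      nlinarith [norm_nonneg s, norm_nonneg (s - 1)])
  refine ⟨δ, hδ0, hsub.trans hεU, 2 * C, α * M ^ 2 + α * (S.card * K ^ 2), by positivity,
    by positivity, fun s hs y hy => ?_⟩
  have hy0 : 0 < y := by linarith
  have hcont : ∀ w : ℂ, 0 < w.im → ContinuousAt (pull g (F s)) w := fun w hw =>
    ((hF.weakMaass s (hεU (hsub hs))).isC2.contDiffAt_pull g hw).continuousAt
  have h1 := hasSum_sq_mode hα hcont hy0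
  have h2 := hasSum_sq_mode hα hcont one_pos
  have h3 : HasSum (fun n => if n ∈ S then (K * Real.exp (C * y)) ^ 2 else 0)
      (∑ n ∈ S, if n ∈ S then (K * Real.exp (C * y)) ^ 2 else 0) :=
    hasSum_sum_of_ne_finset_zero fun n hn => if_neg hn
  -- Parseval at height `y` is compared term by term with Parseval at height `1`, except for the
  -- finitely many modes in `S`, which are bounded directly.
  have h4 := hasSum_le (fun n => ?_) h1 (h2.add h3)
  · have h5 : ∫ x in (0 : ℝ)..α, ‖pull g (F s) (x + (1 : ℝ) * Complex.I)‖ ^ 2 ≤ α * M ^ 2 := by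
      have h6 := intervalIntegral.norm_integral_le_of_norm_le_const (a := 0) (b := α) (C := M ^ 2)
        (f := fun x : ℝ => ‖pull g (F s) (x + (1 : ℝ) * Complex.I)‖ ^ 2) (fun x hx => by
          rw [Set.uIoc_of_le hα.le] at hx
          rw [norm_pow, norm_norm]
          exact pow_le_pow_left₀ (norm_nonneg _)
            (hM s (hsub hs) (x, 1) ⟨⟨hx.1.le, hx.2⟩, by norm_num⟩) 2)
      rw [sub_zero, abs_of_pos hα] at h6
      linarith [le_abs_self (∫ x in (0 : ℝ)..α, ‖pull g (F s) (x + (1 : ℝ) * Complex.I)‖ ^ 2),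
        Real.norm_eq_abs (∫ x in (0 : ℝ)..α, ‖pull g (F s) (x + (1 : ℝ) * Complex.I)‖ ^ 2)]
    rw [Finset.sum_ite_mem, Finset.inter_self, Finset.sum_const, nsmul_eq_mul,
      inv_mul_le_iff₀ hα, mul_add, mul_inv_cancel_left₀ hα.ne'] at h4
    refine h4.trans ?_
    have h6 : (1 : ℝ) ≤ Real.exp (2 * C * y) := Real.one_le_exp (by positivity)
    have h7 : (K * Real.exp (C * y)) ^ 2 = K ^ 2 * Real.exp (2 * C * y) := by
      rw [mul_pow, ← Real.exp_nat_mul]; congr 2; push_cast; ring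
    rw [h7, add_mul]
    have h8 := mul_le_mul_of_nonneg_left h6 (show 0 ≤ α * M ^ 2 by positivity)
    linarith
  · split_ifs with hn
    · have := pow_le_pow_left₀ (norm_nonneg _) (hS2 n hn s hs y hy) 2
      linarith [sq_nonneg ‖mode α (pull g (F s)) n 1‖]
    · rw [add_zero]
      exact pow_le_pow_left₀ (norm_nonneg _) (hS1 n hn s hs y hy) 2

end Deformation

/-! ### Integrals over cuspidal strips -/

/-- The part of the strip `-1/2 ≤ x ≤ a - 1/2` with `y ∈ J`. -/
abbrev slab (a : ℕ) (J : Set ℝ) : Set ℍ := rect (Set.Icc (-(1 / 2)) ((a : ℝ) - 1 / 2)) J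

theorem abs_re_le_of_mem_slab {a : ℕ} (ha : 0 < a) {J : Set ℝ} {z : ℍ} (hz : z ∈ slab a J) :
    |z.re| ≤ a := by
  have h1 : (1 : ℝ) ≤ a := by exact_mod_cast ha
  have h2 := hz.1
  rw [abs_le]
  constructor <;> linarith [h2.1, h2.2]

theorem pt_mem_slab {a : ℕ} {J : Set ℝ} {x y : ℝ} (hy : 0 < y)
    (hx : x ∈ Set.Icc (-(1 / 2)) ((a : ℝ) - 1 / 2)) (hJ : y ∈ J) : pt x y ∈ slab a J :=
  ⟨by rwa [pt_re hy], by rwa [pt_im hy]⟩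

theorem continuousAt_pt {p : ℝ × ℝ} (hp : 0 < p.2) :
    ContinuousAt (fun p : ℝ × ℝ => pt p.1 p.2) p :=
  ContinuousAt.comp (f := fun p : ℝ × ℝ => (p.1 : ℂ) + p.2 * Complex.I)
    (g := fun w => (ofComplex w : ℍ))
    ((contMDiffAt_ofComplex (n := 0) (im_line_pos hp)).continuousAt) (by fun_prop)

theorem integrableOn_slab {a : ℕ} {J : Set ℝ} (hJ : MeasurableSet J) (hJ1 : J ⊆ Set.Ioi 1)
    {G : ℍ → ℂ} (hG : Continuous G) {b : ℝ → ℝ} (hb : IntegrableOn b J)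
    (h : ∀ z ∈ slab a J, ‖G z‖ ≤ b z.im) : IntegrableOn G (slab a J) := by
  have hJ0 : J ⊆ Set.Ioi 0 := fun y hy => zero_lt_one.trans (Set.mem_Ioi.mp (hJ1 hy))
  rw [integrableOn_rect_iff G measurableSet_Icc hJ hJ0]
  have h1 : IntegrableOn (fun p : ℝ × ℝ => b p.2)
      (Set.Icc (-(1 / 2)) ((a : ℝ) - 1 / 2) ×ˢ J) := by
    rw [IntegrableOn, Measure.volume_eq_prod, ← Measure.prod_restrict]
    have : IsFiniteMeasure (volume.restrict (Set.Icc (-(1 / 2)) ((a : ℝ) - 1 / 2))) :=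
      ⟨by simp [Real.volume_Icc]⟩
    exact Integrable.comp_snd (f := b) hb _
  refine Integrable.mono' h1 (ContinuousOn.aestronglyMeasurable (fun p hp => ?_)
    (measurableSet_Icc.prod hJ)) (ae_restrict_of_forall_mem (measurableSet_Icc.prod hJ) ?_)
  · have hp2 : 0 < p.2 := hJ0 hp.2
    refine (ContinuousAt.mul ?_ (hG.continuousAt.comp (continuousAt_pt hp2))).continuousWithinAt
    exact Complex.continuous_ofReal.continuousAt.comp
      (continuousAt_const.div (by fun_prop) (by positivity))
  · intro p hp
    have hp2 : 0 < p.2 := hJ0 hp.2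
    have hp1 : 1 < p.2 := hJ1 hp.2
    have h2 := h (pt p.1 p.2) (pt_mem_slab hp2 hp.1 hp.2)
    rw [pt_im hp2] at h2
    rw [norm_mul, Complex.norm_real, Real.norm_of_nonneg (by positivity)]
    refine le_trans (mul_le_of_le_one_left (norm_nonneg _) ?_) h2
    rw [div_le_one (by positivity)]
    nlinarith

theorem setIntegral_slab_eq {a : ℕ} {J : Set ℝ} (hJ : MeasurableSet J) (hJ0 : J ⊆ Set.Ioi 0)
    {G : ℍ → ℂ} (hG : IntegrableOn G (slab a J)) :
    ∫ z in slab a J, G z = ∫ y in J, ((1 / y ^ 2 : ℝ) : ℂ) *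
      ∫ x in Set.Icc (-(1 / 2)) ((a : ℝ) - 1 / 2), G (pt x y) := by
  have h1 := (integrableOn_rect_iff G measurableSet_Icc hJ hJ0).mp hG
  rw [setIntegral_rect G measurableSet_Icc hJ hJ0]
  rw [IntegrableOn, Measure.volume_eq_prod, ← Measure.prod_restrict] at h1
  rw [Measure.volume_eq_prod, ← Measure.prod_restrict, integral_prod_symm _ h1]
  simp only [integral_const_mul]

/-- Completing the square: `(C + 1) y - c y² ≤ (C + 1)² / (4c)`. Gaussian decay beats any
exponential and still leaves `e^{-y}`. -/
theorem exp_mul_exp_neg_sq_le (C : ℝ) {c : ℝ} (hc : 0 < c) (y : ℝ) :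
    Real.exp (C * y) * Real.exp (-c * y ^ 2) ≤
      Real.exp ((C + 1) ^ 2 / (4 * c)) * Real.exp (-1 * y) := by
  rw [← Real.exp_add, ← Real.exp_add, Real.exp_le_exp]
  have h : (C + 1) ^ 2 / (4 * c) = c * ((C + 1) / (2 * c)) ^ 2 := by field_simp; ring
  have h2 : (C + 1) * y = 2 * c * ((C + 1) / (2 * c)) * y := by field_simp
  rw [h]
  nlinarith [mul_nonneg hc.le (sq_nonneg (y - (C + 1) / (2 * c)))]

theorem integrableOn_slab_of_growth {a : ℕ} (ha : 0 < a) {G E : ℍ → ℂ} (hG : Continuous G)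
    (hE : Continuous E) {C K K' c : ℝ} (hK : 0 ≤ K) (hc : 0 < c)
    (h1 : ∀ z : ℍ, |z.re| ≤ a → 1 ≤ z.im → ‖G z‖ ≤ K * Real.exp (C * z.im))
    (h2 : ∀ z : ℍ, |z.re| ≤ a → 1 ≤ z.im → ‖E z‖ ≤ K' * Real.exp (-c * z.im ^ 2)) :
    IntegrableOn (fun z => G z * E z) (slab a (Set.Ioi 1)) := by
  have hb : IntegrableOn (fun y : ℝ => K * K' * Real.exp ((C + 1) ^ 2 / (4 * c)) *
      Real.exp (-1 * y)) (Set.Ioi 1) := (exp_neg_integrableOn_Ioi 1 one_pos).const_mul _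
  refine integrableOn_slab measurableSet_Ioi subset_rfl (hG.mul hE) hb fun z hz => ?_
  have hz1 := abs_re_le_of_mem_slab ha hz
  have hz2 : 1 ≤ z.im := le_of_lt hz.2
  have h3 := h2 z hz1 hz2
  have hK' : 0 ≤ K' := nonneg_of_mul_nonneg_left ((norm_nonneg _).trans h3) (Real.exp_pos _)
  rw [norm_mul]
  calc ‖G z‖ * ‖E z‖ ≤ (K * Real.exp (C * z.im)) * (K' * Real.exp (-c * z.im ^ 2)) :=
        mul_le_mul (h1 z hz1 hz2) h3 (norm_nonneg _) (by positivity)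
    _ = K * K' * (Real.exp (C * z.im) * Real.exp (-c * z.im ^ 2)) := by ring
    _ ≤ K * K' * (Real.exp ((C + 1) ^ 2 / (4 * c)) * Real.exp (-1 * z.im)) :=
        mul_le_mul_of_nonneg_left (exp_mul_exp_neg_sq_le C hc _) (by positivity)
    _ = _ := by ring

theorem norm_cpow_neg_le {y : ℝ} (hy : 1 ≤ y) {s w : ℂ} (hw : w ∈ Metric.ball s 1) :
    ‖(y : ℂ) ^ (-w)‖ ≤ Real.exp ((‖s‖ + 1) * y) := by
  have hy0 : 0 < y := by linarith
  rw [Complex.norm_cpow_eq_rpow_re_of_pos hy0, Real.rpow_def_of_pos hy0, Real.exp_le_exp]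
  have h1 : |(-w).re| ≤ ‖s‖ + 1 := by
    refine (Complex.abs_re_le_norm _).trans ?_
    rw [norm_neg]
    have := norm_add_le (w - s) s
    rw [sub_add_cancel] at this
    have := mem_ball_iff_norm.mp hw
    linarith
  have h2 : 0 ≤ Real.log y := Real.log_nonneg hy
  have h3 : Real.log y ≤ y := (Real.log_le_sub_one_of_pos hy0).trans (by linarith)
  calc Real.log y * (-w).re ≤ Real.log y * (‖s‖ + 1) :=
        mul_le_mul_of_nonneg_left ((le_abs_self _).trans h1) h2
    _ ≤ y * (‖s‖ + 1) := mul_le_mul_of_nonneg_right h3 (by positivity)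
    _ = _ := mul_comm _ _

theorem continuous_im_cpow (s : ℂ) : Continuous fun z : ℍ => (z.im : ℂ) ^ (-s) :=
  (Complex.continuous_ofReal.comp continuous_im).cpow continuous_const fun z => by
    simp [Complex.mem_slitPlane_iff, z.im_pos]

theorem differentiable_im_cpow (z : ℍ) : Differentiable ℂ fun s : ℂ => (z.im : ℂ) ^ (-s) :=
  differentiable_neg.const_cpow (Or.inl (by exact_mod_cast z.im_pos.ne'))

/-- The integral of a rapidly decreasing function against `y^{-s}` over a cuspidal strip is
entire. -/
theorem differentiable_slab_cpow {a : ℕ} (ha : 0 < a) {G E : ℍ → ℂ} (hG : Continuous G)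
    (hE : Continuous E) {C K K' c : ℝ} (hK : 0 ≤ K) (hK' : 0 ≤ K') (hc : 0 < c)
    (h1 : ∀ z : ℍ, |z.re| ≤ a → 1 ≤ z.im → ‖G z‖ ≤ K * Real.exp (C * z.im))
    (h2 : ∀ z : ℍ, |z.re| ≤ a → 1 ≤ z.im → ‖E z‖ ≤ K' * Real.exp (-c * z.im ^ 2)) :
    Differentiable ℂ fun s : ℂ => ∫ z in slab a (Set.Ioi 1), G z * E z * (z.im : ℂ) ^ (-s) := by
  rw [← differentiableOn_univ]
  have hm : MeasurableSet (slab a (Set.Ioi 1)) := measurableSet_rect measurableSet_Icc measurableSet_Ioi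
  refine differentiableOn_integral_of_dominated isOpen_univ (fun s _ => ?_)
    (ae_of_all _ fun z => ((differentiable_im_cpow z).const_mul _).differentiableOn) fun s _ => ?_
  · exact ((hG.mul hE).mul (continuous_im_cpow s)).aestronglyMeasurable
  · refine ⟨1, one_pos, fun z => ‖(K * Real.exp ((C + (‖s‖ + 1)) * z.im) : ℂ) *
      (K' * Real.exp (-c * z.im ^ 2) : ℂ)‖, ?_, ?_⟩
    · refine (integrableOn_slab_of_growth ha (G := fun z => (K * Real.exp ((C + (‖s‖ + 1)) * z.im) : ℂ))
        (E := fun z => (K' * Real.exp (-c * z.im ^ 2) : ℂ)) (C := C + (‖s‖ + 1)) (K' := K') (by fun_prop)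
        (by fun_prop) hK hc (fun z _ _ => ?_) fun z _ _ => ?_).norm
      · simp [-Complex.ofReal_exp, Real.abs_exp, abs_of_nonneg hK]
      · simp [-Complex.ofReal_exp, Real.abs_exp, abs_of_nonneg hK']
    · refine ae_restrict_of_forall_mem hm fun z hz w hw => ?_
      have hz1 := abs_re_le_of_mem_slab ha hz
      have hz2 : 1 ≤ z.im := le_of_lt hz.2
      beta_reduce
      rw [norm_mul, norm_mul, ← Complex.ofReal_mul, ← Complex.ofReal_mul, ← Complex.ofReal_mul,
        Complex.norm_real, Real.norm_of_nonneg (by positivity), add_mul, Real.exp_add]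
      calc ‖G z‖ * ‖E z‖ * ‖(z.im : ℂ) ^ (-w)‖ ≤ (K * Real.exp (C * z.im)) *
            (K' * Real.exp (-c * z.im ^ 2)) * Real.exp ((‖s‖ + 1) * z.im) := by
            gcongr
            · exact h1 z hz1 hz2
            · exact h2 z hz1 hz2
            · exact norm_cpow_neg_le hz2 hw
        _ = _ := by ring

theorem tendsto_slab {a : ℕ} {G : ℍ → ℂ} (hG : IntegrableOn G (slab a (Set.Ioi 1))) :
    Tendsto (fun T : ℝ => ∫ z in slab a (Set.Ioc 1 T), G z) atTop
      (𝓝 (∫ z in slab a (Set.Ioi 1), G z)) := by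
  have hU : slab a (Set.Ioi 1) = ⋃ T : ℝ, slab a (Set.Ioc 1 T) := by
    ext z
    rw [Set.mem_iUnion]
    exact ⟨fun h => ⟨z.im, h.1, h.2, le_rfl⟩, fun ⟨T, h⟩ => ⟨h.1, h.2.1⟩⟩
  rw [hU] at hG ⊢
  exact tendsto_setIntegral_of_monotone
    (fun T => measurableSet_rect measurableSet_Icc measurableSet_Ioc)
    (fun T T' hT z hz => ⟨hz.1, hz.2.1, hz.2.2.trans hT⟩) hG

/-- By periodicity the interval `[-1/2, α - 1/2]` of the truncated domain may be replaced by `[0,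
α]`. -/
theorem integral_slice_eq {E : Type*} [NormedAddCommGroup E] [NormedSpace ℝ E]
    {Γ : Subgroup SL(2, ℤ)} [Γ.FiniteIndex] {f : ℍ → ℂ}
    (hinv : ∀ γ ∈ Γ, ∀ z : ℍ, f (γ • z) = f z) (g : SL(2, ℤ)) (Φ : ℂ → E) {y : ℝ} (hy : 0 < y) :
    ∫ x in Set.Icc (-(1 / 2)) ((cuspWidth Γ g : ℝ) - 1 / 2), Φ (f (g • pt x y)) =
      ∫ x in (0 : ℝ)..(cuspWidth Γ g : ℝ), Φ (f (g • pt x y)) := by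
  have hp : Function.Periodic (fun x : ℝ => Φ (f (g • pt x y))) (cuspWidth Γ g : ℝ) := by
    intro x
    have := pull_periodic hinv g (im_line_pos (x := x) hy)
    simp only [pull] at this
    simp only
    congr 1
    rw [pt, pt, ← this]
    congr 3
    push_cast; ring
  have h := hp.intervalIntegral_add_eq 0 (-(1 / 2))
  rw [zero_add] at h
  have h1 : (0 : ℝ) ≤ cuspWidth Γ g := Nat.cast_nonneg _
  rw [h, integral_Icc_eq_integral_Ioc, ← intervalIntegral.integral_of_le (by linarith)]
  congr 1
  ring

theorem integral_slice_eq_constTerm {Γ : Subgroup SL(2, ℤ)} [Γ.FiniteIndex] {f : ℍ → ℂ}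
    (hinv : ∀ γ ∈ Γ, ∀ z : ℍ, f (γ • z) = f z) (g : SL(2, ℤ)) {y : ℝ} (hy : 0 < y) :
    ∫ x in Set.Icc (-(1 / 2)) ((cuspWidth Γ g : ℝ) - 1 / 2), f (g • pt x y) =
      cuspWidth Γ g * constTerm Γ g f y := by
  have h1 : (cuspWidth Γ g : ℂ) ≠ 0 := by exact_mod_cast (cuspWidth_pos Γ g).ne'
  refine (integral_slice_eq hinv g id hy).trans ?_
  rw [constTerm, ← mul_assoc, mul_one_div_cancel h1, one_mul]
  rfl

theorem isCompact_slab_Icc (a : ℕ) {b d : ℝ} (hb : 0 < b) : IsCompact (slab a (Set.Icc b d)) :=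
  isCompact_rect _ isCompact_Icc hb

/-- The strip integral of a spectral deformation against a rapidly decreasing function is
holomorphic near `s = 1`. -/
theorem IsSpectralDeformation.differentiableOn_slab {Γ : Subgroup SL(2, ℤ)} [Γ.FiniteIndex]
    {f : ℍ → ℂ} {U : Set ℂ} {F : ℂ → ℍ → ℂ} (hF : IsSpectralDeformation Γ f U F) (g : SL(2, ℤ))
    {E : ℍ → ℂ} (hE : Continuous E) {K' c : ℝ} (hc : 0 < c)
    (h2 : ∀ z : ℍ, |z.re| ≤ cuspWidth Γ g → 1 ≤ z.im → ‖E z‖ ≤ K' * Real.exp (-c * z.im ^ 2)) :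
    ∃ ε > 0, DifferentiableOn ℂ (fun s => ∫ z in slab (cuspWidth Γ g) (Set.Ioi 1),
      F s (g • z) * E z) (Metric.ball 1 ε) := by
  obtain ⟨ε, hε, hεU, C, K, hC, hK, hl2⟩ := hF.exists_l2_bound g
  have ha := cuspWidth_pos Γ g
  have hcont : ∀ s ∈ U, Continuous fun z => F s (g • z) := fun s hs =>
    ((hF.weakMaass s hs).isC2.comp_smul g).continuous
  have hint : ∀ s ∈ U, IntegrableOn (fun z => F s (g • z) * E z)
      (slab (cuspWidth Γ g) (Set.Ioi 1)) := by
    intro s hs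
    obtain ⟨C', K'', hC', hK'', hb⟩ := (hF.weakMaass s hs).strip_bound g (cuspWidth Γ g)
    exact integrableOn_slab_of_growth ha (hcont s hs) hE hK'' hc hb h2
  have hsub1 : Set.Ioi (1 : ℝ) ⊆ Set.Ioi 0 := Set.Ioi_subset_Ioi zero_le_one
  -- Uniformly in `s` only a mean square bound in `x` is available, so there is no pointwise
  -- majorant on the strip. The `x`-integral is carried out first and holomorphy is proved for the
  -- remaining integral over `y`.
  refine ⟨ε, hε, DifferentiableOn.congr (f := fun s => ∫ y in Set.Ioi (1 : ℝ),
    ((1 / y ^ 2 : ℝ) : ℂ) * ∫ x in Set.Icc (-(1 / 2)) ((cuspWidth Γ g : ℝ) - 1 / 2),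
      F s (g • pt x y) * E (pt x y)) ?_ fun s hs =>
      setIntegral_slab_eq measurableSet_Ioi hsub1 (hint s (hεU hs))⟩
  have hcE : ∀ y : ℝ, 0 < y → Continuous fun x : ℝ => E (pt x y) := fun y hy =>
    hE.comp (continuous_iff_continuousAt.mpr fun x => ContinuousAt.comp
      (g := fun p : ℝ × ℝ => pt p.1 p.2) (f := fun x : ℝ => (x, y)) (continuousAt_pt hy)
      (by fun_prop))
  have hcF : ∀ s ∈ U, ∀ y : ℝ, 0 < y → Continuous fun x : ℝ => F s (g • pt x y) := fun s hs y hy =>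
    (hcont s hs).comp (continuous_iff_continuousAt.mpr fun x => ContinuousAt.comp
      (g := fun p : ℝ × ℝ => pt p.1 p.2) (f := fun x : ℝ => (x, y)) (continuousAt_pt hy)
      (by fun_prop))
  refine differentiableOn_integral_of_dominated Metric.isOpen_ball (fun s hs => ?_)
    (ae_restrict_of_forall_mem measurableSet_Ioi fun y hy => ?_) fun s hs => ?_
  · have h1 := (integrableOn_rect_iff _ measurableSet_Icc measurableSet_Ioi hsub1).mp
      (hint s (hεU hs))
    rw [IntegrableOn, Measure.volume_eq_prod, ← Measure.prod_restrict] at h1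
    have h3 := h1.integral_prod_right.aestronglyMeasurable
    simpa only [integral_const_mul] using h3
  · have hy0 : (0 : ℝ) < y := hsub1 hy
    refine (differentiableOn_integral_compact isCompact_Icc measurableSet_Icc Metric.isOpen_ball
      (G := fun s x => F s (g • pt x y) * E (pt x y)) ?_ fun x _ =>
        ((hF.holomorphic _).mono hεU).mul_const _).const_mul _
    exact ((hF.continuousOn_pt g (p := fun x : ℝ => (x, y)) (by fun_prop) fun _ _ => hy0).mono
      (Set.prod_mono hεU subset_rfl)).mul ((hcE y hy0).comp continuous_snd).continuousOn
  · obtain ⟨δ, hδ, hsub⟩ := Metric.isOpen_iff.mp Metric.isOpen_ball s hs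
    set α : ℝ := ((cuspWidth Γ g : ℕ) : ℝ) with hα
    have hα0 : 0 < α := Nat.cast_pos.mpr ha
    have hK' : 0 ≤ K' := nonneg_of_mul_nonneg_left ((norm_nonneg _).trans
      (h2 (pt 0 1) (by rw [pt_re one_pos, abs_zero]; exact hα0.le) (by rw [pt_im one_pos])))
      (Real.exp_pos _)
    refine ⟨δ, hδ, fun y => K' * (α + K) * Real.exp ((C + 1) ^ 2 / (4 * c)) * Real.exp (-1 * y),
      (exp_neg_integrableOn_Ioi 1 one_pos).const_mul _,
      ae_restrict_of_forall_mem measurableSet_Ioi fun y hy w hw => ?_⟩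
    have hy1 : (1 : ℝ) < y := hy
    have hy0 : (0 : ℝ) < y := hsub1 hy
    have hw' := hsub hw
    have hcf := hcF w (hεU hw') y hy0
    rw [norm_mul, Complex.norm_real, Real.norm_of_nonneg (by positivity)]
    have hle1 : 1 / y ^ 2 ≤ 1 := by
      rw [div_le_one (by positivity)]; nlinarith
    refine (mul_le_of_le_one_left (norm_nonneg _) hle1).trans ?_
    have hcs : Continuous fun x : ℝ => ‖F w (g • pt x y)‖ ^ 2 := hcf.norm.pow 2
    have hl := hl2 w hw' y hy1.le
    rw [← integral_slice_eq (hF.weakMaass w (hεU hw')).invariant g (fun v => ‖v‖ ^ 2) hy0] at hl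
    -- The bound `‖F‖ ≤ 1 + ‖F‖²` replaces the Cauchy–Schwarz inequality in passing from the mean
    -- square to the mean.
    calc ‖∫ x in Set.Icc (-(1 / 2)) (α - 1 / 2), F w (g • pt x y) * E (pt x y)‖
        ≤ ∫ x in Set.Icc (-(1 / 2)) (α - 1 / 2), (1 + ‖F w (g • pt x y)‖ ^ 2) *
            (K' * Real.exp (-c * y ^ 2)) := by
          refine norm_integral_le_of_norm_le ((continuous_const.add hcs).mul_const _).integrableOn_Icc
            (ae_restrict_of_forall_mem measurableSet_Icc fun x hx => ?_)
          have hx' := pt_mem_slab (J := Set.Ioi 1) hy0 hx hy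
          have h3 := h2 (pt x y) (abs_re_le_of_mem_slab ha hx') (by rw [pt_im hy0]; exact hy1.le)
          rw [pt_im hy0] at h3
          rw [norm_mul]
          refine mul_le_mul ?_ h3 (norm_nonneg _) (by positivity)
          nlinarith [sq_nonneg (‖F w (g • pt x y)‖ - 1)]
      _ = (α + ∫ x in Set.Icc (-(1 / 2)) (α - 1 / 2), ‖F w (g • pt x y)‖ ^ 2) *
            (K' * Real.exp (-c * y ^ 2)) := by
          rw [integral_mul_const, integral_add (by simp)
            hcs.integrableOn_Icc]
          simp [hα0.le]
      _ ≤ (α * Real.exp (C * y) + K * Real.exp (C * y)) * (K' * Real.exp (-c * y ^ 2)) := by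
          gcongr
          exact le_mul_of_one_le_right hα0.le (Real.one_le_exp (by positivity))
      _ = K' * (α + K) * (Real.exp (C * y) * Real.exp (-c * y ^ 2)) := by ring
      _ ≤ K' * (α + K) * (Real.exp ((C + 1) ^ 2 / (4 * c)) * Real.exp (-1 * y)) :=
          mul_le_mul_of_nonneg_left (exp_mul_exp_neg_sq_le C hc y) (by positivity)
      _ = _ := by ring

/-! ### The height function and cutoff functions -/

/-- The maximum of the imaginary part over the `SL₂(ℤ)`-orbit of `z`. -/
def height (z : ℍ) : ℝ := ((ModularGroup.exists_max_im z).choose • z).im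

theorem exists_height (z : ℍ) : ∃ g : SL(2, ℤ), height z = (g • z).im := ⟨_, rfl⟩

theorem im_smul_le_height (g : SL(2, ℤ)) (z : ℍ) : (g • z).im ≤ height z :=
  (ModularGroup.exists_max_im z).choose_spec g

theorem height_pos (z : ℍ) : 0 < height z := im_pos _

theorem height_smul (g : SL(2, ℤ)) (z : ℍ) : height (g • z) = height z := by
  obtain ⟨a, ha⟩ := exists_height (g • z)
  obtain ⟨b, hb⟩ := exists_height z
  refine le_antisymm ?_ ?_
  · rw [ha, ← mul_smul]; exact im_smul_le_height _ _
  · have := im_smul_le_height (b * g⁻¹) (g • z)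
    rwa [← mul_smul, inv_mul_cancel_right, ← hb] at this

/-- Either the lower row has `c = 0`, and `Im` does not increase, or `|cz + d|² ≥ y²` and the new
imaginary part is at most `1 / y`. -/
theorem height_le (z : ℍ) : height z ≤ max z.im (1 / z.im) := by
  obtain ⟨g, hg⟩ := exists_height z
  obtain ⟨n, hn, hn', him, -, -⟩ := smul_im_re g z
  have hy := z.im_pos
  rw [hg, him]
  by_cases hc : g 1 0 = 0
  · have hd : g 1 1 ≠ 0 := fun h => by
      simp [hc, h] at hn'
      exact hn.ne' hn'
    have h1 : (1 : ℝ) ≤ (g 1 1 : ℝ) ^ 2 := by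
      exact_mod_cast Int.one_le_abs hd |>.trans (by rw [← sq_abs]; nlinarith [Int.one_le_abs hd])
    have h2 : 1 ≤ n := by rw [hn', hc]; simpa using h1
    exact (div_le_self hy.le h2).trans (le_max_left _ _)
  · have h1 : (1 : ℝ) ≤ (g 1 0 : ℝ) ^ 2 := by
      exact_mod_cast Int.one_le_abs hc |>.trans (by rw [← sq_abs]; nlinarith [Int.one_le_abs hc])
    have h2 : z.im ^ 2 ≤ n := by
      rw [hn']; nlinarith [sq_nonneg ((g 1 0 : ℝ) * z.re + g 1 1), sq_nonneg z.im]
    refine le_trans ?_ (le_max_right _ _)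
    rw [div_le_div_iff₀ hn hy]
    nlinarith

theorem height_eq_im {z : ℍ} (hz : 1 < z.im) : height z = z.im := by
  refine le_antisymm ((height_le z).trans (max_le le_rfl ?_)) (by
    simpa using im_smul_le_height 1 z)
  rw [div_le_iff₀ z.im_pos]
  nlinarith

/-- The logarithm of `Im` is `1`-Lipschitz for the hyperbolic distance, which is invariant, so the
maximum over an orbit inherits the property. Continuity of the height follows. -/
theorem height_le_mul_exp_dist (z w : ℍ) : height z ≤ height w * Real.exp (dist z w) := by
  obtain ⟨g, hg⟩ := exists_height z
  have h1 : dist (g • z) (g • w) = dist z w :=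
    dist_smul ((Matrix.SpecialLinearGroup.map (Int.castRingHom ℝ)) g : SL(2, ℝ)) z w
  have h2 := im_div_exp_dist_le (g • z) (g • w)
  rw [h1, div_le_iff₀ (Real.exp_pos _)] at h2
  rw [hg]
  exact h2.trans (mul_le_mul_of_nonneg_right (im_smul_le_height g w) (Real.exp_pos _).le)

theorem continuous_height : Continuous height := by
  have h1 : LipschitzWith 1 fun z => Real.log (height z) := by
    refine LipschitzWith.of_le_add fun z w => ?_
    have h := Real.log_le_log (height_pos z) (height_le_mul_exp_dist z w)
    rwa [Real.log_mul (height_pos w).ne' (Real.exp_pos _).ne', Real.log_exp] at h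
  have h2 : height = fun z => Real.exp (Real.log (height z)) :=
    funext fun z => (Real.exp_log (height_pos z)).symm
  rw [h2]
  exact Real.continuous_exp.comp h1.continuous

theorem height_lt_two {a : ℕ} {z : ℍ} (hz : z ∈ truncDomain a 1) : height z < 2 := by
  obtain ⟨h1, j, -, w, hw, rfl⟩ := hz
  rw [← zpow_natCast, ModularGroup.im_T_zpow_smul] at h1
  rw [height_smul]
  -- In the standard domain `y² ≥ 3/4`, hence `1 / y < 2`.
  have h3 := ModularGroup.three_le_four_mul_im_sq_of_mem_fd hw
  refine (height_le w).trans_lt (max_lt (by linarith) ?_)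
  rw [div_lt_iff₀ w.im_pos]
  nlinarith [w.im_pos]

/-- The cutoff `1` on `(-∞, T]` and `0` on `[T + 1, ∞)`. -/
def step (T y : ℝ) : ℝ := Real.smoothTransition (T + 1 - y)

theorem contDiff_step (T : ℝ) : ContDiff ℝ 2 (step T) :=
  (Real.smoothTransition.contDiff (n := 2)).comp (contDiff_const.sub contDiff_id)

theorem step_eq_one {T y : ℝ} (h : y ≤ T) : step T y = 1 :=
  Real.smoothTransition.one_of_one_le (by linarith)

theorem step_eq_zero {T y : ℝ} (h : T + 1 ≤ y) : step T y = 0 :=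
  Real.smoothTransition.zero_of_nonpos (by linarith)

theorem isC2_im {ρ : ℝ → ℝ} (hρ : ContDiff ℝ 2 ρ) : IsC2 fun z => (ρ z.im : ℂ) := by
  intro z
  have h1 : ContDiff ℝ 2 fun w : ℂ => (ρ w.im : ℂ) :=
    Complex.ofRealCLM.contDiff.comp (hρ.comp Complex.imCLM.contDiff)
  refine h1.contDiffAt.congr_of_eventuallyEq ?_
  filter_upwards [(isOpen_lt continuous_const Complex.continuous_im).mem_nhds z.2] with w hw
  rw [ofComplex_apply_of_im_pos hw]
  rfl

/-- The `SL₂(ℤ)`-invariant cutoff function. -/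
def cutoff (T : ℝ) (z : ℍ) : ℂ := (step T (height z) : ℂ)

theorem cutoff_smul (T : ℝ) (g : SL(2, ℤ)) (z : ℍ) : cutoff T (g • z) = cutoff T z := by
  rw [cutoff, cutoff, height_smul]

theorem eventually_cutoff_eq_one {T : ℝ} {z : ℍ} (hz : height z < T) :
    ∀ᶠ w in 𝓝 z, cutoff T w = 1 := by
  filter_upwards [continuous_height.continuousAt.eventually_lt continuousAt_const hz] with w hw
  rw [cutoff, step_eq_one hw.le, Complex.ofReal_one]

theorem eventually_cutoff_eq_step {T : ℝ} {z : ℍ} (hz : 1 < z.im) :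
    ∀ᶠ w in 𝓝 z, cutoff T w = (step T w.im : ℂ) := by
  filter_upwards [continuousAt_const.eventually_lt continuous_im.continuousAt hz] with w hw
  rw [cutoff, height_eq_im hw]

/-- The height need not be differentiable, but where it exceeds `1` it is locally the imaginary part
of one translate, and elsewhere the cutoff is locally constant because `T > 1`. -/
theorem isC2_cutoff {T : ℝ} (hT : 1 < T) : IsC2 (cutoff T) := by
  intro z
  by_cases hz : 1 < height z
  · obtain ⟨g, hg⟩ := exists_height z
    rw [hg] at hz
    refine IsC2.congr z (f := fun z => (step T (g • z).im : ℂ)) (((isC2_im (contDiff_step T)).comp_smul g) z) ?_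
    filter_upwards [(continuous_const_smul g).continuousAt.eventually
      (eventually_cutoff_eq_step hz)] with w hw
    rw [← hw, cutoff_smul]
  · exact IsC2.congr z (f := fun _ => (1 : ℂ)) contDiffAt_const
      (eventually_cutoff_eq_one ((not_lt.mp hz).trans_lt hT))

theorem height_le_of_mem_tsupport {T : ℝ} {f : ℍ → ℂ} {z : ℍ}
    (hz : z ∈ tsupport fun z => cutoff T z * f z) : height z ≤ T + 1 := by
  have h1 : tsupport (fun z => cutoff T z * f z) ⊆ {z | height z ≤ T + 1} := by
    refine closure_minimal (fun w hw => ?_) (isClosed_le continuous_height continuous_const)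
    by_contra hn
    refine hw ?_
    rw [Set.mem_ofPred_eq, not_le] at hn
    simp [cutoff, step_eq_zero hn.le]
  exact h1 hz

/-- Move the point into the standard domain, where its height bounds `y`, and absorb the remaining
element into `Γ` and one of finitely many truncated pieces. -/
theorem exists_compact_of_height_le {N : ℕ} {Γ : Subgroup SL(2, ℤ)} [Γ.FiniteIndex]
    {σ : Cusp N Γ → SL(2, ℤ)} (hσ : IsCuspChoice N Γ σ) (T : ℝ) :
    ∃ K : Set ℍ, IsCompact K ∧ ∀ z, height z ≤ T → ∃ γ ∈ Γ, γ • z ∈ K := by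
  have := finite_cusp hσ
  refine ⟨⋃ c, (fun z : ℍ => σ c • z) '' truncDomain (cuspWidth Γ (σ c)) T,
    isCompact_iUnion fun c => (isCompact_truncDomain _ T).image (continuous_const_smul _),
    fun z hz => ?_⟩
  obtain ⟨δ, hδ⟩ := ModularGroup.exists_smul_mem_fd z
  obtain ⟨c, j, hj, hm⟩ := hσ.exists_decomp_lt δ⁻¹
  obtain ⟨γ, hγ, h⟩ := exists_smul_eq_of_mem_pm hm
  refine ⟨γ⁻¹, Γ.inv_mem hγ, Set.mem_iUnion.mpr ⟨c, ModularGroup.T ^ j • (δ • z), ⟨?_, j, hj, δ • z,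
    hδ, rfl⟩, ?_⟩⟩
  · rw [← zpow_natCast, ModularGroup.im_T_zpow_smul]
    exact (im_smul_le_height δ z).trans hz
  · rw [eq_inv_smul_iff, ← h]
    simp only [← mul_smul]
    convert one_smul SL(2, ℤ) z using 2
    group

/-! ### An energy estimate for eigenfunctions -/

theorem fderiv_star_comp {u : ℂ → ℂ} {z : ℂ} (hu : DifferentiableAt ℝ u z) (v : ℂ) :
    fderiv ℝ (fun w => (starRingEnd ℂ) (u w)) z v = (starRingEnd ℂ) (fderiv ℝ u z v) := by
  have h := (Complex.conjCLE : ℂ →L[ℝ] ℂ).hasFDerivAt.comp z hu.hasFDerivAt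
  rw [show (fun w => (starRingEnd ℂ) (u w)) = (Complex.conjCLE : ℂ →L[ℝ] ℂ) ∘ u from rfl, h.fderiv]
  rfl

theorem laplacian_star_comp {u : ℂ → ℂ} {z : ℂ} (hu : ContDiffAt ℝ 2 u z) :
    Laplacian.laplacian (fun w => (starRingEnd ℂ) (u w)) z =
      (starRingEnd ℂ) (Laplacian.laplacian u z) := by
  have hs : ContDiffAt ℝ 2 (fun w => (starRingEnd ℂ) (u w)) z :=
    (Complex.conjCLE : ℂ →L[ℝ] ℂ).contDiff.contDiffAt.comp z hu
  have key : ∀ v : ℂ, fderiv ℝ (fderiv ℝ fun w => (starRingEnd ℂ) (u w)) z v v =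
      (starRingEnd ℂ) (fderiv ℝ (fderiv ℝ u) z v v) := by
    intro v
    rw [← fderiv_fderiv_apply hs, ← fderiv_fderiv_apply hu, ← fderiv_star_comp
      (((hu.fderiv_right (m := 1) (by norm_num)).clm_apply contDiffAt_const).differentiableAt
        (by norm_num))]
    refine congrArg (fun A : ℂ →L[ℝ] ℂ => A v) (Filter.EventuallyEq.fderiv_eq ?_)
    filter_upwards [hu.eventually_differentiableAt] with w hw
    exact fderiv_star_comp hw v
  rw [laplacian_apply, laplacian_apply, map_add, key, key]

/-- The product rule for `u ū` together with the equation for `u`; only the real part of the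
eigenvalue enters. -/
theorem laplacian_normSq {u : ℂ → ℂ} {z lam : ℂ} {r : ℝ} (hu : ContDiffAt ℝ 2 u z)
    (hl : Laplacian.laplacian u z = -(lam / (r : ℂ) ^ 2) * u z) :
    Laplacian.laplacian (fun w => u w * (starRingEnd ℂ) (u w)) z =
      ((2 * (‖fderiv ℝ u z 1‖ ^ 2 + ‖fderiv ℝ u z Complex.I‖ ^ 2) -
        2 * lam.re / r ^ 2 * ‖u z‖ ^ 2 : ℝ) : ℂ) := by
  have hs : ContDiffAt ℝ 2 (fun w => (starRingEnd ℂ) (u w)) z :=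
    (Complex.conjCLE : ℂ →L[ℝ] ℂ).contDiff.contDiffAt.comp z hu
  have hd := hu.differentiableAt (by norm_num)
  rw [laplacian_mul hu hs, laplacian_star_comp hu, hl, fderiv_star_comp hd, fderiv_star_comp hd,
    Complex.mul_conj, Complex.mul_conj, Complex.normSq_eq_norm_sq, Complex.normSq_eq_norm_sq]
  have h1 : u z * (starRingEnd ℂ) (u z) = (‖u z‖ : ℂ) ^ 2 := by
    rw [Complex.mul_conj, Complex.normSq_eq_norm_sq]; push_cast; ring
  have h2 : (starRingEnd ℂ) lam + lam = 2 * (lam.re : ℂ) := by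
    rw [add_comm, Complex.add_conj]; push_cast; ring
  simp only [map_mul, map_neg, map_div₀, map_pow, Complex.conj_ofReal]
  push_cast
  linear_combination (-(lam / (r : ℂ) ^ 2) - (starRingEnd ℂ) lam / (r : ℂ) ^ 2) * h1 -
    ((‖u z‖ : ℂ) ^ 2 / (r : ℂ) ^ 2) * h2

theorem laplacian_comp_sub (f : ℂ → ℂ) (c z : ℂ) :
    Laplacian.laplacian (fun w => f (w - c)) z = Laplacian.laplacian f (z - c) := by
  have h1 : fderiv ℝ (fun w => f (w - c)) = fun w => fderiv ℝ f (w - c) :=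
    funext fun w => fderiv_comp_sub c
  rw [laplacian_apply, laplacian_apply, h1, fderiv_comp_sub c]

theorem continuous_laplacian {η : ℂ → ℂ} (hη : ContDiff ℝ 2 η) :
    Continuous (Laplacian.laplacian η) := by
  have h : Laplacian.laplacian η = fun z => fderiv ℝ (fderiv ℝ η) z 1 1 +
      fderiv ℝ (fderiv ℝ η) z Complex.I Complex.I := funext fun z => laplacian_apply η z
  have h2 : Continuous (fderiv ℝ (fderiv ℝ η)) :=
    (hη.fderiv_right (m := 1) (by norm_num)).continuous_fderiv (by norm_num)
  rw [h]
  fun_prop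

theorem hasCompactSupport_laplacian {η : ℂ → ℂ} (hc : HasCompactSupport η) :
    HasCompactSupport (Laplacian.laplacian η) := by
  refine ((hc.fderiv ℝ).fderiv ℝ).mono fun z hz => ?_
  rw [Function.mem_support, laplacian_apply] at hz
  intro h0
  simp [h0] at hz

/-- The box over which the energy of an eigenfunction is estimated. -/
def box (a : ℕ) (T : ℝ) : Set ℂ :=
  {w | w.re ∈ Set.Icc (-(1 / 2)) ((a : ℝ) - 1 / 2) ∧ w.im ∈ Set.Icc T (T + 1)}

theorem measurableSet_box (a : ℕ) (T : ℝ) : MeasurableSet (box a T) :=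
  measurableSet_reProdIm' measurableSet_Icc measurableSet_Icc

theorem box_subset {a : ℕ} (ha : 0 < a) (T : ℝ) :
    box a T ⊆ Metric.closedBall ((T : ℂ) * Complex.I) (a + 2) := by
  intro w hw
  have h1 : (1 : ℝ) ≤ a := by exact_mod_cast ha
  rw [mem_closedBall_iff_norm]
  refine (Complex.norm_le_abs_re_add_abs_im _).trans ?_
  have h2 : |(w - T * Complex.I).re| ≤ a := by
    rw [abs_le]; simp; constructor <;> linarith [hw.1.1, hw.1.2]
  have h3 : |(w - T * Complex.I).im| ≤ 1 := by
    rw [abs_le]; simp; constructor <;> linarith [hw.2.1, hw.2.2]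
  linarith

theorem measureReal_box_le {a : ℕ} (ha : 0 < a) (T : ℝ) : volume (box a T) < ⊤ ∧
    volume.real (box a T) ≤ volume.real (Metric.closedBall (0 : ℂ) (a + 2)) := by
  have h1 := measure_mono (μ := volume) (box_subset ha T)
  rw [Measure.addHaar_closedBall_center] at h1
  have h2 : volume (Metric.closedBall (0 : ℂ) (a + 2)) < ⊤ :=
    (isCompact_closedBall _ _).measure_lt_top
  exact ⟨h1.trans_lt h2, ENNReal.toReal_mono h2.ne h1⟩

/-- A Caccioppoli estimate: testing the formula for the Laplacian of `|u|²` with a bump function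
bounds the integral of `|∇u|²` by that of `|u|²` on a larger disc. All bumps are translates of a
single one, so the constants do not depend on `T`. -/
theorem energy_estimate {u : ℂ → ℂ} {lam : ℂ} (hu : ∀ w : ℂ, 0 < w.im → ContDiffAt ℝ 2 u w)
    (hl : ∀ w : ℂ, 0 < w.im → Laplacian.laplacian u w = -(lam / (w.im : ℂ) ^ 2) * u w)
    {a : ℕ} (ha : 0 < a) {C K : ℝ} (hC : 0 ≤ C) (hK : 0 ≤ K)
    (hb : ∀ w : ℂ, |w.re| ≤ a + 3 → 1 ≤ w.im → ‖u w‖ ≤ K * Real.exp (C * w.im)) :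
    ∃ K₁ : ℝ, 0 ≤ K₁ ∧ ∀ T : ℝ, a + 4 ≤ T →
      IntegrableOn (fun w => ‖fderiv ℝ u w Complex.I‖ ^ 2) (box a T) ∧
      ∫ w in box a T, ‖fderiv ℝ u w Complex.I‖ ^ 2 ≤ K₁ * Real.exp (2 * C * T) := by
  -- The inner disc contains the box after translation by `iT`; the outer one stays in `y ≥ 1` as
  -- soon as `T ≥ a + 4`.
  let η₀ : ContDiffBump (0 : ℂ) := ⟨a + 2, a + 3, by positivity, by linarith⟩
  have hη₀ : ContDiff ℝ 2 fun w : ℂ => (η₀ w : ℂ) :=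
    Complex.ofRealCLM.contDiff.comp (η₀.contDiff (n := 2))
  have hη₀c : HasCompactSupport fun w : ℂ => (η₀ w : ℂ) :=
    η₀.hasCompactSupport.comp_left (g := fun x : ℝ => (x : ℂ)) (by simp)
  obtain ⟨M, hM⟩ := (continuous_laplacian hη₀).bounded_above_of_compact_support
    (hasCompactSupport_laplacian hη₀c)
  have hM0 : 0 ≤ M := (norm_nonneg _).trans (hM 0)
  set B := volume.real (Metric.closedBall (0 : ℂ) (a + 3)) with hB
  refine ⟨(M + 2 * ‖lam‖) * (K * Real.exp (C * (a + 3))) ^ 2 * B, by positivity, fun T hT => ?_⟩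
  set c : ℂ := (T : ℂ) * Complex.I with hc
  have hcre : c.re = 0 := by simp [hc]
  have hcim : c.im = T := by simp [hc]
  set η : ℂ → ℂ := fun w => (η₀ (w - c) : ℂ) with hη
  have hη2 : ContDiff ℝ 2 η := hη₀.comp (contDiff_id.sub contDiff_const)
  have hBall : ∀ w ∈ Metric.closedBall c (a + 3), |w.re| ≤ a + 3 ∧ 1 ≤ w.im ∧ w.im ≤ T + (a + 3) := by
    intro w hw
    rw [mem_closedBall_iff_norm] at hw
    have h1 := (Complex.abs_re_le_norm (w - c)).trans hw
    have h2 := (Complex.abs_im_le_norm (w - c)).trans hw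
    rw [Complex.sub_re, hcre, sub_zero] at h1
    rw [Complex.sub_im, hcim, abs_le] at h2
    exact ⟨h1, by linarith, by linarith⟩
  have hηs : Function.support η ⊆ Metric.closedBall c (a + 3) := by
    intro w hw
    by_contra hn
    refine hw ?_
    rw [mem_closedBall_iff_norm, not_le] at hn
    simp only [hη]
    rw [η₀.zero_of_le_dist (by rw [dist_zero_right]; exact hn.le), Complex.ofReal_zero]
  have hηt : tsupport η ⊆ Metric.closedBall c (a + 3) :=
    closure_minimal hηs Metric.isClosed_closedBall
  have hηc : HasCompactSupport η := HasCompactSupport.of_support_subset_isCompact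
    (isCompact_closedBall c (a + 3)) hηs
  have hsub : tsupport η ⊆ {w | 0 < w.im} := fun w hw => by
    have := (hBall w (hηt hw)).2.1
    rw [Set.mem_ofPred_eq]; linarith
  have hus : ∀ w ∈ {w : ℂ | 0 < w.im}, ContDiffAt ℝ 2 (fun w => u w * (starRingEnd ℂ) (u w)) w :=
    fun w hw => (hu w hw).mul ((Complex.conjCLE : ℂ →L[ℝ] ℂ).contDiff.contDiffAt.comp w (hu w hw))
  have hgr := integral_mul_laplacian hη2 hηc hsub hus
  have hη0 : ∀ w, 0 ≤ η₀ (w - c) := fun w => η₀.nonneg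
  have hη1 : ∀ w, η₀ (w - c) ≤ 1 := fun w => η₀.le_one
  set e : ℂ → ℝ := fun w => ‖fderiv ℝ u w 1‖ ^ 2 + ‖fderiv ℝ u w Complex.I‖ ^ 2 with he
  have hfc : ∀ w ∈ {w : ℂ | 0 < w.im}, ∀ v : ℂ, ContinuousAt (fun w => fderiv ℝ u w v) w :=
    fun w hw v => continuousAt_fderiv_apply ((hu w hw).of_le (by norm_num)) v
  have i1 : Integrable fun w => η w * ((e w : ℝ) : ℂ) :=
    integrable_mul_of_tsupport hη2.continuous hηc hsub fun w hw =>
      Complex.continuous_ofReal.continuousAt.comp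
        (((hfc w hw 1).norm.pow 2).add ((hfc w hw Complex.I).norm.pow 2))
  have i2 : Integrable fun w => η w * ((2 * lam.re / w.im ^ 2 * ‖u w‖ ^ 2 : ℝ) : ℂ) :=
    integrable_mul_of_tsupport hη2.continuous hηc hsub fun w hw => by
      refine Complex.continuous_ofReal.continuousAt.comp (ContinuousAt.mul
        (continuousAt_const.div (Complex.continuous_im.continuousAt.pow 2) ?_)
        ((hu w hw).continuousAt.norm.pow 2))
      exact pow_ne_zero 2 (ne_of_gt hw)
  have hL : ∫ w, η w * Laplacian.laplacian (fun w => u w * (starRingEnd ℂ) (u w)) w =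
      2 * (∫ w, η w * ((e w : ℝ) : ℂ)) -
        ∫ w, η w * ((2 * lam.re / w.im ^ 2 * ‖u w‖ ^ 2 : ℝ) : ℂ) := by
    rw [← integral_const_mul, ← integral_sub (i1.const_mul 2) i2]
    · refine integral_congr_ae (ae_of_all _ fun w => ?_)
      by_cases hw : 0 < w.im
      · simp only [laplacian_normSq (hu w hw) (hl w hw), he]
        push_cast; ring
      · have : η w = 0 := image_eq_zero_of_notMem_tsupport fun h => hw (hsub h)
        simp [this]
  rw [hL] at hgr
  have i1' : Integrable fun w => η₀ (w - c) * e w := by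
    have := i1.re
    refine this.congr (ae_of_all _ fun w => ?_)
    simp [hη, ← Complex.ofReal_mul]
  have hre : ∫ w, η w * ((e w : ℝ) : ℂ) = ((∫ w, η₀ (w - c) * e w : ℝ) : ℂ) := by
    rw [← integral_complex_ofReal]
    refine integral_congr_ae (ae_of_all _ fun w => ?_)
    simp [hη]
  have hbnd : ‖(∫ w, Laplacian.laplacian η w * (u w * (starRingEnd ℂ) (u w))) +
      ∫ w, η w * ((2 * lam.re / w.im ^ 2 * ‖u w‖ ^ 2 : ℝ) : ℂ)‖ ≤
      (M + 2 * ‖lam‖) * (K * Real.exp (C * (T + (a + 3)))) ^ 2 * B := by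
    have hlap0 : ∀ w ∉ Metric.closedBall c (a + 3), Laplacian.laplacian η w = 0 := by
      intro w hw
      have h0 : η =ᶠ[𝓝 w] fun _ => 0 := notMem_tsupport_iff_eventuallyEq.mp fun h => hw (hηt h)
      rw [(InnerProductSpace.laplacian_congr_nhds h0).self_of_nhds]
      simp [laplacian_apply]
    have i3 : Integrable fun w => Laplacian.laplacian η w * (u w * (starRingEnd ℂ) (u w)) :=
      integrable_mul_of_tsupport (continuous_laplacian hη2) (hasCompactSupport_laplacian hηc)
        (O := {w | 0 < w.im}) (fun w hw => by
          have h1 : w ∈ Metric.closedBall c (a + 3) :=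
            closure_minimal (fun w hw => by
              by_contra hn
              exact hw (hlap0 w hn)) Metric.isClosed_closedBall hw
          have := (hBall w h1).2.1
          rw [Set.mem_ofPred_eq]; linarith) fun w hw => (hus w hw).continuousAt
    rw [← integral_add i3 i2, ← setIntegral_eq_integral_of_forall_compl_eq_zero
      (s := Metric.closedBall c (a + 3)) fun w hw => by
        rw [hlap0 w hw, image_eq_zero_of_notMem_tsupport fun h => hw (hηt h)]; simp]
    refine (norm_setIntegral_le_of_norm_le_const (C := (M + 2 * ‖lam‖) *
      (K * Real.exp (C * (T + (a + 3)))) ^ 2) (isCompact_closedBall _ _).measure_lt_top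
      fun w hw => ?_).trans (le_of_eq ?_)
    · obtain ⟨h1, h2, h3⟩ := hBall w hw
      have h4 : ‖u w‖ ≤ K * Real.exp (C * (T + (a + 3))) := (hb w h1 h2).trans (by gcongr)
      have h5 : ‖Laplacian.laplacian η w‖ ≤ M := by
        rw [hη, laplacian_comp_sub (fun w => (η₀ w : ℂ)) c w]; exact hM _
      refine (norm_add_le _ _).trans ?_
      rw [norm_mul, norm_mul, RCLike.norm_conj, norm_mul, Complex.norm_real, hη, Complex.norm_real,
        Real.norm_of_nonneg (hη0 w), ← pow_two, norm_mul, Real.norm_of_nonneg (sq_nonneg ‖u w‖)]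
      have h6 : ‖2 * lam.re / w.im ^ 2‖ ≤ 2 * ‖lam‖ := by
        rw [norm_div, norm_mul, Real.norm_of_nonneg (sq_nonneg w.im)]
        refine (div_le_self (by positivity) (by nlinarith)).trans ?_
        rw [Real.norm_of_nonneg zero_le_two]
        exact mul_le_mul_of_nonneg_left (Complex.abs_re_le_norm lam) zero_le_two
      calc ‖Laplacian.laplacian η w‖ * ‖u w‖ ^ 2 + η₀ (w - c) * (‖2 * lam.re / w.im ^ 2‖ * ‖u w‖ ^ 2)
          ≤ M * ‖u w‖ ^ 2 + 1 * (2 * ‖lam‖ * ‖u w‖ ^ 2) := by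
            gcongr
            exact hη1 w
        _ = (M + 2 * ‖lam‖) * ‖u w‖ ^ 2 := by ring
        _ ≤ _ := by gcongr
    · congr 1
      rw [hB, Measure.real, Measure.real, Measure.addHaar_closedBall_center]
  have h2E : 2 * ∫ w, η₀ (w - c) * e w ≤ (M + 2 * ‖lam‖) *
      (K * Real.exp (C * (T + (a + 3)))) ^ 2 * B := by
    rw [← hgr, sub_add_cancel, hre, norm_mul, Complex.norm_real] at hbnd
    refine le_trans ?_ hbnd
    rw [Complex.norm_ofNat]
    exact mul_le_mul_of_nonneg_left (le_abs_self _) zero_le_two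
  have hpos : ∀ w, 0 ≤ η₀ (w - c) * e w := fun w => mul_nonneg (hη0 w) (by positivity)
  have hle : ∀ w ∈ box a T, ‖fderiv ℝ u w Complex.I‖ ^ 2 ≤ η₀ (w - c) * e w := fun w hw => by
    have h1 : η₀ (w - c) = 1 := η₀.one_of_mem_closedBall (by
      have := box_subset ha T hw
      rw [mem_closedBall_iff_norm] at this
      rwa [mem_closedBall_zero_iff])
    rw [h1, one_mul]
    exact le_add_of_nonneg_left (by positivity)
  have hint : IntegrableOn (fun w => ‖fderiv ℝ u w Complex.I‖ ^ 2) (box a T) := by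
    refine Integrable.mono' i1'.integrableOn (ContinuousOn.aestronglyMeasurable (fun w hw => ?_)
      (measurableSet_box a T)) (ae_restrict_of_forall_mem (measurableSet_box a T) fun w hw => ?_)
    · have hw0 : 0 < w.im := by linarith [hw.2.1, (Nat.cast_nonneg a : (0 : ℝ) ≤ a)]
      exact ((hfc w hw0 Complex.I).norm.pow 2).continuousWithinAt
    · rw [Real.norm_of_nonneg (by positivity)]
      exact hle w hw
  refine ⟨hint, ?_⟩
  have h3 : ∫ w in box a T, ‖fderiv ℝ u w Complex.I‖ ^ 2 ≤ ∫ w, η₀ (w - c) * e w :=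
    (setIntegral_mono_on hint i1'.integrableOn (measurableSet_box a T) hle).trans
      (setIntegral_le_integral i1' (ae_of_all _ hpos))
  -- The square of the growth bound at the top of the disc gives the rate `2C`.
  have h4 : Real.exp (C * (T + (a + 3))) ^ 2 = Real.exp (C * (a + 3)) ^ 2 * Real.exp (2 * C * T) := by
    rw [← Real.exp_nat_mul, ← Real.exp_nat_mul, ← Real.exp_add]; congr 1; push_cast; ring
  have h5 := integral_nonneg (μ := volume) (f := fun w : ℂ => η₀ (w - c) * e w) hpos
  rw [mul_pow, h4] at h2E
  calc _ ≤ _ := h3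
    _ ≤ _ := by linarith
    _ ≤ _ := h2E
    _ = _ := by ring

/-! ### Cutting off eigenfunctions in a cusp -/

theorem contDiff_deriv_step (T : ℝ) : ContDiff ℝ 1 (deriv (step T)) :=
  (contDiff_succ_iff_deriv (n := 1).mp (contDiff_step T)).2.2

theorem continuous_deriv_deriv_step (T : ℝ) : Continuous (deriv (deriv (step T))) :=
  (contDiff_deriv_step T).continuous_deriv le_rfl

theorem hasDerivAt_step (T y : ℝ) : HasDerivAt (step T) (deriv (step T) y) y :=
  ((contDiff_step T).differentiable (by norm_num) y).hasDerivAt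

theorem hasDerivAt_deriv_step (T y : ℝ) : HasDerivAt (deriv (step T)) (deriv (deriv (step T)) y) y :=
  ((contDiff_deriv_step T).differentiable (by norm_num) y).hasDerivAt

theorem deriv_step_eq_zero {T y : ℝ} (h : y < T ∨ T + 1 < y) :
    deriv (step T) y = 0 ∧ deriv (deriv (step T)) y = 0 := by
  have h1 : ∀ᶠ t in 𝓝 y, deriv (step T) t = 0 := by
    rcases h with h | h
    · filter_upwards [gt_mem_nhds h] with t ht
      have : step T =ᶠ[𝓝 t] fun _ => 1 := by
        filter_upwards [gt_mem_nhds ht] with t ht using step_eq_one ht.le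
      rw [this.deriv_eq, deriv_const]
    · filter_upwards [lt_mem_nhds h] with t ht
      have : step T =ᶠ[𝓝 t] fun _ => 0 := by
        filter_upwards [lt_mem_nhds ht] with t ht using step_eq_zero ht.le
      rw [this.deriv_eq, deriv_const]
  exact ⟨h1.self_of_nhds, (EventuallyEq.deriv_eq h1).trans (by simp)⟩

theorem exists_deriv_step_bound : ∃ M : ℝ, 0 ≤ M ∧ ∀ T y : ℝ,
    |deriv (step T) y| ≤ M ∧ |deriv (deriv (step T)) y| ≤ M := by
  obtain ⟨M₁, h₁⟩ := isCompact_Icc.exists_bound_of_continuousOn (s := Set.Icc (0 : ℝ) 1)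
    (contDiff_deriv_step 0).continuous.continuousOn
  obtain ⟨M₂, h₂⟩ := isCompact_Icc.exists_bound_of_continuousOn (s := Set.Icc (0 : ℝ) 1)
    (continuous_deriv_deriv_step 0).continuousOn
  -- All cutoffs are translates of one, so one pair of bounds on `[0, 1]` serves for every `T`.
  have key : ∀ T, step T = fun y => step 0 (y - T) := fun T => by
    ext y; simp only [step]; congr 1; ring
  refine ⟨max |M₁| |M₂|, (abs_nonneg _).trans (le_max_left _ _), fun T y => ?_⟩
  have e1 : deriv (step T) = fun y => deriv (step 0) (y - T) := by
    rw [key T]; ext y; rw [deriv_comp_sub_const]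
  rw [e1, deriv_comp_sub_const]
  beta_reduce
  by_cases hy : y - T ∈ Set.Icc (0 : ℝ) 1
  · exact ⟨(h₁ _ hy).trans ((le_abs_self _).trans (le_max_left _ _)),
      (h₂ _ hy).trans ((le_abs_self _).trans (le_max_right _ _))⟩
  · have h := deriv_step_eq_zero (T := 0) (y := y - T) (by
      rw [Set.mem_Icc, not_and_or, not_le, not_le] at hy; simpa using hy)
    rw [h.1, h.2, abs_zero]
    exact ⟨(abs_nonneg _).trans (le_max_left _ _), (abs_nonneg _).trans (le_max_left _ _)⟩

theorem hasFDerivAt_im_comp {ρ : ℝ → ℝ} {ρ' : ℝ} {w : ℂ} (h : HasDerivAt ρ ρ' w.im) :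
    HasFDerivAt (fun w : ℂ => (ρ w.im : ℂ)) (ρ' • Complex.ofRealCLM.comp Complex.imCLM) w := by
  have h1 : HasFDerivAt (fun w : ℂ => ρ w.im) (ρ' • Complex.imCLM) w :=
    h.comp_hasFDerivAt w Complex.imCLM.hasFDerivAt
  refine (Complex.ofRealCLM.hasFDerivAt.comp w h1).congr_fderiv ?_
  rw [ContinuousLinearMap.comp_smul]

theorem laplacian_im_comp {ρ : ℝ → ℝ} (hρ : ContDiff ℝ 2 ρ) (w : ℂ) :
    Laplacian.laplacian (fun w : ℂ => (ρ w.im : ℂ)) w = ((deriv (deriv ρ) w.im : ℝ) : ℂ) := by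
  have hC : ContDiff ℝ 2 fun w : ℂ => (ρ w.im : ℂ) :=
    Complex.ofRealCLM.contDiff.comp (hρ.comp Complex.imCLM.contDiff)
  have h1 : ∀ v : ℂ, (fun w : ℂ => fderiv ℝ (fun w : ℂ => (ρ w.im : ℂ)) w v) =
      fun w : ℂ => (((fun t => deriv ρ t * v.im) w.im : ℝ) : ℂ) := fun v => by
    ext w
    rw [(hasFDerivAt_im_comp (hρ.differentiable (by norm_num) w.im).hasDerivAt).fderiv]
    simp
  have h2 : DifferentiableAt ℝ (deriv ρ) w.im :=
    (contDiff_succ_iff_deriv (n := 1).mp hρ).2.2.differentiable (by norm_num) _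
  rw [laplacian_apply, ← fderiv_fderiv_apply hC.contDiffAt, ← fderiv_fderiv_apply hC.contDiffAt,
    h1, h1, (hasFDerivAt_im_comp (h2.hasDerivAt.mul_const _)).fderiv,
    (hasFDerivAt_im_comp (h2.hasDerivAt.mul_const _)).fderiv]
  simp

/-- The derivative of `f ∘ g` in the direction of the imaginary axis. -/
def vert (g : SL(2, ℤ)) (f : ℍ → ℂ) (z : ℍ) : ℂ := fderiv ℝ (pull g f) z Complex.I

theorem continuous_vert {f : ℍ → ℂ} (hf : IsC2 f) (g : SL(2, ℤ)) : Continuous (vert g f) := by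
  rw [continuous_iff_continuousAt]
  intro z
  exact ContinuousAt.comp (g := fun w : ℂ => fderiv ℝ (pull g f) w Complex.I)
    (f := UpperHalfPlane.coe)
    (continuousAt_fderiv_apply ((hf.contDiffAt_pull g z.im_pos).of_le (by norm_num)) _)
    continuous_coe.continuousAt

/-- The commutator of the Laplacian with the cutoff. -/
def cutErr (T : ℝ) (g : SL(2, ℤ)) (f : ℍ → ℂ) (z : ℍ) : ℂ :=
  -(z.im : ℂ) ^ 2 * (((deriv (deriv (step T)) z.im : ℝ) : ℂ) * f (g • z) +
    2 * (((deriv (step T) z.im : ℝ) : ℂ) * vert g f z))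

theorem continuous_cutErr {f : ℍ → ℂ} (hf : IsC2 f) (g : SL(2, ℤ)) (T : ℝ) :
    Continuous (cutErr T g f) := by
  have h1 := (hf.comp_smul g).continuous
  have h2 := continuous_vert hf g
  have h3 := continuous_deriv_deriv_step T
  have h4 := (contDiff_deriv_step T).continuous
  have h5 : Continuous fun z : ℍ => z.im := continuous_im
  exact ((Complex.continuous_ofReal.comp h5).pow 2).neg.mul
    (((Complex.continuous_ofReal.comp (h3.comp h5)).mul h1).add
      (continuous_const.mul ((Complex.continuous_ofReal.comp (h4.comp h5)).mul h2)))

section Cusp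

variable {Γ : Subgroup SL(2, ℤ)} {f : ℍ → ℂ} {lam : ℂ}

theorem hypLaplacian_step_mul (hf : IsWeakMaassForm Γ lam f) (g : SL(2, ℤ)) (T : ℝ) (z : ℍ) :
    hypLaplacian (fun z => (step T z.im : ℂ) * f (g • z)) z =
      lam * ((step T z.im : ℂ) * f (g • z)) + cutErr T g f z := by
  have h1 : (fun w : ℂ => (step T (ofComplex w).im : ℂ) * f (g • ofComplex w)) =ᶠ[𝓝 (z : ℂ)]
      fun w => (step T w.im : ℂ) * pull g f w := by
    filter_upwards [(isOpen_lt continuous_const Complex.continuous_im).mem_nhds z.2] with w hw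
    rw [pull, ofComplex_apply_of_im_pos hw]
    rfl
  have hC : ContDiff ℝ 2 fun w : ℂ => (step T w.im : ℂ) :=
    Complex.ofRealCLM.contDiff.comp ((contDiff_step T).comp Complex.imCLM.contDiff)
  have hz : ((z : ℂ).im : ℂ) ≠ 0 := by exact_mod_cast z.im_pos.ne'
  rw [hypLaplacian, (InnerProductSpace.laplacian_congr_nhds h1).self_of_nhds,
    laplacian_mul hC.contDiffAt (hf.isC2.contDiffAt_pull g z.im_pos),
    laplacian_im_comp (contDiff_step T), laplacian_pull hf g z.im_pos,
    (hasFDerivAt_im_comp (hasDerivAt_step T _)).fderiv, cutErr, vert,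
    show f (g • z) = pull g f z by rw [pull, ofComplex_apply]]
  have hz' : (z.im : ℂ) ≠ 0 := hz
  simp only [smul_apply, ContinuousLinearMap.comp_apply, Complex.imCLM_apply,
    Complex.one_im, Complex.I_im, map_zero, Complex.ofRealCLM_apply, Complex.ofReal_one,
    smul_zero, Complex.real_smul, mul_one, coe_im]
  field_simp
  ring

theorem tendsto_step_integral {a : ℕ} {G : ℍ → ℂ} (hG : IntegrableOn G (slab a (Set.Ioi 1))) :
    Tendsto (fun n : ℕ => ∫ z in slab a (Set.Ioi 1), (step n z.im : ℂ) * G z) atTop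
      (𝓝 (∫ z in slab a (Set.Ioi 1), G z)) := by
  refine tendsto_integral_of_dominated_convergence (fun z => ‖G z‖) (fun n => ?_) hG.norm
    (fun n => ae_of_all _ fun z => ?_) (ae_of_all _ fun z => ?_)
  · exact (isC2_im (contDiff_step n)).continuous.aestronglyMeasurable.mul hG.aestronglyMeasurable
  · rw [norm_mul, Complex.norm_real, step, Real.norm_of_nonneg (Real.smoothTransition.nonneg _)]
    exact mul_le_of_le_one_left (norm_nonneg _) (Real.smoothTransition.le_one _)
  · refine tendsto_const_nhds.congr' ?_
    filter_upwards [eventually_ge_atTop ⌈z.im⌉₊] with n hn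
    rw [step_eq_one ((Nat.le_ceil _).trans (by exact_mod_cast hn)), Complex.ofReal_one, one_mul]

theorem norm_cutErr_le {M : ℝ} (hM : ∀ T y : ℝ, |deriv (step T) y| ≤ M ∧
    |deriv (deriv (step T)) y| ≤ M) (T : ℝ) (g : SL(2, ℤ)) (f : ℍ → ℂ) (z : ℍ) :
    ‖cutErr T g f z‖ ≤ z.im ^ 2 * (M * (‖f (g • z)‖ + 2 * (1 + ‖vert g f z‖ ^ 2))) := by
  obtain ⟨h1, h2⟩ := hM T z.im
  rw [cutErr, norm_mul, norm_neg, norm_pow, Complex.norm_real, Real.norm_of_nonneg z.im_pos.le]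
  refine mul_le_mul_of_nonneg_left ((norm_add_le _ _).trans ?_) (sq_nonneg _)
  rw [norm_mul, norm_mul, norm_mul, Complex.norm_real, Complex.norm_real, Complex.norm_ofNat,
    Real.norm_eq_abs, Real.norm_eq_abs]
  have h3 : ‖vert g f z‖ ≤ 1 + ‖vert g f z‖ ^ 2 := by nlinarith [sq_nonneg (‖vert g f z‖ - 1)]
  have h4 := mul_le_mul h1 h3 (norm_nonneg _) ((abs_nonneg _).trans h1)
  have h5 := mul_le_mul_of_nonneg_right h2 (norm_nonneg (f (g • z)))
  linarith

/-- The commutator lives on `T ≤ y ≤ T + 1`. There `f` is at most exponentially large and its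
vertical derivative is controlled in mean square by the energy estimate, so the Gaussian decay of
`E` wins. -/
theorem tendsto_cutErr_integral (hf : IsWeakMaassForm Γ lam f) (g : SL(2, ℤ)) {a : ℕ} (ha : 0 < a)
    {E : ℍ → ℂ} {K' c : ℝ} (hK' : 0 ≤ K') (hc : 0 < c)
    (hE : ∀ z : ℍ, |z.re| ≤ a → 1 ≤ z.im → ‖E z‖ ≤ K' * Real.exp (-c * z.im ^ 2)) :
    Tendsto (fun n : ℕ => ∫ z in slab a (Set.Ioi 1), cutErr n g f z * E z) atTop (𝓝 0) := by
  obtain ⟨M, hM0, hM⟩ := exists_deriv_step_bound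
  obtain ⟨C, K, hC, hK, hb⟩ := hf.strip_bound g (a + 3)
  obtain ⟨K₁, hK₁, hen⟩ := energy_estimate (u := pull g f)
    (fun w hw => hf.isC2.contDiffAt_pull g hw) (fun w hw => laplacian_pull hf g hw) ha hC hK
    (fun w h1 h2 => by
      have hw : 0 < w.im := by linarith
      simpa [pull, ofComplex_apply_of_im_pos hw] using hb ⟨w, hw⟩ h1 h2)
  set B := volume.real (Metric.closedBall (0 : ℂ) (a + 2)) with hB
  set K₂ : ℝ := M * ((K * Real.exp C + 2) * B + 2 * K₁) * K' with hK₂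
  have hB0 : 0 ≤ B := measureReal_nonneg
  have hbound : ∀ T : ℝ, a + 4 ≤ T → ‖∫ z in slab a (Set.Ioi 1), cutErr T g f z * E z‖ ≤
      K₂ * (Real.exp (2 * C * T) * Real.exp (-c * T ^ 2)) := by
    intro T hT
    have hT1 : 1 < T := by linarith [(Nat.cast_nonneg a : (0 : ℝ) ≤ a)]
    set S : Set ℂ := {w | w.re ∈ Set.Icc (-(1 / 2)) ((a : ℝ) - 1 / 2) ∧ w.im ∈ Set.Ioi 1} with hS
    have hSm : MeasurableSet S := measurableSet_reProdIm' measurableSet_Icc measurableSet_Ioi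
    rw [show slab a (Set.Ioi 1) = {z : ℍ | (z : ℂ) ∈ S} from rfl, setIntegral_uhp _ hSm fun w hw =>
      zero_lt_one.trans (Set.mem_Ioi.mp hw.2)]
    have hsub : box a T ⊆ S := fun w hw => ⟨hw.1, hT1.trans_le hw.2.1⟩
    rw [setIntegral_eq_of_subset_of_forall_sdiff_eq_zero hSm hsub fun w hw => by
      have hw0 : 0 < w.im := zero_lt_one.trans (Set.mem_Ioi.mp hw.1.2)
      have h1 : w.im < T ∨ T + 1 < w.im := by
        by_contra hn
        rw [not_or, not_lt, not_lt] at hn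
        exact hw.2 ⟨hw.1.1, hn⟩
      have h2 : (ofComplex w).im = w.im := by rw [ofComplex_apply_of_im_pos hw0]; rfl
      rw [cutErr, h2, (deriv_step_eq_zero h1).1, (deriv_step_eq_zero h1).2]
      simp]
    obtain ⟨hint, hle⟩ := hen T hT
    obtain ⟨hfin, hvol⟩ := measureReal_box_le ha T
    have hconst : ∀ r : ℝ, IntegrableOn (fun _ : ℂ => r) (box a T) := fun r =>
      integrableOn_const hfin.ne
    set r := K * Real.exp (C * (T + 1)) + 2 with hr
    refine (norm_integral_le_of_norm_le (((hconst r).add (hint.const_mul 2)).const_mul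
      (M * (K' * Real.exp (-c * T ^ 2)))) (ae_restrict_of_forall_mem (measurableSet_box a T)
      fun w hw => ?_)).trans ?_
    · have hw1 : 1 < w.im := hT1.trans_le hw.2.1
      have hw0 : 0 < w.im := by linarith
      set z : ℍ := ⟨w, hw0⟩ with hz
      have hzi : z.im = w.im := rfl
      have hzs : z ∈ slab a (Set.Ioi 1) := hsub hw
      have hza := abs_re_le_of_mem_slab ha hzs
      have hoz : ofComplex w = z := ofComplex_apply_of_im_pos hw0
      rw [hoz, norm_mul, Complex.norm_real, Real.norm_of_nonneg (by positivity), norm_mul]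
      have h1 := hE z hza hw1.le
      have h2 : Real.exp (-c * z.im ^ 2) ≤ Real.exp (-c * T ^ 2) := by
        rw [Real.exp_le_exp, hzi]
        nlinarith [pow_le_pow_left₀ (by linarith : (0 : ℝ) ≤ T) hw.2.1 2]
      have h3 := h1.trans (mul_le_mul_of_nonneg_left h2 hK')
      have h4 := norm_cutErr_le hM T g f z
      have h5 : ‖f (g • z)‖ ≤ K * Real.exp (C * (T + 1)) := (hb z (by linarith) hw1.le).trans (by
        gcongr
        exact hw.2.2)
      have h6 : vert g f z = fderiv ℝ (pull g f) w Complex.I := rfl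
      rw [hzi] at h4
      calc 1 / w.im ^ 2 * (‖cutErr T g f z‖ * ‖E z‖)
          ≤ 1 / w.im ^ 2 * ((w.im ^ 2 * (M * (‖f (g • z)‖ + 2 * (1 + ‖vert g f z‖ ^ 2)))) *
            (K' * Real.exp (-c * T ^ 2))) := by gcongr
        _ = M * (K' * Real.exp (-c * T ^ 2)) *
            (‖f (g • z)‖ + 2 * (1 + ‖vert g f z‖ ^ 2)) := by field_simp
        _ ≤ M * (K' * Real.exp (-c * T ^ 2)) *
            (K * Real.exp (C * (T + 1)) + 2 * (1 + ‖vert g f z‖ ^ 2)) := by gcongr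
        _ = _ := by rw [h6, hr]; simp only [Pi.add_apply]; ring
    · simp only [Pi.add_apply]
      rw [integral_const_mul, integral_add (hconst r) (hint.const_mul 2), integral_const_mul,
        setIntegral_const, smul_eq_mul]
      have h1 : 1 ≤ Real.exp (2 * C * T) := Real.one_le_exp (by positivity)
      have h2 : r ≤ (K * Real.exp C + 2) * Real.exp (2 * C * T) := by
        have : Real.exp (C * (T + 1)) ≤ Real.exp C * Real.exp (2 * C * T) := by
          rw [← Real.exp_add, Real.exp_le_exp]; nlinarith
        rw [hr, add_mul, mul_assoc]
        gcongr
        linarith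
      have hr0 : 0 ≤ r := by positivity
      calc _ ≤ M * (K' * Real.exp (-c * T ^ 2)) * (B * ((K * Real.exp C + 2) *
            Real.exp (2 * C * T)) + 2 * (K₁ * Real.exp (2 * C * T))) := by gcongr
        _ = _ := by rw [hK₂]; ring
  have hlim : Tendsto (fun n : ℕ => K₂ * (Real.exp ((2 * C + 1) ^ 2 / (4 * c)) *
      Real.exp (-1 * (n : ℝ)))) atTop (𝓝 0) := by
    have h1 : Tendsto (fun n : ℕ => Real.exp (-1 * (n : ℝ))) atTop (𝓝 0) := by
      exact (Real.tendsto_exp_neg_atTop_nhds_zero.comp tendsto_natCast_atTop_atTop).congr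
        fun n => by simp
    simpa using (h1.const_mul _).const_mul K₂
  have hK₂0 : 0 ≤ K₂ := by positivity
  refine squeeze_zero_norm' ?_ hlim
  filter_upwards [eventually_ge_atTop (a + 4)] with n hn
  exact (hbound n (by exact_mod_cast hn)).trans
    (mul_le_mul_of_nonneg_left (exp_mul_exp_neg_sq_le _ hc _) hK₂0)

end Cusp

/-! ### The boundary contribution of a cusp -/

theorem integrableOn_slab_of_eventually_zero {a : ℕ} {G : ℍ → ℂ} (hG : Continuous G) {T : ℝ}
    (h : ∀ z : ℍ, T < z.im → G z = 0) : IntegrableOn G (slab a (Set.Ioi 1)) := by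
  refine IntegrableOn.of_forall_sdiff_eq_zero (s := slab a (Set.Icc 1 T))
    (hG.continuousOn.integrableOn_compact (isCompact_slab_Icc a one_pos))
    (measurableSet_rect measurableSet_Icc measurableSet_Ioi) fun z hz => h z ?_
  by_contra hn
  exact hz.2 ⟨hz.1.1, le_of_lt hz.1.2, not_lt.mp hn⟩

section Cusp

variable {Γ : Subgroup SL(2, ℤ)} [Γ.FiniteIndex] {f : ℍ → ℂ} {lam : ℂ}

/-- The derivative of the constant term. -/
def constTermDeriv (Γ : Subgroup SL(2, ℤ)) (g : SL(2, ℤ)) (f : ℍ → ℂ) (y : ℝ) : ℂ :=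
  mode (cuspWidth Γ g : ℝ) (fun w => fderiv ℝ (pull g f) w Complex.I) 0 y

theorem hasDerivAt_constTermDeriv (hf : IsWeakMaassForm Γ lam f) (g : SL(2, ℤ)) {y : ℝ}
    (hy : 0 < y) :
    HasDerivAt (constTermDeriv Γ g f) (-lam / (y : ℂ) ^ 2 * constTerm Γ g f y) y := by
  refine (hasDerivAt_mode_fderiv (Nat.cast_pos.mpr (cuspWidth_pos Γ g))
    (fun w hw => hf.isC2.contDiffAt_pull g hw) (fun w hw => pull_periodic hf.invariant g hw)
    (fun w hw => laplacian_pull hf g hw) 0 hy).congr_deriv ?_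
  rw [constTerm_eq_mode]
  simp
  ring

theorem integral_slice_vert (hf : IsWeakMaassForm Γ lam f) (g : SL(2, ℤ)) {y : ℝ} (hy : 0 < y) :
    ∫ x in Set.Icc (-(1 / 2)) ((cuspWidth Γ g : ℝ) - 1 / 2), vert g f (pt x y) =
      cuspWidth Γ g * constTermDeriv Γ g f y := by
  have h0 : (-(1 / 2) : ℝ) ≤ (cuspWidth Γ g : ℝ) - 1 / 2 := by
    linarith [(Nat.cast_nonneg _ : (0 : ℝ) ≤ cuspWidth Γ g)]
  have h1 := hasDerivAt_integral_line (v := pull g f) (e := fun _ => 1)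
    (fun w hw => (hf.isC2.contDiffAt_pull g hw).of_le (by norm_num)) continuous_const
    (a := -(1 / 2)) (b := (cuspWidth Γ g : ℝ) - 1 / 2) hy
  simp only [mul_one, intervalIntegral.integral_of_le h0, ← integral_Icc_eq_integral_Ioc] at h1
  have h2 : HasDerivAt (fun y : ℝ => ∫ x in Set.Icc (-(1 / 2)) ((cuspWidth Γ g : ℝ) - 1 / 2),
      pull g f (x + y * Complex.I)) (cuspWidth Γ g * constTermDeriv Γ g f y) y := by
    refine ((hasDerivAt_constTerm hf.isC2 g hy).const_mul _).congr_of_eventuallyEq ?_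
    filter_upwards [lt_mem_nhds hy] with t ht
    exact integral_slice_eq_constTerm hf.invariant g ht
  rw [← h1.unique h2]
  simp only [vert, coe_pt hy]

/-- Integration over `x` leaves only the constant term `a`. With `χ` the cutoff, the remaining
integrand is `-y (χ a)''`, whose primitive is `χ a - y (χ a)'`; this vanishes for large `y` and
equals `a(1) - a'(1)` at `y = 1`. The result does not depend on `T`, so no divergence appears. -/
theorem integral_cutoff_linear (hf : IsWeakMaassForm Γ lam f) (g : SL(2, ℤ)) (κ : ℂ) {T : ℝ}
    (hT : 1 < T) :
    ∫ z in slab (cuspWidth Γ g) (Set.Ioi 1),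
      (lam * ((step T z.im : ℂ) * f (g • z)) + cutErr T g f z) * (κ * z.im) =
      κ * cuspWidth Γ g * (constTermDeriv Γ g f 1 - constTerm Γ g f 1) := by
  set α : ℂ := (cuspWidth Γ g : ℂ) with hα
  set a := constTerm Γ g f with ha
  set a' := constTermDeriv Γ g f with ha'
  have hcf := (hf.isC2.comp_smul g).continuous
  have hcs := (isC2_im (contDiff_step T)).continuous
  have hzero : ∀ z : ℍ, T + 1 < z.im →
      (lam * ((step T z.im : ℂ) * f (g • z)) + cutErr T g f z) * (κ * z.im) = 0 := by
    intro z hz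
    rw [cutErr, step_eq_zero hz.le, (deriv_step_eq_zero (Or.inr hz)).1,
      (deriv_step_eq_zero (Or.inr hz)).2]
    simp
  have hsub1 : Set.Ioi (1 : ℝ) ⊆ Set.Ioi 0 := Set.Ioi_subset_Ioi zero_le_one
  have hi : IntegrableOn (fun z : ℍ => (lam * ((step T z.im : ℂ) * f (g • z)) + cutErr T g f z) *
      (κ * z.im)) (slab (cuspWidth Γ g) (Set.Ioi 1)) := integrableOn_slab_of_eventually_zero
    (((continuous_const.mul (hcs.mul hcf)).add (continuous_cutErr hf.isC2 g T)).mul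
      (continuous_const.mul (Complex.continuous_ofReal.comp continuous_im))) hzero
  rw [setIntegral_slab_eq measurableSet_Ioi hsub1 hi]
  set Φ : ℝ → ℂ := fun y => (step T y : ℂ) * a y -
    y * (((deriv (step T) y : ℝ) : ℂ) * a y + (step T y : ℂ) * a' y) with hΦ
  set Φ' : ℝ → ℂ := fun y => -(y : ℂ) * (((deriv (deriv (step T)) y : ℝ) : ℂ) * a y +
    2 * (((deriv (step T) y : ℝ) : ℂ) * a' y) - lam / (y : ℂ) ^ 2 * ((step T y : ℂ) * a y)) with hΦ'
  have hda : ∀ y : ℝ, 0 < y → HasDerivAt a (a' y) y := fun y hy => hasDerivAt_constTerm hf.isC2 g hy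
  have hda' : ∀ y : ℝ, 0 < y → HasDerivAt a' (-lam / (y : ℂ) ^ 2 * a y) y := fun y hy =>
    hasDerivAt_constTermDeriv hf g hy
  have hd : ∀ y : ℝ, 0 < y → HasDerivAt Φ (Φ' y) y := by
    intro y hy
    have h1 := (hasDerivAt_step T y).ofReal_comp
    have h2 := (hasDerivAt_deriv_step T y).ofReal_comp
    have h3 := (Complex.ofRealCLM.hasDerivAt (x := y))
    refine ((h1.mul (hda y hy)).sub (h3.mul ((h2.mul (hda y hy)).add
      (h1.mul (hda' y hy))))).congr_deriv ?_
    simp only [hΦ', Complex.ofRealCLM_apply, Complex.ofReal_one, Pi.add_apply, Pi.mul_apply]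
    ring
  have hslice : ∀ y ∈ Set.Ioi (1 : ℝ), ((1 / y ^ 2 : ℝ) : ℂ) *
      ∫ x in Set.Icc (-(1 / 2)) ((cuspWidth Γ g : ℝ) - 1 / 2),
        (lam * ((step T (pt x y).im : ℂ) * f (g • pt x y)) + cutErr T g f (pt x y)) *
          (κ * (pt x y).im) = κ * α * Φ' y := by
    intro y hy
    have hy0 : (0 : ℝ) < y := hsub1 hy
    have hyc : (y : ℂ) ≠ 0 := by exact_mod_cast hy0.ne'
    have hpt : Continuous fun x : ℝ => pt x y := continuous_iff_continuousAt.mpr fun x =>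
      ContinuousAt.comp (g := fun p : ℝ × ℝ => pt p.1 p.2) (f := fun x : ℝ => (x, y))
        (continuousAt_pt hy0) (by fun_prop)
    have e : ∀ x : ℝ, (lam * ((step T (pt x y).im : ℂ) * f (g • pt x y)) + cutErr T g f (pt x y)) *
        (κ * (pt x y).im) = κ * y * (lam * (step T y : ℂ) -
          (y : ℂ) ^ 2 * ((deriv (deriv (step T)) y : ℝ) : ℂ)) * f (g • pt x y) +
        -(2 * κ * (y : ℂ) ^ 3 * ((deriv (step T) y : ℝ) : ℂ)) * vert g f (pt x y) := by
      intro x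
      rw [cutErr, pt_im hy0]; ring
    simp only [e]
    have c1 : ∀ r : ℂ, IntegrableOn (fun x : ℝ => r * f (g • pt x y))
        (Set.Icc (-(1 / 2)) ((cuspWidth Γ g : ℝ) - 1 / 2)) := fun r =>
      (continuous_const.mul (hcf.comp hpt)).integrableOn_Icc
    have c2 : ∀ r : ℂ, IntegrableOn (fun x : ℝ => r * vert g f (pt x y))
        (Set.Icc (-(1 / 2)) ((cuspWidth Γ g : ℝ) - 1 / 2)) := fun r =>
      (continuous_const.mul ((continuous_vert hf.isC2 g).comp hpt)).integrableOn_Icc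
    rw [integral_add (c1 _) (c2 _), integral_const_mul,
      integral_const_mul, integral_slice_eq_constTerm hf.invariant g hy0,
      integral_slice_vert hf g hy0]
    simp only [hΦ', ← ha, ← ha', ← hα]
    push_cast
    field_simp
    ring
  rw [setIntegral_congr_fun measurableSet_Ioi hslice, integral_const_mul]
  have hΦ0 : ∀ y : ℝ, T + 1 < y → Φ y = 0 ∧ Φ' y = 0 := by
    intro y hy
    simp only [hΦ, hΦ']
    rw [step_eq_zero hy.le, (deriv_step_eq_zero (Or.inr hy)).1, (deriv_step_eq_zero (Or.inr hy)).2]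
    simp
  have hac : ContinuousOn a (Set.Ioi 0) := fun y hy => (hda y hy).continuousAt.continuousWithinAt
  have hac' : ContinuousOn a' (Set.Ioi 0) := fun y hy => (hda' y hy).continuousAt.continuousWithinAt
  have hcont : ContinuousOn Φ' (Set.Ioi 0) := by
    have h1 : Continuous fun y : ℝ => ((step T y : ℝ) : ℂ) :=
      Complex.continuous_ofReal.comp (contDiff_step T).continuous
    have h2 : Continuous fun y : ℝ => ((deriv (step T) y : ℝ) : ℂ) :=
      Complex.continuous_ofReal.comp (contDiff_deriv_step T).continuous
    have h3 : Continuous fun y : ℝ => ((deriv (deriv (step T)) y : ℝ) : ℂ) :=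
      Complex.continuous_ofReal.comp (continuous_deriv_deriv_step T)
    have h4 : Continuous fun y : ℝ => (y : ℂ) := Complex.continuous_ofReal
    refine h4.neg.continuousOn.mul (((h3.continuousOn.mul hac).add
      (continuousOn_const.mul (h2.continuousOn.mul hac'))).sub
      ((continuousOn_const.div (h4.pow 2).continuousOn fun y hy => ?_).mul
        (h1.continuousOn.mul hac)))
    exact pow_ne_zero 2 (Complex.ofReal_ne_zero.mpr (Set.mem_Ioi.mp hy).ne')
  have hint : IntegrableOn Φ' (Set.Ioi 1) := by
    refine IntegrableOn.of_forall_sdiff_eq_zero (s := Set.Icc 1 (T + 1))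
      ((hcont.mono fun y hy => zero_lt_one.trans_le hy.1).integrableOn_Icc) measurableSet_Ioi
      fun y hy => (hΦ0 y ?_).2
    by_contra hn
    exact hy.2 ⟨le_of_lt hy.1, not_lt.mp hn⟩
  rw [integral_Ioi_of_hasDerivAt_of_tendsto (hd 1 one_pos).continuousAt.continuousWithinAt
    (fun y hy => hd y (hsub1 hy)) hint (tendsto_const_nhds.congr' (f₁ := fun _ => (0 : ℂ)) (by
      filter_upwards [eventually_gt_atTop (T + 1)] with y hy
      exact (hΦ0 y hy).1.symm))]
  simp only [hΦ]
  rw [step_eq_one hT.le, (deriv_step_eq_zero (Or.inl hT)).1]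
  push_cast
  ring

/-- The contribution of a cusp to the integral of the Laplacian of a truncated eigenfunction. -/
theorem tendsto_cusp_contribution (hf : IsWeakMaassForm Γ lam f) (g : SL(2, ℤ)) {Θ : ℍ → ℂ}
    (hΘ : Continuous Θ) {κ : ℂ} {K' c : ℝ} (hK' : 0 ≤ K') (hc : 0 < c)
    (hE : ∀ z : ℍ, |z.re| ≤ cuspWidth Γ g → 1 ≤ z.im →
      ‖Θ z - κ * z.im‖ ≤ K' * Real.exp (-c * z.im ^ 2)) :
    Tendsto (fun n : ℕ => ∫ z in fdT (cuspWidth Γ g),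
        hypLaplacian (fun z => cutoff n z * f (g • z)) z * Θ z) atTop
      (𝓝 (lam * ((∫ z in truncDomain (cuspWidth Γ g) 1, f (g • z) * Θ z) +
        ∫ z in slab (cuspWidth Γ g) (Set.Ioi 1), f (g • z) * (Θ z - κ * z.im)) +
        κ * cuspWidth Γ g * (constTermDeriv Γ g f 1 - constTerm Γ g f 1))) := by
  have hα := cuspWidth_pos Γ g
  have hcf := (hf.isC2.comp_smul g).continuous
  have hEc : Continuous fun z : ℍ => Θ z - κ * z.im :=
    hΘ.sub (continuous_const.mul (Complex.continuous_ofReal.comp continuous_im))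
  obtain ⟨C, K, hC, hK, hb⟩ := hf.strip_bound g (cuspWidth Γ g)
  have hfE := integrableOn_slab_of_growth hα hcf hEc hK hc hb hE
  have h1 := ((tendsto_step_integral hfE).const_mul lam).add
    (tendsto_cutErr_integral hf g hα hK' hc hE)
  have h2 := (h1.add_const (κ * cuspWidth Γ g * (constTermDeriv Γ g f 1 - constTerm Γ g f 1))).const_add
    (lam * ∫ z in truncDomain (cuspWidth Γ g) 1, f (g • z) * Θ z)
  rw [add_zero] at h2
  rw [mul_add, add_assoc]
  refine h2.congr' ?_
  filter_upwards [eventually_ge_atTop 2] with n hn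
  have hn2 : (2 : ℝ) ≤ n := by exact_mod_cast hn
  have hcs := (isC2_im (contDiff_step (n : ℝ))).continuous
  have hlin : Continuous fun z : ℍ => κ * (z.im : ℂ) :=
    continuous_const.mul (Complex.continuous_ofReal.comp continuous_im)
  -- On the core the height is below `2 ≤ n`, so the cutoff is `1` near each point and the
  -- eigenvalue equation applies.
  have hA : ∀ z ∈ truncDomain (cuspWidth Γ g) 1,
      hypLaplacian (fun z => cutoff n z * f (g • z)) z * Θ z = lam * (f (g • z) * Θ z) := by
    intro z hz
    have h3 : ∀ᶠ w in 𝓝 z, cutoff n w * f (g • w) = f (g • w) := by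
      filter_upwards [eventually_cutoff_eq_one ((height_lt_two hz).trans_le hn2)] with w hw
      rw [hw, one_mul]
    rw [hypLaplacian_congr h3, hypLaplacian_comp_smul hf.isC2, hf.eigen]
    ring
  -- The kernel is split as `(Θ - κ y) + κ y`: the commutator vanishes in the limit against the
  -- first part, while the second is integrated exactly.
  have hB : ∀ z ∈ slab (cuspWidth Γ g) (Set.Ioi 1),
      hypLaplacian (fun z => cutoff n z * f (g • z)) z * Θ z =
      (lam * ((step n z.im : ℂ) * (f (g • z) * (Θ z - κ * z.im))) +
        cutErr n g f z * (Θ z - κ * z.im)) +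
      (lam * ((step n z.im : ℂ) * f (g • z)) + cutErr n g f z) * (κ * z.im) := by
    intro z hz
    have h3 : ∀ᶠ w in 𝓝 z, cutoff n w * f (g • w) = (step n w.im : ℂ) * f (g • w) := by
      filter_upwards [eventually_cutoff_eq_step hz.2] with w hw
      rw [hw]
    rw [hypLaplacian_congr h3, hypLaplacian_step_mul hf]
    ring
  have i0 : ∀ z : ℍ, (n : ℝ) + 1 < z.im → step n z.im = 0 ∧ cutErr n g f z = 0 := by
    intro z hz
    rw [cutErr, step_eq_zero hz.le, (deriv_step_eq_zero (Or.inr hz)).1,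
      (deriv_step_eq_zero (Or.inr hz)).2]
    simp
  have i1 : IntegrableOn (fun z => lam * ((step n z.im : ℂ) * (f (g • z) * (Θ z - κ * z.im))))
      (slab (cuspWidth Γ g) (Set.Ioi 1)) :=
    integrableOn_slab_of_eventually_zero (T := n + 1) (continuous_const.mul (hcs.mul (hcf.mul hEc)))
      fun z hz => by simp [(i0 z hz).1]
  have i2 : IntegrableOn (fun z => cutErr n g f z * (Θ z - κ * z.im))
      (slab (cuspWidth Γ g) (Set.Ioi 1)) :=
    integrableOn_slab_of_eventually_zero (T := n + 1) ((continuous_cutErr hf.isC2 g n).mul hEc)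
      fun z hz => by simp [(i0 z hz).2]
  have i12 : IntegrableOn (fun z => lam * ((step n z.im : ℂ) * (f (g • z) * (Θ z - κ * z.im))) +
      cutErr n g f z * (Θ z - κ * z.im)) (slab (cuspWidth Γ g) (Set.Ioi 1)) := i1.add i2
  have i3 : IntegrableOn (fun z => (lam * ((step n z.im : ℂ) * f (g • z)) + cutErr n g f z) *
      (κ * z.im)) (slab (cuspWidth Γ g) (Set.Ioi 1)) :=
    integrableOn_slab_of_eventually_zero (T := n + 1)
      (((continuous_const.mul (hcs.mul hcf)).add (continuous_cutErr hf.isC2 g n)).mul hlin)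
      fun z hz => by simp [(i0 z hz).1, (i0 z hz).2]
  have hmt : MeasurableSet (truncDomain (cuspWidth Γ g) 1) :=
    (isCompact_truncDomain _ _).measurableSet
  have hms : MeasurableSet (slab (cuspWidth Γ g) (Set.Ioi 1)) :=
    measurableSet_rect measurableSet_Icc measurableSet_Ioi
  have i4 : IntegrableOn (fun z => hypLaplacian (fun z => cutoff n z * f (g • z)) z * Θ z)
      (truncDomain (cuspWidth Γ g) 1) :=
    (continuous_hypLaplacian ((isC2_cutoff (by linarith)).mul (hf.isC2.comp_smul g))).mul hΘ
      |>.continuousOn.integrableOn_compact (isCompact_truncDomain _ _)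
  rw [fdT_diff_eq hα, setIntegral_union (disjoint_truncDomain_rect _ _ _) hms i4
    ((i12.add i3).congr_fun (fun z hz => (hB z hz).symm) hms),
    setIntegral_congr_fun hmt hA, setIntegral_congr_fun hms hB, integral_const_mul]
  congr 1
  rw [integral_add i12 i3, integral_add i1 i2, integral_const_mul,
    integral_cutoff_linear hf g κ (by linarith)]

end Cusp

/-! ### The lift of an eigenfunction against the Laplacian of the theta kernel -/

/-- The part of the theta integral at the cusp `g` which does not involve the constant term. -/
def cuspPart (N : ℕ) (L : Submodule ℤ V) (Γ : Subgroup SL(2, ℤ)) (h : Disc N L) (τ : ℍ)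
    (g : SL(2, ℤ)) (f : ℍ → ℂ) : ℂ :=
  (∫ z in truncDomain (cuspWidth Γ g) 1, f (g • z) * theta N L (phi0 N) h τ (g • z)) +
    ∫ z in slab (cuspWidth Γ g) (Set.Ioi 1),
      f (g • z) * (theta N L (phi0 N) h τ (g • z) - cuspKappa N L h g τ * z.im)

variable {N : ℕ} {L : Submodule ℤ V} {Γ : Subgroup SL(2, ℤ)} [Γ.FiniteIndex]
  {σ : Cusp N Γ → SL(2, ℤ)} {D : Set ℍ} {f : ℍ → ℂ} {lam : ℂ}

/-- Since the kernel of `Δφ₀` decays like a Gaussian at every cusp, exponential growth of the form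
does no harm. -/
theorem integrableOn_lift (hN : 0 < N) (hL : IsEvenLattice N L) (hΓ : ActsTrivially N L Γ)
    (hσ : IsCuspChoice N Γ σ) (hD : IsFundDomain Γ D) (hf : IsWeakMaassForm Γ lam f)
    (h : Disc N L) (τ : ℍ) : IntegrableOn (fun z => f z * theta N L (lapPhi0 N) h τ z) D := by
  have hc := continuous_theta hN hL.span_eq_top (Or.inr rfl : lapPhi0 N = phi0 N ∨ _) h τ
  rw [integrableOn_fundDomain_iff hσ hD fun γ hγ z => by
    rw [hf.invariant γ hγ, theta_invariant hL (Or.inr rfl) hΓ h hγ]]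
  intro c
  have hα := cuspWidth_pos Γ (σ c)
  have hcf := (hf.isC2.comp_smul (σ c)).continuous
  have hcθ := hc.comp (continuous_const_smul (σ c))
  obtain ⟨C, K, hC, hK, hb⟩ := hf.strip_bound (σ c) (cuspWidth Γ (σ c))
  obtain ⟨K', c', hK', hc', hE⟩ := theta_cusp_asymptotics hN hL h (σ c) τ (cuspWidth Γ (σ c))
  rw [fdT_diff_eq hα]
  exact ((hcf.mul hcθ).continuousOn.integrableOn_compact (isCompact_truncDomain _ _)).union
    (integrableOn_slab_of_growth hα hcf hcθ hK hc' hb fun z hz hz' => (hE z hz hz').2)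

/-- Green's formula is applied to the form times the invariant cutoff, and the cutoff is removed at
both ends: on the left by dominated convergence, on the right cusp by cusp, where each strip leaves
a boundary term at `y = 1`. -/
theorem integral_lift (hN : 0 < N) (hL : IsEvenLattice N L) (hΓ : ActsTrivially N L Γ)
    (hσ : IsCuspChoice N Γ σ) (hD : IsFundDomain Γ D) (hf : IsWeakMaassForm Γ lam f)
    (h : Disc N L) (τ : ℍ) :
    ∫ z in D, f z * theta N L (lapPhi0 N) h τ z =
      ∑ᶠ c, (lam * cuspPart N L Γ h τ (σ c) f + cuspKappa N L h (σ c) τ * cuspWidth Γ (σ c) *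
        (constTermDeriv Γ (σ c) f 1 - constTerm Γ (σ c) f 1)) := by
  have := finite_cusp hσ
  have := Fintype.ofFinite (Cusp N Γ)
  have hint := integrableOn_lift hN hL hΓ hσ hD hf h τ
  have hΘ := continuous_theta hN hL.span_eq_top (Or.inl rfl : phi0 N = phi0 N ∨ _) h τ
  have h1 : Tendsto (fun n : ℕ => ∫ z in D, (cutoff n z * f z) * theta N L (lapPhi0 N) h τ z) atTop
      (𝓝 (∫ z in D, f z * theta N L (lapPhi0 N) h τ z)) := by
    refine tendsto_integral_filter_of_dominated_convergence
      (fun z => ‖f z * theta N L (lapPhi0 N) h τ z‖) ?_ ?_ hint.norm (ae_of_all _ fun z => ?_)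
    · filter_upwards [eventually_ge_atTop 2] with n hn
      have hn2 : (1 : ℝ) < n := by exact_mod_cast hn
      simp only [mul_assoc]
      exact (isC2_cutoff hn2).continuous.aestronglyMeasurable.mul hint.aestronglyMeasurable
    · refine Eventually.of_forall fun n => ae_of_all _ fun z => ?_
      rw [mul_assoc, norm_mul, cutoff, Complex.norm_real, step,
        Real.norm_of_nonneg (Real.smoothTransition.nonneg _)]
      exact mul_le_of_le_one_left (norm_nonneg _) (Real.smoothTransition.le_one _)
    · refine tendsto_const_nhds.congr' ?_
      filter_upwards [eventually_ge_atTop ⌈height z⌉₊] with n hn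
      rw [cutoff, step_eq_one ((Nat.le_ceil _).trans (by exact_mod_cast hn)), Complex.ofReal_one,
        one_mul]
  rw [finsum_eq_sum_of_fintype]
  refine tendsto_nhds_unique h1 ?_
  have h2 : ∀ c, Tendsto _ atTop _ := fun c => by
    obtain ⟨K', c', hK', hc', hE⟩ := theta_cusp_asymptotics hN hL h (σ c) τ (cuspWidth Γ (σ c))
    exact tendsto_cusp_contribution hf (σ c) (hΘ.comp (continuous_const_smul (σ c))) hK' hc'
      (κ := cuspKappa N L h (σ c) τ) fun z hz hz' => (hE z hz hz').1
  refine (tendsto_finsetSum Finset.univ fun c _ => h2 c).congr' ?_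
  filter_upwards [eventually_ge_atTop 2] with n hn
  have hn2 : (1 : ℝ) < n := by exact_mod_cast hn
  have hG : IsC2 fun z => cutoff n z * f z := (isC2_cutoff hn2).mul hf.isC2
  have hGinv : ∀ γ ∈ Γ, ∀ z : ℍ, cutoff n (γ • z) * f (γ • z) = cutoff n z * f z :=
    fun γ hγ z => by rw [cutoff_smul, hf.invariant γ hγ]
  obtain ⟨K, hK, hKs⟩ := exists_compact_of_height_le hσ ((n : ℝ) + 1)
  rw [green hN hL hΓ hD h τ hK hG hGinv fun z hz => hKs z (height_le_of_mem_tsupport hz)]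
  have hlap : ∀ (g : SL(2, ℤ)) (z : ℍ), hypLaplacian (fun z => cutoff n z * f z) (g • z) =
      hypLaplacian (fun z => cutoff n z * f (g • z)) z := fun g z => by
    rw [← hypLaplacian_comp_smul hG]
    simp only [cutoff_smul]
  have hinv : ∀ γ ∈ Γ, ∀ z : ℍ, hypLaplacian (fun z => cutoff n z * f z) (γ • z) *
      theta N L (phi0 N) h τ (γ • z) = hypLaplacian (fun z => cutoff n z * f z) z *
      theta N L (phi0 N) h τ z := fun γ hγ z => by
    rw [hlap, theta_invariant hL (Or.inl rfl) hΓ h hγ]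
    simp only [hf.invariant γ hγ]
  rw [setIntegral_fundDomain hσ hD hinv, finsum_eq_sum_of_fintype]
  · simp only [hlap]
    rfl
  · rw [integrableOn_fundDomain_iff hσ hD hinv]
    intro c
    simp only [hlap]
    have hcont : Continuous fun z : ℍ => hypLaplacian (fun z => cutoff n z * f (σ c • z)) z *
        theta N L (phi0 N) h τ (σ c • z) :=
      (continuous_hypLaplacian ((isC2_cutoff hn2).mul (hf.isC2.comp_smul (σ c)))).mul
        (hΘ.comp (continuous_const_smul (σ c)))
    rw [fdT_diff_eq (cuspWidth_pos Γ (σ c))]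
    refine (hcont.continuousOn.integrableOn_compact (isCompact_truncDomain _ _)).union
      (integrableOn_slab_of_eventually_zero hcont (T := n + 1) fun z hz => ?_)
    have h3 : ∀ᶠ w in 𝓝 z, cutoff n w * f (σ c • w) = (fun _ => (0 : ℂ)) w := by
      have hz1 : 1 < z.im := by linarith
      filter_upwards [eventually_cutoff_eq_step (T := n) hz1,
        continuousAt_const.eventually_lt continuous_im.continuousAt hz] with w hw hw'
      rw [hw, step_eq_zero hw'.le, Complex.ofReal_zero, zero_mul]
    rw [hypLaplacian_congr h3]
    simp [hypLaplacian, laplacian_apply]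

/-- The core is compact, so continuity and holomorphy in `s` suffice there; on the strip the uniform
mean square bound is what makes the integral holomorphic. -/
theorem IsSpectralDeformation.analyticAt_cuspPart {U : Set ℂ} {F : ℂ → ℍ → ℂ} (hN : 0 < N)
    (hL : IsEvenLattice N L) (hF : IsSpectralDeformation Γ f U F) (h : Disc N L) (τ : ℍ)
    (g : SL(2, ℤ)) : AnalyticAt ℂ (fun s => cuspPart N L Γ h τ g (F s)) 1 := by
  have hΘ := (continuous_theta hN hL.span_eq_top (Or.inl rfl : phi0 N = phi0 N ∨ _) h τ).comp
    (continuous_const_smul g)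
  obtain ⟨K', c', hK', hc', hE⟩ := theta_cusp_asymptotics hN hL h g τ (cuspWidth Γ g)
  obtain ⟨ε, hε, hd⟩ := hF.differentiableOn_slab g
    (E := fun z => theta N L (phi0 N) h τ (g • z) - cuspKappa N L h g τ * z.im)
    (hΘ.sub (continuous_const.mul (Complex.continuous_ofReal.comp continuous_im))) hc'
    fun z hz hz' => (hE z hz hz').1
  refine AnalyticAt.add (DifferentiableOn.analyticAt ?_ (hF.isOpen.mem_nhds hF.one_mem))
    (hd.analyticAt (Metric.ball_mem_nhds _ hε))
  refine differentiableOn_integral_compact (isCompact_truncDomain _ _)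
    (isCompact_truncDomain _ _).measurableSet hF.isOpen
    (G := fun s z => F s (g • z) * theta N L (phi0 N) h τ (g • z)) ?_
    fun z _ => (hF.holomorphic _).mul_const _
  refine (hF.continuousOn.comp (f := fun p : ℂ × ℍ => (p.1, g • p.2)) (Continuous.continuousOn
    (continuous_fst.prodMk (continuous_snd.const_smul g))) fun p hp => ⟨hp.1, trivial⟩).mul ?_
  exact (hΘ.comp continuous_snd).continuousOn

omit [Γ.FiniteIndex] in
/-- If the constant term is `A y^s + B y^{1-s}`, its boundary contribution is linear in
`A` and `B`. -/
theorem constTermDeriv_sub (hf : IsC2 f) (g : SL(2, ℤ)) {s A B : ℂ}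
    (h : ∀ y : ℝ, 0 < y → constTerm Γ g f y = A * (y : ℂ) ^ s + B * (y : ℂ) ^ (1 - s)) :
    constTermDeriv Γ g f 1 - constTerm Γ g f 1 = (s - 1) * A - s * B := by
  have h1 := hasDerivAt_constTerm (Γ := Γ) hf g one_pos
  have h2 : HasDerivAt (constTerm Γ g f) _ 1 :=
    (((hasDerivAt_ofReal_cpow' one_pos s).const_mul A).add
      ((hasDerivAt_ofReal_cpow' one_pos (1 - s)).const_mul B)).congr_of_eventuallyEq (by
        filter_upwards [lt_mem_nhds one_pos] with y hy
        exact h y hy)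
  rw [constTermDeriv, h1.unique h2, h 1 one_pos]
  simp
  ring

/-- The value of the difference-type regularization. -/
theorem hasCT_diffLift {U : Set ℂ} {F : ℂ → ℍ → ℂ} {A B : Cusp N Γ → ℂ → ℂ} (hN : 0 < N)
    (hL : IsEvenLattice N L) (hΓ : ActsTrivially N L Γ) (hσ : IsCuspChoice N Γ σ)
    (hD : IsFundDomain Γ D) (hF : IsSpectralDeformation Γ f U F) (hAB : HasConstTerms Γ σ F A B)
    (h : Disc N L) (τ : ℍ) :
    HasCT (fun s => 1 / (s * (1 - s)) * ∫ z in D, F s z * theta N L (lapPhi0 N) h τ z) 1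
      (∑ᶠ c, (cuspPart N L Γ h τ (σ c) f + cuspKappa N L h (σ c) τ * cuspWidth Γ (σ c) *
        (deriv (B c) 1 - A c 1))) := by
  have := finite_cusp hσ
  have := Fintype.ofFinite (Cusp N Γ)
  -- Dividing `(s-1) A - s B` by `s (1-s)` gives `-A/s + B/(s-1)`. The polar part `B(1)/(s-1)` is
  -- split off, and the difference quotient left over takes the value `B'(1)` at `s = 1`.
  set g : ℂ → ℂ := fun s => ∑ c, (cuspPart N L Γ h τ (σ c) (F s) +
    cuspKappa N L h (σ c) τ * cuspWidth Γ (σ c) * (dslope (B c) 1 s - A c s / s)) with hg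
  have hga : AnalyticAt ℂ g 1 := by
    refine Finset.analyticAt_fun_sum _ fun c _ => (hF.analyticAt_cuspPart hN hL h τ (σ c)).add
      (analyticAt_const.mul (AnalyticAt.sub ?_ ((hAB c).1.div analyticAt_id one_ne_zero)))
    obtain ⟨p, hp⟩ := (hAB c).2.1
    exact ⟨_, hp.has_fpower_series_dslope_fslope⟩
  have hg1 : g 1 = ∑ᶠ c, (cuspPart N L Γ h τ (σ c) f + cuspKappa N L h (σ c) τ *
      cuspWidth Γ (σ c) * (deriv (B c) 1 - A c 1)) := by
    simp only [hg, finsum_eq_sum_of_fintype, hF.at_one, dslope_same, div_one]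
  rw [← hg1]
  refine hasCT_of_simplePole (p := ∑ c, cuspKappa N L h (σ c) τ * cuspWidth Γ (σ c) * B c 1) hga ?_
  have hall : ∀ᶠ s in 𝓝 (1 : ℂ), ∀ c, ∀ y : ℝ, 0 < y →
      constTerm Γ (σ c) (F s) y = A c s * (y : ℂ) ^ s + B c s * (y : ℂ) ^ (1 - s) :=
    eventually_all.mpr fun c => (hAB c).2.2
  have h0 : ∀ᶠ s : ℂ in 𝓝 1, s ≠ 0 := continuousAt_id.eventually_ne one_ne_zero
  filter_upwards [nhdsWithin_le_nhds hall, nhdsWithin_le_nhds h0,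
    nhdsWithin_le_nhds (hF.isOpen.mem_nhds hF.one_mem), self_mem_nhdsWithin] with s hs hs0 hsU hs1
  have hs1' : s - 1 ≠ 0 := sub_ne_zero.mpr hs1
  have hs1'' : 1 - s ≠ 0 := sub_ne_zero.mpr (Ne.symm hs1)
  rw [integral_lift hN hL hΓ hσ hD (hF.weakMaass s hsU), finsum_eq_sum_of_fintype, Finset.mul_sum,
    Finset.sum_div, ← Finset.sum_add_distrib]
  refine Finset.sum_congr rfl fun c _ => ?_
  rw [constTermDeriv_sub (hF.weakMaass s hsU).isC2 (σ c) (hs c), dslope_of_ne _ hs1,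
    slope_def_field]
  field_simp
  ring

/-! ### The truncated integrals -/

/-- Against `κ y` only the constant term `A y + B` contributes on the strip, namely `κ α` times the
integral of `(A y + B) y^{-s-1}` over `y > 1`. It converges for `Re s > 1` and is visibly
meromorphic; the rest of the strip integral converges for every `s`. -/
theorem tendsto_truncDomain (hf : IsWeakMaassForm Γ lam f) (g : SL(2, ℤ)) {Θ : ℍ → ℂ}
    (hΘ : Continuous Θ) {κ A B : ℂ} {K' c : ℝ} (hc : 0 < c)
    (hE : ∀ z : ℍ, |z.re| ≤ cuspWidth Γ g → 1 ≤ z.im →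
      ‖Θ z - κ * z.im‖ ≤ K' * Real.exp (-c * z.im ^ 2))
    (hAB : ∀ y : ℝ, 0 < y → constTerm Γ g f y = A * y + B) {s : ℂ} (hs : 1 < s.re) :
    Tendsto (fun T : ℝ => ∫ z in truncDomain (cuspWidth Γ g) T,
        f (g • z) * Θ z * (z.im : ℂ) ^ (-s)) atTop
      (𝓝 ((∫ z in truncDomain (cuspWidth Γ g) 1, f (g • z) * Θ z * (z.im : ℂ) ^ (-s)) +
        (∫ z in slab (cuspWidth Γ g) (Set.Ioi 1),
          f (g • z) * (Θ z - κ * z.im) * (z.im : ℂ) ^ (-s)) +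
        κ * cuspWidth Γ g * (A / (s - 1) + B / s))) := by
  have hα := cuspWidth_pos Γ g
  have hcf := (hf.isC2.comp_smul g).continuous
  have hlin : Continuous fun z : ℍ => κ * (z.im : ℂ) :=
    continuous_const.mul (Complex.continuous_ofReal.comp continuous_im)
  have hcs := continuous_im_cpow s
  obtain ⟨C, K, hC, hK, hb⟩ := hf.strip_bound g (cuspWidth Γ g)
  have hint : IntegrableOn (fun z : ℍ => f (g • z) * (Θ z - κ * z.im) * (z.im : ℂ) ^ (-s))
      (slab (cuspWidth Γ g) (Set.Ioi 1)) := by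
    have h1 := integrableOn_slab_of_growth hα (G := fun z => f (g • z) * (z.im : ℂ) ^ (-s))
      (E := fun z => Θ z - κ * z.im) (C := C + (‖s‖ + 1)) (hcf.mul hcs) (hΘ.sub hlin) hK hc (fun z hz hz' => by
        rw [norm_mul, add_mul, Real.exp_add, ← mul_assoc]
        exact mul_le_mul (hb z hz hz') (norm_cpow_neg_le hz' (Metric.mem_ball_self one_pos))
          (norm_nonneg _) (by positivity)) hE
    refine h1.congr_fun (fun z _ => ?_) (measurableSet_rect measurableSet_Icc measurableSet_Ioi)
    ring
  have hs1 : s - 1 ≠ 0 := fun h => by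
    rw [sub_eq_zero.mp h, Complex.one_re] at hs; exact lt_irrefl _ hs
  have hs0 : s ≠ 0 := fun h => by
    rw [h, Complex.zero_re] at hs; linarith
  have hr1 : (-s).re < -1 := by rw [Complex.neg_re]; linarith
  have hr2 : (-s - 1).re < -1 := by rw [Complex.sub_re, Complex.neg_re, Complex.one_re]; linarith
  have j1 := (integrableOn_Ioi_cpow_of_lt hr1 (c := 1) one_pos).const_mul A
  have j2 := (integrableOn_Ioi_cpow_of_lt hr2 (c := 1) one_pos).const_mul B
  have hpow := intervalIntegral_tendsto_integral_Ioi 1 (j1.add j2) tendsto_id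
  simp only [Pi.add_apply] at hpow
  rw [integral_add j1 j2, integral_const_mul, integral_const_mul,
    integral_Ioi_cpow_of_lt hr1 one_pos, integral_Ioi_cpow_of_lt hr2 one_pos] at hpow
  have hval : A * (-((1 : ℝ) : ℂ) ^ (-s + 1) / (-s + 1)) +
      B * (-((1 : ℝ) : ℂ) ^ (-s - 1 + 1) / (-s - 1 + 1)) = A / (s - 1) + B / s := by
    have h1 : -s + 1 ≠ 0 := fun h => hs1 (by linear_combination -h)
    rw [Complex.ofReal_one, Complex.one_cpow, Complex.one_cpow, sub_add_cancel]
    field_simp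
    ring
  rw [hval] at hpow
  refine (((tendsto_slab hint).const_add (∫ z in truncDomain (cuspWidth Γ g) 1,
    f (g • z) * Θ z * (z.im : ℂ) ^ (-s))).add (hpow.const_mul (κ * cuspWidth Γ g))).congr' ?_
  filter_upwards [eventually_ge_atTop 1] with T hT
  have hm : MeasurableSet (slab (cuspWidth Γ g) (Set.Ioc 1 T)) :=
    measurableSet_rect measurableSet_Icc measurableSet_Ioc
  have hcomp : ∀ G : ℍ → ℂ, Continuous G → IntegrableOn G (slab (cuspWidth Γ g) (Set.Ioc 1 T)) :=
    fun G hG => (hG.continuousOn.integrableOn_compact (isCompact_slab_Icc _ one_pos)).mono_set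
      fun z hz => ⟨hz.1, hz.2.1.le, hz.2.2⟩
  have hlini := hcomp (fun z => f (g • z) * (κ * z.im) * (z.im : ℂ) ^ (-s)) ((hcf.mul hlin).mul hcs)
  have hG : Continuous fun z => f (g • z) * Θ z * (z.im : ℂ) ^ (-s) := (hcf.mul hΘ).mul hcs
  have hG' : Continuous fun z => f (g • z) * (Θ z - κ * z.im) * (z.im : ℂ) ^ (-s) :=
    (hcf.mul (hΘ.sub hlin)).mul hcs
  have hdis : Disjoint (truncDomain (cuspWidth Γ g) 1) (slab (cuspWidth Γ g) (Set.Ioc 1 T)) :=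
    Set.disjoint_left.mpr fun z h h' => absurd h.1 (not_le.mpr h'.2.1)
  rw [truncDomain_eq_union hα hT, setIntegral_union hdis hm (hG.continuousOn.integrableOn_compact
    (isCompact_truncDomain _ _)) (hcomp _ hG), add_assoc]
  congr 1
  have hsplit : ∫ z in slab (cuspWidth Γ g) (Set.Ioc 1 T), f (g • z) * Θ z * (z.im : ℂ) ^ (-s) =
      (∫ z in slab (cuspWidth Γ g) (Set.Ioc 1 T),
        f (g • z) * (Θ z - κ * z.im) * (z.im : ℂ) ^ (-s)) +
      ∫ z in slab (cuspWidth Γ g) (Set.Ioc 1 T), f (g • z) * (κ * z.im) * (z.im : ℂ) ^ (-s) := by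
    rw [← integral_add (hcomp _ hG') hlini]
    congr 1
    ext z
    ring
  refine Eq.trans ?_ hsplit.symm
  congr 1
  rw [setIntegral_slab_eq measurableSet_Ioc (fun y hy => zero_lt_one.trans (Set.mem_Ioc.mp hy).1)
    hlini, id, intervalIntegral.integral_of_le hT, ← integral_const_mul]
  refine setIntegral_congr_fun measurableSet_Ioc fun y hy => ?_
  have hy0 : 0 < y := zero_lt_one.trans hy.1
  have hyc : (y : ℂ) ≠ 0 := Complex.ofReal_ne_zero.mpr hy0.ne'
  simp only [pt_im hy0]
  rw [integral_mul_const, integral_mul_const, integral_slice_eq_constTerm hf.invariant g hy0,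
    hAB y hy0, Complex.cpow_sub _ _ hyc, Complex.cpow_one]
  push_cast
  field_simp

/-- The value of the truncation regularization. -/
theorem exists_truncLift {A B : Cusp N Γ → ℂ} (hN : 0 < N) (hL : IsEvenLattice N L)
    (hσ : IsCuspChoice N Γ σ) (hf : IsWeakMaassForm Γ lam f)
    (hAB : ∀ c, ∀ y : ℝ, 0 < y → constTerm Γ (σ c) f y = A c * y + B c) (h : Disc N L) (τ : ℍ) :
    IsTruncLift N L Γ σ f h τ (∑ᶠ c, (cuspPart N L Γ h τ (σ c) f +
      cuspKappa N L h (σ c) τ * cuspWidth Γ (σ c) * (-A c))) := by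
  have := finite_cusp hσ
  have := Fintype.ofFinite (Cusp N Γ)
  have hΘ := fun c => (continuous_theta hN hL.span_eq_top (Or.inl rfl : phi0 N = phi0 N ∨ _) h τ).comp
    (continuous_const_smul (σ c))
  have hcf := fun c => (hf.isC2.comp_smul (σ c)).continuous
  set P : Cusp N Γ → ℂ → ℂ := fun c s =>
    (∫ z in truncDomain (cuspWidth Γ (σ c)) 1,
      f (σ c • z) * theta N L (phi0 N) h τ (σ c • z) * (z.im : ℂ) ^ (-s)) +
    ∫ z in slab (cuspWidth Γ (σ c)) (Set.Ioi 1), f (σ c • z) *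
      (theta N L (phi0 N) h τ (σ c • z) - cuspKappa N L h (σ c) τ * z.im) * (z.im : ℂ) ^ (-s) with hP
  have hPd : ∀ c, Differentiable ℂ (P c) := by
    intro c
    obtain ⟨C, K, hC, hK, hb⟩ := hf.strip_bound (σ c) (cuspWidth Γ (σ c))
    obtain ⟨K', c', hK', hc', hE⟩ := theta_cusp_asymptotics hN hL h (σ c) τ (cuspWidth Γ (σ c))
    refine Differentiable.add ?_ (differentiable_slab_cpow (cuspWidth_pos Γ (σ c)) (hcf c)
      ((hΘ c).sub (continuous_const.mul (Complex.continuous_ofReal.comp continuous_im))) hK hK' hc'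
      hb fun z hz hz' => (hE z hz hz').1)
    rw [← differentiableOn_univ]
    refine differentiableOn_integral_compact (isCompact_truncDomain _ _)
      (isCompact_truncDomain _ _).measurableSet isOpen_univ (G := fun s z =>
        f (σ c • z) * theta N L (phi0 N) h τ (σ c • z) * (z.im : ℂ) ^ (-s)) ?_
      fun z _ => ((differentiable_im_cpow z).const_mul _).differentiableOn
    refine Continuous.continuousOn ((((hcf c).mul (hΘ c)).comp continuous_snd).mul ?_)
    exact ((Complex.continuous_ofReal.comp continuous_im).comp continuous_snd).cpow
      continuous_fst.neg fun p => by simp [Complex.mem_slitPlane_iff, p.2.im_pos]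
  refine ⟨fun s => ∑ c, (P c s + cuspKappa N L h (σ c) τ * cuspWidth Γ (σ c) *
    (A c / (s - 1) + B c / s)), fun s _ => ?_, ⟨1, fun s hs => ⟨fun c => P c s +
    cuspKappa N L h (σ c) τ * cuspWidth Γ (σ c) * (A c / (s - 1) + B c / s), fun c => ?_, ?_⟩⟩, ?_⟩
  · refine MeromorphicAt.fun_sum fun c _ => ((hPd c).analyticAt s).meromorphicAt.add ?_
    fun_prop
  · obtain ⟨K', c', hK', hc', hE⟩ := theta_cusp_asymptotics hN hL h (σ c) τ (cuspWidth Γ (σ c))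
    exact tendsto_truncDomain hf (σ c) (hΘ c) hc' (fun z hz hz' => (hE z hz hz').1) (hAB c) hs
  · rw [finsum_eq_sum_of_fintype]
  · set g : ℂ → ℂ := fun s => ∑ c, (P c s + cuspKappa N L h (σ c) τ * cuspWidth Γ (σ c) *
      (A c / (s - 1))) with hg
    have hga : AnalyticAt ℂ g 0 := Finset.analyticAt_fun_sum _ fun c _ =>
      ((hPd c).analyticAt 0).add (analyticAt_const.mul (analyticAt_const.div
        (analyticAt_id.sub analyticAt_const) (by simp)))
    have hg0 : g 0 = ∑ᶠ c, (cuspPart N L Γ h τ (σ c) f +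
        cuspKappa N L h (σ c) τ * cuspWidth Γ (σ c) * (-A c)) := by
      rw [finsum_eq_sum_of_fintype]
      refine Finset.sum_congr rfl fun c _ => ?_
      simp only [hP, neg_zero, Complex.cpow_zero, mul_one, zero_sub, div_neg, div_one, cuspPart]
    rw [← hg0]
    -- Only the terms `B/s` are polar at `0` and they do not affect the constant term; `A/(s-1)` is
    -- regular with value `-A`.
    refine hasCT_of_simplePole (p := ∑ c, cuspKappa N L h (σ c) τ * cuspWidth Γ (σ c) * B c) hga
      (Eventually.of_forall fun s => ?_)
    rw [Finset.sum_div, ← Finset.sum_add_distrib]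
    refine Finset.sum_congr rfl fun c _ => ?_
    rw [sub_zero]
    ring

omit [Γ.FiniteIndex] in
-- The limits determine the continuation on a right half-plane, hence near `0` by the identity
-- theorem, and constant terms are unique.
theorem IsTruncLift.unique {I J : ℂ} {h : Disc N L} {τ : ℍ} (hI : IsTruncLift N L Γ σ f h τ I)
    (hJ : IsTruncLift N L Γ σ f h τ J) : I = J := by
  obtain ⟨Z, hZ, ⟨r, hr⟩, hZI⟩ := hI
  obtain ⟨W, hW, ⟨r', hr'⟩, hWJ⟩ := hJ
  have hev := eventuallyEq_of_eqOn_halfPlane hZ hW (r := max r r') (fun s hs => by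
    obtain ⟨v, hv, e⟩ := hr s ((le_max_left _ _).trans_lt hs)
    obtain ⟨w, hw, e'⟩ := hr' s ((le_max_right _ _).trans_lt hs)
    rw [e, e', show v = w from funext fun c => tendsto_nhds_unique (hv c) (hw c)]) 0
  exact hZI.unique (hWJ.congr hev)

omit [Γ.FiniteIndex] in
-- Here `α / β = ε` turns the boundary coefficient at a cusp into the coefficient of the unary theta
-- series in the final formula.
theorem cuspKappa_mul_cuspWidth (h : Disc N L) (g : SL(2, ℤ)) (τ : ℍ) (b : ℂ) :
    cuspKappa N L h g τ * cuspWidth Γ g * b = b * (cuspEps L Γ g : ℂ) / (√(N : ℝ) : ℂ) *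
      unaryTheta N L (ℓ₀.map (conj g)) h τ := by
  rw [cuspKappa, cuspEps]
  push_cast
  simp only [div_eq_mul_inv, mul_inv]
  ring

/-- A function which is a combination of `y^s` and `y^{1-s}` vanishes identically only if both
coefficients vanish. -/
theorem coeff_eq_zero_of_powers {s A B : ℂ} (hs : (2 : ℂ) ^ s ≠ (2 : ℂ) ^ (1 - s))
    (h : ∀ y : ℝ, 0 < y → A * (y : ℂ) ^ s + B * (y : ℂ) ^ (1 - s) = 0) : B = 0 := by
  have h1 := h 1 one_pos
  have h2 := h 2 two_pos
  simp only [Complex.ofReal_one, Complex.one_cpow, mul_one, Complex.ofReal_ofNat] at h1 h2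
  have h3 : B * ((2 : ℂ) ^ (1 - s) - (2 : ℂ) ^ s) = 0 := by
    linear_combination h2 - (2 : ℂ) ^ s * h1
  exact (mul_eq_zero.mp h3).resolve_right (sub_ne_zero.mpr hs.symm)

end RegTheta

end

theorem mainTheorem5 (N : ℕ) (hN : 0 < N)
    (L : Submodule ℤ RegTheta.V) (hL : RegTheta.IsEvenLattice N L)
    (Γ : Subgroup SL(2, ℤ)) (hΓ : CongruenceSubgroup.IsCongruenceSubgroup Γ)
    (hΓL : RegTheta.ActsTrivially N L Γ)
    (σ : RegTheta.Cusp N Γ → SL(2, ℤ)) (hσ : RegTheta.IsCuspChoice N Γ σ)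
    (D : Set ℍ) (hD : RegTheta.IsFundDomain Γ D)
    (f : ℍ → ℂ) (hf : RegTheta.IsHarmonicWeakMaassForm Γ f)
    (U : Set ℂ) (F : ℂ → ℍ → ℂ) (hF : RegTheta.IsSpectralDeformation Γ f U F) :
    (∃ A B : RegTheta.Cusp N Γ → ℂ → ℂ, RegTheta.HasConstTerms Γ σ F A B) ∧
    ∀ A B : RegTheta.Cusp N Γ → ℂ → ℂ, RegTheta.HasConstTerms Γ σ F A B →
      ∀ (τ : ℍ) (h : RegTheta.Disc N L),
        (∃ I : ℂ, RegTheta.IsTruncLift N L Γ σ f h τ I) ∧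
        (∃ J : ℂ, RegTheta.IsDiffLift N L D U F h τ J) ∧
        ∀ I J : ℂ, RegTheta.IsTruncLift N L Γ σ f h τ I →
          RegTheta.IsDiffLift N L D U F h τ J →
          J = I + ∑ᶠ c : RegTheta.Cusp N Γ,
              deriv (B c) 1 * (RegTheta.cuspEps L Γ (σ c) : ℂ) / (√(N : ℝ) : ℂ) *
                RegTheta.unaryTheta N L (RegTheta.ℓ₀.map (RegTheta.conj (σ c))) h τ ∧
          ((∀ c, ∀ᶠ s in 𝓝 (1 : ℂ), ∀ y : ℝ, 0 < y →
              RegTheta.constTerm Γ (σ c) (F s) y = 0) → J = I) := by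
  have hfin : Γ.FiniteIndex := hΓ.finiteIndex
  have hcusp := RegTheta.finite_cusp hσ
  have := Fintype.ofFinite (RegTheta.Cusp N Γ)
  refine ⟨RegTheta.exists_hasConstTerms σ hF, fun A B hAB τ h => ?_⟩
  have hAB1 : ∀ c, ∀ y : ℝ, 0 < y →
      RegTheta.constTerm Γ (σ c) f y = A c 1 * y + B c 1 := fun c y hy => by
    have := (hAB c).2.2.self_of_nhds y hy
    rwa [hF.at_one, Complex.cpow_one, sub_self, Complex.cpow_zero, mul_one] at this
  have hI := RegTheta.exists_truncLift hN hL hσ hf hAB1 h τ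
  have hJ := RegTheta.hasCT_diffLift hN hL hΓL hσ hD hF hAB h τ
  refine ⟨⟨_, hI⟩, ⟨_, fun s hs => RegTheta.integrableOn_lift hN hL hΓL hσ hD
    (hF.weakMaass s hs) h τ, hJ⟩, fun I J hI' hJ' => ?_⟩
  have key : J = I + ∑ᶠ c : RegTheta.Cusp N Γ,
      deriv (B c) 1 * (RegTheta.cuspEps L Γ (σ c) : ℂ) / (√(N : ℝ) : ℂ) *
        RegTheta.unaryTheta N L (RegTheta.ℓ₀.map (RegTheta.conj (σ c))) h τ := by
    -- Both values contain the same `cuspPart` and the same term in `-A(1)`, so only the terms with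
    -- `B'(1)` remain.
    rw [hI'.unique hI, hJ'.2.unique hJ]
    simp only [finsum_eq_sum_of_fintype, ← RegTheta.cuspKappa_mul_cuspWidth]
    rw [← Finset.sum_add_distrib]
    exact Finset.sum_congr rfl fun c _ => by ring
  refine ⟨key, fun h0 => ?_⟩
  have hB : ∀ c, deriv (B c) 1 = 0 := by
    intro c
    have hne : ∀ᶠ s : ℂ in 𝓝 1, (2 : ℂ) ^ s ≠ (2 : ℂ) ^ (1 - s) := by
      have h1 : ContinuousAt (fun s : ℂ => (2 : ℂ) ^ s) 1 :=
        continuousAt_id.const_cpow (Or.inl two_ne_zero)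
      have h2 : ContinuousAt (fun s : ℂ => (2 : ℂ) ^ (1 - s)) 1 :=
        (continuousAt_const.sub continuousAt_id).const_cpow (Or.inl two_ne_zero)
      exact ((h1.sub h2).eventually_ne (y := 0) (by norm_num)).mono fun s hs => sub_ne_zero.mp hs
    -- A vanishing constant term forces `B` to vanish near `1` because `y^s` and `y^{1-s}` are
    -- independent there; hence its derivative at `1` is zero.
    have hz : B c =ᶠ[𝓝 1] fun _ => 0 := by
      filter_upwards [hne, h0 c, (hAB c).2.2] with s hs h1 h2
      exact RegTheta.coeff_eq_zero_of_powers hs fun y hy => by rw [← h2 y hy, h1 y hy]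
    rw [hz.deriv_eq, deriv_const]
  rw [key]
  simp [hB]
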